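/- Let $\mathbf{emTT}$ be the extensional level of the Minimalist Foundation: the dependent type theory with the four kinds of types $prop_s, prop, set, col$ (with $prop_s\hookrightarrow prop\hookrightarrow col$ and $prop_s\hookrightarrow set\hookrightarrow col$), the base sets $\mathsf{N_0},\mathsf{N_1}$, the set constructors $\Sigma,\Pi,+,\mathsf{List}$ and quotients $A/R$ of a set by a small equivalence relation, the collections $\mathcal P(1)$ (small propositions up to equiprovability), $A\to\mathcal P(1)$ for a set $A$, and $\Sigma$ of collections, and predicate logic with a proof-irrelevant, reflective equality $\mathsf{Eq}$ and a canonical proof-term $\mathsf{true}$. Let $\mathbf{emTT}+\mathsf{propext}$ be its extension by the rules deriving $\varphi=\psi\; prop$ (respectively $prop_s$) from $\varphi\Leftrightarrow\psi\;\mathsf{true}$ for propositions (respectively small propositions) $\varphi,\psi$. In $\mathbf{emTT}$, *canonical isomorphisms* between collections in the same context are the functional terms (up to judgemental equality) inductively generated by: $\mathsf{true}\in\psi\;[x\in\varphi]$ for equiprovable propositions $\varphi,\psi$; the identities of $\mathsf{N_0},\mathsf{N_1},\mathcal P(1)$; and the functorial actions of $\mathsf{List},+,\Sigma,\Pi$ and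 of quotients (along a canonical isomorphism which preserves and reflects the relations). They extend componentwise to contexts. Two contexts are *canonically related* if there is a canonical isomorphism between them; two types in context $A\;[\Gamma]$, $B\;[\Delta]$ are canonically related if there are canonical isomorphisms $\sigma\in\Delta\;[\Gamma]$ and $\tau(x)\in B[\sigma]\;[\Gamma,x\in A]$; two terms $a\in A\;[\Gamma]$, $b\in B\;[\Delta]$ are canonically related if moreover $\tau(a)=b[\sigma]\in B[\sigma]\;[\Gamma]$. Being canonically related is an equivalence relation on the derivable contexts, collections in context and terms in context of $\mathbf{emTT}$; write $[-]$ for its equivalence classes. Let $[\![-]\!]$ be the partial interpretation defined by recursion on the (fully annotated) pre-syntax, which sends contexts, types in context and terms in context to equivalence classes of canonically related $\mathbf{emTT}$-contexts, collections and terms, by interpreting each constructor as the same constructor of $\mathbf{emTT}$ applied to suitable representatives of the interpretations of its arguments. For a type judgement $A\;type\;[\Gamma]$, with $type$ one of the four kinds, or a term judgement $a\in A\;[\Gamma]$, being defined includes that all representatives live in contexts belonging to $[\![\Gamma\;ctx]\!]$ and, for the type judgement, that at least one representative is of kind $type$. Then: **Validity.** 1. If $\mathbf{emTT}+\mathsf{propext}\vdash\Gamma\;ctx$,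 then $[\![\Gamma\;ctx]\!]$ is defined. 2. If $\mathbf{emTT}+\mathsf{propext}\vdash A\;type\;[\Gamma]$, then $[\![A\;type\;[\Gamma]]\!]$ is defined. 3. If $\mathbf{emTT}+\mathsf{propext}\vdash a\in A\;[\Gamma]$, then $[\![a\in A\;[\Gamma]]\!]$ and $[\![A\;col\;[\Gamma]]\!]$ are defined, and all terms of the former have types belonging to the latter. 4. If $\mathbf{emTT}+\mathsf{propext}\vdash A=B\;type\;[\Gamma]$, then $[\![A\;type\;[\Gamma]]\!]$ and $[\![B\;type\;[\Gamma]]\!]$ are defined and equal. 5. If $\mathbf{emTT}+\mathsf{propext}\vdash a=b\in A\;[\Gamma]$, then $[\![a\in A\;[\Gamma]]\!]$ and $[\![b\in A\;[\Gamma]]\!]$ are defined and equal. **Identity on $\mathbf{emTT}$ up to canonical isomorphisms.** If $\mathbf{emTT}$ derives $\Gamma\;ctx$, $A\;type\;[\Gamma]$, or $a\in A\;[\Gamma]$, then respectively $[\![\Gamma\;ctx]\!]=[\Gamma\;ctx]$, $[\![A\;type\;[\Gamma]]\!]=[A\;type\;[\Gamma]]$, or $[\![a\in A\;[\Gamma]]\!]=[a\in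 A\;[\Gamma]]$. **Conservativity.** If $\mathbf{emTT}\vdash\varphi\;prop\;[\Gamma]$ and $\mathbf{emTT}+\mathsf{propext}\vdash\varphi\;\mathsf{true}\;[\Gamma]$, then $\mathbf{emTT}\vdash\varphi\;\mathsf{true}\;[\Gamma]$. -/

import Mathlib

namespace EmTT

/-! ## Pre-syntax (de Bruijn indices; index `0` is the last variable of the context) -/

/-- The two sorts of expressions: pre-types (which include the pre-propositions) and pre-terms. -/
inductive Srt where
  | ty
  | tm

/-- Fully annotated pre-types and pre-terms.  The comments list the arguments which bind variables;
all the other arguments bind none. -/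
inductive Exp : Srt → Type where
  /-- the empty set -/
  | N0 : Exp .ty
  /-- the singleton set -/
  | N1 : Exp .ty
  /-- the power collection of the singleton -/
  | P1 : Exp .ty
  /-- `(Σ x ∈ A) B`; `B` binds `x` -/
  | sig (A B : Exp .ty) : Exp .ty
  /-- `(Π x ∈ A) B`; `B` binds `x` -/
  | pi (A B : Exp .ty) : Exp .ty
  /-- disjoint sum `A + B` -/
  | sum (A B : Exp .ty) : Exp .ty
  /-- `List(A)` -/
  | list (A : Exp .ty) : Exp .ty
  /-- quotient `A / R`; `R` binds `x, y ∈ A` -/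
  | quo (A R : Exp .ty) : Exp .ty
  | bot : Exp .ty
  | and (φ ψ : Exp .ty) : Exp .ty
  | or (φ ψ : Exp .ty) : Exp .ty
  | imp (φ ψ : Exp .ty) : Exp .ty
  /-- `(∃ x ∈ A) φ`; `φ` binds `x` -/
  | ex (A φ : Exp .ty) : Exp .ty
  /-- `(∀ x ∈ A) φ`; `φ` binds `x` -/
  | all (A φ : Exp .ty) : Exp .ty
  /-- `Eq(A, a, b)` -/
  | eq (A : Exp .ty) (a b : Exp .tm) : Exp .ty
  | var (n : ℕ) : Exp .tm
  /-- the canonical proof-term `true` of the proposition `φ` -/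
  | tru (φ : Exp .ty) : Exp .tm
  /-- eliminator of `N0` with motive `M`; `M` binds one variable -/
  | emp (M : Exp .ty) (c : Exp .tm) : Exp .tm
  | star : Exp .tm
  /-- eliminator of `N1` with motive `M`; `M` binds one variable -/
  | elN1 (M : Exp .ty) (t c : Exp .tm) : Exp .tm
  /-- `⟨a, b⟩ ∈ (Σ x ∈ A) B`; `B` binds `x` -/
  | pair (A B : Exp .ty) (a b : Exp .tm) : Exp .tm
  /-- `El_Σ(d, (x,y).m)`; `B` and `M` bind one variable, `m` binds `x, y` -/
  | elSig (A B M : Exp .ty) (d m : Exp .tm) : Exp .tm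
  /-- `(λ x ∈ A) b`; `b` binds `x` -/
  | lam (A : Exp .ty) (b : Exp .tm) : Exp .tm
  /-- `Ap(f, a)` -/
  | app (f a : Exp .tm) : Exp .tm
  /-- the empty list of `List(A)` -/
  | nil (A : Exp .ty) : Exp .tm
  /-- `cons(s, c)`: the list `s` with `c` appended -/
  | cons (s c : Exp .tm) : Exp .tm
  /-- `El_List(s, a, (x,y,z).l)`; `L` binds one variable, `l` binds `x, y, z` -/
  | elList (A L : Exp .ty) (s a l : Exp .tm) : Exp .tm
  /-- `inl(a) ∈ A + B` -/
  | inl (A B : Exp .ty) (a : Exp .tm) : Exp .tm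
  /-- `inr(b) ∈ A + B` -/
  | inr (A B : Exp .ty) (b : Exp .tm) : Exp .tm
  /-- `El_+(w, (x).a, (y).b)`; `M`, `a` and `b` bind one variable each -/
  | elSum (A B M : Exp .ty) (w a b : Exp .tm) : Exp .tm
  /-- the equivalence class `[a] ∈ A / R`; `R` binds two variables -/
  | qcl (A R : Exp .ty) (a : Exp .tm) : Exp .tm
  /-- `El_Q(p, (x).l)`; `R` binds two variables, `L` and `l` bind one each -/
  | elQ (A R L : Exp .ty) (p l : Exp .tm) : Exp .tm
  /-- `[φ] ∈ P(1)` -/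
  | pcl (φ : Exp .ty) : Exp .tm

abbrev Ty := Exp .ty
abbrev Tm := Exp .tm

/-- Pre-contexts; the head of the list is the type of the last declared variable. -/
abbrev Ctx := List Ty

/-- Renaming under one binder. -/
def upr (ρ : ℕ → ℕ) : ℕ → ℕ
  | 0 => 0
  | n + 1 => ρ n + 1

def Exp.ren : {s : Srt} → Exp s → (ℕ → ℕ) → Exp s
  | _, .N0, _ => .N0
  | _, .N1, _ => .N1
  | _, .P1, _ => .P1
  | _, .sig A B, ρ => .sig (A.ren ρ) (B.ren (upr ρ))
  | _, .pi A B, ρ => .pi (A.ren ρ) (B.ren (upr ρ))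
  | _, .sum A B, ρ => .sum (A.ren ρ) (B.ren ρ)
  | _, .list A, ρ => .list (A.ren ρ)
  | _, .quo A R, ρ => .quo (A.ren ρ) (R.ren (upr (upr ρ)))
  | _, .bot, _ => .bot
  | _, .and φ ψ, ρ => .and (φ.ren ρ) (ψ.ren ρ)
  | _, .or φ ψ, ρ => .or (φ.ren ρ) (ψ.ren ρ)
  | _, .imp φ ψ, ρ => .imp (φ.ren ρ) (ψ.ren ρ)
  | _, .ex A φ, ρ => .ex (A.ren ρ) (φ.ren (upr ρ))
  | _, .all A φ, ρ => .all (A.ren ρ) (φ.ren (upr ρ))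
  | _, .eq A a b, ρ => .eq (A.ren ρ) (a.ren ρ) (b.ren ρ)
  | _, .var n, ρ => .var (ρ n)
  | _, .tru φ, ρ => .tru (φ.ren ρ)
  | _, .emp M c, ρ => .emp (M.ren (upr ρ)) (c.ren ρ)
  | _, .star, _ => .star
  | _, .elN1 M t c, ρ => .elN1 (M.ren (upr ρ)) (t.ren ρ) (c.ren ρ)
  | _, .pair A B a b, ρ => .pair (A.ren ρ) (B.ren (upr ρ)) (a.ren ρ) (b.ren ρ)
  | _, .elSig A B M d m, ρ =>
      .elSig (A.ren ρ) (B.ren (upr ρ)) (M.ren (upr ρ)) (d.ren ρ) (m.ren (upr (upr ρ)))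
  | _, .lam A b, ρ => .lam (A.ren ρ) (b.ren (upr ρ))
  | _, .app f a, ρ => .app (f.ren ρ) (a.ren ρ)
  | _, .nil A, ρ => .nil (A.ren ρ)
  | _, .cons s c, ρ => .cons (s.ren ρ) (c.ren ρ)
  | _, .elList A L s a l, ρ =>
      .elList (A.ren ρ) (L.ren (upr ρ)) (s.ren ρ) (a.ren ρ) (l.ren (upr (upr (upr ρ))))
  | _, .inl A B a, ρ => .inl (A.ren ρ) (B.ren ρ) (a.ren ρ)
  | _, .inr A B b, ρ => .inr (A.ren ρ) (B.ren ρ) (b.ren ρ)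
  | _, .elSum A B M w a b, ρ =>
      .elSum (A.ren ρ) (B.ren ρ) (M.ren (upr ρ)) (w.ren ρ) (a.ren (upr ρ)) (b.ren (upr ρ))
  | _, .qcl A R a, ρ => .qcl (A.ren ρ) (R.ren (upr (upr ρ))) (a.ren ρ)
  | _, .elQ A R L p l, ρ =>
      .elQ (A.ren ρ) (R.ren (upr (upr ρ))) (L.ren (upr ρ)) (p.ren ρ) (l.ren (upr ρ))
  | _, .pcl φ, ρ => .pcl (φ.ren ρ)

/-- Weakening by `k` variables at the end of the context. -/
def Exp.lift {s : Srt} (e : Exp s) (k : ℕ) : Exp s := e.ren (fun n => n + k)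

/-- Weakening by `k` variables below one bound variable. -/
def Exp.lift₁ {s : Srt} (e : Exp s) (k : ℕ) : Exp s := e.ren (upr (fun n => n + k))

/-- Weakening by `k` variables below two bound variables. -/
def Exp.lift₂ {s : Srt} (e : Exp s) (k : ℕ) : Exp s := e.ren (upr (upr (fun n => n + k)))

/-- Simultaneous substitutions. -/
abbrev Sub := ℕ → Tm

/-- The substitution which sends the last variable to `a` and the other ones according to `σ`. -/
def scons (a : Tm) (σ : Sub) : Sub
  | 0 => a
  | n + 1 => σ n

/-- Substitution under one binder. -/
def ups (σ : Sub) : Sub := scons (.var 0) (fun n => (σ n).lift 1)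

/-- Capture-avoiding simultaneous substitution. -/
def Exp.subst : {s : Srt} → Exp s → Sub → Exp s
  | _, .N0, _ => .N0
  | _, .N1, _ => .N1
  | _, .P1, _ => .P1
  | _, .sig A B, σ => .sig (A.subst σ) (B.subst (ups σ))
  | _, .pi A B, σ => .pi (A.subst σ) (B.subst (ups σ))
  | _, .sum A B, σ => .sum (A.subst σ) (B.subst σ)
  | _, .list A, σ => .list (A.subst σ)
  | _, .quo A R, σ => .quo (A.subst σ) (R.subst (ups (ups σ)))
  | _, .bot, _ => .bot
  | _, .and φ ψ, σ => .and (φ.subst σ) (ψ.subst σ)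
  | _, .or φ ψ, σ => .or (φ.subst σ) (ψ.subst σ)
  | _, .imp φ ψ, σ => .imp (φ.subst σ) (ψ.subst σ)
  | _, .ex A φ, σ => .ex (A.subst σ) (φ.subst (ups σ))
  | _, .all A φ, σ => .all (A.subst σ) (φ.subst (ups σ))
  | _, .eq A a b, σ => .eq (A.subst σ) (a.subst σ) (b.subst σ)
  | _, .var n, σ => σ n
  | _, .tru φ, σ => .tru (φ.subst σ)
  | _, .emp M c, σ => .emp (M.subst (ups σ)) (c.subst σ)
  | _, .star, _ => .star
  | _, .elN1 M t c, σ => .elN1 (M.subst (ups σ)) (t.subst σ) (c.subst σ)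
  | _, .pair A B a b, σ => .pair (A.subst σ) (B.subst (ups σ)) (a.subst σ) (b.subst σ)
  | _, .elSig A B M d m, σ =>
      .elSig (A.subst σ) (B.subst (ups σ)) (M.subst (ups σ)) (d.subst σ) (m.subst (ups (ups σ)))
  | _, .lam A b, σ => .lam (A.subst σ) (b.subst (ups σ))
  | _, .app f a, σ => .app (f.subst σ) (a.subst σ)
  | _, .nil A, σ => .nil (A.subst σ)
  | _, .cons s c, σ => .cons (s.subst σ) (c.subst σ)
  | _, .elList A L s a l, σ =>
      .elList (A.subst σ) (L.subst (ups σ)) (s.subst σ) (a.subst σ) (l.subst (ups (ups (ups σ))))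
  | _, .inl A B a, σ => .inl (A.subst σ) (B.subst σ) (a.subst σ)
  | _, .inr A B b, σ => .inr (A.subst σ) (B.subst σ) (b.subst σ)
  | _, .elSum A B M w a b, σ =>
      .elSum (A.subst σ) (B.subst σ) (M.subst (ups σ)) (w.subst σ) (a.subst (ups σ))
        (b.subst (ups σ))
  | _, .qcl A R a, σ => .qcl (A.subst σ) (R.subst (ups (ups σ))) (a.subst σ)
  | _, .elQ A R L p l, σ =>
      .elQ (A.subst σ) (R.subst (ups (ups σ))) (L.subst (ups σ)) (p.subst σ) (l.subst (ups σ))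
  | _, .pcl φ, σ => .pcl (φ.subst σ)

/-- For `e` over `Γ, x` and `a` over an extension of `Γ` by `k` variables: `e[a/x]` over that
extension. -/
def Exp.inst₁ {s : Srt} (e : Exp s) (k : ℕ) (a : Tm) : Exp s :=
  e.subst (scons a (fun n => .var (n + k)))

/-- For `e` over `Γ, x, y` and `a, b` over an extension of `Γ` by `k` variables:
`e[a/x, b/y]`. -/
def Exp.inst₂ {s : Srt} (e : Exp s) (k : ℕ) (a b : Tm) : Exp s :=
  e.subst (scons b (scons a (fun n => .var (n + k))))

/-- For `e` over `Γ, x, y, z` and `a, b, c` over an extension of `Γ` by `k` variables: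
`e[a/x, b/y, c/z]`. -/
def Exp.inst₃ {s : Srt} (e : Exp s) (k : ℕ) (a b c : Tm) : Exp s :=
  e.subst (scons c (scons b (scons a (fun n => .var (n + k)))))

/-- `φ ⇔ ψ` -/
def Exp.iff (φ ψ : Ty) : Ty := .and (.imp φ ψ) (.imp ψ φ)

/-- `⊤ := ¬⊥` -/
def Exp.top : Ty := .imp .bot .bot

/-! ## Judgements and derivability -/

/-- The four kinds of types. -/
inductive Kind where
  | props
  | prop
  | set
  | col

/-- Propositions: small (`true`) or not (`false`). -/
def Kind.prp : Bool → Kind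
  | true => .props
  | false => .prop

/-- Types: sets (`true`) or collections (`false`). -/
def Kind.typ : Bool → Kind
  | true => .set
  | false => .col

/-- The four generating inclusions between kinds. -/
inductive Kind.Incl : Kind → Kind → Prop where
  | props_prop : Kind.Incl .props .prop
  | props_set : Kind.Incl .props .set
  | set_col : Kind.Incl .set .col
  | prop_col : Kind.Incl .prop .col

/-- Judgements: `Γ ctx`, `A k [Γ]`, `A = B k [Γ]`, `a ∈ A [Γ]`, `a = b ∈ A [Γ]`. -/
inductive Judg where
  | ctx (Γ : Ctx)
  | ty (Γ : Ctx) (A : Ty) (k : Kind)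
  | tyEq (Γ : Ctx) (A B : Ty) (k : Kind)
  | tm (Γ : Ctx) (a : Tm) (A : Ty)
  | tmEq (Γ : Ctx) (a b : Tm) (A : Ty)

/-- The judgement `φ true [Γ]`, that is, `true ∈ φ [Γ]`. -/
@[reducible] def Judg.tr (Γ : Ctx) (φ : Ty) : Judg := .tm Γ (.tru φ) φ

/-- The two theories: `emTT`, and `emTT + propext`. -/
inductive Theory where
  | emTT
  | emTTpropext

/-- Derivability of judgements. -/
inductive Der (T : Theory) : Judg → Prop where
  /- contexts and variables -/
  | ctx_nil : Der T (.ctx [])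
  | ctx_cons {Γ A} : Der T (.ty Γ A .col) → Der T (.ctx (A :: Γ))
  | var {Γ : Ctx} {i : ℕ} {A : Ty} : Der T (.ctx Γ) → Γ[i]? = some A →
      Der T (.tm Γ (.var i) (A.lift (i + 1)))
  /- inclusions of kinds -/
  | incl {Γ A k k'} : Kind.Incl k k' → Der T (.ty Γ A k) → Der T (.ty Γ A k')
  | incl_eq {Γ A B k k'} : Kind.Incl k k' → Der T (.tyEq Γ A B k) → Der T (.tyEq Γ A B k')
  /- equality is an equivalence relation; conversion -/
  | ty_refl {Γ A k} : Der T (.ty Γ A k) → Der T (.tyEq Γ A A k)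
  | ty_symm {Γ A B k} : Der T (.tyEq Γ A B k) → Der T (.tyEq Γ B A k)
  | ty_trans {Γ A B C k} : Der T (.tyEq Γ A B k) → Der T (.tyEq Γ B C k) →
      Der T (.tyEq Γ A C k)
  | tm_refl {Γ a A} : Der T (.tm Γ a A) → Der T (.tmEq Γ a a A)
  | tm_symm {Γ a b A} : Der T (.tmEq Γ a b A) → Der T (.tmEq Γ b a A)
  | tm_trans {Γ a b c A} : Der T (.tmEq Γ a b A) → Der T (.tmEq Γ b c A) →
      Der T (.tmEq Γ a c A)
  | conv {Γ a A B} : Der T (.tm Γ a A) → Der T (.tyEq Γ A B .col) → Der T (.tm Γ a B)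
  | conv_eq {Γ a b A B} : Der T (.tmEq Γ a b A) → Der T (.tyEq Γ A B .col) →
      Der T (.tmEq Γ a b B)
  /- telescopic substitution (weakening is the special case of a substitution by variables) -/
  | sub_ty {Γ Δ : Ctx} {σ : Sub} {A k} : Der T (.ctx Δ) →
      (∀ (i : ℕ) (B : Ty), Γ[i]? = some B →
        Der T (.tm Δ (σ i) ((B.lift (i + 1)).subst σ))) →
      Der T (.ty Γ A k) → Der T (.ty Δ (A.subst σ) k)
  | sub_tyEq {Γ Δ : Ctx} {σ : Sub} {A B k} : Der T (.ctx Δ) →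
      (∀ (i : ℕ) (C : Ty), Γ[i]? = some C →
        Der T (.tm Δ (σ i) ((C.lift (i + 1)).subst σ))) →
      Der T (.tyEq Γ A B k) → Der T (.tyEq Δ (A.subst σ) (B.subst σ) k)
  | sub_tm {Γ Δ : Ctx} {σ : Sub} {a A} : Der T (.ctx Δ) →
      (∀ (i : ℕ) (C : Ty), Γ[i]? = some C →
        Der T (.tm Δ (σ i) ((C.lift (i + 1)).subst σ))) →
      Der T (.tm Γ a A) → Der T (.tm Δ (a.subst σ) (A.subst σ))
  | sub_tmEq {Γ Δ : Ctx} {σ : Sub} {a b A} : Der T (.ctx Δ) →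
      (∀ (i : ℕ) (C : Ty), Γ[i]? = some C →
        Der T (.tm Δ (σ i) ((C.lift (i + 1)).subst σ))) →
      Der T (.tmEq Γ a b A) → Der T (.tmEq Δ (a.subst σ) (b.subst σ) (A.subst σ))
  | subEq_ty {Γ Δ : Ctx} {σ τ : Sub} {A k} : Der T (.ctx Δ) →
      (∀ (i : ℕ) (C : Ty), Γ[i]? = some C →
        Der T (.tm Δ (σ i) ((C.lift (i + 1)).subst σ))) →
      (∀ (i : ℕ) (C : Ty), Γ[i]? = some C →
        Der T (.tm Δ (τ i) ((C.lift (i + 1)).subst τ))) →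
      (∀ (i : ℕ) (C : Ty), Γ[i]? = some C →
        Der T (.tmEq Δ (σ i) (τ i) ((C.lift (i + 1)).subst σ))) →
      Der T (.ty Γ A k) → Der T (.tyEq Δ (A.subst σ) (A.subst τ) k)
  | subEq_tm {Γ Δ : Ctx} {σ τ : Sub} {a A} : Der T (.ctx Δ) →
      (∀ (i : ℕ) (C : Ty), Γ[i]? = some C →
        Der T (.tm Δ (σ i) ((C.lift (i + 1)).subst σ))) →
      (∀ (i : ℕ) (C : Ty), Γ[i]? = some C →
        Der T (.tm Δ (τ i) ((C.lift (i + 1)).subst τ))) →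
      (∀ (i : ℕ) (C : Ty), Γ[i]? = some C →
        Der T (.tmEq Δ (σ i) (τ i) ((C.lift (i + 1)).subst σ))) →
      Der T (.tm Γ a A) → Der T (.tmEq Δ (a.subst σ) (a.subst τ) (A.subst σ))
  /- formation of types, with the corresponding equalities -/
  | N0_form {Γ} : Der T (.ctx Γ) → Der T (.ty Γ .N0 .set)
  | N1_form {Γ} : Der T (.ctx Γ) → Der T (.ty Γ .N1 .set)
  | P1_form {Γ} : Der T (.ctx Γ) → Der T (.ty Γ .P1 .col)
  | sig_form {Γ A B} (s : Bool) : Der T (.ty Γ A (.typ s)) → Der T (.ty (A :: Γ) B (.typ s)) →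
      Der T (.ty Γ (.sig A B) (.typ s))
  | sig_eq {Γ A A' B B'} (s : Bool) : Der T (.tyEq Γ A A' (.typ s)) →
      Der T (.tyEq (A :: Γ) B B' (.typ s)) → Der T (.tyEq Γ (.sig A B) (.sig A' B') (.typ s))
  | pi_form {Γ A B} : Der T (.ty Γ A .set) → Der T (.ty (A :: Γ) B .set) →
      Der T (.ty Γ (.pi A B) .set)
  | pi_eq {Γ A A' B B'} : Der T (.tyEq Γ A A' .set) → Der T (.tyEq (A :: Γ) B B' .set) →
      Der T (.tyEq Γ (.pi A B) (.pi A' B') .set)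
  | piP1_form {Γ A} : Der T (.ty Γ A .set) → Der T (.ty Γ (.pi A .P1) .col)
  | piP1_eq {Γ A A'} : Der T (.tyEq Γ A A' .set) →
      Der T (.tyEq Γ (.pi A .P1) (.pi A' .P1) .col)
  | sum_form {Γ A B} : Der T (.ty Γ A .set) → Der T (.ty Γ B .set) →
      Der T (.ty Γ (.sum A B) .set)
  | sum_eq {Γ A A' B B'} : Der T (.tyEq Γ A A' .set) → Der T (.tyEq Γ B B' .set) →
      Der T (.tyEq Γ (.sum A B) (.sum A' B') .set)
  | list_form {Γ A} : Der T (.ty Γ A .set) → Der T (.ty Γ (.list A) .set)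
  | list_eq {Γ A A'} : Der T (.tyEq Γ A A' .set) → Der T (.tyEq Γ (.list A) (.list A') .set)
  | quo_form {Γ A R} : Der T (.ty Γ A .set) → Der T (.ty (A.lift 1 :: A :: Γ) R .props) →
      Der T (.tr (A :: Γ) (R.inst₂ 1 (.var 0) (.var 0))) →
      Der T (.tr (R :: A.lift 1 :: A :: Γ) (R.inst₂ 3 (.var 1) (.var 2))) →
      Der T (.tr (R.inst₂ 4 (.var 2) (.var 1) :: R.inst₂ 3 (.var 2) (.var 1) ::
          A.lift 2 :: A.lift 1 :: A :: Γ)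
        (R.inst₂ 5 (.var 4) (.var 2))) →
      Der T (.ty Γ (.quo A R) .set)
  | quo_eq {Γ A A' R R'} : Der T (.ty Γ (.quo A R) .set) → Der T (.tyEq Γ A A' .set) →
      Der T (.tyEq (A.lift 1 :: A :: Γ) R R' .props) →
      Der T (.tyEq Γ (.quo A R) (.quo A' R') .set)
  | bot_form {Γ} : Der T (.ctx Γ) → Der T (.ty Γ .bot .props)
  | and_form {Γ φ ψ} (s : Bool) : Der T (.ty Γ φ (.prp s)) → Der T (.ty Γ ψ (.prp s)) →
      Der T (.ty Γ (.and φ ψ) (.prp s))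
  | and_eq {Γ φ φ' ψ ψ'} (s : Bool) : Der T (.tyEq Γ φ φ' (.prp s)) →
      Der T (.tyEq Γ ψ ψ' (.prp s)) → Der T (.tyEq Γ (.and φ ψ) (.and φ' ψ') (.prp s))
  | or_form {Γ φ ψ} (s : Bool) : Der T (.ty Γ φ (.prp s)) → Der T (.ty Γ ψ (.prp s)) →
      Der T (.ty Γ (.or φ ψ) (.prp s))
  | or_eq {Γ φ φ' ψ ψ'} (s : Bool) : Der T (.tyEq Γ φ φ' (.prp s)) →
      Der T (.tyEq Γ ψ ψ' (.prp s)) → Der T (.tyEq Γ (.or φ ψ) (.or φ' ψ') (.prp s))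
  | imp_form {Γ φ ψ} (s : Bool) : Der T (.ty Γ φ (.prp s)) → Der T (.ty Γ ψ (.prp s)) →
      Der T (.ty Γ (.imp φ ψ) (.prp s))
  | imp_eq {Γ φ φ' ψ ψ'} (s : Bool) : Der T (.tyEq Γ φ φ' (.prp s)) →
      Der T (.tyEq Γ ψ ψ' (.prp s)) → Der T (.tyEq Γ (.imp φ ψ) (.imp φ' ψ') (.prp s))
  | ex_form {Γ A φ} (s : Bool) : Der T (.ty Γ A (.typ s)) → Der T (.ty (A :: Γ) φ (.prp s)) →
      Der T (.ty Γ (.ex A φ) (.prp s))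
  | ex_eq {Γ A A' φ φ'} (s : Bool) : Der T (.tyEq Γ A A' (.typ s)) →
      Der T (.tyEq (A :: Γ) φ φ' (.prp s)) → Der T (.tyEq Γ (.ex A φ) (.ex A' φ') (.prp s))
  | all_form {Γ A φ} (s : Bool) : Der T (.ty Γ A (.typ s)) → Der T (.ty (A :: Γ) φ (.prp s)) →
      Der T (.ty Γ (.all A φ) (.prp s))
  | all_eq {Γ A A' φ φ'} (s : Bool) : Der T (.tyEq Γ A A' (.typ s)) →
      Der T (.tyEq (A :: Γ) φ φ' (.prp s)) → Der T (.tyEq Γ (.all A φ) (.all A' φ') (.prp s))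
  | eq_form {Γ A a b} (s : Bool) : Der T (.ty Γ A (.typ s)) → Der T (.tm Γ a A) →
      Der T (.tm Γ b A) → Der T (.ty Γ (.eq A a b) (.prp s))
  | eq_eq {Γ A A' a a' b b'} (s : Bool) : Der T (.tyEq Γ A A' (.typ s)) →
      Der T (.tmEq Γ a a' A) → Der T (.tmEq Γ b b' A) →
      Der T (.tyEq Γ (.eq A a b) (.eq A' a' b') (.prp s))
  | eqP1_form {Γ a b} : Der T (.tm Γ a .P1) → Der T (.tm Γ b .P1) →
      Der T (.ty Γ (.eq .P1 a b) .props)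
  | eqP1_eq {Γ a a' b b'} : Der T (.tmEq Γ a a' .P1) → Der T (.tmEq Γ b b' .P1) →
      Der T (.tyEq Γ (.eq .P1 a b) (.eq .P1 a' b') .props)
  /- propositional extensionality, for propositions and for small propositions -/
  | propext {Γ φ ψ} (s : Bool) : T = .emTTpropext → Der T (.ty Γ φ (.prp s)) →
      Der T (.ty Γ ψ (.prp s)) → Der T (.tr Γ (Exp.iff φ ψ)) → Der T (.tyEq Γ φ ψ (.prp s))
  /- empty set -/
  | N0_elim {Γ M c} : Der T (.ty (.N0 :: Γ) M .col) → Der T (.tm Γ c .N0) →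
      Der T (.tm Γ (.emp M c) (M.inst₁ 0 c))
  | N0_elim_eq {Γ M M' c c'} : Der T (.tyEq (.N0 :: Γ) M M' .col) →
      Der T (.tmEq Γ c c' .N0) → Der T (.tmEq Γ (.emp M c) (.emp M' c') (M.inst₁ 0 c))
  /- singleton set -/
  | N1_intro {Γ} : Der T (.ctx Γ) → Der T (.tm Γ .star .N1)
  | N1_elim {Γ M t c} : Der T (.ty (.N1 :: Γ) M .col) → Der T (.tm Γ t .N1) →
      Der T (.tm Γ c (M.inst₁ 0 .star)) → Der T (.tm Γ (.elN1 M t c) (M.inst₁ 0 t))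
  | N1_elim_eq {Γ M M' t t' c c'} : Der T (.tyEq (.N1 :: Γ) M M' .col) →
      Der T (.tmEq Γ t t' .N1) → Der T (.tmEq Γ c c' (M.inst₁ 0 .star)) →
      Der T (.tmEq Γ (.elN1 M t c) (.elN1 M' t' c') (M.inst₁ 0 t))
  | N1_beta {Γ M c} : Der T (.ty (.N1 :: Γ) M .col) → Der T (.tm Γ c (M.inst₁ 0 .star)) →
      Der T (.tmEq Γ (.elN1 M .star c) c (M.inst₁ 0 .star))
  /- dependent sums -/
  | sig_intro {Γ A B a b} : Der T (.ty (A :: Γ) B .col) → Der T (.tm Γ a A) →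
      Der T (.tm Γ b (B.inst₁ 0 a)) → Der T (.tm Γ (.pair A B a b) (.sig A B))
  | sig_intro_eq {Γ A A' B B' a a' b b'} : Der T (.tyEq Γ A A' .col) →
      Der T (.tyEq (A :: Γ) B B' .col) → Der T (.tmEq Γ a a' A) →
      Der T (.tmEq Γ b b' (B.inst₁ 0 a)) →
      Der T (.tmEq Γ (.pair A B a b) (.pair A' B' a' b') (.sig A B))
  | sig_elim {Γ A B M d m} : Der T (.ty (.sig A B :: Γ) M .col) → Der T (.tm Γ d (.sig A B)) →
      Der T (.tm (B :: A :: Γ) m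
        (M.inst₁ 2 (.pair (A.lift 2) (B.lift₁ 2) (.var 1) (.var 0)))) →
      Der T (.tm Γ (.elSig A B M d m) (M.inst₁ 0 d))
  | sig_elim_eq {Γ A A' B B' M M' d d' m m'} : Der T (.tyEq Γ A A' .col) →
      Der T (.tyEq (A :: Γ) B B' .col) → Der T (.tyEq (.sig A B :: Γ) M M' .col) →
      Der T (.tmEq Γ d d' (.sig A B)) →
      Der T (.tmEq (B :: A :: Γ) m m'
        (M.inst₁ 2 (.pair (A.lift 2) (B.lift₁ 2) (.var 1) (.var 0)))) →
      Der T (.tmEq Γ (.elSig A B M d m) (.elSig A' B' M' d' m') (M.inst₁ 0 d))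
  | sig_beta {Γ A B M a b m} : Der T (.ty (.sig A B :: Γ) M .col) → Der T (.tm Γ a A) →
      Der T (.tm Γ b (B.inst₁ 0 a)) →
      Der T (.tm (B :: A :: Γ) m
        (M.inst₁ 2 (.pair (A.lift 2) (B.lift₁ 2) (.var 1) (.var 0)))) →
      Der T (.tmEq Γ (.elSig A B M (.pair A B a b) m) (m.inst₂ 0 a b)
        (M.inst₁ 0 (.pair A B a b)))
  /- dependent products -/
  | pi_intro {Γ A B b} : Der T (.ty Γ (.pi A B) .col) → Der T (.tm (A :: Γ) b B) →
      Der T (.tm Γ (.lam A b) (.pi A B))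
  | pi_intro_eq {Γ A A' B b b'} : Der T (.ty Γ (.pi A B) .col) → Der T (.tyEq Γ A A' .set) →
      Der T (.tmEq (A :: Γ) b b' B) → Der T (.tmEq Γ (.lam A b) (.lam A' b') (.pi A B))
  | pi_elim {Γ A B f a} : Der T (.tm Γ f (.pi A B)) → Der T (.tm Γ a A) →
      Der T (.tm Γ (.app f a) (B.inst₁ 0 a))
  | pi_elim_eq {Γ A B f f' a a'} : Der T (.tmEq Γ f f' (.pi A B)) → Der T (.tmEq Γ a a' A) →
      Der T (.tmEq Γ (.app f a) (.app f' a') (B.inst₁ 0 a))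
  | pi_beta {Γ A B a b} : Der T (.ty Γ (.pi A B) .col) → Der T (.tm (A :: Γ) b B) →
      Der T (.tm Γ a A) → Der T (.tmEq Γ (.app (.lam A b) a) (b.inst₁ 0 a) (B.inst₁ 0 a))
  | pi_eta {Γ A B f} : Der T (.tm Γ f (.pi A B)) →
      Der T (.tmEq Γ (.lam A (.app (f.lift 1) (.var 0))) f (.pi A B))
  /- lists -/
  | list_nil {Γ A} : Der T (.ty Γ A .set) → Der T (.tm Γ (.nil A) (.list A))
  | list_nil_eq {Γ A A'} : Der T (.tyEq Γ A A' .set) →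
      Der T (.tmEq Γ (.nil A) (.nil A') (.list A))
  | list_cons {Γ A s c} : Der T (.tm Γ s (.list A)) → Der T (.tm Γ c A) →
      Der T (.tm Γ (.cons s c) (.list A))
  | list_cons_eq {Γ A s s' c c'} : Der T (.tmEq Γ s s' (.list A)) → Der T (.tmEq Γ c c' A) →
      Der T (.tmEq Γ (.cons s c) (.cons s' c') (.list A))
  | list_elim {Γ A L s a l} : Der T (.ty (.list A :: Γ) L .col) → Der T (.tm Γ s (.list A)) →
      Der T (.tm Γ a (L.inst₁ 0 (.nil A))) →
      Der T (.tm (L.inst₁ 2 (.var 1) :: A.lift 1 :: .list A :: Γ) l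
        (L.inst₁ 3 (.cons (.var 2) (.var 1)))) →
      Der T (.tm Γ (.elList A L s a l) (L.inst₁ 0 s))
  | list_elim_eq {Γ A A' L L' s s' a a' l l'} : Der T (.tyEq Γ A A' .set) →
      Der T (.tyEq (.list A :: Γ) L L' .col) → Der T (.tmEq Γ s s' (.list A)) →
      Der T (.tmEq Γ a a' (L.inst₁ 0 (.nil A))) →
      Der T (.tmEq (L.inst₁ 2 (.var 1) :: A.lift 1 :: .list A :: Γ) l l'
        (L.inst₁ 3 (.cons (.var 2) (.var 1)))) →
      Der T (.tmEq Γ (.elList A L s a l) (.elList A' L' s' a' l') (L.inst₁ 0 s))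
  | list_beta_nil {Γ A L a l} : Der T (.ty (.list A :: Γ) L .col) →
      Der T (.tm Γ a (L.inst₁ 0 (.nil A))) →
      Der T (.tm (L.inst₁ 2 (.var 1) :: A.lift 1 :: .list A :: Γ) l
        (L.inst₁ 3 (.cons (.var 2) (.var 1)))) →
      Der T (.tmEq Γ (.elList A L (.nil A) a l) a (L.inst₁ 0 (.nil A)))
  | list_beta_cons {Γ A L s c a l} : Der T (.ty (.list A :: Γ) L .col) →
      Der T (.tm Γ s (.list A)) → Der T (.tm Γ c A) →
      Der T (.tm Γ a (L.inst₁ 0 (.nil A))) →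
      Der T (.tm (L.inst₁ 2 (.var 1) :: A.lift 1 :: .list A :: Γ) l
        (L.inst₁ 3 (.cons (.var 2) (.var 1)))) →
      Der T (.tmEq Γ (.elList A L (.cons s c) a l) (l.inst₃ 0 s c (.elList A L s a l))
        (L.inst₁ 0 (.cons s c)))
  /- disjoint sums -/
  | sum_inl {Γ A B a} : Der T (.ty Γ (.sum A B) .set) → Der T (.tm Γ a A) →
      Der T (.tm Γ (.inl A B a) (.sum A B))
  | sum_inl_eq {Γ A A' B B' a a'} : Der T (.tyEq Γ A A' .set) → Der T (.tyEq Γ B B' .set) →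
      Der T (.tmEq Γ a a' A) → Der T (.tmEq Γ (.inl A B a) (.inl A' B' a') (.sum A B))
  | sum_inr {Γ A B b} : Der T (.ty Γ (.sum A B) .set) → Der T (.tm Γ b B) →
      Der T (.tm Γ (.inr A B b) (.sum A B))
  | sum_inr_eq {Γ A A' B B' b b'} : Der T (.tyEq Γ A A' .set) → Der T (.tyEq Γ B B' .set) →
      Der T (.tmEq Γ b b' B) → Der T (.tmEq Γ (.inr A B b) (.inr A' B' b') (.sum A B))
  | sum_elim {Γ A B M w a b} : Der T (.ty (.sum A B :: Γ) M .col) →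
      Der T (.tm Γ w (.sum A B)) →
      Der T (.tm (A :: Γ) a (M.inst₁ 1 (.inl (A.lift 1) (B.lift 1) (.var 0)))) →
      Der T (.tm (B :: Γ) b (M.inst₁ 1 (.inr (A.lift 1) (B.lift 1) (.var 0)))) →
      Der T (.tm Γ (.elSum A B M w a b) (M.inst₁ 0 w))
  | sum_elim_eq {Γ A A' B B' M M' w w' a a' b b'} : Der T (.tyEq Γ A A' .set) →
      Der T (.tyEq Γ B B' .set) → Der T (.tyEq (.sum A B :: Γ) M M' .col) →
      Der T (.tmEq Γ w w' (.sum A B)) →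
      Der T (.tmEq (A :: Γ) a a' (M.inst₁ 1 (.inl (A.lift 1) (B.lift 1) (.var 0)))) →
      Der T (.tmEq (B :: Γ) b b' (M.inst₁ 1 (.inr (A.lift 1) (B.lift 1) (.var 0)))) →
      Der T (.tmEq Γ (.elSum A B M w a b) (.elSum A' B' M' w' a' b') (M.inst₁ 0 w))
  | sum_beta_inl {Γ A B M c a b} : Der T (.ty (.sum A B :: Γ) M .col) → Der T (.tm Γ c A) →
      Der T (.tm (A :: Γ) a (M.inst₁ 1 (.inl (A.lift 1) (B.lift 1) (.var 0)))) →
      Der T (.tm (B :: Γ) b (M.inst₁ 1 (.inr (A.lift 1) (B.lift 1) (.var 0)))) →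
      Der T (.tmEq Γ (.elSum A B M (.inl A B c) a b) (a.inst₁ 0 c) (M.inst₁ 0 (.inl A B c)))
  | sum_beta_inr {Γ A B M c a b} : Der T (.ty (.sum A B :: Γ) M .col) → Der T (.tm Γ c B) →
      Der T (.tm (A :: Γ) a (M.inst₁ 1 (.inl (A.lift 1) (B.lift 1) (.var 0)))) →
      Der T (.tm (B :: Γ) b (M.inst₁ 1 (.inr (A.lift 1) (B.lift 1) (.var 0)))) →
      Der T (.tmEq Γ (.elSum A B M (.inr A B c) a b) (b.inst₁ 0 c) (M.inst₁ 0 (.inr A B c)))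
  /- quotients -/
  | quo_intro {Γ A R a} : Der T (.ty Γ (.quo A R) .set) → Der T (.tm Γ a A) →
      Der T (.tm Γ (.qcl A R a) (.quo A R))
  | quo_intro_eq {Γ A A' R R' a a'} : Der T (.ty Γ (.quo A R) .set) →
      Der T (.tyEq Γ A A' .set) → Der T (.tyEq (A.lift 1 :: A :: Γ) R R' .props) →
      Der T (.tmEq Γ a a' A) → Der T (.tmEq Γ (.qcl A R a) (.qcl A' R' a') (.quo A R))
  | quo_class_eq {Γ A R a b} : Der T (.ty Γ (.quo A R) .set) → Der T (.tm Γ a A) →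
      Der T (.tm Γ b A) → Der T (.tr Γ (R.inst₂ 0 a b)) →
      Der T (.tmEq Γ (.qcl A R a) (.qcl A R b) (.quo A R))
  | quo_effective {Γ A R a b} : Der T (.ty Γ (.quo A R) .set) → Der T (.tm Γ a A) →
      Der T (.tm Γ b A) → Der T (.tmEq Γ (.qcl A R a) (.qcl A R b) (.quo A R)) →
      Der T (.tr Γ (R.inst₂ 0 a b))
  | quo_elim {Γ A R L p l} : Der T (.ty (.quo A R :: Γ) L .col) → Der T (.tm Γ p (.quo A R)) →
      Der T (.tm (A :: Γ) l (L.inst₁ 1 (.qcl (A.lift 1) (R.lift₂ 1) (.var 0)))) →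
      Der T (.tmEq (R :: A.lift 1 :: A :: Γ) (l.inst₁ 3 (.var 2)) (l.inst₁ 3 (.var 1))
        (L.inst₁ 3 (.qcl (A.lift 3) (R.lift₂ 3) (.var 2)))) →
      Der T (.tm Γ (.elQ A R L p l) (L.inst₁ 0 p))
  | quo_elim_eq {Γ A A' R R' L L' p p' l l'} : Der T (.tyEq Γ A A' .set) →
      Der T (.tyEq (A.lift 1 :: A :: Γ) R R' .props) →
      Der T (.tyEq (.quo A R :: Γ) L L' .col) → Der T (.tmEq Γ p p' (.quo A R)) →
      Der T (.tmEq (A :: Γ) l l' (L.inst₁ 1 (.qcl (A.lift 1) (R.lift₂ 1) (.var 0)))) →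
      Der T (.tmEq (R :: A.lift 1 :: A :: Γ) (l.inst₁ 3 (.var 2)) (l.inst₁ 3 (.var 1))
        (L.inst₁ 3 (.qcl (A.lift 3) (R.lift₂ 3) (.var 2)))) →
      Der T (.tmEq Γ (.elQ A R L p l) (.elQ A' R' L' p' l') (L.inst₁ 0 p))
  | quo_beta {Γ A R L a l} : Der T (.ty (.quo A R :: Γ) L .col) → Der T (.tm Γ a A) →
      Der T (.tm (A :: Γ) l (L.inst₁ 1 (.qcl (A.lift 1) (R.lift₂ 1) (.var 0)))) →
      Der T (.tmEq (R :: A.lift 1 :: A :: Γ) (l.inst₁ 3 (.var 2)) (l.inst₁ 3 (.var 1))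
        (L.inst₁ 3 (.qcl (A.lift 3) (R.lift₂ 3) (.var 2)))) →
      Der T (.tmEq Γ (.elQ A R L (.qcl A R a) l) (l.inst₁ 0 a) (L.inst₁ 0 (.qcl A R a)))
  /- power collection of the singleton -/
  | P1_intro {Γ φ} : Der T (.ty Γ φ .props) → Der T (.tm Γ (.pcl φ) .P1)
  | P1_class_eq {Γ φ ψ} : Der T (.ty Γ φ .props) → Der T (.ty Γ ψ .props) →
      Der T (.tr Γ (Exp.iff φ ψ)) → Der T (.tmEq Γ (.pcl φ) (.pcl ψ) .P1)
  | P1_effective {Γ φ ψ} : Der T (.ty Γ φ .props) → Der T (.ty Γ ψ .props) →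
      Der T (.tmEq Γ (.pcl φ) (.pcl ψ) .P1) → Der T (.tr Γ (Exp.iff φ ψ))
  | P1_eta {Γ U} : Der T (.tm Γ U .P1) → Der T (.tmEq Γ (.pcl (.eq .P1 U (.pcl Exp.top))) U .P1)
  /- propositions are proof-irrelevant, and `true` is their canonical proof-term -/
  | prop_mono {Γ φ p q} : Der T (.ty Γ φ .prop) → Der T (.tm Γ p φ) → Der T (.tm Γ q φ) →
      Der T (.tmEq Γ p q φ)
  | prop_true {Γ φ p} : Der T (.ty Γ φ .prop) → Der T (.tm Γ p φ) → Der T (.tr Γ φ)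
  /- logic -/
  | bot_elim {Γ φ} : Der T (.tr Γ .bot) → Der T (.ty Γ φ .prop) → Der T (.tr Γ φ)
  | and_intro {Γ φ ψ} : Der T (.ty Γ φ .prop) → Der T (.ty Γ ψ .prop) → Der T (.tr Γ φ) →
      Der T (.tr Γ ψ) → Der T (.tr Γ (.and φ ψ))
  | and_left {Γ φ ψ} : Der T (.ty Γ φ .prop) → Der T (.ty Γ ψ .prop) →
      Der T (.tr Γ (.and φ ψ)) → Der T (.tr Γ φ)
  | and_right {Γ φ ψ} : Der T (.ty Γ φ .prop) → Der T (.ty Γ ψ .prop) →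
      Der T (.tr Γ (.and φ ψ)) → Der T (.tr Γ ψ)
  | or_inl {Γ φ ψ} : Der T (.ty Γ φ .prop) → Der T (.ty Γ ψ .prop) → Der T (.tr Γ φ) →
      Der T (.tr Γ (.or φ ψ))
  | or_inr {Γ φ ψ} : Der T (.ty Γ φ .prop) → Der T (.ty Γ ψ .prop) → Der T (.tr Γ ψ) →
      Der T (.tr Γ (.or φ ψ))
  | or_elim {Γ φ ψ χ} : Der T (.ty Γ φ .prop) → Der T (.ty Γ ψ .prop) →
      Der T (.ty Γ χ .prop) → Der T (.tr Γ (.or φ ψ)) → Der T (.tr (φ :: Γ) (χ.lift 1)) →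
      Der T (.tr (ψ :: Γ) (χ.lift 1)) → Der T (.tr Γ χ)
  | imp_intro {Γ φ ψ} : Der T (.ty Γ φ .prop) → Der T (.ty Γ ψ .prop) →
      Der T (.tr (φ :: Γ) (ψ.lift 1)) → Der T (.tr Γ (.imp φ ψ))
  | imp_elim {Γ φ ψ} : Der T (.ty Γ φ .prop) → Der T (.ty Γ ψ .prop) →
      Der T (.tr Γ (.imp φ ψ)) → Der T (.tr Γ φ) → Der T (.tr Γ ψ)
  | ex_intro {Γ A φ a} : Der T (.ty (A :: Γ) φ .prop) → Der T (.tm Γ a A) →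
      Der T (.tr Γ (φ.inst₁ 0 a)) → Der T (.tr Γ (.ex A φ))
  | ex_elim {Γ A φ χ} : Der T (.ty (A :: Γ) φ .prop) → Der T (.ty Γ χ .prop) →
      Der T (.tr Γ (.ex A φ)) → Der T (.tr (φ :: A :: Γ) (χ.lift 2)) → Der T (.tr Γ χ)
  | all_intro {Γ A φ} : Der T (.ty (A :: Γ) φ .prop) → Der T (.tr (A :: Γ) φ) →
      Der T (.tr Γ (.all A φ))
  | all_elim {Γ A φ a} : Der T (.ty (A :: Γ) φ .prop) → Der T (.tr Γ (.all A φ)) →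
      Der T (.tm Γ a A) → Der T (.tr Γ (φ.inst₁ 0 a))
  | eq_intro {Γ A a} : Der T (.tm Γ a A) → Der T (.tr Γ (.eq A a a))
  | eq_reflect {Γ A a b} : Der T (.tm Γ a A) → Der T (.tm Γ b A) →
      Der T (.tr Γ (.eq A a b)) → Der T (.tmEq Γ a b A)

/-! ## Canonical isomorphisms of `emTT` -/

/-- `CanIso Γ A B τ`: the functional term `τ(x) ∈ B [Γ, x ∈ A]` of `emTT` is a canonical
isomorphism.  Functional terms are considered up to judgemental equality. -/
inductive CanIso : Ctx → Ty → Ty → Tm → Prop where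
  | prop {Γ φ ψ} : Der .emTT (.ty Γ φ .prop) → Der .emTT (.ty Γ ψ .prop) →
      Der .emTT (.tr Γ (Exp.iff φ ψ)) → CanIso Γ φ ψ (.tru (ψ.lift 1))
  | N0 {Γ} : Der .emTT (.ctx Γ) → CanIso Γ .N0 .N0 (.var 0)
  | N1 {Γ} : Der .emTT (.ctx Γ) → CanIso Γ .N1 .N1 (.var 0)
  | P1 {Γ} : Der .emTT (.ctx Γ) → CanIso Γ .P1 .P1 (.var 0)
  | list {Γ A B τ} : Der .emTT (.ty Γ A .set) → Der .emTT (.ty Γ B .set) → CanIso Γ A B τ →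
      CanIso Γ (.list A) (.list B)
        (.elList (A.lift 1) (.list (B.lift 2)) (.var 0) (.nil (B.lift 1))
          (.cons (.var 0) (τ.inst₁ 4 (.var 1))))
  | sum {Γ A A' B B' τ σ} : Der .emTT (.ty Γ A .set) → Der .emTT (.ty Γ A' .set) →
      Der .emTT (.ty Γ B .set) → Der .emTT (.ty Γ B' .set) →
      CanIso Γ A A' τ → CanIso Γ B B' σ →
      CanIso Γ (.sum A B) (.sum A' B')
        (.elSum (A.lift 1) (B.lift 1) (.sum (A'.lift 2) (B'.lift 2)) (.var 0)
          (.inl (A'.lift 2) (B'.lift 2) (τ.inst₁ 2 (.var 0)))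
          (.inr (A'.lift 2) (B'.lift 2) (σ.inst₁ 2 (.var 0))))
  | sig {Γ A A' B B' τ σ} : Der .emTT (.ty (A :: Γ) B .col) →
      Der .emTT (.ty (A' :: Γ) B' .col) → CanIso Γ A A' τ →
      CanIso (A :: Γ) B (B'.inst₁ 1 τ) σ →
      CanIso Γ (.sig A B) (.sig A' B')
        (.elSig (A.lift 1) (B.lift₁ 1) (.sig (A'.lift 2) (B'.lift₁ 2)) (.var 0)
          (.pair (A'.lift 3) (B'.lift₁ 3) (τ.inst₁ 3 (.var 1)) (σ.inst₂ 3 (.var 1) (.var 0))))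
  | pi {Γ A A' B B' τ σ} : Der .emTT (.ty Γ (.pi A B) .col) →
      Der .emTT (.ty Γ (.pi A' B') .col) → CanIso Γ A' A τ →
      CanIso (A' :: Γ) (B.inst₁ 1 τ) B' σ →
      CanIso Γ (.pi A B) (.pi A' B')
        (.lam (A'.lift 1)
          (σ.inst₂ 2 (.var 0) (.app (.var 1) (τ.inst₁ 2 (.var 0)))))
  | quo {Γ A B R S τ} : Der .emTT (.ty Γ (.quo A R) .set) → Der .emTT (.ty Γ (.quo B S) .set) →
      CanIso Γ A B τ →
      Der .emTT (.tr (A.lift 1 :: A :: Γ)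
        (Exp.iff R (S.inst₂ 2 (τ.inst₁ 2 (.var 1)) (τ.inst₁ 2 (.var 0))))) →
      CanIso Γ (.quo A R) (.quo B S)
        (.elQ (A.lift 1) (R.lift₂ 1) (.quo (B.lift 2) (S.lift₂ 2)) (.var 0)
          (.qcl (B.lift 2) (S.lift₂ 2) (τ.inst₁ 2 (.var 0))))
  | eqv {Γ A B τ τ'} : CanIso Γ A B τ → Der .emTT (.tmEq (A :: Γ) τ τ' (B.lift 1)) →
      CanIso Γ A B τ'

/-- `CtxIso Γ Δ σ`: the telescopic substitution `σ ∈ Δ [Γ]` is a canonical isomorphism. -/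
inductive CtxIso : Ctx → Ctx → Sub → Prop where
  | nil : CtxIso [] [] .var
  | cons {Γ Δ A B σ τ} : Der .emTT (.ty Γ A .col) → Der .emTT (.ty Δ B .col) →
      CtxIso Γ Δ σ → CanIso Γ A (B.subst σ) τ →
      CtxIso (A :: Γ) (B :: Δ) (scons τ (fun n => (σ n).lift 1))

/-- A type in context. -/
structure TyJ where
  ctx : Ctx
  ty : Ty

/-- A term in context. -/
structure TmJ where
  ctx : Ctx
  tm : Tm
  ty : Ty

/-- Canonically related `emTT`-contexts. -/
def CtxRel (Γ Δ : Ctx) : Prop :=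
  Der .emTT (.ctx Γ) ∧ Der .emTT (.ctx Δ) ∧ ∃ σ, CtxIso Γ Δ σ

/-- Canonically related dependent `emTT`-collections. -/
def TyRel (J K : TyJ) : Prop :=
  Der .emTT (.ty J.ctx J.ty .col) ∧ Der .emTT (.ty K.ctx K.ty .col) ∧
    ∃ σ τ, CtxIso J.ctx K.ctx σ ∧ CanIso J.ctx J.ty (K.ty.subst σ) τ

/-- Canonically related dependent `emTT`-terms. -/
def TmRel (J K : TmJ) : Prop :=
  Der .emTT (.tm J.ctx J.tm J.ty) ∧ Der .emTT (.tm K.ctx K.tm K.ty) ∧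
    ∃ σ τ, CtxIso J.ctx K.ctx σ ∧ CanIso J.ctx J.ty (K.ty.subst σ) τ ∧
      Der .emTT (.tmEq J.ctx (τ.inst₁ 0 J.tm) (K.tm.subst σ) (K.ty.subst σ))

/-- The class of the contexts canonically related to `Γ`. -/
def ctxCls (Γ : Ctx) : Set Ctx := {Δ | CtxRel Γ Δ}

/-- The class of the collections canonically related to `A col [Γ]`. -/
def tyCls (Γ : Ctx) (A : Ty) : Set TyJ := {K | TyRel ⟨Γ, A⟩ K}

/-- The class of the terms canonically related to `a ∈ A [Γ]`. -/
def tmCls (Γ : Ctx) (a : Tm) (A : Ty) : Set TmJ := {K | TmRel ⟨Γ, a, A⟩ K}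

/-- `S ≡ [Γ ctx]` for the derivable `emTT`-context `Γ`. -/
def CtxIs (S : Set Ctx) (Γ : Ctx) : Prop := Der .emTT (.ctx Γ) ∧ S = ctxCls Γ

/-- `S ≡ [A col [Γ]]` for the derivable `emTT`-collection `A`. -/
def TyIs (S : Set TyJ) (Γ : Ctx) (A : Ty) : Prop := Der .emTT (.ty Γ A .col) ∧ S = tyCls Γ A

/-- `S ≡ [a ∈ A [Γ]]` for the derivable `emTT`-term `a`. -/
def TmIs (S : Set TmJ) (Γ : Ctx) (a : Tm) (A : Ty) : Prop :=
  Der .emTT (.tm Γ a A) ∧ S = tmCls Γ a A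

/-! ## The interpretation

The interpretation of an expression in a context `Γ` depends on `Γ` only through the interpretation
of `Γ`, so it is defined by structural recursion on expressions, taking the latter as an argument.
Partiality: the interpretation is defined when its value is the equivalence class of a derivable
`emTT`-judgement. -/

@[reducible] def Obj : Srt → Type
  | .ty => TyJ
  | .tm => TmJ

/-- `[Γ', x ∈ A' ctx]` provided that `S ≡ [A' col [Γ']]`. -/
def ctxExt (S : Set TyJ) : Set Ctx :=
  {Δ | ∃ Γ' A', TyIs S Γ' A' ∧ Δ ∈ ctxCls (A' :: Γ')}

/-- `[Γ', x ∈ A', y ∈ A' ctx]` provided that `S ≡ [A' col [Γ']]`. -/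
def ctxExtTwice (S : Set TyJ) : Set Ctx :=
  {Δ | ∃ Γ' A', TyIs S Γ' A' ∧ Δ ∈ ctxCls (A'.lift 1 :: A' :: Γ')}

/-- `[Γ', x ∈ List(A'), y ∈ A', z ∈ L'(x) ctx]` provided that `S ≡ [L' col [Γ', x ∈ List(A')]]`. -/
def ctxExtList (S : Set TyJ) : Set Ctx :=
  {Δ | ∃ Γ' A' L', TyIs S (.list A' :: Γ') L' ∧
    Δ ∈ ctxCls (L'.inst₁ 2 (.var 1) :: A'.lift 1 :: .list A' :: Γ')}

/-- A constant type. -/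
def semConst (C : Set Ctx) (K : Ty) : Set TyJ :=
  {J | ∃ Γ', CtxIs C Γ' ∧ J ∈ tyCls Γ' K}

/-- `[F(A') [Γ']]` provided that `S ≡ [A' [Γ']]`. -/
def semUn (F : Ty → Ty) (S : Set TyJ) : Set TyJ :=
  {J | ∃ Γ' A', TyIs S Γ' A' ∧ J ∈ tyCls Γ' (F A')}

/-- `[F(A', B') [Γ']]` provided that `S ≡ [A' [Γ']]` and `S' ≡ [B' [Γ']]`. -/
def semBin (F : Ty → Ty → Ty) (S S' : Set TyJ) : Set TyJ :=
  {J | ∃ Γ' A' B', TyIs S Γ' A' ∧ TyIs S' Γ' B' ∧ J ∈ tyCls Γ' (F A' B')}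

/-- `[(F x ∈ A') B' [Γ']]` provided that `S ≡ [B' [Γ', x ∈ A']]`. -/
def semBind (F : Ty → Ty → Ty) (S : Set TyJ) : Set TyJ :=
  {J | ∃ Γ' A' B', TyIs S (A' :: Γ') B' ∧ J ∈ tyCls Γ' (F A' B')}

/-- `[A'/R' [Γ']]` provided that `S ≡ [R' [Γ', x ∈ A', y ∈ A']]`. -/
def semQuo (S : Set TyJ) : Set TyJ :=
  {J | ∃ Γ' A' R', TyIs S (A'.lift 1 :: A' :: Γ') R' ∧ J ∈ tyCls Γ' (.quo A' R')}

/-- The interpretation of the expression `e` in a context whose interpretation is `C`. -/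
def sem : {s : Srt} → Exp s → Set Ctx → Set (Obj s)
  | _, .N0, C => semConst C .N0
  | _, .N1, C => semConst C .N1
  | _, .P1, C => semConst C .P1
  | _, .sig A B, C => semBind .sig (sem B (ctxExt (sem A C)))
  | _, .pi A B, C => semBind .pi (sem B (ctxExt (sem A C)))
  | _, .sum A B, C => semBin .sum (sem A C) (sem B C)
  | _, .list A, C => semUn .list (sem A C)
  | _, .quo A R, C => semQuo (sem R (ctxExtTwice (sem A C)))
  | _, .bot, C => semConst C .bot
  | _, .and φ ψ, C => semBin .and (sem φ C) (sem ψ C)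
  | _, .or φ ψ, C => semBin .or (sem φ C) (sem ψ C)
  | _, .imp φ ψ, C => semBin .imp (sem φ C) (sem ψ C)
  | _, .ex A φ, C => semBind .ex (sem φ (ctxExt (sem A C)))
  | _, .all A φ, C => semBind .all (sem φ (ctxExt (sem A C)))
  | _, .eq A a b, C =>
      {J : TyJ | ∃ Γ' A' a' b', TyIs (sem A C) Γ' A' ∧ TmIs (sem a C) Γ' a' A' ∧
        TmIs (sem b C) Γ' b' A' ∧ J ∈ tyCls Γ' (.eq A' a' b')}
  | _, .var n, C =>
      {J : TmJ | ∃ (Γ' : Ctx) (A' : Ty), CtxIs C Γ' ∧ Γ'[n]? = some A' ∧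
        J ∈ tmCls Γ' (.var n) (A'.lift (n + 1))}
  | _, .tru φ, C =>
      {J : TmJ | ∃ Γ' φ', TyIs (sem φ C) Γ' φ' ∧ J ∈ tmCls Γ' (.tru φ') φ'}
  | _, .emp M c, C =>
      {J : TmJ | ∃ Γ' M' c', TyIs (sem M (ctxExt (semConst C .N0))) (.N0 :: Γ') M' ∧
        TmIs (sem c C) Γ' c' .N0 ∧ J ∈ tmCls Γ' (.emp M' c') (M'.inst₁ 0 c')}
  | _, .star, C => {J : TmJ | ∃ Γ', CtxIs C Γ' ∧ J ∈ tmCls Γ' .star .N1}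
  | _, .elN1 M t c, C =>
      {J : TmJ | ∃ Γ' M' t' c', TyIs (sem M (ctxExt (semConst C .N1))) (.N1 :: Γ') M' ∧
        TmIs (sem t C) Γ' t' .N1 ∧ TmIs (sem c C) Γ' c' (M'.inst₁ 0 .star) ∧
        J ∈ tmCls Γ' (.elN1 M' t' c') (M'.inst₁ 0 t')}
  | _, .pair A B a b, C =>
      {J : TmJ | ∃ Γ' A' B' a' b', TyIs (sem B (ctxExt (sem A C))) (A' :: Γ') B' ∧
        TmIs (sem a C) Γ' a' A' ∧ TmIs (sem b C) Γ' b' (B'.inst₁ 0 a') ∧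
        J ∈ tmCls Γ' (.pair A' B' a' b') (.sig A' B')}
  | _, .elSig A B M d m, C =>
      {J : TmJ | ∃ Γ' A' B' M' d' m', TyIs (sem B (ctxExt (sem A C))) (A' :: Γ') B' ∧
        TyIs (sem M (ctxExt (semBind .sig (sem B (ctxExt (sem A C)))))) (.sig A' B' :: Γ') M' ∧
        TmIs (sem d C) Γ' d' (.sig A' B') ∧
        TmIs (sem m (ctxExt (sem B (ctxExt (sem A C))))) (B' :: A' :: Γ') m'
          (M'.inst₁ 2 (.pair (A'.lift 2) (B'.lift₁ 2) (.var 1) (.var 0))) ∧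
        J ∈ tmCls Γ' (.elSig A' B' M' d' m') (M'.inst₁ 0 d')}
  | _, .lam A b, C =>
      {J : TmJ | ∃ Γ' A' B' b', TmIs (sem b (ctxExt (sem A C))) (A' :: Γ') b' B' ∧
        J ∈ tmCls Γ' (.lam A' b') (.pi A' B')}
  | _, .app f a, C =>
      {J : TmJ | ∃ Γ' A' B' f' a', TmIs (sem f C) Γ' f' (.pi A' B') ∧
        TmIs (sem a C) Γ' a' A' ∧ J ∈ tmCls Γ' (.app f' a') (B'.inst₁ 0 a')}
  | _, .nil A, C =>
      {J : TmJ | ∃ Γ' A', TyIs (sem A C) Γ' A' ∧ J ∈ tmCls Γ' (.nil A') (.list A')}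
  | _, .cons s c, C =>
      {J : TmJ | ∃ Γ' A' s' c', TmIs (sem s C) Γ' s' (.list A') ∧ TmIs (sem c C) Γ' c' A' ∧
        J ∈ tmCls Γ' (.cons s' c') (.list A')}
  | _, .elList A L s a l, C =>
      {J : TmJ | ∃ Γ' A' L' s' a' l', TyIs (sem A C) Γ' A' ∧
        TyIs (sem L (ctxExt (semUn .list (sem A C)))) (.list A' :: Γ') L' ∧
        TmIs (sem s C) Γ' s' (.list A') ∧ TmIs (sem a C) Γ' a' (L'.inst₁ 0 (.nil A')) ∧
        TmIs (sem l (ctxExtList (sem L (ctxExt (semUn .list (sem A C))))))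
          (L'.inst₁ 2 (.var 1) :: A'.lift 1 :: .list A' :: Γ') l'
          (L'.inst₁ 3 (.cons (.var 2) (.var 1))) ∧
        J ∈ tmCls Γ' (.elList A' L' s' a' l') (L'.inst₁ 0 s')}
  | _, .inl A B a, C =>
      {J : TmJ | ∃ Γ' A' B' a', TyIs (sem A C) Γ' A' ∧ TyIs (sem B C) Γ' B' ∧
        TmIs (sem a C) Γ' a' A' ∧ J ∈ tmCls Γ' (.inl A' B' a') (.sum A' B')}
  | _, .inr A B b, C =>
      {J : TmJ | ∃ Γ' A' B' b', TyIs (sem A C) Γ' A' ∧ TyIs (sem B C) Γ' B' ∧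
        TmIs (sem b C) Γ' b' B' ∧ J ∈ tmCls Γ' (.inr A' B' b') (.sum A' B')}
  | _, .elSum A B M w a b, C =>
      {J : TmJ | ∃ Γ' A' B' M' w' a' b', TyIs (sem A C) Γ' A' ∧ TyIs (sem B C) Γ' B' ∧
        TyIs (sem M (ctxExt (semBin .sum (sem A C) (sem B C)))) (.sum A' B' :: Γ') M' ∧
        TmIs (sem w C) Γ' w' (.sum A' B') ∧
        TmIs (sem a (ctxExt (sem A C))) (A' :: Γ') a'
          (M'.inst₁ 1 (.inl (A'.lift 1) (B'.lift 1) (.var 0))) ∧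
        TmIs (sem b (ctxExt (sem B C))) (B' :: Γ') b'
          (M'.inst₁ 1 (.inr (A'.lift 1) (B'.lift 1) (.var 0))) ∧
        J ∈ tmCls Γ' (.elSum A' B' M' w' a' b') (M'.inst₁ 0 w')}
  | _, .qcl A R a, C =>
      {J : TmJ | ∃ Γ' A' R' a',
        TyIs (sem R (ctxExtTwice (sem A C))) (A'.lift 1 :: A' :: Γ') R' ∧
        TmIs (sem a C) Γ' a' A' ∧ J ∈ tmCls Γ' (.qcl A' R' a') (.quo A' R')}
  | _, .elQ A R L p l, C =>
      {J : TmJ | ∃ Γ' A' R' L' p' l',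
        TyIs (sem R (ctxExtTwice (sem A C))) (A'.lift 1 :: A' :: Γ') R' ∧
        TyIs (sem L (ctxExt (semQuo (sem R (ctxExtTwice (sem A C)))))) (.quo A' R' :: Γ') L' ∧
        TmIs (sem p C) Γ' p' (.quo A' R') ∧
        TmIs (sem l (ctxExt (sem A C))) (A' :: Γ') l'
          (L'.inst₁ 1 (.qcl (A'.lift 1) (R'.lift₂ 1) (.var 0))) ∧
        J ∈ tmCls Γ' (.elQ A' R' L' p' l') (L'.inst₁ 0 p')}
  | _, .pcl φ, C =>
      {J : TmJ | ∃ Γ' φ', TyIs (sem φ C) Γ' φ' ∧ J ∈ tmCls Γ' (.pcl φ') .P1}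

/-- The interpretation of `Γ ctx`. -/
def interpCtx : Ctx → Set Ctx
  | [] => ctxCls []
  | A :: Γ => ctxExt (sem A (interpCtx Γ))

/-- The interpretation of `A type [Γ]`. -/
def interpTy (Γ : Ctx) (A : Ty) : Set TyJ := sem A (interpCtx Γ)

/-- The interpretation of `a ∈ A [Γ]`; as terms are fully annotated, it does not depend on the
type `A` with which `a` is presented. -/
def interpTm (Γ : Ctx) (a : Tm) : Set TmJ := sem a (interpCtx Γ)

/-- The interpretation of `Γ ctx` is defined. -/
def CtxDefined (Γ : Ctx) : Prop := ∃ Γ', CtxIs (interpCtx Γ) Γ'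

/-- The interpretation of `A k [Γ]` is defined: it is an equivalence class of collections, all in
contexts which belong to the interpretation of `Γ`, and at least one of them is of kind `k`. -/
def TyDefined (Γ : Ctx) (A : Ty) (k : Kind) : Prop :=
  (∃ Γ' A', TyIs (interpTy Γ A) Γ' A') ∧
  (∀ J ∈ interpTy Γ A, J.ctx ∈ interpCtx Γ) ∧
  ∃ J ∈ interpTy Γ A, Der .emTT (.ty J.ctx J.ty k)

/-- The interpretation of `a ∈ A [Γ]` is defined: it is an equivalence class of terms, all in
contexts which belong to the interpretation of `Γ`. -/
def TmDefined (Γ : Ctx) (a : Tm) : Prop :=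
  (∃ Γ' a' A', TmIs (interpTm Γ a) Γ' a' A') ∧
  ∀ J ∈ interpTm Γ a, J.ctx ∈ interpCtx Γ

end EmTT

namespace EmTT

/-! ## Calculus of substitutions -/

/-! Propositional extensionality identifies only equiprovable propositions, and in a
proof-irrelevant theory two equiprovable propositions are isomorphic in exactly one way. So `emTT +
propext` can be read inside `emTT` by taking types up to canonical isomorphism, provided that
canonical isomorphisms behave like identities: they contain identities, compose, have inverses, are
stable under substitution, and there is at most one of them between two given types or contexts.
Every choice of an isomorphism in the interpretation is then immaterial.

Uniqueness comes from extensionality. Equality reflection makes judgemental equality the same as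
truth of `Eq`, and a proposition over an inductive type can be proved by elimination, so a map out
of such a type is determined by its values on canonical elements. The relation `Iso` therefore
describes a canonical isomorphism by those values instead of by an explicit term. Uniqueness
(`Iso.unique`) and composition (`Iso.comp`, by recursion on the size of types) are proved for `Iso`,
and then `iso_of_canIso` and `canIso_of_iso` show that it coincides with `CanIso`. Inverses follow
(`Iso.symm`), as does the fact that the identity between judgementally equal types is canonical
(`iso_of_eqTy`). All this uses the metatheory of `emTT`: inversion of type formation and
presuppositions (`presup`).

Next, every type and term constructor respects canonical isomorphisms (the lemmas of `TyI` and
`TmI`). Hence the interpretation by equivalence classes can be computed on a single choice of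
representatives: `rel e Γ X` says that `X` represents `e` over the `emTT`-context `Γ`, and
`sem_eq_cls` says that the interpretation of `e` is then the class of `X`. Consequently
representatives are unique up to canonical isomorphism (`rel_ty_unique`, `rel_tm_unique`). They are
also stable under substitution (`rel_subst`).

Validity is an induction on derivations (`judg_valid`). An equality is valid when its two sides have
a common representative over every representative of the context. A rule of `emTT` is validated by
applying the same rule to representatives. For propositional extensionality, the representatives of
the two propositions are equiprovable in `emTT`, hence canonically isomorphic, hence each of them
represents both propositions (`TyV.propext`).

Over `emTT` every expression represents itself (`judg_self`), so the interpretation is the identity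
up to canonical isomorphism. Conservativity follows: if the extension proves an `emTT`-proposition
`φ`, some representative of `φ` is true in `emTT`; as `φ` represents itself, it is canonically
isomorphic to that representative, that is, equiprovable with it. -/

/-- The substitution which weakens by `k` variables. -/
def sh (k : ℕ) : Sub := fun n => .var (n + k)

/-- Composition of substitutions. -/
def cmp (σ τ : Sub) : Sub := fun n => (σ n).subst τ

theorem ups_var (ρ : ℕ → ℕ) : ups (fun n => .var (ρ n)) = fun n => .var (upr ρ n) := by
  funext n
  cases n <;> simp [ups, scons, upr, Exp.lift, Exp.ren]

/-- Renamings are a separate notion only because `ups` is defined through them. The lemmas below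
follow the order forced by binders: a renaming before a substitution, then a substitution before a
renaming, then two substitutions, each one needing the earlier ones to commute with `ups`. -/
theorem ren_eq_subst {s : Srt} (e : Exp s) (ρ : ℕ → ℕ) :
    e.ren ρ = e.subst (fun n => .var (ρ n)) := by
  induction e generalizing ρ <;> simp [Exp.ren, Exp.subst, ups_var, *]

theorem ups_upr (ρ : ℕ → ℕ) (τ : Sub) : (fun n => ups τ (upr ρ n)) = ups (fun n => τ (ρ n)) := by
  funext n; cases n <;> rfl

theorem ren_subst {s : Srt} (e : Exp s) (ρ : ℕ → ℕ) (τ : Sub) :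
    (e.ren ρ).subst τ = e.subst (fun n => τ (ρ n)) := by
  induction e generalizing ρ τ <;> simp [Exp.ren, Exp.subst, ups_upr, *]

theorem ren_ren {s : Srt} (e : Exp s) (ρ θ : ℕ → ℕ) :
    (e.ren ρ).ren θ = e.ren (fun n => θ (ρ n)) := by
  rw [ren_eq_subst _ θ, ren_subst, ← ren_eq_subst]

theorem ups_ren (σ : Sub) (ρ : ℕ → ℕ) :
    (fun n => (ups σ n).ren (upr ρ)) = ups (fun n => (σ n).ren ρ) := by
  funext n
  cases n with
  | zero => rfl
  | succ n => simp [ups, scons, Exp.lift, ren_ren, upr]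

theorem subst_ren {s : Srt} (e : Exp s) (σ : Sub) (ρ : ℕ → ℕ) :
    (e.subst σ).ren ρ = e.subst (fun n => (σ n).ren ρ) := by
  induction e generalizing ρ σ <;> simp [Exp.ren, Exp.subst, ups_ren, *]

theorem ups_cmp (σ τ : Sub) : cmp (ups σ) (ups τ) = ups (cmp σ τ) := by
  funext n
  cases n with
  | zero => rfl
  | succ n => simp [cmp, ups, scons, Exp.lift, ren_subst, subst_ren]

@[simp] theorem subst_subst {s : Srt} (e : Exp s) (σ τ : Sub) :
    (e.subst σ).subst τ = e.subst (cmp σ τ) := by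
  induction e generalizing σ τ <;> simp [Exp.subst, ups_cmp, *]; rfl

-- From here on all lifts, instances and `ups` are rewritten into `scons`, `sh` and `cmp`, for which
-- the simplification lemmas below compute a normal form. The side conditions of the rules are then
-- matched by simplification alone.
@[simp] theorem lift_eq {s : Srt} (e : Exp s) (k : ℕ) : e.lift k = e.subst (sh k) :=
  ren_eq_subst e _

@[simp] theorem lift₁_eq {s : Srt} (e : Exp s) (k : ℕ) : e.lift₁ k = e.subst (ups (sh k)) := by
  unfold sh; rw [Exp.lift₁, ren_eq_subst, ups_var]

@[simp] theorem lift₂_eq {s : Srt} (e : Exp s) (k : ℕ) :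
    e.lift₂ k = e.subst (ups (ups (sh k))) := by
  unfold sh; rw [Exp.lift₂, ren_eq_subst, ups_var, ups_var]

@[simp] theorem inst₁_eq {s : Srt} (e : Exp s) (k : ℕ) (a : Tm) :
    e.inst₁ k a = e.subst (scons a (sh k)) := rfl

@[simp] theorem inst₂_eq {s : Srt} (e : Exp s) (k : ℕ) (a b : Tm) :
    e.inst₂ k a b = e.subst (scons b (scons a (sh k))) := rfl

@[simp] theorem inst₃_eq {s : Srt} (e : Exp s) (k : ℕ) (a b c : Tm) :
    e.inst₃ k a b c = e.subst (scons c (scons b (scons a (sh k)))) := rfl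

@[simp] theorem ups_eq (σ : Sub) : ups σ = scons (.var 0) (cmp σ (sh 1)) := by
  funext n; cases n <;> simp [ups, scons, cmp]

@[simp] theorem scons_zero (a : Tm) (σ : Sub) : scons a σ 0 = a := rfl
@[simp] theorem scons_succ (a : Tm) (σ : Sub) (n : ℕ) : scons a σ (n + 1) = σ n := rfl
@[simp] theorem scons_one (a : Tm) (σ : Sub) : scons a σ 1 = σ 0 := rfl
@[simp] theorem scons_two (a : Tm) (σ : Sub) : scons a σ 2 = σ 1 := rfl
@[simp] theorem scons_three (a : Tm) (σ : Sub) : scons a σ 3 = σ 2 := rfl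
@[simp] theorem scons_four (a : Tm) (σ : Sub) : scons a σ 4 = σ 3 := rfl
@[simp] theorem sh_apply (k n : ℕ) : sh k n = .var (n + k) := rfl
@[simp] theorem cmp_apply (σ τ : Sub) (n : ℕ) : cmp σ τ n = (σ n).subst τ := rfl

@[simp] theorem cmp_scons (a : Tm) (σ τ : Sub) :
    cmp (scons a σ) τ = scons (a.subst τ) (cmp σ τ) := by
  funext n; cases n <;> rfl

@[simp] theorem cmp_assoc (σ τ θ : Sub) : cmp (cmp σ τ) θ = cmp σ (cmp τ θ) := by
  funext n; simp

@[simp] theorem sh_cmp_scons (k : ℕ) (a : Tm) (σ : Sub) :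
    cmp (sh (k + 1)) (scons a σ) = cmp (sh k) σ := rfl

@[simp] theorem sh_cmp_sh (j k : ℕ) : cmp (sh j) (sh k) = sh (j + k) := by
  funext n; simp [Exp.subst]; omega

@[simp] theorem sh_cmp_sh_cmp (j k : ℕ) (σ : Sub) :
    cmp (sh j) (cmp (sh k) σ) = cmp (sh (j + k)) σ := by
  rw [← cmp_assoc, sh_cmp_sh]

@[simp] theorem sh_zero_cmp (σ : Sub) : cmp (sh 0) σ = σ := rfl

theorem ups_sh_zero : ups (sh 0) = sh 0 := by
  funext n; cases n <;> rfl

@[simp] theorem subst_sh_zero {s : Srt} (e : Exp s) : e.subst (sh 0) = e := by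
  induction e <;> simp only [Exp.subst, ups_sh_zero, *]
  rfl

@[simp] theorem cmp_sh_zero (σ : Sub) : cmp σ (sh 0) = σ := by
  funext n; simp

@[simp] theorem scons_var_sh (k : ℕ) : scons (.var k) (sh (k + 1)) = sh k := by
  funext n
  cases n with
  | zero => simp
  | succ n => simp [sh]; omega

@[simp] theorem scons_var_zero_sh : scons (.var 0) (sh 1) = sh 0 := scons_var_sh 0
@[simp] theorem scons_var_one_sh : scons (.var 1) (sh 2) = sh 1 := scons_var_sh 1

@[simp] theorem scons_eta (σ : Sub) : scons (σ 0) (cmp (sh 1) σ) = σ := by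
  funext n; cases n <;> rfl

attribute [simp] Exp.subst

/-! ## Substitution and presuppositions in `emTT` -/

abbrev IsCtx (Γ : Ctx) : Prop := Der .emTT (.ctx Γ)
abbrev IsTy (Γ : Ctx) (A : Ty) (k : Kind) : Prop := Der .emTT (.ty Γ A k)
abbrev EqTy (Γ : Ctx) (A B : Ty) (k : Kind) : Prop := Der .emTT (.tyEq Γ A B k)
abbrev IsTm (Γ : Ctx) (a : Tm) (A : Ty) : Prop := Der .emTT (.tm Γ a A)
abbrev EqTm (Γ : Ctx) (a b : Tm) (A : Ty) : Prop := Der .emTT (.tmEq Γ a b A)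
abbrev IsTrue (Γ : Ctx) (φ : Ty) : Prop := Der .emTT (.tr Γ φ)

/-- The context of a judgement; for `Γ ctx`, the context without its last variable. -/
def Judg.base : Judg → Ctx
  | .ctx Γ => Γ.tail
  | .ty Γ _ _ => Γ
  | .tyEq Γ _ _ _ => Γ
  | .tm Γ _ _ => Γ
  | .tmEq Γ _ _ _ => Γ

/-- All truncations of the context are treated together for two reasons: the premises of `all_intro`
live in a longer context than its conclusion, and a premise `Γ ctx` has as base only the context
without its last variable, so the full context is supplied by the premise itself. -/
theorem der_drop {T : Theory} {J : Judg} (h : Der T J) : ∀ i, Der T (.ctx (J.base.drop i)) := by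
  induction h
  case ctx_nil => intro i; simpa [Judg.base] using Der.ctx_nil
  case ctx_cons ih => exact ih
  case all_intro ih => exact fun i => ih (i + 1)
  case var h _ ih =>
    intro i
    cases i with
    | zero => exact h
    | succ i => simpa [Judg.base] using ih i
  case sub_ty h _ _ ih _ _ | sub_tyEq h _ _ ih _ _ | sub_tm h _ _ ih _ _ | sub_tmEq h _ _ ih _ _ =>
    intro i
    cases i with
    | zero => exact h
    | succ i => simpa [Judg.base] using ih i
  case subEq_ty h _ _ _ _ ih _ _ _ _ | subEq_tm h _ _ _ _ ih _ _ _ _ =>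
    intro i
    cases i with
    | zero => exact h
    | succ i => simpa [Judg.base] using ih i
  case N0_form h ih | N1_form h ih | P1_form h ih | bot_form h ih | N1_intro h ih =>
    intro i
    cases i with
    | zero => exact h
    | succ i => simpa [Judg.base] using ih i
  all_goals assumption

theorem der_base {T : Theory} {J : Judg} (h : Der T J) : Der T (.ctx J.base) := der_drop h 0

theorem tail_ctx {A : Ty} {Γ : Ctx} (h : IsCtx (A :: Γ)) : IsCtx Γ := der_base h

theorem head_ty {A : Ty} {Γ : Ctx} (h : IsCtx (A :: Γ)) : IsTy Γ A .col := by
  cases h; assumption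

/-! ### Well-formed telescopic substitutions and their equality -/

/-- `σ` is a telescopic substitution `σ ∈ Γ [Δ]`. -/
structure SubOk (Δ : Ctx) (σ : Sub) (Γ : Ctx) : Prop where
  ctx : IsCtx Δ
  tm : ∀ (i : ℕ) (B : Ty), Γ[i]? = some B → IsTm Δ (σ i) (B.subst (cmp (sh (i + 1)) σ))

/-- Equality of telescopic substitutions. -/
structure SubEq (Δ : Ctx) (σ τ : Sub) (Γ : Ctx) : Prop where
  left : SubOk Δ σ Γ
  right : SubOk Δ τ Γ
  eq : ∀ (i : ℕ) (B : Ty), Γ[i]? = some B →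
    EqTm Δ (σ i) (τ i) (B.subst (cmp (sh (i + 1)) σ))

variable {Γ Δ Θ Γ' Δ' : Ctx} {σ τ σ' τ' ρ : Sub}
  {A B C M L R S A' B' C' M' L' R' S' φ ψ χ φ' ψ' : Ty}
  {a b c d e0 f s t u v w m l p a' b' c' d' f' s' t' u' v' w' m' l' p' α β α' β' θ θ' δ κ : Tm}
  {k : Kind}

theorem ty_subst (h : IsTy Γ A k) (s : SubOk Δ σ Γ) : IsTy Δ (A.subst σ) k :=
  .sub_ty s.ctx (by simpa using s.tm) h

theorem eqTy_subst (h : EqTy Γ A B k) (s : SubOk Δ σ Γ) : EqTy Δ (A.subst σ) (B.subst σ) k :=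
  .sub_tyEq s.ctx (by simpa using s.tm) h

theorem tm_subst (h : IsTm Γ a A) (s : SubOk Δ σ Γ) : IsTm Δ (a.subst σ) (A.subst σ) :=
  .sub_tm s.ctx (by simpa using s.tm) h

theorem tr_subst (h : IsTrue Γ φ) (s : SubOk Δ σ Γ) : IsTrue Δ (φ.subst σ) :=
  tm_subst h s

theorem eqTm_subst (h : EqTm Γ a b A) (s : SubOk Δ σ Γ) :
    EqTm Δ (a.subst σ) (b.subst σ) (A.subst σ) :=
  .sub_tmEq s.ctx (by simpa using s.tm) h

theorem ty_substEq (h : IsTy Γ A k) (s : SubEq Δ σ τ Γ) : EqTy Δ (A.subst σ) (A.subst τ) k :=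
  .subEq_ty s.left.ctx (by simpa using s.left.tm) (by simpa using s.right.tm)
    (by simpa using s.eq) h

theorem tm_substEq (h : IsTm Γ a A) (s : SubEq Δ σ τ Γ) :
    EqTm Δ (a.subst σ) (a.subst τ) (A.subst σ) :=
  .subEq_tm s.left.ctx (by simpa using s.left.tm) (by simpa using s.right.tm)
    (by simpa using s.eq) h

theorem ctx_of_ty (h : IsTy Γ A k) : IsCtx Γ := der_base h
theorem ctx_of_tm (h : IsTm Γ a A) : IsCtx Γ := der_base h

theorem Der.ty_col : ∀ {k : Kind}, IsTy Γ A k → IsTy Γ A .col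
  | .props, h => .incl .prop_col (.incl .props_prop h)
  | .prop, h => .incl .prop_col h
  | .set, h => .incl .set_col h
  | .col, h => h

theorem Der.tyEq_col : ∀ {k : Kind}, EqTy Γ A B k → EqTy Γ A B .col
  | .props, h => .incl_eq .prop_col (.incl_eq .props_prop h)
  | .prop, h => .incl_eq .prop_col h
  | .set, h => .incl_eq .set_col h
  | .col, h => h

theorem Der.ty_prop : ∀ {s : Bool}, IsTy Γ A (.prp s) → IsTy Γ A .prop
  | true, h => .incl .props_prop h
  | false, h => h

theorem Der.tyEq_prop : ∀ {s : Bool}, EqTy Γ A B (.prp s) → EqTy Γ A B .prop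
  | true, h => .incl_eq .props_prop h
  | false, h => h

theorem SubOk.id (h : IsCtx Γ) : SubOk Γ (sh 0) Γ :=
  ⟨h, fun i B hB => by simpa using Der.var h hB⟩

theorem SubOk.sh_one (h : IsCtx (A :: Γ)) : SubOk (A :: Γ) (sh 1) Γ :=
  ⟨h, fun i B hB => by simpa using Der.var (i := i + 1) (A := B) h (by simpa using hB)⟩

theorem SubOk.comp (h : SubOk Δ σ Γ) (h' : SubOk Θ τ Δ) : SubOk Θ (cmp σ τ) Γ :=
  ⟨h'.ctx, fun i B hB => by simpa using tm_subst (h.tm i B hB) h'⟩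

theorem SubOk.scons (h : SubOk Δ σ Γ) (ha : IsTm Δ a (A.subst σ)) :
    SubOk Δ (scons a σ) (A :: Γ) :=
  ⟨h.ctx, fun i B hB => by
    cases i with
    | zero => obtain rfl : A = B := by simpa using hB
              simpa using ha
    | succ i => simpa using h.tm i B (by simpa using hB)⟩

theorem tm_var_zero (h : IsTy Γ A k) : IsTm (A :: Γ) (.var 0) (A.subst (sh 1)) := by
  simpa using Der.var (i := 0) (A := A) (.ctx_cons h.ty_col) (by simp)

theorem SubOk.shift (h : SubOk Δ σ Γ) (hB : IsTy Δ B k) : SubOk (B :: Δ) (cmp σ (sh 1)) Γ :=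
  h.comp (.sh_one (.ctx_cons hB.ty_col))

theorem SubOk.ups (h : SubOk Δ σ Γ) (hA : IsTy Γ A k) :
    SubOk (A.subst σ :: Δ) (ups σ) (A :: Γ) := by
  rw [ups_eq]
  refine .scons (h.shift (ty_subst hA h)) ?_
  simpa using tm_var_zero (ty_subst hA h)

theorem SubOk.inst (ha : IsTm Γ a A) : SubOk Γ (EmTT.scons a (sh 0)) (A :: Γ) :=
  .scons (.id (ctx_of_tm ha)) (by simpa using ha)

/-- Context conversion is the identity substitution between two contexts: the variables stay and the
last one is retyped along `e`. Iteration converts a whole telescope, one type at a time. -/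
theorem SubOk.conv_cons {k' : Kind} (h : SubOk Γ (sh 0) Δ) (e : EqTy Γ A A' k)
    (hA' : IsTy Γ A' k') :
    SubOk (A' :: Γ) (sh 0) (A :: Δ) := by
  rw [← scons_var_zero_sh]
  refine .scons (by simpa using h.shift hA') ?_
  have hs := SubOk.sh_one (.ctx_cons hA'.ty_col)
  exact .conv (tm_var_zero hA') (.ty_symm (by simpa using (eqTy_subst e hs).tyEq_col))

theorem SubEq.refl (h : SubOk Δ σ Γ) : SubEq Δ σ σ Γ := ⟨h, h, fun i B hB => .tm_refl (h.tm i B hB)⟩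

theorem ty_of_getElem : ∀ {Γ : Ctx} {i : ℕ}, IsCtx Γ → Γ[i]? = some B →
    IsTy (Γ.drop (i + 1)) B .col
  | A :: Γ, 0, h, e => by
      obtain rfl : A = B := by simpa using e
      simpa using head_ty h
  | A :: Γ, i + 1, h, e => by
      simpa using ty_of_getElem (i := i) (tail_ctx h) (by simpa using e)

theorem SubOk.drop (h : SubOk Δ σ Γ) (i : ℕ) : SubOk Δ (cmp (sh i) σ) (Γ.drop i) :=
  ⟨h.ctx, fun j B hB => by
    have := h.tm (i + j) B (by simpa using hB)
    rw [show i + j + 1 = (j + 1) + i by omega] at this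
    simpa [Nat.add_comm] using this⟩

theorem SubEq.drop (h : SubEq Δ σ τ Γ) (i : ℕ) : SubEq Δ (cmp (sh i) σ) (cmp (sh i) τ) (Γ.drop i) :=
  ⟨h.left.drop i, h.right.drop i, fun j B hB => by
    have := h.eq (i + j) B (by simpa using hB)
    rw [show i + j + 1 = (j + 1) + i by omega] at this
    simpa [Nat.add_comm] using this⟩

/-- The equations of `SubEq` are typed by the instances along the left substitution. Exchanging the
sides needs a conversion between the two instances of each type of `Γ`, which is why `Γ` has to be
derivable. -/
theorem SubEq.symm (hΓ : IsCtx Γ) (h : SubEq Δ σ τ Γ) : SubEq Δ τ σ Γ :=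
  ⟨h.right, h.left, fun i B hB =>
    .conv_eq (.tm_symm (h.eq i B hB)) (ty_substEq (ty_of_getElem hΓ hB) (h.drop (i + 1)))⟩

theorem SubEq.comp_left (hs : SubOk Δ σ Γ) (h : SubEq Θ τ τ' Δ) :
    SubEq Θ (cmp σ τ) (cmp σ τ') Γ :=
  ⟨hs.comp h.left, hs.comp h.right, fun i B hB => by
    simpa using tm_substEq (hs.tm i B hB) h⟩

theorem SubEq.comp_right (h : SubEq Δ σ τ Γ) (hs : SubOk Θ τ' Δ) :
    SubEq Θ (cmp σ τ') (cmp τ τ') Γ :=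
  ⟨h.left.comp hs, h.right.comp hs, fun i B hB => by
    simpa using eqTm_subst (h.eq i B hB) hs⟩

theorem SubEq.scons' (h : SubEq Δ σ τ Γ) (hA : IsTy Γ A k) (ha : IsTm Δ a (A.subst σ))
    (hb : IsTm Δ b (A.subst σ)) (e : EqTm Δ a b (A.subst σ)) :
    SubEq Δ (scons a σ) (scons b τ) (A :: Γ) :=
  ⟨.scons h.left ha, .scons h.right (.conv hb (ty_substEq hA h).tyEq_col), fun i B hB => by
    cases i with
    | zero => obtain rfl : A = B := by simpa using hB
              simpa using e
    | succ i => simpa using h.eq i B (by simpa using hB)⟩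

theorem SubEq.ups (h : SubEq Δ σ τ Γ) (hA : IsTy Γ A k) :
    SubEq (A.subst σ :: Δ) (ups σ) (ups τ) (A :: Γ) := by
  rw [ups_eq, ups_eq]
  have hs := ty_subst hA h.left
  have h0 : IsTm (A.subst σ :: Δ) (.var 0) (A.subst (cmp σ (sh 1))) := by
    simpa using tm_var_zero hs
  exact .scons' (h.comp_right (.sh_one (.ctx_cons hs.ty_col))) hA h0 h0 (.tm_refl h0)

/-! ### Inversion of type formation -/

/-- The data from which a derivable type is formed. -/
def TyInv (Γ : Ctx) : Ty → Prop
  | .sig A B => IsTy Γ A .col ∧ IsTy (A :: Γ) B .col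
  | .pi A B => IsTy Γ A .set ∧ IsTy (A :: Γ) B .col ∧ (IsTy (A :: Γ) B .set ∨ B = .P1)
  | .sum A B => IsTy Γ A .set ∧ IsTy Γ B .set
  | .list A => IsTy Γ A .set
  | .quo A R => IsTy Γ A .set ∧ IsTy (A.lift 1 :: A :: Γ) R .props
  | .eq A a b => IsTy Γ A .col ∧ IsTm Γ a A ∧ IsTm Γ b A
  | .and φ ψ => IsTy Γ φ .prop ∧ IsTy Γ ψ .prop
  | .or φ ψ => IsTy Γ φ .prop ∧ IsTy Γ ψ .prop
  | .imp φ ψ => IsTy Γ φ .prop ∧ IsTy Γ ψ .prop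
  | .ex A φ => IsTy Γ A .col ∧ IsTy (A :: Γ) φ .prop
  | .all A φ => IsTy Γ A .col ∧ IsTy (A :: Γ) φ .prop
  | _ => True

theorem SubOk.ups_ups (h : SubOk Δ σ Γ) (hA : IsTy Γ A k) :
    SubOk (A.subst (cmp σ (sh 1)) :: A.subst σ :: Δ) (EmTT.ups (EmTT.ups σ))
      (A.subst (sh 1) :: A :: Γ) := by
  have := (h.ups hA).ups (ty_subst hA (.sh_one (.ctx_cons hA.ty_col)))
  simpa using this

theorem TyInv.subst (h : TyInv Γ A) (s : SubOk Δ σ Γ) : TyInv Δ (A.subst σ) := by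
  cases A <;> simp only [TyInv, Exp.subst] at h ⊢
  case sig => exact ⟨ty_subst h.1 s, ty_subst h.2 (s.ups h.1)⟩
  case pi =>
    refine ⟨ty_subst h.1 s, ty_subst h.2.1 (s.ups h.1), ?_⟩
    rcases h.2.2 with h2 | h2
    · exact .inl (ty_subst h2 (s.ups h.1))
    · exact .inr (by rw [h2]; rfl)
  case ex => exact ⟨ty_subst h.1 s, ty_subst h.2 (s.ups h.1)⟩
  case all => exact ⟨ty_subst h.1 s, ty_subst h.2 (s.ups h.1)⟩
  case sum => exact ⟨ty_subst h.1 s, ty_subst h.2 s⟩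
  case and => exact ⟨ty_subst h.1 s, ty_subst h.2 s⟩
  case or => exact ⟨ty_subst h.1 s, ty_subst h.2 s⟩
  case imp => exact ⟨ty_subst h.1 s, ty_subst h.2 s⟩
  case list => exact ty_subst h s
  case quo => exact ⟨ty_subst h.1 s, by simpa using ty_subst (by simpa using h.2) (s.ups_ups h.1)⟩
  case eq => exact ⟨ty_subst h.1 s, tm_subst h.2.1 s, tm_subst h.2.2 s⟩

/-- The motive of the inversion lemma. -/
def Judg.TyInv : Judg → Prop
  | .ty Γ A _ => EmTT.TyInv Γ A
  | _ => True

/-- A type judgement need not end with a formation rule, because inclusion of kinds and substitution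
are primitive rules. The former does not touch the data and the latter is absorbed by `TyInv.subst`.
-/
theorem judg_tyInv {J : Judg} (h : Der .emTT J) : J.TyInv := by
  induction h with
  | incl _ _ ih => exact ih
  | sub_ty h1 h2 _ _ _ ih =>
    exact EmTT.TyInv.subst ih ⟨h1, by simpa using h2⟩
  | sig_form _ h1 h2 => exact ⟨h1.ty_col, h2.ty_col⟩
  | pi_form h1 h2 => exact ⟨h1, h2.ty_col, .inl h2⟩
  | piP1_form h1 => exact ⟨h1, .P1_form (.ctx_cons h1.ty_col), .inr rfl⟩
  | sum_form h1 h2 => exact ⟨h1, h2⟩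
  | list_form h1 => exact h1
  | quo_form h1 h2 => exact ⟨h1, h2⟩
  | and_form _ h1 h2 => exact ⟨h1.ty_prop, h2.ty_prop⟩
  | or_form _ h1 h2 => exact ⟨h1.ty_prop, h2.ty_prop⟩
  | imp_form _ h1 h2 => exact ⟨h1.ty_prop, h2.ty_prop⟩
  | ex_form _ h1 h2 => exact ⟨h1.ty_col, h2.ty_prop⟩
  | all_form _ h1 h2 => exact ⟨h1.ty_col, h2.ty_prop⟩
  | eq_form _ h1 h2 h3 => exact ⟨h1.ty_col, h2, h3⟩
  | eqP1_form h1 h2 => exact ⟨.P1_form (ctx_of_tm h1), h1, h2⟩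
  | N0_form | N1_form | P1_form | bot_form => trivial
  | _ => trivial

theorem tyInv (h : IsTy Γ A k) : TyInv Γ A := judg_tyInv h

/-- The propositional types, recognized by their outermost constructor. -/
def IsPropHead : Ty → Prop
  | .bot | .and _ _ | .or _ _ | .imp _ _ | .ex _ _ | .all _ _ | .eq _ _ _ => True
  | _ => False

theorem IsPropHead.subst (h : IsPropHead A) (σ : Sub) : IsPropHead (A.subst σ) := by
  cases A <;> trivial

/-- The motive of the lemma on the outermost constructor of a proposition. -/
def Judg.PropHead : Judg → Prop
  | .ty _ A .props | .ty _ A .prop => IsPropHead A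
  | _ => True

theorem judg_propHead {J : Judg} (h : Der .emTT J) : J.PropHead := by
  induction h with
  | incl i _ ih => cases i <;> first | exact ih | trivial
  | @sub_ty _ _ σ _ k _ _ _ _ _ ih =>
    cases k <;> first | exact IsPropHead.subst ih σ | trivial
  | sig_form s => cases s <;> trivial
  | and_form s => cases s <;> trivial
  | or_form s => cases s <;> trivial
  | imp_form s => cases s <;> trivial
  | ex_form s => cases s <;> trivial
  | all_form s => cases s <;> trivial
  | eq_form s => cases s <;> trivial
  | _ => trivial

/-- No type of kind `prop` is headed by a set or collection constructor. In case analyses on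
canonical isomorphisms this discards every combination of the clause for propositions with another
clause. -/
theorem propHead (h : IsTy Γ A .prop) : IsPropHead A := judg_propHead h

/-! ### Rules in the normal forms of the calculus of substitutions -/

/-- The primed lemmas carry as hypotheses the presuppositions of their equalities. They serve in the
proof of `presup`, after which these hypotheses can be dropped. -/
theorem SubEq.inst' (hA : IsTy Γ A k) (ha : IsTm Γ a A) (hb : IsTm Γ b A) (e : EqTm Γ a b A) :
    SubEq Γ (EmTT.scons a (sh 0)) (EmTT.scons b (sh 0)) (A :: Γ) :=
  .scons' (.refl (.id (ctx_of_tm ha))) hA (by simpa using ha) (by simpa using hb)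
    (by simpa using e)

theorem eqTy_substEq' (hA : IsTy Γ A k) (h : EqTy Γ A B k) (s : SubEq Δ σ τ Γ) :
    EqTy Δ (A.subst σ) (B.subst τ) k :=
  .ty_trans (ty_substEq hA s) (eqTy_subst h s.right)

theorem eqTm_substEq' (ha : IsTm Γ a A) (h : EqTm Γ a b A) (hA : IsTy Γ A .col)
    (hΓ : IsCtx Γ) (s : SubEq Δ σ τ Γ) :
    EqTm Δ (a.subst σ) (b.subst τ) (A.subst σ) :=
  .tm_trans (tm_substEq ha s)
    (.conv_eq (eqTm_subst h s.right) (ty_substEq hA (s.symm hΓ)))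

theorem SubOk.sh_two (h : IsCtx (B :: A :: Γ)) : SubOk (B :: A :: Γ) (sh 2) Γ := by
  simpa using (SubOk.sh_one (tail_ctx h)).comp (.sh_one h)

theorem SubOk.sh_three (h : IsCtx (C :: B :: A :: Γ)) : SubOk (C :: B :: A :: Γ) (sh 3) Γ := by
  simpa using (SubOk.sh_two (tail_ctx h)).comp (.sh_one h)

theorem tm_var_one (h : IsCtx (B :: A :: Γ)) : IsTm (B :: A :: Γ) (.var 1) (A.subst (sh 2)) := by
  simpa using Der.var (i := 1) (A := A) h (by simp)

theorem tm_var_two (h : IsCtx (C :: B :: A :: Γ)) :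
    IsTm (C :: B :: A :: Γ) (.var 2) (A.subst (sh 3)) := by
  simpa using Der.var (i := 2) (A := A) h (by simp)

theorem tm_conv_ctx (e : EqTy Γ A A' k) (hA' : IsTy Γ A' k) (h : IsTm (A :: Γ) a B) :
    IsTm (A' :: Γ) a B := by
  simpa using tm_subst h (SubOk.conv_cons (.id (ctx_of_ty hA')) e hA')

theorem ty_conv_ctx {k' : Kind} (e : EqTy Γ A A' k) (hA' : IsTy Γ A' k)
    (h : IsTy (A :: Γ) B k') : IsTy (A' :: Γ) B k' := by
  simpa using ty_subst h (SubOk.conv_cons (.id (ctx_of_ty hA')) e hA')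

theorem eqTy_conv_ctx {k' : Kind} (e : EqTy Γ A A' k) (hA' : IsTy Γ A' k)
    (h : EqTy (A :: Γ) B C k') : EqTy (A' :: Γ) B C k' := by
  simpa using eqTy_subst h (SubOk.conv_cons (.id (ctx_of_ty hA')) e hA')

theorem eqTm_conv_ctx (e : EqTy Γ A A' k) (hA' : IsTy Γ A' k)
    (h : EqTm (A :: Γ) a b B) : EqTm (A' :: Γ) a b B := by
  simpa using eqTm_subst h (SubOk.conv_cons (.id (ctx_of_ty hA')) e hA')

/-! ### Generic canonical elements and the contexts of the eliminators -/

/-- The generic pair over `Γ, x ∈ A, y ∈ B`. -/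
abbrev pairV (A B : Ty) : Tm := .pair (A.subst (sh 2)) (B.subst (ups (sh 2))) (.var 1) (.var 0)

theorem tm_pairV (hB : IsTy (A :: Γ) B .col) :
    IsTm (B :: A :: Γ) (pairV A B) ((Exp.sig A B).subst (sh 2)) := by
  have hc := Der.ctx_cons hB
  have s2 := SubOk.sh_two hc
  refine .sig_intro (ty_subst hB (s2.ups (head_ty (ctx_of_ty hB)))) (tm_var_one hc) ?_
  simpa using tm_var_zero hB

theorem SubOk.pairV (hB : IsTy (A :: Γ) B .col) :
    SubOk (B :: A :: Γ) (EmTT.scons (EmTT.pairV A B) (sh 2)) (.sig A B :: Γ) :=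
  .scons (.sh_two (.ctx_cons hB)) (tm_pairV hB)

/-- The generic element `inl(x)` over `Γ, x ∈ A`. -/
abbrev inlV (A B : Ty) : Tm := .inl (A.subst (sh 1)) (B.subst (sh 1)) (.var 0)
/-- The generic element `inr(y)` over `Γ, y ∈ B`. -/
abbrev inrV (A B : Ty) : Tm := .inr (A.subst (sh 1)) (B.subst (sh 1)) (.var 0)

theorem tm_inlV (hA : IsTy Γ A .set) (hB : IsTy Γ B .set) :
    IsTm (A :: Γ) (inlV A B) ((Exp.sum A B).subst (sh 1)) :=
  .sum_inl (ty_subst (.sum_form hA hB) (.sh_one (.ctx_cons hA.ty_col))) (tm_var_zero hA)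

theorem tm_inrV (hA : IsTy Γ A .set) (hB : IsTy Γ B .set) :
    IsTm (B :: Γ) (inrV A B) ((Exp.sum A B).subst (sh 1)) :=
  .sum_inr (ty_subst (.sum_form hA hB) (.sh_one (.ctx_cons hB.ty_col))) (tm_var_zero hB)

theorem SubOk.inlV (hA : IsTy Γ A .set) (hB : IsTy Γ B .set) :
    SubOk (A :: Γ) (EmTT.scons (EmTT.inlV A B) (sh 1)) (.sum A B :: Γ) :=
  .scons (.sh_one (.ctx_cons hA.ty_col)) (tm_inlV hA hB)

theorem SubOk.inrV (hA : IsTy Γ A .set) (hB : IsTy Γ B .set) :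
    SubOk (B :: Γ) (EmTT.scons (EmTT.inrV A B) (sh 1)) (.sum A B :: Γ) :=
  .scons (.sh_one (.ctx_cons hB.ty_col)) (tm_inrV hA hB)

/-- The generic class `[x]` over `Γ, x ∈ A`. -/
abbrev qclV (A R : Ty) : Tm := .qcl (A.subst (sh 1)) (R.subst (ups (ups (sh 1)))) (.var 0)

theorem tm_qclV (h : IsTy Γ (.quo A R) .set) :
    IsTm (A :: Γ) (qclV A R) ((Exp.quo A R).subst (sh 1)) := by
  have hA : IsTy Γ A .set := (tyInv h).1
  exact .quo_intro (ty_subst h (.sh_one (.ctx_cons hA.ty_col))) (tm_var_zero hA)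

theorem SubOk.qclV (h : IsTy Γ (.quo A R) .set) :
    SubOk (A :: Γ) (EmTT.scons (EmTT.qclV A R) (sh 1)) (.quo A R :: Γ) :=
  .scons (.sh_one (.ctx_cons (tyInv h).1.ty_col)) (tm_qclV h)

/-- The context of the inductive step of a list eliminator. -/
abbrev listCtx (Γ : Ctx) (A L : Ty) : Ctx :=
  L.subst (sh 1) :: A.subst (sh 1) :: .list A :: Γ

theorem ctx_list_two (hA : IsTy Γ A .set) : IsCtx (A.subst (sh 1) :: .list A :: Γ) :=
  .ctx_cons (ty_subst hA (.sh_one (.ctx_cons (Der.list_form hA).ty_col))).ty_col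

theorem ctx_listCtx (hA : IsTy Γ A .set) (hL : IsTy (.list A :: Γ) L .col) :
    IsCtx (listCtx Γ A L) :=
  .ctx_cons (ty_subst hL (.sh_one (ctx_list_two hA)))

theorem tm_consV (hA : IsTy Γ A .set) :
    IsTm (A.subst (sh 1) :: .list A :: Γ) (.cons (.var 1) (.var 0))
      ((Exp.list A).subst (sh 2)) := by
  have hc := ctx_list_two hA
  exact .list_cons (tm_var_one hc) (by simpa using tm_var_zero (head_ty hc))

theorem SubOk.consV (hA : IsTy Γ A .set) :
    SubOk (A.subst (sh 1) :: .list A :: Γ) (EmTT.scons (.cons (.var 1) (.var 0)) (sh 2))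
      (.list A :: Γ) :=
  .scons (.sh_two (ctx_list_two hA)) (tm_consV hA)

theorem SubOk.list_cons (hA : IsTy Γ A .set) (hL : IsTy (.list A :: Γ) L .col) :
    SubOk (listCtx Γ A L) (EmTT.scons (.cons (.var 2) (.var 1)) (sh 3)) (.list A :: Γ) := by
  simpa using (SubOk.consV hA).comp (.sh_one (ctx_listCtx hA hL))

/-- The context of the condition on a quotient eliminator. -/
abbrev quoCtx (Γ : Ctx) (A R : Ty) : Ctx := R :: A.subst (sh 1) :: A :: Γ

theorem ctx_two (hA : IsTy Γ A k) : IsCtx (A.subst (sh 1) :: A :: Γ) :=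
  .ctx_cons (ty_subst hA (.sh_one (.ctx_cons hA.ty_col))).ty_col

theorem SubOk.two (h : SubOk Δ σ Γ) (ha : IsTm Δ a (A.subst σ)) (hb : IsTm Δ b (A.subst σ)) :
    SubOk Δ (EmTT.scons b (EmTT.scons a σ)) (A.subst (sh 1) :: A :: Γ) :=
  (h.scons ha).scons (by simpa using hb)

theorem SubOk.conv_two (e : EqTy Γ A A' k) (hA' : IsTy Γ A' k) :
    SubOk (A'.subst (sh 1) :: A' :: Γ) (sh 0) (A.subst (sh 1) :: A :: Γ) := by
  have s1 := SubOk.sh_one (.ctx_cons hA'.ty_col)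
  exact .conv_cons (.conv_cons (.id (ctx_of_ty hA')) e hA') (eqTy_subst e s1) (ty_subst hA' s1)

attribute [simp] pairV inlV inrV qclV listCtx quoCtx

/-! ### Presuppositions -/

/-- The presuppositions of a judgement. -/
def Judg.Presup : Judg → Prop
  | .ctx _ | .ty _ _ _ => True
  | .tyEq Γ A B k => IsTy Γ A k ∧ IsTy Γ B k
  | .tm Γ _ A => IsTy Γ A .col
  | .tmEq Γ a b A => IsTy Γ A .col ∧ IsTm Γ a A ∧ IsTm Γ b A

/-! ### Equiprovability of propositions -/

theorem iff_elim_left (hφ : IsTy Γ φ .prop) (hψ : IsTy Γ ψ .prop)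
    (h : IsTrue Γ (Exp.iff φ ψ)) : IsTrue Γ (.imp φ ψ) :=
  .and_left (.imp_form false hφ hψ) (.imp_form false hψ hφ) h

theorem iff_elim_right (hφ : IsTy Γ φ .prop) (hψ : IsTy Γ ψ .prop)
    (h : IsTrue Γ (Exp.iff φ ψ)) : IsTrue Γ (.imp ψ φ) :=
  .and_right (.imp_form false hφ hψ) (.imp_form false hψ hφ) h

theorem imp_intro' (hφ : IsTy Γ φ .prop) (hψ : IsTy Γ ψ .prop)
    (h : IsTrue (φ :: Γ) (ψ.subst (sh 1))) : IsTrue Γ (.imp φ ψ) :=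
  .imp_intro hφ hψ (by simpa using h)

theorem iff_intro (hφ : IsTy Γ φ .prop) (hψ : IsTy Γ ψ .prop)
    (h : IsTrue (φ :: Γ) (ψ.subst (sh 1))) (h' : IsTrue (ψ :: Γ) (φ.subst (sh 1))) :
    IsTrue Γ (Exp.iff φ ψ) :=
  .and_intro (.imp_form false hφ hψ) (.imp_form false hψ hφ) (imp_intro' hφ hψ h)
    (imp_intro' hψ hφ h')

theorem tr_of_tm (hφ : IsTy Γ φ .prop) (h : IsTm Γ p φ) : IsTrue Γ φ := .prop_true hφ h

theorem tr_conv (h : IsTrue Γ φ) (e : EqTy Γ φ ψ .prop) (hψ : IsTy Γ ψ .prop) : IsTrue Γ ψ :=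
  .prop_true hψ (.conv h e.tyEq_col)

theorem tr_head (h : IsTy Γ φ .prop) : IsTrue (φ :: Γ) (φ.subst (sh 1)) :=
  .prop_true (ty_subst h (.sh_one (.ctx_cons h.ty_col))) (tm_var_zero h)

theorem iff_of_eqTy (hφ : IsTy Γ φ .prop) (hψ : IsTy Γ ψ .prop) (e : EqTy Γ φ ψ .prop) :
    IsTrue Γ (Exp.iff φ ψ) := by
  refine iff_intro hφ hψ ?_ ?_
  · have s := SubOk.sh_one (.ctx_cons hφ.ty_col)
    exact tr_conv (tr_head hφ) (eqTy_subst e s) (ty_subst hψ s)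
  · have s := SubOk.sh_one (.ctx_cons hψ.ty_col)
    exact tr_conv (tr_head hψ) (.ty_symm (eqTy_subst e s)) (ty_subst hφ s)

theorem tr_mp (hφ : IsTy Γ φ .prop) (hψ : IsTy Γ ψ .prop)
    (h : IsTrue Γ (Exp.iff φ ψ)) (hp : IsTrue Γ φ) : IsTrue Γ ψ :=
  .imp_elim hφ hψ (iff_elim_left hφ hψ h) hp

theorem tr_mpr (hφ : IsTy Γ φ .prop) (hψ : IsTy Γ ψ .prop)
    (h : IsTrue Γ (Exp.iff φ ψ)) (hp : IsTrue Γ ψ) : IsTrue Γ φ :=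
  .imp_elim hψ hφ (iff_elim_right hφ hψ h) hp

/-! ### Equivalence relations of quotients and their stability -/

/-- The equivalence conditions on the relation of a quotient. -/
structure QuoCond (Γ : Ctx) (A R : Ty) : Prop where
  set : IsTy Γ A .set
  rel : IsTy (A.subst (sh 1) :: A :: Γ) R .props
  refl : IsTrue (A :: Γ) (R.subst (scons (.var 0) (scons (.var 0) (sh 1))))
  symm : IsTrue (R :: A.subst (sh 1) :: A :: Γ) (R.subst (scons (.var 2) (scons (.var 1) (sh 3))))
  trans : IsTrue (R.subst (scons (.var 1) (scons (.var 2) (sh 4))) ::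
      R.subst (scons (.var 1) (scons (.var 2) (sh 3))) ::
      A.subst (sh 2) :: A.subst (sh 1) :: A :: Γ)
    (R.subst (scons (.var 2) (scons (.var 4) (sh 5))))

theorem QuoCond.form (h : QuoCond Γ A R) : IsTy Γ (.quo A R) .set :=
  .quo_form h.set (by simpa using h.rel) h.refl (by simpa using h.symm) (by simpa using h.trans)

/-- The identity substitution maps each telescope built from `A'` and `R'` to the corresponding one
built from `A` and `R`. It carries each equivalence condition on `R` to the primed context, where
its conclusion is converted to `R'`. -/
theorem QuoCond.conv (h : QuoCond Γ A R) (e : EqTy Γ A A' .set) (hA' : IsTy Γ A' .set)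
    (eR : EqTy (A.subst (sh 1) :: A :: Γ) R R' .props)
    (hR' : IsTy (A.subst (sh 1) :: A :: Γ) R' .props) : QuoCond Γ A' R' := by
  have s := SubOk.conv_two e hA'
  have hR'1 : IsTy (A'.subst (sh 1) :: A' :: Γ) R' .props := by simpa using ty_subst hR' s
  have eR1 : EqTy (A'.subst (sh 1) :: A' :: Γ) R R' .props := by simpa using eqTy_subst eR s
  have hR1 : IsTy (A'.subst (sh 1) :: A' :: Γ) R .props := by simpa using ty_subst h.rel s
  have hc := Der.ctx_cons hA'.ty_col
  have hc2 := ctx_two hA'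
  refine ⟨hA', hR'1, ?_, ?_, ?_⟩
  · have s0 : SubOk (A' :: Γ) (scons (.var 0) (scons (.var 0) (sh 1)))
        (A'.subst (sh 1) :: A' :: Γ) :=
      .two (.sh_one hc) (tm_var_zero hA') (tm_var_zero hA')
    refine tr_conv (φ := R.subst (scons (.var 0) (scons (.var 0) (sh 1)))) ?_ ?_ ?_
    · exact tm_conv_ctx e hA' h.refl
    · exact (eqTy_subst eR1 s0).tyEq_prop (s := true)
    · exact (ty_subst hR'1 s0).ty_prop (s := true)
  · have hc3 : IsCtx (R' :: A'.subst (sh 1) :: A' :: Γ) := .ctx_cons hR'1.ty_col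
    have s0 : SubOk (R' :: A'.subst (sh 1) :: A' :: Γ) (scons (.var 2) (scons (.var 1) (sh 3)))
        (A'.subst (sh 1) :: A' :: Γ) := .two (.sh_three hc3)
          (by simpa using tm_var_one hc3) (tm_var_two hc3)
    refine tr_conv (φ := R.subst (scons (.var 2) (scons (.var 1) (sh 3)))) ?_ ?_ ?_
    · have := tm_subst h.symm (s.conv_cons eR1 hR'1)
      simpa using this
    · exact (eqTy_subst eR1 s0).tyEq_prop (s := true)
    · exact (ty_subst hR'1 s0).ty_prop (s := true)
  · have hA2 : IsTy (A'.subst (sh 1) :: A' :: Γ) (A'.subst (sh 2)) .set :=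
      ty_subst hA' (.sh_two hc2)
    have hc3 : IsCtx (A'.subst (sh 2) :: A'.subst (sh 1) :: A' :: Γ) := .ctx_cons hA2.ty_col
    have s3 : SubOk (A'.subst (sh 2) :: A'.subst (sh 1) :: A' :: Γ) (sh 0)
        (A.subst (sh 2) :: A.subst (sh 1) :: A :: Γ) :=
      s.conv_cons (eqTy_subst e (.sh_two hc2)) hA2
    have s12 : SubOk (A'.subst (sh 2) :: A'.subst (sh 1) :: A' :: Γ)
        (scons (.var 1) (scons (.var 2) (sh 3))) (A'.subst (sh 1) :: A' :: Γ) :=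
      .two (.sh_three hc3) (tm_var_two hc3) (by simpa using tm_var_one hc3)
    have hR1' := ty_subst hR'1 s12
    have s4 := s3.conv_cons (eqTy_subst eR1 s12) hR1'
    have hc4 := Der.ctx_cons hR1'.ty_col
    have s01 : SubOk (R'.subst (scons (.var 1) (scons (.var 2) (sh 3))) ::
          A'.subst (sh 2) :: A'.subst (sh 1) :: A' :: Γ)
        (scons (.var 1) (scons (.var 2) (sh 4))) (A'.subst (sh 1) :: A' :: Γ) := by
      refine .two ?_ ?_ ?_
      · simpa using (SubOk.sh_three hc3).comp (.sh_one hc4)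
      · simpa using tm_var_two hc4
      · simpa using tm_var_one hc4
    have hR2' := ty_subst hR'1 s01
    -- The identity between the five-variable telescopes of transitivity, assembled one variable at
    -- a time: three elements, then two hypotheses.
    have s5 := s4.conv_cons (eqTy_subst eR1 s01) hR2'
    have hc5 := Der.ctx_cons hR2'.ty_col
    have s6 : SubOk (R'.subst (scons (.var 1) (scons (.var 2) (sh 4))) ::
          R'.subst (scons (.var 1) (scons (.var 2) (sh 3))) ::
          A'.subst (sh 2) :: A'.subst (sh 1) :: A' :: Γ)
        (scons (.var 2) (scons (.var 4) (sh 5))) (A'.subst (sh 1) :: A' :: Γ) := by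
      refine .two ?_ ?_ ?_
      · simpa using (SubOk.sh_three hc3).comp (.sh_two hc5)
      · simpa using Der.var (i := 4) (A := A') hc5 (by simp)
      · simpa using Der.var (i := 2) (A := A'.subst (sh 2)) hc5 (by simp)
    refine tr_conv (φ := R.subst (scons (.var 2) (scons (.var 4) (sh 5)))) ?_ ?_ ?_
    · simpa using tm_subst h.trans s5
    · exact (eqTy_subst eR1 s6).tyEq_prop (s := true)
    · exact (ty_subst hR'1 s6).ty_prop (s := true)

theorem iff_form {φ ψ : Ty} (hφ : IsTy Γ φ .prop) (hψ : IsTy Γ ψ .prop) :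
    IsTy Γ (Exp.iff φ ψ) .prop :=
  .and_form false (.imp_form false hφ hψ) (.imp_form false hψ hφ)

/-- The inversion of the formation of quotients. -/
def Judg.QuoInv : Judg → Prop
  | .ty Γ (.quo A R) _ => QuoCond Γ A R
  | _ => True

theorem QuoCond.subst (h : QuoCond Γ A R) (s : SubOk Δ σ Γ) :
    QuoCond Δ (A.subst σ) (R.subst (ups (ups σ))) := by
  have s2 := s.ups_ups h.set
  have hA := ty_subst h.set s
  have hA2 := ty_subst h.set (.sh_one (.ctx_cons h.set.ty_col))
  refine ⟨hA, by simpa using ty_subst h.rel s2, ?_, ?_, ?_⟩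
  · simpa using tm_subst h.refl (s.ups h.set)
  · simpa using tm_subst h.symm (s2.ups h.rel)
  · have hc2 := ctx_two h.set
    have hA3 : IsTy (A.subst (sh 1) :: A :: Γ) (A.subst (sh 2)) .set :=
      ty_subst h.set (.sh_two hc2)
    have hc5 := ctx_of_tm h.trans
    have s5 := ((s2.ups hA3).ups (head_ty (tail_ctx hc5))).ups (head_ty hc5)
    simpa using tm_subst h.trans s5

/-- The formation of quotients has the equivalence conditions among its premises, and `TyInv` does
not keep them. They are needed whenever a quotient is formed anew, as on the right-hand side of a
congruence rule. -/
theorem judg_quoInv {J : Judg} (h : Der .emTT J) : J.QuoInv := by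
  induction h with
  | @incl _ A _ _ _ _ ih => cases A <;> trivial
  | @sub_ty _ _ _ A _ h1 h2 _ _ _ ih =>
    cases A <;> first | trivial | exact QuoCond.subst ih ⟨h1, by simpa using h2⟩
  | quo_form h1 h2 h3 h4 h5 =>
    exact ⟨h1, by simpa using h2, h3, by simpa using h4, by simpa using h5⟩
  | _ => trivial

theorem quoCond (h : IsTy Γ (.quo A R) k) : QuoCond Γ A R := judg_quoInv h

/-! ### Typing of the right-hand sides of the congruence rules -/

theorem eqTm_inst {Γ : Ctx} {A B B' : Ty} {a a' : Tm} (hB : IsTy (A :: Γ) B k) (e : EqTy (A :: Γ) B B' k)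
    (ha : IsTm Γ a A) (ha' : IsTm Γ a' A) (ea : EqTm Γ a a' A) :
    EqTy Γ (B.subst (scons a (sh 0))) (B'.subst (scons a' (sh 0))) .col :=
  (eqTy_substEq' hB e (.inst' (head_ty (ctx_of_ty hB)) ha ha' ea)).tyEq_col

/-- In a congruence rule the premises are typed by the data of the left-hand side. In this lemma and
the next ones the right-hand term is formed from its own annotations, in converted contexts where it
binds variables, and its type is converted back at the end. -/
theorem presup_sig_intro (hA : IsTy Γ A' .col) (eA : EqTy Γ A A' .col)
    (hB : IsTy (A :: Γ) B .col)
    (hB' : IsTy (A :: Γ) B' .col) (eB : EqTy (A :: Γ) B B' .col)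
    (ha : IsTm Γ a A) (ha' : IsTm Γ a' A) (ea : EqTm Γ a a' A)
    (hb' : IsTm Γ b' (B.subst (scons a (sh 0)))) :
    IsTm Γ (.pair A' B' a' b') (.sig A B) := by
  refine .conv (.sig_intro (ty_conv_ctx eA hA hB') (.conv ha' eA) ?_)
    (.ty_symm (.sig_eq false eA eB))
  exact .conv hb' (eqTm_inst hB eB ha ha' ea)

theorem presup_sig_elim (hA' : IsTy Γ A' .col) (eA : EqTy Γ A A' .col)
    (hB : IsTy (A :: Γ) B .col) (hB' : IsTy (A :: Γ) B' .col) (eB : EqTy (A :: Γ) B B' .col)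
    (hM : IsTy (.sig A B :: Γ) M .col) (hM' : IsTy (.sig A B :: Γ) M' .col)
    (eM : EqTy (.sig A B :: Γ) M M' .col)
    (hd : IsTm Γ d (.sig A B)) (hd' : IsTm Γ d' (.sig A B)) (ed : EqTm Γ d d' (.sig A B))
    (hm' : IsTm (B :: A :: Γ) m' (M.subst (scons (pairV A B) (sh 2)))) :
    IsTm Γ (.elSig A' B' M' d' m') (M.subst (scons d (sh 0))) := by
  have eS : EqTy Γ (.sig A B) (.sig A' B') .col := .sig_eq false eA eB
  have hA : IsTy Γ A .col := head_ty (ctx_of_ty hB)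
  have hB1 := ty_conv_ctx eA hA' hB'
  have hS' : IsTy Γ (.sig A' B') .col := .sig_form false hA' hB1
  refine .conv (.sig_elim (ty_conv_ctx eS hS' hM') (.conv hd' eS) ?_)
    (.ty_symm (eqTm_inst hM eM hd hd' ed))
  have hc := Der.ctx_cons hB
  have s2 := SubOk.sh_two hc
  have sAB : SubOk (B' :: A' :: Γ) (sh 0) (B :: A :: Γ) :=
    (SubOk.conv_cons (.id (ctx_of_ty hA)) eA hA').conv_cons (eqTy_conv_ctx eA hA' eB) hB1
  -- The type of a branch is the motive at the generic pair, and that pair carries the annotations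
  -- `A` and `B`. Replacing the motive is therefore not enough: the pairs with the two annotations
  -- have to be equated as well.
  have eP : EqTm (B :: A :: Γ) (pairV A B) (pairV A' B') ((Exp.sig A B).subst (sh 2)) := by
    refine .sig_intro_eq (eqTy_subst eA s2) (eqTy_subst eB (s2.ups hA))
      (.tm_refl (tm_var_one hc)) (.tm_refl ?_)
    simpa using tm_var_zero hB
  have hP' : IsTm (B :: A :: Γ) (pairV A' B') ((Exp.sig A B).subst (sh 2)) := by
    have := tm_pairV hB1
    refine .conv (B := (Exp.sig A B).subst (sh 2)) (A := (Exp.sig A' B').subst (sh 2)) ?_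
      (.ty_symm (eqTy_subst eS s2))
    have sBA : SubOk (B :: A :: Γ) (sh 0) (B' :: A' :: Γ) :=
      (SubOk.conv_cons (.id (ctx_of_ty hA)) (.ty_symm eA) hA).conv_cons (.ty_symm eB) hB
    simpa using tm_subst this sBA
  have sP := SubEq.scons' (.refl s2) (Der.sig_form false hA hB) (tm_pairV hB) hP' eP
  have := tm_subst (.conv hm' (eqTy_substEq' hM eM sP)) sAB
  simpa using this

theorem presup_list_elim (hA : IsTy Γ A .set) (hA' : IsTy Γ A' .set) (eA : EqTy Γ A A' .set)
    (hL : IsTy (.list A :: Γ) L .col) (hL' : IsTy (.list A :: Γ) L' .col)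
    (eL : EqTy (.list A :: Γ) L L' .col)
    (hs : IsTm Γ s (.list A)) (hs' : IsTm Γ s' (.list A)) (es : EqTm Γ s s' (.list A))
    (ha' : IsTm Γ a' (L.subst (scons (.nil A) (sh 0))))
    (hl' : IsTm (listCtx Γ A L) l' (L.subst (scons (.cons (.var 2) (.var 1)) (sh 3)))) :
    IsTm Γ (.elList A' L' s' a' l') (L.subst (scons s (sh 0))) := by
  have eS : EqTy Γ (.list A) (.list A') .set := .list_eq eA
  have hS' : IsTy Γ (.list A') .set := .list_form hA'
  have hL1 := ty_conv_ctx eS hS' hL'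
  have eL1 := eqTy_conv_ctx eS hS' eL
  refine .conv (.list_elim hL1 (.conv hs' eS.tyEq_col) ?_ ?_)
    (.ty_symm (eqTm_inst hL eL hs hs' es))
  · exact .conv ha' (eqTm_inst hL eL (.list_nil hA)
      (.conv (.list_nil hA') (.ty_symm eS.tyEq_col)) (.list_nil_eq eA))
  · have hc := ctx_listCtx hA hL
    have hc' := ctx_listCtx hA' hL1
    have h1 := IsTm (listCtx Γ A L) l' (L'.subst (scons (.cons (.var 2) (.var 1)) (sh 3)))
    have sL : SubOk (listCtx Γ A' L') (sh 0) (listCtx Γ A L) := by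
      refine ((SubOk.conv_cons (.id (ctx_of_ty hA)) eS hS').conv_cons (eqTy_subst eA ?_)
        (head_ty (tail_ctx hc'))).conv_cons (eqTy_subst eL1 ?_) (head_ty hc')
      · exact .sh_one (tail_ctx (tail_ctx hc'))
      · exact .sh_one (tail_ctx hc')
    have := tm_subst (.conv hl' (eqTy_subst eL (SubOk.list_cons hA hL))) sL
    simpa using this

theorem presup_sum_elim (hA : IsTy Γ A .set) (hA' : IsTy Γ A' .set) (eA : EqTy Γ A A' .set)
    (hB : IsTy Γ B .set) (hB' : IsTy Γ B' .set) (eB : EqTy Γ B B' .set)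
    (hM : IsTy (.sum A B :: Γ) M .col) (hM' : IsTy (.sum A B :: Γ) M' .col)
    (eM : EqTy (.sum A B :: Γ) M M' .col)
    (hw : IsTm Γ w (.sum A B)) (hw' : IsTm Γ w' (.sum A B)) (ew : EqTm Γ w w' (.sum A B))
    (ha' : IsTm (A :: Γ) a' (M.subst (scons (inlV A B) (sh 1))))
    (hb' : IsTm (B :: Γ) b' (M.subst (scons (inrV A B) (sh 1)))) :
    IsTm Γ (.elSum A' B' M' w' a' b') (M.subst (scons w (sh 0))) := by
  have eS : EqTy Γ (.sum A B) (.sum A' B') .set := .sum_eq eA eB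
  have hS : IsTy Γ (.sum A B) .set := .sum_form hA hB
  have hS' : IsTy Γ (.sum A' B') .set := .sum_form hA' hB'
  have hM1 := ty_conv_ctx eS hS' hM'
  refine .conv (.sum_elim hM1 (.conv hw' eS.tyEq_col) ?_ ?_)
    (.ty_symm (eqTm_inst hM eM hw hw' ew))
  · have s1 := SubOk.sh_one (.ctx_cons hA.ty_col)
    have e1 : EqTm (A :: Γ) (inlV A B) (inlV A' B') ((Exp.sum A B).subst (sh 1)) :=
      .sum_inl_eq (eqTy_subst eA s1) (eqTy_subst eB s1) (.tm_refl (tm_var_zero hA))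
    have h1 : IsTm (A :: Γ) (inlV A' B') ((Exp.sum A B).subst (sh 1)) :=
      .conv (tm_conv_ctx (.ty_symm eA) hA (tm_inlV hA' hB'))
        (.ty_symm (eqTy_subst eS s1).tyEq_col)
    have sP := SubEq.scons' (.refl s1) hS (tm_inlV hA hB) h1 e1
    simpa using tm_conv_ctx eA hA' (.conv ha' (eqTy_substEq' hM eM sP))
  · have s1 := SubOk.sh_one (.ctx_cons hB.ty_col)
    have e1 : EqTm (B :: Γ) (inrV A B) (inrV A' B') ((Exp.sum A B).subst (sh 1)) :=
      .sum_inr_eq (eqTy_subst eA s1) (eqTy_subst eB s1) (.tm_refl (tm_var_zero hB))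
    have h1 : IsTm (B :: Γ) (inrV A' B') ((Exp.sum A B).subst (sh 1)) :=
      .conv (tm_conv_ctx (.ty_symm eB) hB (tm_inrV hA' hB'))
        (.ty_symm (eqTy_subst eS s1).tyEq_col)
    have sP := SubEq.scons' (.refl s1) hS (tm_inrV hA hB) h1 e1
    simpa using tm_conv_ctx eB hB' (.conv hb' (eqTy_substEq' hM eM sP))

theorem presup_quo_elim (hQ : QuoCond Γ A R) (hA' : IsTy Γ A' .set) (eA : EqTy Γ A A' .set)
    (hR' : IsTy (A.subst (sh 1) :: A :: Γ) R' .props)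
    (eR : EqTy (A.subst (sh 1) :: A :: Γ) R R' .props)
    (hL : IsTy (.quo A R :: Γ) L .col) (hL' : IsTy (.quo A R :: Γ) L' .col)
    (eL : EqTy (.quo A R :: Γ) L L' .col)
    (hp : IsTm Γ p (.quo A R)) (hp' : IsTm Γ p' (.quo A R)) (ep : EqTm Γ p p' (.quo A R))
    (hl' : IsTm (A :: Γ) l' (L.subst (scons (qclV A R) (sh 1))))
    (el : EqTm (A :: Γ) l l' (L.subst (scons (qclV A R) (sh 1))))
    (hr : EqTm (quoCtx Γ A R) (l.subst (sh 2)) (l.subst (scons (.var 1) (sh 3)))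
      (L.subst (scons ((qclV A R).subst (sh 2)) (sh 3)))) :
    IsTm Γ (.elQ A' R' L' p' l') (L.subst (scons p (sh 0))) := by
  have hA := hQ.set
  have hQs := hQ.form
  have eS : EqTy Γ (.quo A R) (.quo A' R') .set := .quo_eq hQs eA (by simpa using eR)
  have hQ' := hQ.conv eA hA' eR hR'
  have hS' := hQ'.form
  have s1 := SubOk.sh_one (.ctx_cons hA.ty_col)
  have e1 : EqTm (A :: Γ) (qclV A R) (qclV A' R') ((Exp.quo A R).subst (sh 1)) := by
    refine .quo_intro_eq (ty_subst hQs s1) (eqTy_subst eA s1) ?_ (.tm_refl (tm_var_zero hA))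
    simpa using eqTy_subst eR (s1.ups_ups hA)
  have h1 : IsTm (A :: Γ) (qclV A' R') ((Exp.quo A R).subst (sh 1)) :=
    .conv (tm_conv_ctx (.ty_symm eA) hA (tm_qclV hS')) (.ty_symm (eqTy_subst eS s1).tyEq_col)
  have sP := SubEq.scons' (.refl s1) hQs (tm_qclV hQs) h1 e1
  have eT := eqTy_substEq' hL eL sP
  refine .conv (.quo_elim (ty_conv_ctx eS hS' hL') (.conv hp' eS.tyEq_col) ?_ ?_)
    (.ty_symm (eqTm_inst hL eL hp hp' ep))
  · simpa using tm_conv_ctx eA hA' (.conv hl' eT)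
  -- The respect condition for `l'` is the chain `l'(x) = l(x) = l(y) = l'(y)`, whose middle link is
  -- the respect condition for `l`.
  · have hR := hQ.rel
    have hc : IsCtx (quoCtx Γ A R) := .ctx_cons hR.ty_col
    have hR1 : IsTy (A'.subst (sh 1) :: A' :: Γ) R' .props := hQ'.rel
    have sC : SubOk (quoCtx Γ A' R') (sh 0) (quoCtx Γ A R) :=
      (SubOk.conv_two eA hA').conv_cons
        (by simpa using eqTy_subst eR (SubOk.conv_two eA hA')) hR1
    have s2 : SubOk (quoCtx Γ A R) (sh 2) (A :: Γ) := .sh_two hc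
    have s3 : SubOk (quoCtx Γ A R) (sh 3) Γ := .sh_three hc
    have sy : SubOk (quoCtx Γ A R) (scons (.var 1) (sh 3)) (A :: Γ) :=
      s3.scons (by simpa using tm_var_one hc)
    have ex : EqTm (quoCtx Γ A R) (l'.subst (sh 2)) (l.subst (sh 2))
        (L.subst (scons ((qclV A R).subst (sh 2)) (sh 3))) := by
      simpa using Der.tm_symm (eqTm_subst el s2)
    -- The link at `y` is naturally typed in `L([y])`. The last variable of the context is a proof
    -- of `R(x, y)`, so that `[y] = [x]` and the link can be converted to `L([x])`.
    have hcl : EqTm (quoCtx Γ A R) ((qclV A R).subst (scons (.var 1) (sh 3)))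
        ((qclV A R).subst (sh 2)) ((Exp.quo A R).subst (sh 3)) := by
      have hq := ty_subst hQs s3
      have hx : IsTm (quoCtx Γ A R) (.var 2) (A.subst (sh 3)) := tm_var_two hc
      have hy : IsTm (quoCtx Γ A R) (.var 1) (A.subst (sh 3)) := by simpa using tm_var_one hc
      have := Der.tm_symm (.quo_class_eq hq hx hy (by simpa using tr_head (hR.ty_prop (s := true))))
      simpa using this
    have hty1 := tm_subst (tm_qclV hQs) sy
    have hty2 := tm_subst (tm_qclV hQs) s2
    have ey : EqTm (quoCtx Γ A R) (l.subst (scons (.var 1) (sh 3)))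
        (l'.subst (scons (.var 1) (sh 3)))
        (L.subst (scons ((qclV A R).subst (sh 2)) (sh 3))) := by
      have := eqTm_subst el sy
      refine .conv_eq this ?_
      have sE : SubEq (quoCtx Γ A R)
          (scons ((qclV A R).subst (scons (.var 1) (sh 3))) (sh 3))
          (scons ((qclV A R).subst (sh 2)) (sh 3)) (.quo A R :: Γ) := by
        refine .scons' (.refl s3) hQs ?_ ?_ hcl
        · simpa using hty1
        · simpa using hty2
      simpa using ty_substEq hL sE
    have e3 := Der.conv_eq (.tm_trans (.tm_trans ex hr) ey)
      (B := L'.subst (scons ((qclV A' R').subst (sh 2)) (sh 3)))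
      (by simpa using eqTy_subst eT s2)
    simpa using eqTm_subst e3 sC

/-- Products with a set as codomain and products with codomain `P1` have separate congruence rules.
Inversion decides which one applies. -/
theorem pi_eq_dom (h : IsTy Γ (.pi A B) .col) (eA : EqTy Γ A A' .set) (hA' : IsTy Γ A' .set) :
    EqTy Γ (.pi A B) (.pi A' B) .col ∧ IsTy Γ (.pi A' B) .col := by
  obtain ⟨_, _, h2 | rfl⟩ := tyInv h
  · exact ⟨(Der.pi_eq eA (.ty_refl h2)).tyEq_col,
      (Der.pi_form hA' (ty_conv_ctx eA hA' h2)).ty_col⟩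
  · exact ⟨.piP1_eq eA, .piP1_form hA'⟩

theorem ty_inst (hB : IsTy (A :: Γ) B k) (ha : IsTm Γ a A) :
    IsTy Γ (B.subst (scons a (sh 0))) k := ty_subst hB (.inst ha)

/-- Most rules state the well-formedness of their data among their premises, or inherit it from the
induction hypotheses. The work lies in the congruence rules, whose right-hand sides are treated by
the preceding lemmas, and in the computation rules, whose reducts are instances of the branches. -/
theorem presup {J : Judg} (h : Der .emTT J) : J.Presup := by
  induction h with
  | ctx_nil | ctx_cons | incl | sub_ty => trivial
  | N0_form | N1_form | P1_form | sig_form | pi_form | piP1_form | sum_form | list_form => trivial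
  | quo_form | bot_form | and_form | or_form | imp_form | ex_form | all_form | eq_form => trivial
  | eqP1_form => trivial
  | var h e _ =>
    simpa [Judg.Presup] using ty_subst (ty_of_getElem h e) ((SubOk.id h).drop _)
  | incl_eq i _ ih => exact ⟨.incl i ih.1, .incl i ih.2⟩
  | ty_refl h => exact ⟨h, h⟩
  | ty_symm _ ih => exact ⟨ih.2, ih.1⟩
  | ty_trans _ _ ih ih' => exact ⟨ih.1, ih'.2⟩
  | tm_refl h ih => exact ⟨ih, h, h⟩
  | tm_symm _ ih => exact ⟨ih.1, ih.2.2, ih.2.1⟩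
  | tm_trans _ _ ih ih' => exact ⟨ih.1, ih.2.1, ih'.2.2⟩
  | conv _ _ _ ih => exact ih.2
  | conv_eq _ e ih ih' => exact ⟨ih'.2, .conv ih.2.1 e, .conv ih.2.2 e⟩
  | sub_tyEq h1 h2 _ _ _ ih =>
    exact ⟨.sub_ty h1 h2 ih.1, .sub_ty h1 h2 ih.2⟩
  | sub_tm h1 h2 _ _ _ ih => exact .sub_ty h1 h2 ih
  | sub_tmEq h1 h2 _ _ _ ih => exact ⟨.sub_ty h1 h2 ih.1, .sub_tm h1 h2 ih.2.1, .sub_tm h1 h2 ih.2.2⟩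
  | subEq_ty h1 h2 h3 h4 h5 => exact ⟨.sub_ty h1 h2 h5, .sub_ty h1 h3 h5⟩
  | subEq_tm h1 h2 h3 h4 h5 _ _ _ _ ih =>
    exact ⟨.sub_ty h1 h2 ih, .sub_tm h1 h2 h5,
      .conv (.sub_tm h1 h3 h5) (.ty_symm (.subEq_ty h1 h2 h3 h4 ih))⟩
  | sig_eq s h1 h2 ih1 ih2 =>
    exact ⟨.sig_form s ih1.1 ih2.1, .sig_form s ih1.2 (ty_conv_ctx h1 ih1.2 ih2.2)⟩
  | pi_eq h1 h2 ih1 ih2 =>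
    exact ⟨.pi_form ih1.1 ih2.1, .pi_form ih1.2 (ty_conv_ctx h1 ih1.2 ih2.2)⟩
  | piP1_eq _ ih1 => exact ⟨.piP1_form ih1.1, .piP1_form ih1.2⟩
  | sum_eq _ _ ih1 ih2 => exact ⟨.sum_form ih1.1 ih2.1, .sum_form ih1.2 ih2.2⟩
  | list_eq _ ih1 => exact ⟨.list_form ih1.1, .list_form ih1.2⟩
  | quo_eq h1 h2 h3 _ ih2 ih3 =>
    exact ⟨h1, ((quoCond h1).conv h2 ih2.2 (by simpa using h3) (by simpa using ih3.2)).form⟩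
  | and_eq s _ _ ih1 ih2 => exact ⟨.and_form s ih1.1 ih2.1, .and_form s ih1.2 ih2.2⟩
  | or_eq s _ _ ih1 ih2 => exact ⟨.or_form s ih1.1 ih2.1, .or_form s ih1.2 ih2.2⟩
  | imp_eq s _ _ ih1 ih2 => exact ⟨.imp_form s ih1.1 ih2.1, .imp_form s ih1.2 ih2.2⟩
  | ex_eq s h1 h2 ih1 ih2 =>
    exact ⟨.ex_form s ih1.1 ih2.1, .ex_form s ih1.2 (ty_conv_ctx h1 ih1.2 ih2.2)⟩
  | all_eq s h1 h2 ih1 ih2 =>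
    exact ⟨.all_form s ih1.1 ih2.1, .all_form s ih1.2 (ty_conv_ctx h1 ih1.2 ih2.2)⟩
  | eq_eq s h1 _ _ ih1 ih2 ih3 =>
    have e := h1.tyEq_col
    exact ⟨.eq_form s ih1.1 ih2.2.1 ih3.2.1, .eq_form s ih1.2 (.conv ih2.2.2 e) (.conv ih3.2.2 e)⟩
  | eqP1_eq _ _ ih2 ih3 => exact ⟨.eqP1_form ih2.2.1 ih3.2.1, .eqP1_form ih2.2.2 ih3.2.2⟩
  -- The side condition `h` would identify `emTT` with the extended theory.
  | propext _ h => cases h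
  | N0_elim h1 h2 => exact ty_inst h1 h2
  | N0_elim_eq h1 h2 ih1 ih2 =>
    exact ⟨ty_inst ih1.1 ih2.2.1, .N0_elim ih1.1 ih2.2.1,
      .conv (.N0_elim ih1.2 ih2.2.2) (.ty_symm (eqTm_inst ih1.1 h1 ih2.2.1 ih2.2.2 h2))⟩
  | N1_intro h => exact (Der.N1_form h).ty_col
  | N1_elim h1 h2 => exact ty_inst h1 h2
  | N1_elim_eq h1 h2 _ ih1 ih2 ih3 =>
    have hs := Der.N1_intro (ctx_of_tm ih2.2.1)
    exact ⟨ty_inst ih1.1 ih2.2.1, .N1_elim ih1.1 ih2.2.1 ih3.2.1,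
      .conv (.N1_elim ih1.2 ih2.2.2 (.conv ih3.2.2 (eqTm_inst ih1.1 h1 hs hs (.tm_refl hs))))
        (.ty_symm (eqTm_inst ih1.1 h1 ih2.2.1 ih2.2.2 h2))⟩
  | N1_beta h1 h2 _ ih => exact ⟨ih, .N1_elim h1 (.N1_intro (ctx_of_tm h2)) h2, h2⟩
  | sig_intro h1 => exact .sig_form false (head_ty (ctx_of_ty h1)) h1
  | sig_intro_eq h1 h2 h3 _ ih1 ih2 ih3 ih4 =>
    exact ⟨.sig_form false ih1.1 ih2.1, .sig_intro ih2.1 ih3.2.1 ih4.2.1,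
      presup_sig_intro ih1.2 h1 ih2.1 ih2.2 h2 ih3.2.1 ih3.2.2 h3 ih4.2.2⟩
  | sig_elim h1 h2 => exact ty_inst h1 h2
  | sig_elim_eq h1 h2 h3 h4 _ ih1 ih2 ih3 ih4 ih5 =>
    refine ⟨ty_inst ih3.1 ih4.2.1, .sig_elim ih3.1 ih4.2.1 ih5.2.1, ?_⟩
    exact presup_sig_elim ih1.2 h1 ih2.1 ih2.2 h2 ih3.1 ih3.2 h3 ih4.2.1 ih4.2.2 h4
      (by simpa using ih5.2.2)
  | @sig_beta Γ A B M a b m h1 h2 h3 h4 =>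
    have hB : IsTy (A :: Γ) B .col := (tyInv (head_ty (ctx_of_ty h1))).2
    have hp := Der.sig_intro hB h2 h3
    refine ⟨ty_inst h1 hp, .sig_elim h1 hp h4, ?_⟩
    have s : SubOk Γ (scons b (scons a (sh 0))) (B :: A :: Γ) := (SubOk.inst h2).scons h3
    simpa using tm_subst h4 s
  | pi_intro h => exact h
  | pi_intro_eq h1 h2 h3 _ ih2 ih3 =>
    refine ⟨h1, .pi_intro h1 ih3.2.1, ?_⟩
    obtain ⟨e, h4⟩ := pi_eq_dom h1 h2 ih2.2
    exact .conv (.pi_intro h4 (tm_conv_ctx h2 ih2.2 ih3.2.2)) (.ty_symm e)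
  | pi_elim _ h2 ih => exact ty_inst (tyInv ih).2.1 h2
  | pi_elim_eq _ h2 ih1 ih2 =>
    have hB := (tyInv ih1.1).2.1
    exact ⟨ty_inst hB ih2.2.1, .pi_elim ih1.2.1 ih2.2.1, .conv (.pi_elim ih1.2.2 ih2.2.2)
      (.ty_symm (eqTm_inst hB (.ty_refl hB) ih2.2.1 ih2.2.2 h2))⟩
  | pi_beta h1 h2 h3 =>
    have hB := (tyInv h1).2.1
    exact ⟨ty_inst hB h3, .pi_elim (.pi_intro h1 h2) h3, tm_subst h2 (.inst h3)⟩
  | @pi_eta Γ A B f h ih =>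
    refine ⟨ih, .pi_intro ih ?_, h⟩
    have hA := (tyInv ih).1
    have := Der.pi_elim (tm_subst h (.sh_one (.ctx_cons hA.ty_col))) (tm_var_zero hA)
    simpa using this
  | list_nil h => exact (Der.list_form h).ty_col
  | list_nil_eq h ih =>
    exact ⟨(Der.list_form ih.1).ty_col, .list_nil ih.1,
      .conv (.list_nil ih.2) (.ty_symm (Der.list_eq h).tyEq_col)⟩
  | list_cons _ _ ih => exact ih
  | list_cons_eq _ _ ih1 ih2 =>
    exact ⟨ih1.1, .list_cons ih1.2.1 ih2.2.1, .list_cons ih1.2.2 ih2.2.2⟩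
  | list_elim h1 h2 => exact ty_inst h1 h2
  | list_elim_eq h1 h2 h3 h4 _ ih1 ih2 ih3 ih4 ih5 =>
    refine ⟨ty_inst ih2.1 ih3.2.1, .list_elim ih2.1 ih3.2.1 ih4.2.1 ih5.2.1, ?_⟩
    exact presup_list_elim ih1.1 ih1.2 h1 ih2.1 ih2.2 h2 ih3.2.1 ih3.2.2 h3 ih4.2.2
      (by simpa using ih5.2.2)
  | list_beta_nil h1 h2 h3 _ ih =>
    exact ⟨ih, .list_elim h1 (.list_nil (tyInv (head_ty (ctx_of_ty h1)))) h2 h3, h2⟩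
  | @list_beta_cons Γ A L s c a l h1 h2 h3 h4 h5 =>
    have hc := Der.list_cons h2 h3
    refine ⟨ty_inst h1 hc, .list_elim h1 hc h4 h5, ?_⟩
    have s : SubOk Γ (scons (.elList A L s a l) (scons c (scons s (sh 0)))) (listCtx Γ A L) := by
      refine ((SubOk.inst h2).scons (by simpa using h3)).scons ?_
      simpa using Der.list_elim h1 h2 h4 h5
    have h6 : IsTm (listCtx Γ A L) l (L.subst (scons (.cons (.var 2) (.var 1)) (sh 3))) := by
      simpa using h5
    simpa using tm_subst h6 s
  | sum_inl h => exact h.ty_col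
  | sum_inr h => exact h.ty_col
  | sum_inl_eq h1 h2 _ ih1 ih2 ih3 =>
    have hS := Der.sum_form ih1.1 ih2.1
    exact ⟨hS.ty_col, .sum_inl hS ih3.2.1, .conv (.sum_inl (.sum_form ih1.2 ih2.2)
      (.conv ih3.2.2 h1.tyEq_col)) (.ty_symm (Der.sum_eq h1 h2).tyEq_col)⟩
  | sum_inr_eq h1 h2 _ ih1 ih2 ih3 =>
    have hS := Der.sum_form ih1.1 ih2.1
    exact ⟨hS.ty_col, .sum_inr hS ih3.2.1, .conv (.sum_inr (.sum_form ih1.2 ih2.2)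
      (.conv ih3.2.2 h2.tyEq_col)) (.ty_symm (Der.sum_eq h1 h2).tyEq_col)⟩
  | sum_elim h1 h2 => exact ty_inst h1 h2
  | sum_elim_eq h1 h2 h3 h4 _ _ ih1 ih2 ih3 ih4 ih5 ih6 =>
    refine ⟨ty_inst ih3.1 ih4.2.1, .sum_elim ih3.1 ih4.2.1 ih5.2.1 ih6.2.1, ?_⟩
    exact presup_sum_elim ih1.1 ih1.2 h1 ih2.1 ih2.2 h2 ih3.1 ih3.2 h3 ih4.2.1 ih4.2.2 h4
      (by simpa using ih5.2.2) (by simpa using ih6.2.2)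
  | sum_beta_inl h1 h2 h3 h4 =>
    obtain ⟨hA, hB⟩ := tyInv (head_ty (ctx_of_ty h1))
    have hi := Der.sum_inl (.sum_form hA hB) h2
    refine ⟨ty_inst h1 hi, .sum_elim h1 hi h3 h4, ?_⟩
    simpa using tm_subst h3 (.inst h2)
  | sum_beta_inr h1 h2 h3 h4 =>
    obtain ⟨hA, hB⟩ := tyInv (head_ty (ctx_of_ty h1))
    have hi := Der.sum_inr (.sum_form hA hB) h2
    refine ⟨ty_inst h1 hi, .sum_elim h1 hi h3 h4, ?_⟩
    simpa using tm_subst h4 (.inst h2)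
  | quo_intro h => exact h.ty_col
  | quo_intro_eq h1 h2 h3 _ _ ih2 ih3 ih4 =>
    refine ⟨h1.ty_col, .quo_intro h1 ih4.2.1, ?_⟩
    have hQ := (quoCond h1).conv h2 ih2.2 (by simpa using h3) (by simpa using ih3.2)
    exact .conv (.quo_intro hQ.form (.conv ih4.2.2 h2.tyEq_col))
      (.ty_symm (Der.quo_eq h1 h2 h3).tyEq_col)
  | quo_class_eq h1 h2 h3 => exact ⟨h1.ty_col, .quo_intro h1 h2, .quo_intro h1 h3⟩
  | quo_effective h1 h2 h3 =>
    exact (ty_subst (quoCond h1).rel (.two (.id (ctx_of_tm h2)) (by simpa using h2)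
      (by simpa using h3))).ty_col
  | quo_elim h1 h2 => exact ty_inst h1 h2
  | quo_elim_eq h1 h2 h3 h4 h5 h6 ih1 ih2 ih3 ih4 ih5 =>
    refine ⟨ty_inst ih3.1 ih4.2.1, .quo_elim ih3.1 ih4.2.1 ih5.2.1 h6, ?_⟩
    exact presup_quo_elim (quoCond (head_ty (ctx_of_ty ih3.1))) ih1.2 h1
      (by simpa using ih2.2) (by simpa using h2) ih3.1 ih3.2 h3 ih4.2.1 ih4.2.2 h4
      (by simpa using ih5.2.2) (by simpa using h5) (by simpa using h6)
  | quo_beta h1 h2 h3 h4 =>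
    have hi := Der.quo_intro (quoCond (head_ty (ctx_of_ty h1))).form h2
    refine ⟨ty_inst h1 hi, .quo_elim h1 hi h3 h4, ?_⟩
    simpa using tm_subst h3 (.inst h2)
  | P1_intro h => exact .P1_form (ctx_of_ty h)
  | P1_class_eq h1 h2 => exact ⟨.P1_form (ctx_of_ty h1), .P1_intro h1, .P1_intro h2⟩
  | P1_effective h1 h2 =>
    exact (iff_form (h1.ty_prop (s := true)) (h2.ty_prop (s := true))).ty_col
  | P1_eta h =>
    have hb := Der.bot_form (ctx_of_tm h)
    exact ⟨.P1_form (ctx_of_tm h), .P1_intro (.eqP1_form h (.P1_intro (.imp_form true hb hb))), h⟩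
  | prop_mono h h1 h2 => exact ⟨h.ty_col, h1, h2⟩
  | prop_true h => exact h.ty_col
  | bot_elim _ h => exact h.ty_col
  | and_intro h1 h2 => exact (Der.and_form false h1 h2).ty_col
  | and_left h1 => exact h1.ty_col
  | and_right _ h2 => exact h2.ty_col
  | or_inl h1 h2 => exact (Der.or_form false h1 h2).ty_col
  | or_inr h1 h2 => exact (Der.or_form false h1 h2).ty_col
  | or_elim _ _ h => exact h.ty_col
  | imp_intro h1 h2 => exact (Der.imp_form false h1 h2).ty_col
  | imp_elim _ h => exact h.ty_col
  | ex_intro h => exact (Der.ex_form (s := false) (head_ty (ctx_of_ty h)) h).ty_col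
  | ex_elim _ h => exact h.ty_col
  | all_intro h => exact (Der.all_form (s := false) (head_ty (ctx_of_ty h)) h).ty_col
  | all_elim h _ h2 => exact (ty_inst h h2).ty_col
  | eq_intro h ih => exact (Der.eq_form (s := false) ih h h).ty_col
  | eq_reflect h1 h2 _ ih => exact ⟨ih, h1, h2⟩

theorem ty_of_tm (h : IsTm Γ a A) : IsTy Γ A .col := presup h
theorem eqTy_left (h : EqTy Γ A B k) : IsTy Γ A k := (presup h).1
theorem eqTy_right (h : EqTy Γ A B k) : IsTy Γ B k := (presup h).2
theorem eqTm_left (h : EqTm Γ a b A) : IsTm Γ a A := (presup h).2.1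
theorem eqTm_right (h : EqTm Γ a b A) : IsTm Γ b A := (presup h).2.2

/-! ### Substitution along equalities -/

theorem SubEq.scons (h : SubEq Δ σ τ Γ) (hA : IsTy Γ A k) (e : EqTm Δ a b (A.subst σ)) :
    SubEq Δ (scons a σ) (scons b τ) (A :: Γ) :=
  .scons' h hA (eqTm_left e) (eqTm_right e) e

theorem SubEq.inst (e : EqTm Γ a b A) :
    SubEq Γ (EmTT.scons a (sh 0)) (EmTT.scons b (sh 0)) (A :: Γ) :=
  .inst' (ty_of_tm (eqTm_left e)) (eqTm_left e) (eqTm_right e) e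

theorem eqTy_substEq (h : EqTy Γ A B k) (s : SubEq Δ σ τ Γ) : EqTy Δ (A.subst σ) (B.subst τ) k :=
  eqTy_substEq' (eqTy_left h) h s

theorem eqTm_substEq (h : EqTm Γ a b A) (s : SubEq Δ σ τ Γ) :
    EqTm Δ (a.subst σ) (b.subst τ) (A.subst σ) :=
  eqTm_substEq' (eqTm_left h) h (ty_of_tm (eqTm_left h)) (ctx_of_tm (eqTm_left h)) s

theorem SubEq.trans (hΓ : IsCtx Γ) (h : SubEq Δ σ τ Γ) (h' : SubEq Δ τ ρ Γ) : SubEq Δ σ ρ Γ :=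
  ⟨h.left, h'.right, fun i B hB => .tm_trans (h.eq i B hB)
    (.conv_eq (h'.eq i B hB)
      (ty_substEq (ty_of_getElem hΓ hB) ((h.symm hΓ).drop (i + 1))))⟩

theorem SubEq.comp (h : SubEq Δ σ τ Γ) (h' : SubEq Θ σ' τ' Δ) (hΓ : IsCtx Γ) :
    SubEq Θ (cmp σ σ') (cmp τ τ') Γ :=
  (h.comp_right h'.left).trans hΓ (.comp_left h.right h')

theorem eq_form' (hA : IsTy Γ A k) (ha : IsTm Γ a A) (hb : IsTm Γ b A) :
    IsTy Γ (.eq A a b) .prop := .eq_form false hA.ty_col ha hb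

/-- Together with `tr_of_eqTm` this makes judgemental equality provable by the same means as
propositions, in particular by elimination. All the extensionality principles below rest on it. -/
theorem eqTm_of_tr (h : IsTrue Γ (.eq A a b)) : EqTm Γ a b A := by
  obtain ⟨_, ha, hb⟩ := tyInv (ty_of_tm h)
  exact .eq_reflect ha hb h

theorem tr_of_eqTm (h : EqTm Γ a b A) : IsTrue Γ (.eq A a b) := by
  have hA := ty_of_tm (eqTm_left h)
  exact tr_conv (.eq_intro (eqTm_left h))
    (.eq_eq false (.ty_refl hA) (.tm_refl (eqTm_left h)) h) (eq_form' hA (eqTm_left h) (eqTm_right h))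

/-! ### Induction and extensionality -/

/-- Eliminators accept any collection as motive, in particular the proposition `φ`. Applied to the
last variable the eliminator yields a proof-term of `φ`, which may then be replaced by `true`. The
other induction principles have the same proof. -/
theorem tr_sig (hφ : IsTy (.sig A B :: Γ) φ .prop)
    (h : IsTrue (B :: A :: Γ) (φ.subst (scons (pairV A B) (sh 2)))) :
    IsTrue (.sig A B :: Γ) φ := by
  have hc := ctx_of_ty hφ
  obtain ⟨hA, hB⟩ := tyInv (head_ty hc)
  have s := SubOk.sh_one hc
  have hm := tm_subst h ((s.ups hA).ups hB)
  have hM := (ty_subst hφ (s.ups (head_ty hc))).ty_col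
  have := Der.sig_elim (by simpa using hM) (by simpa using tm_var_zero (head_ty hc))
    (by simpa using hm)
  exact tr_of_tm hφ (by simpa using this)

theorem sig_ext (hu : IsTm (.sig A B :: Γ) u C) (hv : IsTm (.sig A B :: Γ) v C)
    (e : EqTm (B :: A :: Γ) (u.subst (scons (pairV A B) (sh 2)))
      (v.subst (scons (pairV A B) (sh 2))) (C.subst (scons (pairV A B) (sh 2)))) :
    EqTm (.sig A B :: Γ) u v C :=
  eqTm_of_tr (tr_sig (eq_form' (ty_of_tm hu) hu hv) (tr_of_eqTm e))

theorem tr_sum (hφ : IsTy (.sum A B :: Γ) φ .prop)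
    (h : IsTrue (A :: Γ) (φ.subst (scons (inlV A B) (sh 1))))
    (h' : IsTrue (B :: Γ) (φ.subst (scons (inrV A B) (sh 1)))) :
    IsTrue (.sum A B :: Γ) φ := by
  have hc := ctx_of_ty hφ
  obtain ⟨hA, hB⟩ := tyInv (head_ty hc)
  have s := SubOk.sh_one hc
  have hm := tm_subst h (s.ups hA)
  have hm' := tm_subst h' (s.ups hB)
  have hM := (ty_subst hφ (s.ups (head_ty hc))).ty_col
  have := Der.sum_elim (by simpa using hM) (by simpa using tm_var_zero (head_ty hc))
    (by simpa using hm) (by simpa using hm')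
  exact tr_of_tm hφ (by simpa using this)

theorem sum_ext (hu : IsTm (.sum A B :: Γ) u C) (hv : IsTm (.sum A B :: Γ) v C)
    (e : EqTm (A :: Γ) (u.subst (scons (inlV A B) (sh 1)))
      (v.subst (scons (inlV A B) (sh 1))) (C.subst (scons (inlV A B) (sh 1))))
    (e' : EqTm (B :: Γ) (u.subst (scons (inrV A B) (sh 1)))
      (v.subst (scons (inrV A B) (sh 1))) (C.subst (scons (inrV A B) (sh 1)))) :
    EqTm (.sum A B :: Γ) u v C :=
  eqTm_of_tr (tr_sum (eq_form' (ty_of_tm hu) hu hv) (tr_of_eqTm e) (tr_of_eqTm e'))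

theorem tr_N0 (hφ : IsTy (.N0 :: Γ) φ .prop) : IsTrue (.N0 :: Γ) φ := by
  have hc := ctx_of_ty hφ
  have hM := (ty_subst hφ ((SubOk.sh_one hc).ups (head_ty hc))).ty_col
  have := Der.N0_elim (by simpa using hM) (tm_var_zero (head_ty hc))
  exact tr_of_tm hφ (by simpa using this)

theorem N0_ext (hu : IsTm (.N0 :: Γ) u C) (hv : IsTm (.N0 :: Γ) v C) : EqTm (.N0 :: Γ) u v C :=
  eqTm_of_tr (tr_N0 (eq_form' (ty_of_tm hu) hu hv))

theorem tr_N1 (hφ : IsTy (.N1 :: Γ) φ .prop) (h : IsTrue Γ (φ.subst (scons .star (sh 0)))) :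
    IsTrue (.N1 :: Γ) φ := by
  have hc := ctx_of_ty hφ
  have s := SubOk.sh_one hc
  have hM := (ty_subst hφ (s.ups (head_ty hc))).ty_col
  have := Der.N1_elim (by simpa using hM) (tm_var_zero (head_ty hc))
    (by simpa using tm_subst h s)
  exact tr_of_tm hφ (by simpa using this)

theorem N1_ext (hu : IsTm (.N1 :: Γ) u C) (hv : IsTm (.N1 :: Γ) v C)
    (e : EqTm Γ (u.subst (scons .star (sh 0))) (v.subst (scons .star (sh 0)))
      (C.subst (scons .star (sh 0)))) : EqTm (.N1 :: Γ) u v C :=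
  eqTm_of_tr (tr_N1 (eq_form' (ty_of_tm hu) hu hv) (tr_of_eqTm e))

theorem tr_list (hφ : IsTy (.list A :: Γ) φ .prop) (h : IsTrue Γ (φ.subst (scons (.nil A) (sh 0))))
    (h' : IsTrue (listCtx Γ A φ) (φ.subst (scons (.cons (.var 2) (.var 1)) (sh 3)))) :
    IsTrue (.list A :: Γ) φ := by
  have hc := ctx_of_ty hφ
  have hA : IsTy Γ A .set := tyInv (head_ty hc)
  have s := SubOk.sh_one hc
  have s1 := s.ups (head_ty hc)
  have hM := (ty_subst hφ s1).ty_col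
  have hA1 := ty_subst hA s
  have h2 := ctx_of_tm h'
  have hl := tm_subst h' ((s1.ups (head_ty (tail_ctx h2))).ups (head_ty h2))
  have := Der.list_elim (by simpa using hM) (by simpa using tm_var_zero (head_ty hc))
    (by simpa using tm_subst h s) (by simpa using hl)
  exact tr_of_tm hφ (by simpa using this)

/-- The proposition proved by induction is `Eq(C, u, v)`. In `e'` it is left abstract as `φ`: the
inductive step only needs the equation at the tail, which reflection extracts from the last variable
of the context. -/
theorem list_ext (hu : IsTm (.list A :: Γ) u C) (hv : IsTm (.list A :: Γ) v C)
    (e : EqTm Γ (u.subst (scons (.nil A) (sh 0))) (v.subst (scons (.nil A) (sh 0)))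
      (C.subst (scons (.nil A) (sh 0))))
    (e' : ∀ φ, IsCtx (listCtx Γ A φ) →
      EqTm (listCtx Γ A φ) (u.subst (sh 2)) (v.subst (sh 2)) (C.subst (sh 2)) →
      EqTm (listCtx Γ A φ) (u.subst (scons (.cons (.var 2) (.var 1)) (sh 3)))
        (v.subst (scons (.cons (.var 2) (.var 1)) (sh 3)))
        (C.subst (scons (.cons (.var 2) (.var 1)) (sh 3)))) :
    EqTm (.list A :: Γ) u v C := by
  have hφ := eq_form' (ty_of_tm hu) hu hv
  refine eqTm_of_tr (tr_list hφ (tr_of_eqTm e) (tr_of_eqTm (e' _ ?_ ?_)))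
  · exact ctx_listCtx (tyInv (head_ty (ctx_of_ty hφ))) hφ.ty_col
  · have h1 := ty_subst hφ (.sh_one (ctx_list_two (tyInv (head_ty (ctx_of_ty hφ)))))
    have := tr_head h1
    simp only [Exp.subst, subst_subst, sh_cmp_sh] at this
    exact eqTm_of_tr this

theorem tr_quo (hφ : IsTy (.quo A R :: Γ) φ .prop)
    (h : IsTrue (A :: Γ) (φ.subst (scons (qclV A R) (sh 1)))) : IsTrue (.quo A R :: Γ) φ := by
  -- The general form in `p` is used below over the context extended by the quotient itself, with
  -- everything weakened and `p` the last variable.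
  have key : ∀ {Γ A R φ p}, IsTy (.quo A R :: Γ) φ .prop → IsTm Γ p (.quo A R) →
      IsTrue (A :: Γ) (φ.subst (scons (qclV A R) (sh 1))) →
      IsTrue Γ (φ.subst (scons p (sh 0))) := by
    intro Γ A R φ p hφ hp h
    have hQ := quoCond (head_ty (ctx_of_ty hφ))
    have hc3 : IsCtx (quoCtx Γ A R) := .ctx_cons hQ.rel.ty_col
    have s2 : SubOk (quoCtx Γ A R) (sh 2) (A :: Γ) := .sh_two hc3
    have h2 := tm_subst h s2
    have hy : IsTm (quoCtx Γ A R) (.var 1) (A.subst (sh 3)) := by simpa using tm_var_one hc3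
    have sy : SubOk (quoCtx Γ A R) (scons (.var 1) (sh 3)) (A :: Γ) := (SubOk.sh_three hc3).scons hy
    have h2' := tm_subst h sy
    have hq3 := ty_subst hQ.form (SubOk.sh_three hc3)
    have hcl : EqTm (quoCtx Γ A R) ((qclV A R).subst (scons (.var 1) (sh 3)))
        ((qclV A R).subst (sh 2)) ((Exp.quo A R).subst (sh 3)) := by
      have := Der.tm_symm (.quo_class_eq hq3 (tm_var_two hc3) hy
        (by simpa using tr_head (hQ.rel.ty_prop (s := true))))
      simpa using this
    have e := ty_substEq hφ (SubEq.scons (.refl (SubOk.sh_three hc3)) hQ.form hcl)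
    simp only [subst_subst, cmp_scons, sh_cmp_sh, sh_cmp_scons] at h2 h2'
    refine tr_of_tm (ty_subst hφ (.inst hp)) (Der.quo_elim hφ.ty_col hp (by simpa using h) ?_)
    -- The respect condition is automatic: the two branches prove `φ([x])` and `φ([y])`, which are
    -- equal propositions because `[x] = [y]`, and proofs are irrelevant.
    have := Der.prop_mono (ty_subst hφ ((SubOk.sh_three hc3).scons (eqTm_right hcl))) h2 (.conv h2' e.tyEq_col)
    simpa using this
  have hc := ctx_of_ty hφ
  have s := SubOk.sh_one hc
  have hl := tm_subst h (s.ups (quoCond (head_ty hc)).set)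
  have := key (Γ := .quo A R :: Γ) (A := A.subst (sh 1)) (R := R.subst (ups (ups (sh 1))))
    (φ := φ.subst (ups (sh 1))) (p := .var 0)
    (by simpa using ty_subst hφ (s.ups (head_ty hc))) (by simpa using tm_var_zero (head_ty hc))
    (by simpa using hl)
  simpa using this

theorem quo_ext (hu : IsTm (.quo A R :: Γ) u C) (hv : IsTm (.quo A R :: Γ) v C)
    (e : EqTm (A :: Γ) (u.subst (scons (qclV A R) (sh 1)))
      (v.subst (scons (qclV A R) (sh 1))) (C.subst (scons (qclV A R) (sh 1)))) :
    EqTm (.quo A R :: Γ) u v C :=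
  eqTm_of_tr (tr_quo (eq_form' (ty_of_tm hu) hu hv) (tr_of_eqTm e))

theorem tm_app_var (hf : IsTm Γ f (.pi A B)) :
    IsTm (A :: Γ) (.app (f.subst (sh 1)) (.var 0)) B := by
  have hA := (tyInv (ty_of_tm hf)).1
  simpa using Der.pi_elim (tm_subst hf (.sh_one (.ctx_cons hA.ty_col))) (tm_var_zero hA)

theorem pi_ext (hf : IsTm Γ f (.pi A B)) (hg : IsTm Γ g (.pi A B))
    (e : EqTm (A :: Γ) (.app (f.subst (sh 1)) (.var 0)) (.app (g.subst (sh 1)) (.var 0)) B) :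
    EqTm Γ f g (.pi A B) := by
  have hA := (tyInv (ty_of_tm hf)).1
  have h1 := Der.pi_eta hf
  have h2 := Der.pi_eta hg
  rw [lift_eq] at h1 h2
  exact .tm_trans (.tm_symm h1) (.tm_trans (.pi_intro_eq (ty_of_tm hf) (.ty_refl hA) e) h2)

end EmTT

namespace EmTT

/-! ## Canonical isomorphisms described by their behaviour on canonical elements -/

/-- The canonical isomorphisms, each one described by its behaviour on canonical elements. -/
inductive Iso : Ctx → Ty → Ty → Tm → Prop where
  | prop {Γ φ ψ θ} : IsTy Γ φ .prop → IsTy Γ ψ .prop → IsTrue Γ (Exp.iff φ ψ) →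
      IsTm (φ :: Γ) θ (ψ.subst (sh 1)) → Iso Γ φ ψ θ
  | N0 {Γ θ} : EqTm (.N0 :: Γ) θ (.var 0) .N0 → Iso Γ .N0 .N0 θ
  | N1 {Γ θ} : EqTm (.N1 :: Γ) θ (.var 0) .N1 → Iso Γ .N1 .N1 θ
  | P1 {Γ θ} : EqTm (.P1 :: Γ) θ (.var 0) .P1 → Iso Γ .P1 .P1 θ
  | list {Γ A B α θ} : IsTy Γ A .set → IsTy Γ B .set → Iso Γ A B α →
      IsTm (.list A :: Γ) θ (.list (B.subst (sh 1))) →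
      EqTm Γ (θ.subst (scons (.nil A) (sh 0))) (.nil B) (.list B) →
      EqTm (A.subst (sh 1) :: .list A :: Γ) (θ.subst (scons (.cons (.var 1) (.var 0)) (sh 2)))
        (.cons (θ.subst (sh 1)) (α.subst (scons (.var 0) (sh 2)))) (.list (B.subst (sh 2))) →
      Iso Γ (.list A) (.list B) θ
  | sum {Γ A A' B B' α β θ} : IsTy Γ A .set → IsTy Γ A' .set → IsTy Γ B .set → IsTy Γ B' .set →
      Iso Γ A A' α → Iso Γ B B' β →
      IsTm (.sum A B :: Γ) θ ((Exp.sum A' B').subst (sh 1)) →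
      EqTm (A :: Γ) (θ.subst (scons (inlV A B) (sh 1)))
        (.inl (A'.subst (sh 1)) (B'.subst (sh 1)) α) ((Exp.sum A' B').subst (sh 1)) →
      EqTm (B :: Γ) (θ.subst (scons (inrV A B) (sh 1)))
        (.inr (A'.subst (sh 1)) (B'.subst (sh 1)) β) ((Exp.sum A' B').subst (sh 1)) →
      Iso Γ (.sum A B) (.sum A' B') θ
  | sig {Γ A A' B B' α β θ} : IsTy (A :: Γ) B .col → IsTy (A' :: Γ) B' .col →
      Iso Γ A A' α → Iso (A :: Γ) B (B'.subst (scons α (sh 1))) β →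
      IsTm (.sig A B :: Γ) θ ((Exp.sig A' B').subst (sh 1)) →
      EqTm (B :: A :: Γ) (θ.subst (scons (pairV A B) (sh 2)))
        (.pair (A'.subst (sh 2)) (B'.subst (ups (sh 2))) (α.subst (sh 1)) β)
        ((Exp.sig A' B').subst (sh 2)) →
      Iso Γ (.sig A B) (.sig A' B') θ
  | pi {Γ A A' B B' α β θ} : IsTy Γ (.pi A B) .col → IsTy Γ (.pi A' B') .col →
      Iso Γ A' A α → Iso (A' :: Γ) (B.subst (scons α (sh 1))) B' β →
      IsTm (.pi A B :: Γ) θ ((Exp.pi A' B').subst (sh 1)) →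
      EqTm (A'.subst (sh 1) :: .pi A B :: Γ) (.app (θ.subst (sh 1)) (.var 0))
        (β.subst (scons (.app (.var 1) (α.subst (scons (.var 0) (sh 2)))) (scons (.var 0) (sh 2))))
        (B'.subst (scons (.var 0) (sh 2))) →
      Iso Γ (.pi A B) (.pi A' B') θ
  | quo {Γ A B R S α θ} : IsTy Γ (.quo A R) .set → IsTy Γ (.quo B S) .set → Iso Γ A B α →
      IsTrue (A.subst (sh 1) :: A :: Γ)
        (Exp.iff R (S.subst (scons (α.subst (scons (.var 0) (sh 2))) (scons (α.subst (sh 1)) (sh 2))))) →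
      IsTm (.quo A R :: Γ) θ ((Exp.quo B S).subst (sh 1)) →
      EqTm (A :: Γ) (θ.subst (scons (qclV A R) (sh 1)))
        (.qcl (B.subst (sh 1)) (S.subst (ups (ups (sh 1)))) α) ((Exp.quo B S).subst (sh 1)) →
      Iso Γ (.quo A R) (.quo B S) θ

variable {Γ Δ Θ Γ' Δ' : Ctx} {σ τ σ' τ' ρ : Sub}
  {A B C M L R S A' B' C' M' L' R' S' φ ψ χ φ' ψ' : Ty}
  {a b c d e0 f g s t u v w m l p a' b' c' d' f' s' t' u' v' w' m' l' p' α β α' β' θ θ' δ κ : Tm}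
  {k : Kind}

theorem Iso.data (h : Iso Γ A B θ) :
    IsTy Γ A .col ∧ IsTy Γ B .col ∧ IsTm (A :: Γ) θ (B.subst (sh 1)) := by
  cases h with
  | prop h1 h2 _ h4 => exact ⟨h1.ty_col, h2.ty_col, h4⟩
  | N0 h => 
    have h0 := head_ty (ctx_of_tm (eqTm_left h))
    exact ⟨h0, h0, eqTm_left h⟩
  | N1 h => 
    have h0 := head_ty (ctx_of_tm (eqTm_left h))
    exact ⟨h0, h0, eqTm_left h⟩
  | P1 h => 
    have h0 := head_ty (ctx_of_tm (eqTm_left h))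
    exact ⟨h0, h0, eqTm_left h⟩
  | list h1 h2 _ h3 => exact ⟨(Der.list_form h1).ty_col, (Der.list_form h2).ty_col, h3⟩
  | sum h1 h2 h3 h4 _ _ h5 =>
    exact ⟨(Der.sum_form h1 h3).ty_col, (Der.sum_form h2 h4).ty_col, h5⟩
  | sig h1 h2 _ _ h5 =>
    exact ⟨.sig_form false (head_ty (ctx_of_ty h1)) h1,
      .sig_form false (head_ty (ctx_of_ty h2)) h2, h5⟩
  | pi h1 h2 _ _ h5 => exact ⟨h1, h2, h5⟩
  | quo h1 h2 _ _ h5 => exact ⟨h1.ty_col, h2.ty_col, h5⟩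

theorem Iso.left (h : Iso Γ A B θ) : IsTy Γ A .col := h.data.1
theorem Iso.right (h : Iso Γ A B θ) : IsTy Γ B .col := h.data.2.1
theorem Iso.tm (h : Iso Γ A B θ) : IsTm (A :: Γ) θ (B.subst (sh 1)) := h.data.2.2
theorem Iso.ctx (h : Iso Γ A B θ) : IsCtx Γ := ctx_of_ty h.left

theorem Iso.subOk (h : Iso Γ A B θ) : SubOk (A :: Γ) (EmTT.scons θ (sh 1)) (B :: Γ) :=
  .scons (.sh_one (.ctx_cons h.left)) h.tm

/-- Closure under judgemental equality, a constructor of `CanIso`, is a consequence here. An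
analysis of `Iso` thus has exactly one clause for each form of the type, besides the one for
propositions. -/
theorem Iso.eqv (h : Iso Γ A B θ) (e : EqTm (A :: Γ) θ θ' (B.subst (sh 1))) : Iso Γ A B θ' := by
  have ht := eqTm_right e
  have e' := Der.tm_symm e
  have hc := ctx_of_tm ht
  cases h with
  | prop h1 h2 h3 _ => exact .prop h1 h2 h3 ht
  | N0 h => exact .N0 (.tm_trans e' h)
  | N1 h => exact .N1 (.tm_trans e' h)
  | P1 h => exact .P1 (.tm_trans e' h)
  | list h1 h2 h3 _ h5 h6 =>
    have s2 := SubOk.consV h1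
    refine .list h1 h2 h3 ht (.tm_trans ?_ h5) (.tm_trans (.tm_trans ?_ h6) ?_)
    · simpa using eqTm_subst e' (.inst (.list_nil h1))
    · simpa using eqTm_subst e' s2
    · have hc2 := ctx_list_two h1
      refine .list_cons_eq ?_ (.tm_refl ?_)
      · simpa using eqTm_subst e (SubOk.sh_one hc2)
      · have := tm_subst h3.tm ((SubOk.sh_two hc2).scons (by simpa using tm_var_zero (head_ty hc2)))
        simpa using this
  | sum h1 h2 h3 h4 h5 h6 _ h8 h9 =>
    refine .sum h1 h2 h3 h4 h5 h6 ht (.tm_trans ?_ h8) (.tm_trans ?_ h9)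
    · simpa using eqTm_subst e' (.inlV h1 h3)
    · simpa using eqTm_subst e' (.inrV h1 h3)
  | sig h1 h2 h3 h4 _ h6 =>
    refine .sig h1 h2 h3 h4 ht (.tm_trans ?_ h6)
    simpa using eqTm_subst e' (.pairV h1)
  | pi h1 h2 h3 h4 _ h6 =>
    refine .pi h1 h2 h3 h4 ht (.tm_trans ?_ h6)
    have hA := ctx_of_tm (eqTm_left h6)
    have := Der.pi_elim_eq (eqTm_subst e' (.sh_one hA)) (.tm_refl (by
      simpa using tm_var_zero (head_ty hA)))
    simpa using this
  | quo h1 h2 h3 h4 _ h6 =>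
    refine .quo h1 h2 h3 h4 ht (.tm_trans ?_ h6)
    simpa using eqTm_subst e' (.qclV h1)

theorem Iso.subst (h : Iso Γ A B θ) : ∀ {Δ σ}, SubOk Δ σ Γ →
    Iso Δ (A.subst σ) (B.subst σ) (θ.subst (ups σ)) := by
  induction h with
  | prop h1 h2 h3 h4 =>
    intro Δ σ s
    refine .prop (ty_subst h1 s) (ty_subst h2 s) (tm_subst h3 s) ?_
    simpa using tm_subst h4 (s.ups h1)
  | N0 h =>
    intro Δ σ s
    exact .N0 (by simpa using eqTm_subst h (s.ups (.N0_form (tail_ctx (ctx_of_tm (eqTm_left h))))))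
  | N1 h =>
    intro Δ σ s
    exact .N1 (by simpa using eqTm_subst h (s.ups (.N1_form (tail_ctx (ctx_of_tm (eqTm_left h))))))
  | P1 h =>
    intro Δ σ s
    exact .P1 (by simpa using eqTm_subst h (s.ups (.P1_form (tail_ctx (ctx_of_tm (eqTm_left h))))))
  | list h1 h2 _ h4 h5 h6 ih =>
    intro Δ σ s
    have sl := s.ups (.list_form h1)
    refine .list (ty_subst h1 s) (ty_subst h2 s) (ih s) ?_ ?_ ?_
    · simpa using tm_subst h4 sl
    · simpa using eqTm_subst h5 s
    · simpa using eqTm_subst h6 (sl.ups (head_ty (ctx_list_two h1)))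
  | sum h1 h2 h3 h4 _ _ h7 h8 h9 ih1 ih2 =>
    intro Δ σ s
    refine .sum (ty_subst h1 s) (ty_subst h2 s) (ty_subst h3 s) (ty_subst h4 s) (ih1 s) (ih2 s)
      ?_ ?_ ?_
    · simpa using tm_subst h7 (s.ups (.sum_form h1 h3))
    · simpa using eqTm_subst h8 (s.ups h1)
    · simpa using eqTm_subst h9 (s.ups h3)
  | @sig _ _ _ _ _ _ β _ h1 h2 h3 h4 h5 h6 ih1 ih2 =>
    intro Δ σ s
    have sA := s.ups (head_ty (ctx_of_ty h1))
    refine .sig (β := β.subst (ups (ups σ))) (ty_subst h1 sA)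
      (ty_subst h2 (s.ups (head_ty (ctx_of_ty h2)))) (ih1 s) ?_ ?_ ?_
    · simpa using ih2 sA
    · simpa using tm_subst h5 (s.ups (head_ty (ctx_of_tm h5)))
    · simpa using eqTm_subst h6 (sA.ups h1)
  | @pi _ _ _ _ _ _ β _ h1 h2 h3 h4 h5 h6 ih1 ih2 =>
    intro Δ σ s
    have sA := s.ups (head_ty (ctx_of_ty h4.left))
    refine .pi (β := β.subst (ups (ups σ))) (ty_subst h1 s) (ty_subst h2 s) (ih1 s) ?_ ?_ ?_
    · simpa using ih2 sA
    · simpa using tm_subst h5 (s.ups h1)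
    · have hc := ctx_of_tm (eqTm_left h6)
      simpa using eqTm_subst h6 ((s.ups h1).ups (head_ty hc))
  | quo h1 h2 _ h4 h5 h6 ih =>
    intro Δ σ s
    have hA := (quoCond h1).set
    refine .quo (ty_subst h1 s) (ty_subst h2 s) (ih s) ?_ ?_ ?_
    · have := tm_subst h4 (s.ups_ups hA)
      simpa [Exp.iff] using this
    · simpa using tm_subst h5 (s.ups h1)
    · simpa using eqTm_subst h6 (s.ups hA)

/-! ### Equal substitutions give identities -/

theorem tm_var_eq (e : EqTy Γ A B k) : IsTm (A :: Γ) (.var 0) (B.subst (sh 1)) := by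
  have hA := eqTy_left e
  exact .conv (tm_var_zero hA) (eqTy_subst e (.sh_one (.ctx_cons hA.ty_col))).tyEq_col

theorem iso_prop_of_eqTy (e : EqTy Γ φ ψ .prop) : Iso Γ φ ψ (.var 0) :=
  .prop (eqTy_left e) (eqTy_right e) (iff_of_eqTy (eqTy_left e) (eqTy_right e) e) (tm_var_eq e)

/-- Identities between the instances of a type along equal substitutions. -/
def Stable (Γ : Ctx) (A : Ty) : Prop :=
  ∀ ⦃Δ σ τ⦄, SubEq Δ σ τ Γ → Iso Δ (A.subst σ) (A.subst τ) (.var 0)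

/-- No clause of `Iso` takes an equality of types as a premise, so the identity between equal types
has to be shown canonical. In these lemmas the identity satisfies the required equations because
canonical elements with equal annotations are equal, and the components are identities by
hypothesis. -/
theorem iso_list_of_eqTy (e : EqTy Γ A B .set) (h : Iso Γ A B (.var 0)) :
    Iso Γ (.list A) (.list B) (.var 0) := by
  have hA := eqTy_left e
  have el := Der.list_eq e
  refine .list hA (eqTy_right e) h (tm_var_eq el) ?_ ?_
  · exact .conv_eq (.list_nil_eq e) el.tyEq_col
  · have hc := ctx_list_two hA
    have := tm_subst (tm_var_eq el) (.consV hA)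
    exact .tm_refl (by simpa using this)

theorem iso_sum_of_eqTy (e : EqTy Γ A A' .set) (h : Iso Γ A A' (.var 0)) (e' : EqTy Γ B B' .set)
    (h' : Iso Γ B B' (.var 0)) : Iso Γ (.sum A B) (.sum A' B') (.var 0) := by
  have hA := eqTy_left e
  have hB := eqTy_left e'
  have el := Der.sum_eq e e'
  have sA := SubOk.sh_one (.ctx_cons hA.ty_col)
  have sB := SubOk.sh_one (.ctx_cons hB.ty_col)
  refine .sum hA (eqTy_right e) hB (eqTy_right e') h h' (tm_var_eq el) ?_ ?_
  · exact .conv_eq (.sum_inl_eq (eqTy_subst e sA) (eqTy_subst e' sA) (.tm_refl (tm_var_zero hA)))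
      (eqTy_subst el sA).tyEq_col
  · exact .conv_eq (.sum_inr_eq (eqTy_subst e sB) (eqTy_subst e' sB) (.tm_refl (tm_var_zero hB)))
      (eqTy_subst el sB).tyEq_col

theorem iso_sig_of_eqTy (e : EqTy Γ A A' .col) (h : Iso Γ A A' (.var 0))
    (e' : EqTy (A :: Γ) B B' .col) (h' : Iso (A :: Γ) B B' (.var 0)) :
    Iso Γ (.sig A B) (.sig A' B') (.var 0) := by
  have hB := eqTy_left e'
  have el := Der.sig_eq false e e'
  have s2 := SubOk.sh_two (.ctx_cons hB)
  refine .sig hB (ty_conv_ctx e (eqTy_right e) (eqTy_right e')) h (by simpa using h')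
    (tm_var_eq el) ?_
  refine .conv_eq (.sig_intro_eq (eqTy_subst e s2) (eqTy_subst e' (s2.ups (eqTy_left e)))
    (.tm_refl (tm_var_one (.ctx_cons hB))) (.tm_refl ?_)) (eqTy_subst el s2).tyEq_col
  simpa using tm_var_zero hB

theorem iso_pi_of_eqTy (h : Iso Γ A' A (.var 0))
    (e : EqTy Γ (.pi A B) (.pi A' B') .col) (h' : Iso (A' :: Γ) B B' (.var 0)) :
    Iso Γ (.pi A B) (.pi A' B') (.var 0) := by
  refine .pi (eqTy_left e) (eqTy_right e) h (by simpa using h') (tm_var_eq e) ?_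
  have h0 := tm_app_var (tm_var_eq e)
  have := tm_app_var (f := .var 0) (A := A'.subst (sh 1)) (B := B'.subst (ups (sh 1)))
    (Γ := .pi A B :: Γ) (by simpa using tm_var_eq e)
  exact .tm_refl (by simpa using this)

theorem iso_quo_of_eqTy (hQ : QuoCond Γ A R) (e : EqTy Γ A A' .set) (h : Iso Γ A A' (.var 0))
    (e' : EqTy (A.subst (sh 1) :: A :: Γ) R R' .props) :
    Iso Γ (.quo A R) (.quo A' R') (.var 0) := by
  have el := Der.quo_eq hQ.form e (by simpa using e')
  have s1 := SubOk.sh_one (.ctx_cons hQ.set.ty_col)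
  refine .quo hQ.form (eqTy_right el) h ?_ (tm_var_eq el) ?_
  · have ep := e'.tyEq_prop (s := true)
    simpa using iff_of_eqTy (eqTy_left ep) (eqTy_right ep) ep
  · refine .conv_eq (.quo_intro_eq (ty_subst hQ.form s1) (eqTy_subst e s1) ?_
      (.tm_refl (tm_var_zero hQ.set))) (eqTy_subst el s1).tyEq_col
    simpa using eqTy_subst e' (s1.ups_ups hQ.set)

/-- The motive of the lemma on identities. -/
def Judg.Stable : Judg → Prop
  | .ty Γ A _ => EmTT.Stable Γ A
  | _ => True

theorem SubEq.ups_ups (h : SubEq Δ σ τ Γ) (hA : IsTy Γ A k) :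
    SubEq (A.subst (cmp σ (sh 1)) :: A.subst σ :: Δ) (EmTT.ups (EmTT.ups σ))
      (EmTT.ups (EmTT.ups τ)) (A.subst (sh 1) :: A :: Γ) := by
  have := (h.ups hA).ups (ty_subst hA (.sh_one (.ctx_cons hA.ty_col)))
  simpa using this

theorem stable_of_prop (h : IsTy Γ A .prop) : Stable Γ A :=
  fun _ _ _ s => iso_prop_of_eqTy (ty_substEq h s)

/-- Two equal substitutions are needed in the motive, since binders are crossed by `SubEq.ups` and
the rule of substitution by composition. When both substitutions are the identity the result is
reflexivity. Propositions require no induction, as equal instances are equiprovable. -/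
theorem judg_stable {J : Judg} (h : Der .emTT J) : J.Stable := by
  induction h with
  | incl _ _ ih => exact ih
  | @sub_ty Γ Δ σ A k h1 h2 h _ _ ih =>
    intro Θ τ τ' s
    simpa using ih (SubEq.comp_left ⟨h1, by simpa using h2⟩ s)
  | N0_form h => exact fun _ _ _ s => .N0 (.tm_refl (tm_var_zero (ty_subst (.N0_form h) s.left)))
  | N1_form h => exact fun _ _ _ s => .N1 (.tm_refl (tm_var_zero (ty_subst (.N1_form h) s.left)))
  | P1_form h => exact fun _ _ _ s => .P1 (.tm_refl (tm_var_zero (ty_subst (.P1_form h) s.left)))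
  | sig_form _ h1 h2 ih1 ih2 =>
    intro Δ σ τ s
    have sA := s.ups h1.ty_col
    exact iso_sig_of_eqTy (ty_substEq h1 s).tyEq_col (ih1 s) (ty_substEq h2 sA).tyEq_col (ih2 sA)
  | pi_form h1 h2 ih1 ih2 =>
    intro Δ σ τ s
    -- The domain of a product is contravariant: its identity goes from the instance along `τ` to
    -- the one along `σ`, and the codomains are compared over the former.
    have s' := s.symm (ctx_of_ty h1)
    refine iso_pi_of_eqTy (ih1 s') (ty_substEq (.pi_form h1 h2) s).tyEq_col ?_
    have sA' := (s'.ups h1).symm (ctx_of_ty h2)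
    exact ih2 sA'
  | piP1_form h1 ih1 =>
    intro Δ σ τ s
    have s' := s.symm (ctx_of_ty h1)
    refine iso_pi_of_eqTy (ih1 s') (ty_substEq (.piP1_form h1) s) ?_
    exact .P1 (.tm_refl (tm_var_zero (.P1_form (.ctx_cons (ty_subst h1 s.right).ty_col))))
  | sum_form h1 h2 ih1 ih2 =>
    intro Δ σ τ s
    exact iso_sum_of_eqTy (ty_substEq h1 s) (ih1 s) (ty_substEq h2 s) (ih2 s)
  | list_form h1 ih1 =>
    intro Δ σ τ s
    exact iso_list_of_eqTy (ty_substEq h1 s) (ih1 s)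
  | quo_form h1 h2 h3 h4 h5 ih1 =>
    intro Δ σ τ s
    have hQ := quoCond (Der.quo_form h1 h2 h3 h4 h5)
    refine iso_quo_of_eqTy (hQ.subst s.left) (ty_substEq h1 s) (ih1 s) ?_
    simpa using ty_substEq hQ.rel (s.ups_ups h1)
  | bot_form h => exact stable_of_prop ((Der.bot_form h).ty_prop (s := true))
  | and_form s h1 h2 => exact stable_of_prop (Der.and_form s h1 h2).ty_prop
  | or_form s h1 h2 => exact stable_of_prop (Der.or_form s h1 h2).ty_prop
  | imp_form s h1 h2 => exact stable_of_prop (Der.imp_form s h1 h2).ty_prop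
  | ex_form s h1 h2 => exact stable_of_prop (Der.ex_form s h1 h2).ty_prop
  | all_form s h1 h2 => exact stable_of_prop (Der.all_form s h1 h2).ty_prop
  | eq_form s h1 h2 h3 => exact stable_of_prop (Der.eq_form s h1 h2 h3).ty_prop
  | eqP1_form h1 h2 => exact stable_of_prop ((Der.eqP1_form h1 h2).ty_prop (s := true))
  | _ => trivial

theorem iso_of_subEq (h : IsTy Γ A k) (s : SubEq Δ σ τ Γ) :
    Iso Δ (A.subst σ) (A.subst τ) (.var 0) := judg_stable h s

theorem Iso.refl (h : IsTy Γ A k) : Iso Γ A A (.var 0) := by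
  simpa using iso_of_subEq h (.refl (.id (ctx_of_ty h)))

/-! ### Composition of canonical isomorphisms -/

/-- The number of type constructors in a type, those in propositions not counted. -/
def tySize : Ty → ℕ
  | .sig A B => tySize A + tySize B + 1
  | .pi A B => tySize A + tySize B + 1
  | .sum A B => tySize A + tySize B + 1
  | .list A => tySize A + 1
  | .quo A _ => tySize A + 1
  | _ => 0

theorem tySize_subst : ∀ (A : Ty) (σ : Sub), tySize (A.subst σ) = tySize A
  | .sig A B, σ => by simp only [Exp.subst, tySize, tySize_subst A, tySize_subst B]
  | .pi A B, σ => by simp only [Exp.subst, tySize, tySize_subst A, tySize_subst B]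
  | .sum A B, σ => by simp only [Exp.subst, tySize, tySize_subst A, tySize_subst B]
  | .list A, σ => by simp only [Exp.subst, tySize, tySize_subst A]
  | .quo A _, σ => by simp only [Exp.subst, tySize, tySize_subst A]
  | .N0, _ | .N1, _ | .P1, _ | .bot, _ | .and _ _, _ | .or _ _, _ | .imp _ _, _ => by
      simp only [Exp.subst, tySize]
  | .ex _ _, _ | .all _ _, _ | .eq _ _ _, _ => by simp only [Exp.subst, tySize]

theorem tySize_prop (h : IsTy Γ A .prop) : tySize A = 0 := by
  have := propHead h
  cases A <;> first | exact False.elim this | simp only [tySize]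

/-- Equiprovable propositions can have arbitrary shapes, which is the reason for giving them size
zero. The size is then an invariant both of substitution and of canonical isomorphism, hence usable
as a recursion measure where instances of codomains and reversed domains occur. -/
theorem iso_tySize (h : Iso Γ A B θ) : tySize A = tySize B := by
  induction h with
  | prop h1 h2 => rw [tySize_prop h1, tySize_prop h2]
  | N0 | N1 | P1 => rfl
  | list _ _ _ _ _ _ ih => simp only [tySize, ih]
  | quo _ _ _ _ _ _ ih => simp only [tySize, ih]
  | sum _ _ _ _ _ _ _ _ _ ih1 ih2 => simp only [tySize, ih1, ih2]
  | sig _ _ _ _ _ _ ih1 ih2 => simp only [tySize, ih1, ih2, tySize_subst]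
  | pi _ _ _ _ _ _ ih1 ih2 => simp only [tySize, ih1, ← ih2, tySize_subst]

theorem iff_trans (hφ : IsTy Γ φ .prop) (hψ : IsTy Γ ψ .prop) (hχ : IsTy Γ χ .prop)
    (h : IsTrue Γ (Exp.iff φ ψ)) (h' : IsTrue Γ (Exp.iff ψ χ)) : IsTrue Γ (Exp.iff φ χ) := by
  have s := SubOk.sh_one (.ctx_cons hφ.ty_col)
  have s' := SubOk.sh_one (.ctx_cons hχ.ty_col)
  refine iff_intro hφ hχ ?_ ?_
  · exact tr_mp (ty_subst hψ s) (ty_subst hχ s) (tr_subst h' s)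
      (tr_mp (ty_subst hφ s) (ty_subst hψ s) (tr_subst h s) (tr_head hφ))
  · exact tr_mpr (ty_subst hφ s') (ty_subst hψ s') (tr_subst h s')
      (tr_mpr (ty_subst hψ s') (ty_subst hχ s') (tr_subst h' s') (tr_head hχ))

theorem iff_symm (hφ : IsTy Γ φ .prop) (hψ : IsTy Γ ψ .prop)
    (h : IsTrue Γ (Exp.iff φ ψ)) : IsTrue Γ (Exp.iff ψ φ) :=
  .and_intro (.imp_form false hψ hφ) (.imp_form false hφ hψ) (iff_elim_right hφ hψ h)
    (iff_elim_left hφ hψ h)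

theorem Iso.act (h : Iso Γ A B θ) (s : SubOk Δ σ Γ) (ha : IsTm Δ a (A.subst σ)) :
    IsTm Δ (θ.subst (scons a σ)) (B.subst σ) := by
  simpa using tm_subst h.tm (s.scons ha)

theorem Iso.congr (h : Iso Γ A B θ) (s : SubOk Δ σ Γ) (e : EqTm Δ a b (A.subst σ)) :
    EqTm Δ (θ.subst (scons a σ)) (θ.subst (scons b σ)) (B.subst σ) := by
  simpa using tm_substEq h.tm (SubEq.scons (.refl s) h.left e)

/-- The recursion cannot follow the derivations: for dependent sums and products one of the codomain
isomorphisms has to be reindexed along a domain isomorphism before it can be composed, and the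
result is no longer a component of the given derivation. Its types still have smaller size. The
equation of a composite on canonical elements chains the equations of the two factors. -/
theorem Iso.comp_aux (n : ℕ) : ∀ {Γ A B C α β}, tySize A < n → Iso Γ A B α → Iso Γ B C β →
    Iso Γ A C (β.subst (scons α (sh 1))) := by
  induction n with
  | zero => intro _ _ _ _ _ _ h; exact absurd h (by omega)
  | succ n ih =>
  intro Γ A B C α β hn h h'
  -- Common to `N0`, `N1` and `P1`, which are closed: both factors equal the variable, hence so does
  -- the composite.
  have hN : ∀ {K}, (∀ σ, K.subst σ = K) → EqTm (K :: Γ) α (.var 0) K →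
      EqTm (K :: Γ) β (.var 0) K → EqTm (K :: Γ) (β.subst (scons α (sh 1))) (.var 0) K := by
    intro K hK e1 e2
    have hc := ctx_of_tm (eqTm_left e1)
    have := eqTm_substEq e2 (SubEq.scons (.refl (.sh_one hc)) (head_ty hc) (by rw [hK]; exact e1))
    rw [hK] at this
    exact this
  cases h with
  | prop h1 h2 h3 h4 =>
    have hp := propHead h2
    cases h' with
    | prop h5 h6 h7 h8 =>
      refine .prop h1 h6 (iff_trans h1 h2 h6 h3 h7) ?_
      simpa using tm_subst h8 ((SubOk.sh_one (.ctx_cons h1.ty_col)).scons h4)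
    | _ => exact hp.elim
  | N0 h =>
    cases h' with
    | prop h5 => exact (propHead h5).elim
    | N0 h1 => exact .N0 (hN (fun _ => rfl) h h1)
  | N1 h =>
    cases h' with
    | prop h5 => exact (propHead h5).elim
    | N1 h1 => exact .N1 (hN (fun _ => rfl) h h1)
  | P1 h =>
    cases h' with
    | prop h5 => exact (propHead h5).elim
    | P1 h1 => exact .P1 (hN (fun _ => rfl) h h1)
  | @list _ A B α₀ _ h1 h2 h3 h4 h5 h6 =>
    have h := Iso.list h1 h2 h3 h4 h5 h6
    cases h' with
    | prop h5 => exact (propHead h5).elim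
    | @list _ _ C β₀ _ g1 g2 g3 g4 g5 g6 =>
      have h' := Iso.list g1 g2 g3 g4 g5 g6
      have hc := ctx_list_two h1
      have s2 := SubOk.sh_two hc
      simp only [tySize] at hn
      refine .list h1 g2 (ih (by omega) h3 g3) ?_ ?_ ?_
      · simpa using h'.act (.sh_one (.ctx_cons h.left)) h4
      · simpa using Der.tm_trans (h'.congr (.id h.ctx) (by simpa using h5)) (by simpa using g5)
      · have e1 := h'.congr s2 (by simpa using h6)
        have h7 : IsTm (A.subst (sh 1) :: .list A :: Γ) (α.subst (sh 1))
            ((Exp.list B).subst (sh 2)) := by simpa using tm_subst h4 (.sh_one hc)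
        have h8 := h3.act s2 (by simpa using tm_var_zero (head_ty hc))
        have e2 := eqTm_subst g6 ((s2.scons h7).scons (A := B.subst (sh 1)) (by simpa using h8))
        simpa using Der.tm_trans e1 (by simpa using e2)
  | @sum _ A A' B B' α₁ α₂ _ h1 h2 h3 h4 h5 h6 h7 h8 h9 =>
    have h := Iso.sum h1 h2 h3 h4 h5 h6 h7 h8 h9
    cases h' with
    | prop h5 => exact (propHead h5).elim
    | @sum _ _ A'' _ B'' β₁ β₂ _ g1 g2 g3 g4 g5 g6 g7 g8 g9 =>
      have h' := Iso.sum g1 g2 g3 g4 g5 g6 g7 g8 g9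
      simp only [tySize] at hn
      have sA := SubOk.sh_one (.ctx_cons h1.ty_col)
      have sB := SubOk.sh_one (.ctx_cons h3.ty_col)
      refine .sum h1 g2 h3 g4 (ih (by omega) h5 g5) (ih (by omega) h6 g6) ?_ ?_ ?_
      · simpa using h'.act (.sh_one (.ctx_cons h.left)) h7
      · have e2 := eqTm_subst g8 h5.subOk
        simpa using Der.tm_trans (h'.congr sA h8) (by simpa using e2)
      · have e2 := eqTm_subst g9 h6.subOk
        simpa using Der.tm_trans (h'.congr sB h9) (by simpa using e2)
  | @sig _ A A' B B' α₁ α₂ _ h1 h2 h3 h4 h5 h6 =>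
    have h := Iso.sig h1 h2 h3 h4 h5 h6
    cases h' with
    | prop h5 => exact (propHead h5).elim
    | @sig _ _ A'' _ B'' β₁ β₂ _ g1 g2 g3 g4 g5 g6 =>
      have h' := Iso.sig g1 g2 g3 g4 g5 g6
      simp only [tySize] at hn
      have s2 := SubOk.sh_two (.ctx_cons h1)
      -- The second codomain isomorphism lives over `A'`. Reindexed along `A → A'`, it starts at the
      -- type where the first one ends.
      have hβ := g4.subst h3.subOk
      refine .sig h1 g2 (ih (by omega) h3 g3) ?_ ?_ ?_
        (β := β₂.subst (scons α₂ (scons (α₁.subst (sh 1)) (sh 2))))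
      · simpa using ih (by omega) h4 hβ
      · simpa using h'.act (.sh_one (.ctx_cons h.left)) h5
      · have s3 : SubOk (B :: A :: Γ) (scons α₂ (scons (α₁.subst (sh 1)) (sh 2)))
            (B' :: A' :: Γ) := by
          have h7 := tm_subst h3.tm (.sh_one (.ctx_cons h1))
          exact (s2.scons (by simpa using h7)).scons (by simpa using h4.tm)
        have e2 := eqTm_subst g6 s3
        simpa using Der.tm_trans (h'.congr s2 h6) (by simpa using e2)
  | @pi _ A A' B B' α₁ α₂ _ h1 h2 h3 h4 h5 h6 =>
    have h := Iso.pi h1 h2 h3 h4 h5 h6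
    cases h' with
    | prop h5 => exact (propHead h5).elim
    | @pi _ _ A'' _ B'' β₁ β₂ _ g1 g2 g3 g4 g5 g6 =>
      have h' := Iso.pi g1 g2 g3 g4 g5 g6
      -- The domain isomorphisms compose from `A''` through `A'` to `A`, whereas the bound concerns
      -- the type built on `A`. Invariance of the size transfers it to `A''`.
      have hs := iso_tySize h
      have hs1 := iso_tySize g3
      have hs3 := iso_tySize h3
      simp only [tySize] at hn hs
      have hA'' := (tyInv g2).1
      have hα := h4.subst g3.subOk
      refine .pi h1 g2 (ih (by omega) g3 h3) ?_ ?_ ?_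
        (β := β₂.subst (scons (α₂.subst (ups (scons β₁ (sh 1)))) (sh 1)))
      · simpa using ih (by simp only [tySize_subst]; omega) hα g4
      · simpa using h'.act (.sh_one (.ctx_cons h.left)) h5
      · have s1 := SubOk.sh_one (.ctx_cons h.left)
        have hA1 := ty_subst hA'' s1
        have hc := Der.ctx_cons hA1.ty_col
        have s2 := SubOk.sh_two hc
        have hv := tm_var_zero hA1
        have hv2 : IsTm (A''.subst (sh 1) :: .pi A B :: Γ) (.var 0) (A''.subst (sh 2)) := by
          simpa using hv
        have hf := tm_subst h5 (.sh_one hc)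
        have e1 := eqTm_subst g6 (((s2.scons (A := .pi A' B') (by simpa using hf))).scons
          (A := A''.subst (sh 1)) (by simpa using hv2))
        have hw := g3.act s2 hv2
        have e2 := eqTm_subst h6 ((SubOk.sh_one hc).scons (A := A'.subst (sh 1)) (by simpa using hw))
        have e3 := g4.congr (s2.scons hv2) (by simpa using e2)
        simpa using Der.tm_trans (by simpa using e1) (by simpa using e3)
  | @quo _ A B R S α₁ _ h1 h2 h3 h4 h5 h6 =>
    have h := Iso.quo h1 h2 h3 h4 h5 h6
    cases h' with
    | prop h5 => exact (propHead h5).elim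
    | @quo _ _ C _ T β₁ _ g1 g2 g3 g4 g5 g6 =>
      have h' := Iso.quo g1 g2 g3 g4 g5 g6
      simp only [tySize] at hn
      have hQ := quoCond h1
      have hc := ctx_two hQ.set
      have s1 := SubOk.sh_one (.ctx_cons hQ.set.ty_col)
      refine .quo h1 g2 (ih (by omega) h3 g3) ?_ ?_ ?_
      · have s2 := SubOk.sh_two hc
        have hx := h3.act s2 (tm_var_one hc)
        have hy := h3.act s2 (a := .var 0) (by simpa using tm_var_zero (head_ty hc))
        have hxx : IsTm (A.subst (sh 1) :: A :: Γ) (α₁.subst (sh 1)) (B.subst (sh 2)) := by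
          simpa using hx
        have hS := ty_subst (quoCond h2).rel (s2.two hxx hy)
        have hx2 := g3.act s2 hxx
        have hy2 := g3.act s2 hy
        have hT := ty_subst (quoCond g2).rel (s2.two hx2 hy2)
        have e := tr_subst g4 (s2.two hxx hy)
        simp only [subst_subst, cmp_scons, Exp.iff, Exp.subst, scons_zero, sh_cmp_scons, sh_zero_cmp] at e
        have := iff_trans (hQ.rel.ty_prop (s := true)) (hS.ty_prop (s := true))
          (hT.ty_prop (s := true)) h4 (by simpa [Exp.iff] using e)
        simpa using this
      · simpa using h'.act (.sh_one (.ctx_cons h.left)) h5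
      · have e2 := eqTm_subst g6 h3.subOk
        simpa using Der.tm_trans (h'.congr s1 h6) (by simpa using e2)

theorem Iso.comp (h : Iso Γ A B α) (h' : Iso Γ B C β) : Iso Γ A C (β.subst (scons α (sh 1))) :=
  Iso.comp_aux _ (Nat.lt_succ_self _) h h'

/-! ### Uniqueness -/

theorem Iso.subEq (h : Iso Γ A B α) (e : EqTm (A :: Γ) α α' (B.subst (sh 1))) :
    SubEq (A :: Γ) (EmTT.scons α (sh 1)) (EmTT.scons α' (sh 1)) (B :: Γ) :=
  .scons (.refl (.sh_one (.ctx_cons h.left))) h.right e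

/-- By induction the components of the two derivations agree, so both maps have the same values on
canonical elements, and extensionality concludes. Between propositions, proof irrelevance suffices.
-/
theorem Iso.unique (h : Iso Γ A B α) : ∀ {α'}, Iso Γ A B α' →
    EqTm (A :: Γ) α α' (B.subst (sh 1)) := by
  induction h with
  | prop h1 h2 h3 h4 =>
    intro α' h'
    exact .prop_mono (ty_subst h2 (.sh_one (.ctx_cons h1.ty_col))) h4 h'.tm
  | N0 h =>
    intro α' h'
    cases h' with
    | prop h5 => exact (propHead h5).elim
    | N0 h' => exact .tm_trans h (.tm_symm h')
  | N1 h =>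
    intro α' h'
    cases h' with
    | prop h5 => exact (propHead h5).elim
    | N1 h' => exact .tm_trans h (.tm_symm h')
  | P1 h =>
    intro α' h'
    cases h' with
    | prop h5 => exact (propHead h5).elim
    | P1 h' => exact .tm_trans h (.tm_symm h')
  | @list Γ A B α₀ θ h1 h2 h3 h4 h5 h6 ih =>
    intro α' h'
    cases h' with
    | prop h5 => exact (propHead h5).elim
    | @list _ _ _ β₀ _ _ _ g3 g4 g5 g6 =>
      refine list_ext h4 g4 (by simpa using Der.tm_trans h5 (.tm_symm g5)) ?_
      intro φ hc e
      have hc2 := tail_ctx hc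
      have s3 := SubOk.sh_three hc
      have s1 := SubOk.sh_one hc
      have hv : IsTm (listCtx Γ A φ) (.var 1) (A.subst (sh 3)) := by simpa using tm_var_one hc
      have e1 := eqTm_subst h6 s1
      have e2 := eqTm_subst g6 s1
      have e3 : EqTm (listCtx Γ A φ) (α₀.subst (scons (.var 1) (sh 3)))
          (β₀.subst (scons (.var 1) (sh 3))) (B.subst (sh 3)) := by
        simpa using eqTm_subst (ih g3) (s3.scons hv)
      have e4 := Der.list_cons_eq (A := B.subst (sh 3)) (by simpa using e) e3
      simpa using Der.tm_trans (by simpa using e1) (.tm_trans (by simpa using e4)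
        (.tm_symm (by simpa using e2)))
  | sum h1 h2 h3 h4 h5 h6 h7 h8 h9 ih1 ih2 =>
    intro α' h'
    cases h' with
    | prop h5 => exact (propHead h5).elim
    | sum _ _ _ _ g5 g6 g7 g8 g9 =>
      have sA := SubOk.sh_one (.ctx_cons h1.ty_col)
      have sB := SubOk.sh_one (.ctx_cons h3.ty_col)
      refine sum_ext h7 g7 ?_ ?_
      · have := Der.sum_inl_eq (.ty_refl (ty_subst h2 sA)) (.ty_refl (ty_subst h4 sA)) (ih1 g5)
        simpa using Der.tm_trans h8 (.tm_trans this (.tm_symm g8))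
      · have := Der.sum_inr_eq (.ty_refl (ty_subst h2 sB)) (.ty_refl (ty_subst h4 sB)) (ih2 g6)
        simpa using Der.tm_trans h9 (.tm_trans this (.tm_symm g9))
  | @sig Γ A A' B B' α₁ α₂ θ h1 h2 h3 h4 h5 h6 ih1 ih2 =>
    intro α' h'
    cases h' with
    | prop h5 => exact (propHead h5).elim
    | @sig _ _ _ _ _ β₁ β₂ _ _ _ g3 g4 g5 g6 =>
      refine sig_ext h5 g5 ?_
      have s2 := SubOk.sh_two (.ctx_cons h1)
      have e1 := ih1 g3
      -- The two codomain components end in different instances of `B'`, along `α₁` and along `β₁`.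
      -- These are equal by the induction hypothesis for the domain, and composing with the identity
      -- between them gives both components the same target.
      have hB' := iso_of_subEq h2 (g3.subEq (.tm_symm e1))
      have e2 := ih2 (by simpa using g4.comp hB')
      have hA' := ty_subst h3.right s2
      have := Der.sig_intro_eq (Γ := B :: A :: Γ) (.ty_refl hA')
        (.ty_refl (ty_subst h2 (s2.ups h3.right)))
        (by simpa using eqTm_subst e1 (.sh_one (.ctx_cons h1))) (by simpa using e2)
      simpa using Der.tm_trans h6 (.tm_trans (by simpa using this) (.tm_symm g6))
  | @pi Γ A A' B B' α₁ α₂ θ h1 h2 h3 h4 h5 h6 ih1 ih2 =>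
    intro α' h'
    cases h' with
    | prop h5 => exact (propHead h5).elim
    | @pi _ _ _ _ _ β₁ β₂ _ _ _ g3 g4 g5 g6 =>
      have e1 := ih1 g3
      have hB := iso_of_subEq (tyInv h1).2.1 (h3.subEq e1)
      have e2 := ih2 (by simpa using hB.comp g4)
      have hc := ctx_of_tm (eqTm_left h6)
      have s1 := SubOk.sh_one hc
      have s2 := SubOk.sh_two hc
      have hv : IsTm (A'.subst (sh 1) :: .pi A B :: Γ) (.var 0) (A'.subst (sh 2)) := by
        simpa using tm_var_zero (head_ty hc)
      have e3 : EqTm (A'.subst (sh 1) :: .pi A B :: Γ) (α₁.subst (scons (.var 0) (sh 2)))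
          (β₁.subst (scons (.var 0) (sh 2))) (A.subst (sh 2)) := by
        simpa using eqTm_subst e1 (s2.scons hv)
      have hf : IsTm (A'.subst (sh 1) :: .pi A B :: Γ) (.var 1) ((Exp.pi A B).subst (sh 2)) :=
        tm_var_one hc
      have e4 := Der.pi_elim_eq (.tm_refl hf) e3
      have e5 := eqTm_substEq e2 (SubEq.scons (.refl (s2.scons hv)) h4.left (by simpa using e4))
      refine pi_ext h5 g5 ?_
      simpa using Der.tm_trans h6 (.tm_trans (by simpa using e5) (.tm_symm g6))
  | quo h1 h2 h3 h4 h5 h6 ih =>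
    intro α' h'
    cases h' with
    | prop h5 => exact (propHead h5).elim
    | quo _ _ g3 g4 g5 g6 =>
      refine quo_ext h5 g5 ?_
      have hQ := quoCond h2
      have s1 := SubOk.sh_one (.ctx_cons h3.left)
      have := Der.quo_intro_eq (ty_subst h2 s1) (.ty_refl (ty_subst hQ.set s1))
        (.ty_refl (by simpa using ty_subst hQ.rel (s1.ups_ups hQ.set))) (ih g3)
      simpa using Der.tm_trans h6 (.tm_trans this (.tm_symm g6))

/-! ### The functorial actions -/

/-- The `_data` lemmas collect the typing premises of the eliminator or abstraction that defines a
functorial action. They hold over any context and are used at several weakenings: one for typing the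
action, others for its computation rules. -/
theorem mapList_data (hA : IsTy Γ A .set) (hB : IsTy Γ B .set) (h : Iso Γ A B α) :
    IsTy (.list A :: Γ) (.list (B.subst (sh 1))) .col ∧ IsTm Γ (.nil B) (.list B) ∧
      IsTm (listCtx Γ A (.list (B.subst (sh 1)))) (.cons (.var 0) (α.subst (scons (.var 1) (sh 3))))
        (.list (B.subst (sh 3))) := by
  have hM := (ty_subst (Der.list_form hB) (.sh_one (.ctx_cons (Der.list_form hA).ty_col))).ty_col
  have hc := ctx_listCtx hA hM
  refine ⟨hM, .list_nil hB, ?_⟩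
  refine .list_cons (by simpa using tm_var_zero (head_ty hc)) ?_
  exact h.act (.sh_three hc) (by simpa using tm_var_one hc)

theorem Iso.mapList (hA : IsTy Γ A .set) (hB : IsTy Γ B .set) (h : Iso Γ A B α) :
    Iso Γ (.list A) (.list B)
      (.elList (A.lift 1) (.list (B.lift 2)) (.var 0) (.nil (B.lift 1))
          (.cons (.var 0) (α.inst₁ 4 (.var 1)))) := by
  have hl := (Der.list_form hA).ty_col
  have s1 := SubOk.sh_one (.ctx_cons hl)
  have hc2 := ctx_list_two hA
  have s2 := SubOk.sh_two hc2
  have d0 := mapList_data hA hB h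
  have d1 := mapList_data (ty_subst hA s1) (ty_subst hB s1) (h.subst s1)
  have d2 := mapList_data (ty_subst hA s2) (ty_subst hB s2) (h.subst s2)
  refine .list hA hB h ?_ ?_ ?_
  · have := Der.list_elim d1.1 (tm_var_zero hl) (by simpa using d1.2.1) (by simpa using d1.2.2)
    simpa using this
  · have := Der.list_beta_nil d0.1 (by simpa using d0.2.1) (by simpa using d0.2.2)
    simpa using this
  · have := Der.list_beta_cons d2.1 (tm_var_one hc2) (c := .var 0)
      (by simpa using tm_var_zero (head_ty hc2))
      (by simpa using d2.2.1) (by simpa using d2.2.2)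
    simpa using this

theorem mapSum_data (h1 : IsTy Γ A .set) (h2 : IsTy Γ A' .set) (h3 : IsTy Γ B .set)
    (h4 : IsTy Γ B' .set) (h : Iso Γ A A' α) (h' : Iso Γ B B' β) :
    IsTy (.sum A B :: Γ) ((Exp.sum A' B').subst (sh 1)) .col ∧
      IsTm (A :: Γ) (.inl (A'.subst (sh 1)) (B'.subst (sh 1)) α) ((Exp.sum A' B').subst (sh 1)) ∧
      IsTm (B :: Γ) (.inr (A'.subst (sh 1)) (B'.subst (sh 1)) β) ((Exp.sum A' B').subst (sh 1)) := by
  have hS' := Der.sum_form h2 h4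
  exact ⟨(ty_subst hS' (.sh_one (.ctx_cons (Der.sum_form h1 h3).ty_col))).ty_col,
    .sum_inl (ty_subst hS' (.sh_one (.ctx_cons h1.ty_col))) h.tm,
    .sum_inr (ty_subst hS' (.sh_one (.ctx_cons h3.ty_col))) h'.tm⟩

theorem Iso.mapSum (h1 : IsTy Γ A .set) (h2 : IsTy Γ A' .set) (h3 : IsTy Γ B .set)
    (h4 : IsTy Γ B' .set) (h : Iso Γ A A' α) (h' : Iso Γ B B' β) :
    Iso Γ (.sum A B) (.sum A' B')
      (.elSum (A.lift 1) (B.lift 1) (.sum (A'.lift 2) (B'.lift 2)) (.var 0)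
          (.inl (A'.lift 2) (B'.lift 2) (α.inst₁ 2 (.var 0)))
          (.inr (A'.lift 2) (B'.lift 2) (β.inst₁ 2 (.var 0)))) := by
  have hl := (Der.sum_form h1 h3).ty_col
  have s1 := SubOk.sh_one (.ctx_cons hl)
  have sA := SubOk.sh_one (.ctx_cons h1.ty_col)
  have sB := SubOk.sh_one (.ctx_cons h3.ty_col)
  have d : ∀ {Δ ρ}, SubOk Δ ρ Γ → _ := fun {Δ ρ} (s : SubOk Δ ρ Γ) =>
    mapSum_data (ty_subst h1 s) (ty_subst h2 s) (ty_subst h3 s) (ty_subst h4 s) (h.subst s)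
      (h'.subst s)
  refine .sum h1 h2 h3 h4 h h' ?_ ?_ ?_
  · have := Der.sum_elim (d s1).1 (tm_var_zero hl) (by simpa using (d s1).2.1)
      (by simpa using (d s1).2.2)
    simpa using this
  · have := Der.sum_beta_inl (d sA).1 (tm_var_zero h1) (by simpa using (d sA).2.1)
      (by simpa using (d sA).2.2)
    simpa using this
  · have := Der.sum_beta_inr (d sB).1 (tm_var_zero h3) (by simpa using (d sB).2.1)
      (by simpa using (d sB).2.2)
    simpa using this

theorem mapSig_data (h1 : IsTy (A :: Γ) B .col) (h2 : IsTy (A' :: Γ) B' .col)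
    (h : Iso Γ A A' α) (h' : Iso (A :: Γ) B (B'.subst (scons α (sh 1))) β) :
    IsTy (.sig A B :: Γ) ((Exp.sig A' B').subst (sh 1)) .col ∧
      IsTm (B :: A :: Γ) (.pair (A'.subst (sh 2)) (B'.subst (ups (sh 2))) (α.subst (sh 1)) β)
        ((Exp.sig A' B').subst (sh 2)) := by
  have hS := Der.sig_form false h.left h1
  have hS' := Der.sig_form false h.right h2
  have hc := Der.ctx_cons h1
  have s2 := SubOk.sh_two hc
  refine ⟨ty_subst hS' (.sh_one (.ctx_cons hS)), .sig_intro (ty_subst h2 (s2.ups h.right)) ?_ ?_⟩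
  · simpa using tm_subst h.tm (.sh_one hc)
  · simpa using h'.tm

theorem Iso.mapSig (h1 : IsTy (A :: Γ) B .col) (h2 : IsTy (A' :: Γ) B' .col)
    (h : Iso Γ A A' α) (h' : Iso (A :: Γ) B (B'.subst (scons α (sh 1))) β) :
    Iso Γ (.sig A B) (.sig A' B')
      (.elSig (A.lift 1) (B.lift₁ 1) (.sig (A'.lift 2) (B'.lift₁ 2)) (.var 0)
          (.pair (A'.lift 3) (B'.lift₁ 3) (α.inst₁ 3 (.var 1)) (β.inst₂ 3 (.var 1) (.var 0)))) := by
  have hl := Der.sig_form false h.left h1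
  have s1 := SubOk.sh_one (.ctx_cons hl)
  have hc := Der.ctx_cons h1
  have s2 := SubOk.sh_two hc
  have d : ∀ {Δ ρ}, SubOk Δ ρ Γ → _ := fun {Δ ρ} (s : SubOk Δ ρ Γ) =>
    mapSig_data (ty_subst h1 (s.ups h.left)) (ty_subst h2 (s.ups h.right)) (h.subst s)
      (β := β.subst (ups (ups ρ))) (by simpa using h'.subst (s.ups h.left))
  refine .sig h1 h2 h h' ?_ ?_
  · have := Der.sig_elim (d s1).1 (tm_var_zero hl) (by simpa using (d s1).2)
    simpa using this
  · have := Der.sig_beta (d s2).1 (tm_var_one hc) (b := .var 0) (by simpa using tm_var_zero h1)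
      (by simpa using (d s2).2)
    simpa using this

theorem mapPi_data (h : Iso Γ A' A α) (h' : Iso (A' :: Γ) (B.subst (scons α (sh 1))) B' β) (hf : IsTm Γ f (.pi A B)) :
    IsTm (A' :: Γ) (β.subst (scons (.app (f.subst (sh 1)) α) (sh 0))) B' := by
  have s1 := SubOk.sh_one (.ctx_cons h.left)
  have := Der.pi_elim (tm_subst hf s1) h.tm
  simpa using h'.act (.id (.ctx_cons h.left)) (by simpa using this)

theorem Iso.mapPi (h1 : IsTy Γ (.pi A B) .col) (h2 : IsTy Γ (.pi A' B') .col)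
    (h : Iso Γ A' A α) (h' : Iso (A' :: Γ) (B.subst (scons α (sh 1))) B' β) :
    Iso Γ (.pi A B) (.pi A' B')
      (.lam (A'.lift 1) (β.inst₂ 2 (.var 0) (.app (.var 1) (α.inst₁ 2 (.var 0))))) := by
  have d : ∀ {Δ ρ f}, SubOk Δ ρ Γ → IsTm Δ f (.pi (A.subst ρ) (B.subst (EmTT.ups ρ))) → _ :=
    fun {Δ ρ f} (s : SubOk Δ ρ Γ) hf =>
    mapPi_data (h.subst s)
      (β := β.subst (ups (ups ρ))) (by simpa using h'.subst (s.ups h.left)) hf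
  have s1 := SubOk.sh_one (.ctx_cons h1)
  have hc : IsCtx (A'.subst (sh 1) :: .pi A B :: Γ) := .ctx_cons (ty_subst h.left s1)
  have s2 := SubOk.sh_two hc
  have d1 := d s1 (tm_var_zero h1)
  have d2 := d s2 (tm_var_one hc)
  refine .pi h1 h2 h h' ?_ ?_
  · have := Der.pi_intro (ty_subst h2 s1) d1
    simpa using this
  · have := Der.pi_beta (ty_subst h2 s2) d2 (a := .var 0) (by simpa using tm_var_zero (head_ty hc))
    simpa using this

theorem mapQuo_data (h1 : IsTy Γ (.quo A R) .set) (h2 : IsTy Γ (.quo B S) .set) (h : Iso Γ A B α)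
    (h3 : IsTrue (A.subst (sh 1) :: A :: Γ) (Exp.iff R
      (S.subst (scons (α.subst (scons (.var 0) (sh 2))) (scons (α.subst (sh 1)) (sh 2)))))) :
    IsTy (.quo A R :: Γ) ((Exp.quo B S).subst (sh 1)) .col ∧
      IsTm (A :: Γ) (.qcl (B.subst (sh 1)) (S.subst (ups (ups (sh 1)))) α)
        ((Exp.quo B S).subst (sh 1)) ∧
      EqTm (quoCtx Γ A R)
        (.qcl (B.subst (sh 3)) (S.subst (ups (ups (sh 3)))) (α.subst (sh 2)))
        (.qcl (B.subst (sh 3)) (S.subst (ups (ups (sh 3)))) (α.subst (scons (.var 1) (sh 3))))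
        ((Exp.quo B S).subst (sh 3)) := by
  have hQ := quoCond h1
  have s1 := SubOk.sh_one (.ctx_cons hQ.set.ty_col)
  refine ⟨(ty_subst h2 (.sh_one (.ctx_cons h1.ty_col))).ty_col, .quo_intro (ty_subst h2 s1) h.tm, ?_⟩
  have hc : IsCtx (quoCtx Γ A R) := .ctx_cons hQ.rel.ty_col
  have s3 := SubOk.sh_three hc
  have hx : IsTm (quoCtx Γ A R) (α.subst (sh 2)) (B.subst (sh 3)) := by
    simpa using h.act s3 (tm_var_two hc)
  have hy : IsTm (quoCtx Γ A R) (α.subst (scons (.var 1) (sh 3))) (B.subst (sh 3)) :=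
    h.act s3 (by simpa using tm_var_one hc)
  have hS := ty_subst (quoCond h2).rel (s3.two hx hy)
  have hR := ty_subst hQ.rel (.sh_one hc)
  have hi : IsTrue (quoCtx Γ A R) (Exp.iff (R.subst (sh 1))
      (S.subst (scons (α.subst (scons (.var 1) (sh 3))) (scons (α.subst (sh 2)) (sh 3))))) := by
    have := tm_subst h3 (.sh_one hc)
    simpa [Exp.iff] using this
  have := tr_mp (hR.ty_prop (s := true)) (hS.ty_prop (s := true)) hi
    (tr_head (hQ.rel.ty_prop (s := true)))
  exact .quo_class_eq (ty_subst h2 s3) hx hy (by simpa using this)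

theorem Iso.mapQuo (h1 : IsTy Γ (.quo A R) .set) (h2 : IsTy Γ (.quo B S) .set) (h : Iso Γ A B α)
    (h3 : IsTrue (A.subst (sh 1) :: A :: Γ) (Exp.iff R
      (S.subst (scons (α.subst (scons (.var 0) (sh 2))) (scons (α.subst (sh 1)) (sh 2)))))) :
    Iso Γ (.quo A R) (.quo B S)
      (.elQ (A.lift 1) (R.lift₂ 1) (.quo (B.lift 2) (S.lift₂ 2)) (.var 0)
          (.qcl (B.lift 2) (S.lift₂ 2) (α.inst₁ 2 (.var 0)))) := by
  have hQ := quoCond h1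
  have s1 := SubOk.sh_one (.ctx_cons h1.ty_col)
  have sA := SubOk.sh_one (.ctx_cons hQ.set.ty_col)
  have d : ∀ {Δ ρ}, SubOk Δ ρ Γ → _ := fun {Δ ρ} (s : SubOk Δ ρ Γ) =>
    mapQuo_data (ty_subst h1 s) (ty_subst h2 s) (h.subst s)
      (by simpa [Exp.iff] using tr_subst h3 (s.ups_ups hQ.set))
  refine .quo h1 h2 h h3 ?_ ?_
  · have := Der.quo_elim (d s1).1 (tm_var_zero h1) (by simpa using (d s1).2.1)
      (by simpa using (d s1).2.2)
    simpa using this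
  · have := Der.quo_beta (d sA).1 (tm_var_zero hQ.set) (by simpa using (d sA).2.1)
      (by simpa using (d sA).2.2)
    simpa using this

theorem iso_of_canIso (h : CanIso Γ A B θ) : Iso Γ A B θ := by
  induction h with
  | prop h1 h2 h3 =>
    refine .prop h1 h2 h3 ?_
    have s := SubOk.sh_one (.ctx_cons h1.ty_col)
    simpa using tr_mp (ty_subst h1 s) (ty_subst h2 s) (tr_subst h3 s) (tr_head h1)
  | N0 h => exact .N0 (.tm_refl (tm_var_zero (.N0_form h)))
  | N1 h => exact .N1 (.tm_refl (tm_var_zero (.N1_form h)))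
  | P1 h => exact .P1 (.tm_refl (tm_var_zero (.P1_form h)))
  | list h1 h2 _ ih => exact .mapList h1 h2 ih
  | sum h1 h2 h3 h4 _ _ ih1 ih2 => exact .mapSum h1 h2 h3 h4 ih1 ih2
  | sig h1 h2 _ _ ih1 ih2 => exact .mapSig h1 h2 ih1 ih2
  | pi h1 h2 _ _ ih1 ih2 => exact .mapPi h1 h2 ih1 ih2
  | quo h1 h2 _ h4 ih => exact .mapQuo h1 h2 ih (by simpa [Exp.iff] using h4)
  | eqv _ h ih => exact ih.eqv (by simpa using h)

/-- The components of `θ` yield a functorial action, which is an `Iso` between the same types by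
`iso_of_canIso`. Uniqueness makes it equal to `θ`, and `CanIso.eqv` absorbs the difference. So
`CanIso` and `Iso` are the same relation. -/
theorem canIso_of_iso (h : Iso Γ A B θ) : CanIso Γ A B θ := by
  have key : ∀ {Γ A B θ θ'}, Iso Γ A B θ → CanIso Γ A B θ' → CanIso Γ A B θ := by
    intro Γ A B θ θ' h h'
    exact .eqv h' (by simpa using (iso_of_canIso h').unique h)
  induction h with
  | prop h1 h2 h3 h4 => exact key (.prop h1 h2 h3 h4) (.prop h1 h2 h3)
  | N0 h => exact key (.N0 h) (.N0 (tail_ctx (ctx_of_tm (eqTm_left h))))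
  | N1 h => exact key (.N1 h) (.N1 (tail_ctx (ctx_of_tm (eqTm_left h))))
  | P1 h => exact key (.P1 h) (.P1 (tail_ctx (ctx_of_tm (eqTm_left h))))
  | list h1 h2 h3 h4 h5 h6 ih => exact key (.list h1 h2 h3 h4 h5 h6) (.list h1 h2 ih)
  | sum h1 h2 h3 h4 h5 h6 h7 h8 h9 ih1 ih2 =>
    exact key (.sum h1 h2 h3 h4 h5 h6 h7 h8 h9) (.sum h1 h2 h3 h4 ih1 ih2)
  | sig h1 h2 h3 h4 h5 h6 ih1 ih2 => exact key (.sig h1 h2 h3 h4 h5 h6) (.sig h1 h2 ih1 ih2)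
  | pi h1 h2 h3 h4 h5 h6 ih1 ih2 => exact key (.pi h1 h2 h3 h4 h5 h6) (.pi h1 h2 ih1 ih2)
  | quo h1 h2 h3 h4 h5 h6 ih =>
    exact key (.quo h1 h2 h3 h4 h5 h6) (.quo h1 h2 ih (by simpa [Exp.iff] using h4))

/-! ### Inverses -/

/-- The composite is a canonical endomorphism, and so is the identity. -/
theorem Iso.cancel (h : Iso Γ A B α) (h' : Iso Γ B A β) :
    EqTm (A :: Γ) (β.subst (scons α (sh 1))) (.var 0) (A.subst (sh 1)) :=
  (h.comp h').unique (.refl h.left)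

/-- The inverse is the functorial action on the inverses of the components. For dependent codomains,
the inverse component reindexed along the inverse of the domain has one end at an instance of the
form `α(β(y))`; `Iso.cancel` equates it with `y`, and the identity between equal instances corrects
that end. -/
theorem Iso.symm (h : Iso Γ A B α) : ∃ β, Iso Γ B A β := by
  induction h with
  | prop h1 h2 h3 h4 =>
    exact ⟨_, iso_of_canIso (.prop h2 h1 (iff_symm h1 h2 h3))⟩
  | N0 h => exact ⟨_, .N0 h⟩
  | N1 h => exact ⟨_, .N1 h⟩
  | P1 h => exact ⟨_, .P1 h⟩
  | list h1 h2 h3 h4 h5 h6 ih =>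
    obtain ⟨β, hβ⟩ := ih
    exact ⟨_, .mapList h2 h1 hβ⟩
  | sum h1 h2 h3 h4 h5 h6 h7 h8 h9 ih1 ih2 =>
    obtain ⟨β, hβ⟩ := ih1
    obtain ⟨γ, hγ⟩ := ih2
    exact ⟨_, .mapSum h2 h1 h4 h3 hβ hγ⟩
  | sig h1 h2 h3 h4 h5 h6 ih1 ih2 =>
    obtain ⟨β, hβ⟩ := ih1
    obtain ⟨γ, hγ⟩ := ih2
    have e := hβ.cancel h3
    have hB := iso_of_subEq h2 (SubEq.scons (.refl (.sh_one (.ctx_cons hβ.left))) h3.right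
      (Der.tm_symm e))
    have h7 := hγ.subst hβ.subOk
    exact ⟨_, .mapSig h2 h1 hβ (Iso.comp (by simpa using hB) (by simpa using h7))⟩
  | pi h1 h2 h3 h4 h5 h6 ih1 ih2 =>
    obtain ⟨β, hβ⟩ := ih1
    obtain ⟨γ, hγ⟩ := ih2
    have e := hβ.cancel h3
    have hB := iso_of_subEq (tyInv h1).2.1 (SubEq.scons (.refl (.sh_one (.ctx_cons hβ.left))) h3.right
      e)
    have h7 := hγ.subst hβ.subOk
    exact ⟨_, .mapPi h2 h1 hβ (Iso.comp (by simpa using h7) (by simpa using hB))⟩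
  | @quo Γ A B R S α _ h1 h2 h3 h4 h5 h6 ih =>
    obtain ⟨β, hβ⟩ := ih
    refine ⟨_, .mapQuo h2 h1 hβ ?_⟩
    have hQ := quoCond h1
    have hQ' := quoCond h2
    have hc := ctx_two hQ'.set
    have s2 := SubOk.sh_two hc
    have hx : IsTm (B.subst (sh 1) :: B :: Γ) (β.subst (sh 1)) (A.subst (sh 2)) := by
      simpa using hβ.act s2 (tm_var_one hc)
    have hv : IsTm (B.subst (sh 1) :: B :: Γ) (.var 0) (B.subst (sh 2)) := by
      simpa using tm_var_zero (head_ty hc)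
    have hy := hβ.act s2 hv
    have hR := ty_subst hQ.rel (s2.two hx hy)
    have e := tr_subst h4 (s2.two hx hy)
    have ec := hβ.cancel h3
    have ex := eqTm_subst ec (.sh_one hc)
    have ey := eqTm_subst ec (s2.scons hv)
    -- Cancellation turns the relation at `α(β(x))` and `α(β(y))` into the relation at `x` and `y`.
    have eS := ty_substEq hQ'.rel (SubEq.scons (A := B.subst (sh 1)) (SubEq.scons (.refl s2) h3.right
      (by simpa using ex)) (ty_subst h3.right (.sh_one (.ctx_cons h3.right))) (by simpa using ey))
    have eS' := eS.tyEq_prop (s := true)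
    have := iff_trans (hR.ty_prop (s := true)) (eqTy_left eS') (eqTy_right eS')
      (by simpa [Exp.iff] using e) (iff_of_eqTy (eqTy_left eS') (eqTy_right eS') eS')
    exact iff_symm (hR.ty_prop (s := true)) (hQ'.rel.ty_prop (s := true)) (by simpa using this)

/-! ### Equal types are canonically isomorphic -/

/-- The motive of the lemma on equal types. -/
def Judg.EqIso : Judg → Prop
  | .tyEq Γ A B _ => ∀ ⦃Δ σ τ⦄, SubEq Δ σ τ Γ → Iso Δ (A.subst σ) (B.subst τ) (.var 0)
  | _ => True

theorem eqIso_of_prop (e : EqTy Γ A B .prop) : (Judg.tyEq Γ A B k).EqIso :=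
  fun _ _ _ s => iso_prop_of_eqTy (eqTy_substEq e s)

/-- In `emTT` an equality of types arises from congruence, substitution and the laws of an
equivalence relation. Congruences are the lemmas on identities above, read along two equal
substitutions; equal propositions are equiprovable. -/
theorem judg_eqIso {J : Judg} (h : Der .emTT J) : J.EqIso := by
  induction h with
  | incl_eq _ _ ih => exact ih
  | ty_refl h => exact fun _ _ _ s => iso_of_subEq h s
  | ty_symm h ih =>
    intro Δ σ τ s
    have s' := s.symm (ctx_of_ty (eqTy_left h))
    have h1 := ih s'
    obtain ⟨θ, hθ⟩ := h1.symm
    -- As `h1` is an identity, cancellation says that its inverse `θ` is equal to the variable.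
    have e := h1.cancel hθ
    have eT := eqTy_substEq h s'
    have e' := eqTm_conv_ctx eT (eqTy_right eT) e
    exact hθ.eqv (by simpa using e')
  | ty_trans _ _ ih ih' =>
    intro Δ σ τ s
    simpa using (ih (.refl s.left)).comp (ih' s)
  | @sub_tyEq Γ Δ σ A B k h1 h2 h _ _ ih =>
    intro Θ τ τ' s
    simpa using ih (SubEq.comp_left ⟨h1, by simpa using h2⟩ s)
  | @subEq_ty Γ Δ σ τ A k h1 h2 h3 h4 h =>
    intro Θ σ' τ' s
    have s0 : SubEq Δ σ τ Γ :=
      ⟨⟨h1, by simpa using h2⟩, ⟨h1, by simpa using h3⟩, by simpa using h4⟩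
    simpa using iso_of_subEq h (s0.comp s (ctx_of_ty h))
  | sig_eq _ h1 h2 ih1 ih2 =>
    intro Δ σ τ s
    have sA := s.ups (eqTy_left h1)
    exact iso_sig_of_eqTy (eqTy_substEq h1 s).tyEq_col (ih1 s) (eqTy_substEq h2 sA).tyEq_col
      (ih2 sA)
  | @pi_eq Γ A A' B B' h1 h2 ih1 ih2 =>
    intro Δ σ τ s
    have hc := ctx_of_ty (eqTy_left h1)
    have h3 := ih1 s
    obtain ⟨θ, hθ⟩ := h3.symm
    have eT := eqTy_substEq h1 s
    have e' := eqTm_conv_ctx eT (eqTy_right eT) (h3.cancel hθ)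
    have h4 := hθ.eqv (by simpa using e')
    refine iso_pi_of_eqTy h4 (eqTy_substEq (.pi_eq h1 h2) s).tyEq_col ?_
    have h5 := ih2 (s.ups (eqTy_left h1))
    have s0 : SubOk (A'.subst τ :: Δ) (sh 0) (A.subst σ :: Δ) :=
      .conv_cons (.id s.left.ctx) eT (eqTy_right eT)
    simpa using h5.subst s0
  | piP1_eq h1 ih1 =>
    intro Δ σ τ s
    have h3 := ih1 s
    obtain ⟨θ, hθ⟩ := h3.symm
    have eT := eqTy_substEq h1 s
    have e' := eqTm_conv_ctx eT (eqTy_right eT) (h3.cancel hθ)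
    have h4 := hθ.eqv (by simpa using e')
    exact iso_pi_of_eqTy h4 (eqTy_substEq (.piP1_eq h1) s)
      (.P1 (.tm_refl (tm_var_zero (.P1_form (.ctx_cons (eqTy_right eT).ty_col)))))
  | sum_eq h1 h2 ih1 ih2 =>
    intro Δ σ τ s
    exact iso_sum_of_eqTy (eqTy_substEq h1 s) (ih1 s) (eqTy_substEq h2 s) (ih2 s)
  | list_eq h1 ih1 =>
    intro Δ σ τ s
    exact iso_list_of_eqTy (eqTy_substEq h1 s) (ih1 s)
  | quo_eq h1 h2 h3 _ ih2 _ =>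
    intro Δ σ τ s
    have hQ := quoCond h1
    refine iso_quo_of_eqTy (hQ.subst s.left) (eqTy_substEq h2 s) (ih2 s) ?_
    have h3' := eqTy_substEq h3 (by simpa using s.ups_ups hQ.set)
    simpa using h3'
  | and_eq s h1 h2 => exact eqIso_of_prop (Der.and_eq s h1 h2).tyEq_prop
  | or_eq s h1 h2 => exact eqIso_of_prop (Der.or_eq s h1 h2).tyEq_prop
  | imp_eq s h1 h2 => exact eqIso_of_prop (Der.imp_eq s h1 h2).tyEq_prop
  | ex_eq s h1 h2 => exact eqIso_of_prop (Der.ex_eq s h1 h2).tyEq_prop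
  | all_eq s h1 h2 => exact eqIso_of_prop (Der.all_eq s h1 h2).tyEq_prop
  | eq_eq s h1 h2 h3 => exact eqIso_of_prop (Der.eq_eq s h1 h2 h3).tyEq_prop
  | eqP1_eq h1 h2 => exact eqIso_of_prop ((Der.eqP1_eq h1 h2).tyEq_prop (s := true))
  | propext _ h => cases h
  | _ => trivial

theorem iso_of_eqTy (e : EqTy Γ A B k) : Iso Γ A B (.var 0) := by
  simpa using judg_eqIso e (.refl (.id (ctx_of_ty (eqTy_left e))))

/-! ### Canonically related types and terms in the same context -/

/-- Canonically isomorphic types in context. -/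
def TyI (Γ : Ctx) (A B : Ty) : Prop := ∃ θ, Iso Γ A B θ

/-- Terms in context which correspond to each other along the canonical isomorphism. -/
def TmI (Γ : Ctx) (a : Tm) (A : Ty) (b : Tm) (B : Ty) : Prop :=
  ∃ θ, Iso Γ A B θ ∧ IsTm Γ a A ∧ EqTm Γ (θ.subst (scons a (sh 0))) b B

theorem TyI.refl (h : IsTy Γ A k) : TyI Γ A A := ⟨_, .refl h⟩
theorem TyI.symm (h : TyI Γ A B) : TyI Γ B A := h.choose_spec.symm
theorem TyI.trans (h : TyI Γ A B) (h' : TyI Γ B C) : TyI Γ A C :=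
  ⟨_, h.choose_spec.comp h'.choose_spec⟩
theorem TyI.subst (h : TyI Γ A B) (s : SubOk Δ σ Γ) : TyI Δ (A.subst σ) (B.subst σ) :=
  ⟨_, h.choose_spec.subst s⟩
theorem TyI.left (h : TyI Γ A B) : IsTy Γ A .col := h.choose_spec.left
theorem TyI.right (h : TyI Γ A B) : IsTy Γ B .col := h.choose_spec.right
theorem TyI.of_eqTy (e : EqTy Γ A B k) : TyI Γ A B := ⟨_, iso_of_eqTy e⟩
theorem TyI.of_subEq (h : IsTy Γ A k) (s : SubEq Δ σ τ Γ) : TyI Δ (A.subst σ) (A.subst τ) :=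
  ⟨_, iso_of_subEq h s⟩

theorem TmI.tyI (h : TmI Γ a A b B) : TyI Γ A B := ⟨_, h.choose_spec.1⟩
theorem TmI.left (h : TmI Γ a A b B) : IsTm Γ a A := h.choose_spec.2.1
theorem TmI.right (h : TmI Γ a A b B) : IsTm Γ b B := eqTm_right h.choose_spec.2.2

theorem TmI.of_eqTm (e : EqTm Γ a b A) : TmI Γ a A b A :=
  ⟨_, .refl (ty_of_tm (eqTm_left e)), eqTm_left e, e⟩

theorem TmI.refl (h : IsTm Γ a A) : TmI Γ a A a A := .of_eqTm (.tm_refl h)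

theorem TmI.act (h : Iso Γ A B θ) (s : SubOk Δ σ Γ) (ha : IsTm Δ a (A.subst σ)) :
    TmI Δ a (A.subst σ) (θ.subst (scons a σ)) (B.subst σ) :=
  ⟨_, h.subst s, ha, by simpa using Der.tm_refl (h.act s ha)⟩

theorem TmI.act_id (h : Iso Γ A B θ) (ha : IsTm Γ a A) :
    TmI Γ a A (θ.subst (scons a (sh 0))) B := by
  simpa using TmI.act h (.id h.ctx) (by simpa using ha)

/-- By uniqueness, a correspondence of terms may be tested along any canonical isomorphism at hand
instead of the one which witnesses it. With the identity it becomes plain equality, as in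
`TmI.eqTm`. -/
theorem TmI.eq_act (h : TmI Γ a A b B) (hθ : Iso Γ A B θ) :
    EqTm Γ (θ.subst (scons a (sh 0))) b B := by
  obtain ⟨θ', h', ha, e⟩ := h
  refine .tm_trans ?_ e
  simpa using eqTm_subst (hθ.unique h') (.inst ha)

theorem TmI.eqTm (h : TmI Γ a A b A) : EqTm Γ a b A := h.eq_act (.refl h.tyI.left)

theorem TmI.trans (h : TmI Γ a A b B) (h' : TmI Γ b B c C) : TmI Γ a A c C := by
  obtain ⟨θ, hθ, ha, e⟩ := h
  obtain ⟨θ', hθ', _, e'⟩ := h'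
  refine ⟨_, hθ.comp hθ', ha, .tm_trans ?_ e'⟩
  simpa using hθ'.congr (.id hθ.ctx) (by simpa using e)

theorem TmI.symm (h : TmI Γ a A b B) : TmI Γ b B a A := by
  obtain ⟨θ, hθ, ha, e⟩ := h
  obtain ⟨θ', hθ'⟩ := hθ.symm
  refine ⟨θ', hθ', eqTm_right e, ?_⟩
  have e1 : EqTm Γ (θ'.subst (scons (θ.subst (scons a (sh 0))) (sh 0))) a A := by
    simpa using eqTm_subst (hθ.cancel hθ') (.inst ha)
  exact .tm_trans (by simpa using hθ'.congr (.id hθ.ctx) (by simpa using Der.tm_symm e)) e1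

theorem TmI.subst (h : TmI Γ a A b B) (s : SubOk Δ σ Γ) :
    TmI Δ (a.subst σ) (A.subst σ) (b.subst σ) (B.subst σ) := by
  obtain ⟨θ, hθ, ha, e⟩ := h
  exact ⟨_, hθ.subst s, tm_subst ha s, by simpa using eqTm_subst e s⟩

/-- The two instances of the term live in different, though equal, types; the identity between these
is canonical. -/
theorem TmI.of_subEq (h : IsTm Γ a A) (s : SubEq Δ σ τ Γ) :
    TmI Δ (a.subst σ) (A.subst σ) (a.subst τ) (A.subst τ) :=
  ⟨_, iso_of_subEq (ty_of_tm h) s, tm_subst h s.left,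
    by simpa using Der.conv_eq (tm_substEq h s) (ty_substEq (ty_of_tm h) s)⟩

theorem TmI.conv (h : IsTm Γ a A) (e : EqTy Γ A B k) : TmI Γ a A a B :=
  ⟨_, iso_of_eqTy e, h, .tm_refl (.conv h e.tyEq_col)⟩

theorem TmI.cast (h : IsTm Γ a A) (e : TyI Γ A B) : ∃ b, TmI Γ a A b B :=
  ⟨_, TmI.act_id e.choose_spec h⟩

/-- Terms of canonically isomorphic propositions correspond to each other. -/
theorem TmI.of_prop (hφ : IsTy Γ φ .prop) (h : TyI Γ φ ψ) (hp : IsTm Γ p φ) (ht : IsTm Γ t ψ) :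
    TmI Γ p φ t ψ := by
  obtain ⟨θ, hθ⟩ := h
  refine ⟨θ, hθ, hp, ?_⟩
  have := propHead hφ
  cases hθ with
  | prop h1 h2 h3 h4 => exact .prop_mono h2 (by simpa using tm_subst h4 (.inst hp)) ht
  | _ => exact this.elim

theorem TyI.of_iff (hφ : IsTy Γ φ .prop) (hψ : IsTy Γ ψ .prop) (h : IsTrue Γ (Exp.iff φ ψ)) :
    TyI Γ φ ψ := ⟨_, iso_of_canIso (.prop hφ hψ h)⟩

/-- A proposition is canonically isomorphic only to propositions equiprovable with it. Hence a
change of representative never affects truth, which is the root of conservativity. -/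
theorem TyI.prop (h : TyI Γ φ ψ) (hφ : IsTy Γ φ .prop) :
    IsTy Γ ψ .prop ∧ IsTrue Γ (Exp.iff φ ψ) := by
  obtain ⟨θ, hθ⟩ := h
  have := propHead hφ
  cases hθ with
  | prop h1 h2 h3 h4 => exact ⟨h2, h3⟩
  | _ => exact this.elim

/-! ### Canonical isomorphisms of contexts -/

/-- Canonical isomorphisms of contexts, up to equality of substitutions. -/
def CtxI (Γ Δ : Ctx) (σ : Sub) : Prop := ∃ ρ, CtxIso Γ Δ ρ ∧ SubEq Γ ρ σ Δ

theorem CtxI.subOk (h : CtxI Γ Δ σ) : SubOk Γ σ Δ := h.choose_spec.2.right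

theorem CtxIso.codom (h : CtxIso Γ Δ σ) : IsCtx Δ := by
  cases h with
  | nil => exact .ctx_nil
  | cons _ h => exact .ctx_cons h

theorem CtxI.left (h : CtxI Γ Δ σ) : IsCtx Γ := h.subOk.ctx
theorem CtxI.right (h : CtxI Γ Δ σ) : IsCtx Δ := h.choose_spec.1.codom

theorem CtxI.congr (h : CtxI Γ Δ σ) (e : SubEq Γ σ τ Δ) : CtxI Γ Δ τ := by
  obtain ⟨ρ, h1, h2⟩ := h
  exact ⟨ρ, h1, h2.trans h1.codom e⟩

theorem SubOk.nil (h : IsCtx Γ) : SubOk Γ σ [] := ⟨h, fun i B hB => by simp at hB⟩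
theorem SubEq.nil (h : IsCtx Γ) : SubEq Γ σ τ [] := ⟨.nil h, .nil h, fun i B hB => by simp at hB⟩

theorem CtxI.nil : CtxI [] [] σ := ⟨_, .nil, .nil .ctx_nil⟩

theorem CtxI.cons (h : CtxI Γ Δ σ) (hB : IsTy Δ B k) (hα : Iso Γ A (B.subst σ) α) :
    CtxI (A :: Γ) (B :: Δ) (scons α (cmp σ (sh 1))) := by
  obtain ⟨ρ, h1, h2⟩ := h
  have h3 : Iso Γ A (B.subst ρ) α := by
    simpa using hα.comp (iso_of_subEq hB (h2.symm h1.codom))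
  have s1 := SubOk.sh_one (.ctx_cons hα.left)
  refine ⟨scons α (cmp ρ (sh 1)), ?_, ?_⟩
  · have := CtxIso.cons hα.left hB.ty_col h1 (canIso_of_iso h3)
    simp only [lift_eq] at this
    exact this
  · exact SubEq.scons (h2.comp_right s1) hB (.tm_refl (by simpa using h3.tm))

theorem CtxI.inv (h : CtxI (A :: Γ) (B :: Δ) σ) :
    ∃ ρ α, CtxI Γ Δ ρ ∧ IsTy Δ B .col ∧ Iso Γ A (B.subst ρ) α ∧
      SubEq (A :: Γ) (scons α (cmp ρ (sh 1))) σ (B :: Δ) := by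
  obtain ⟨ρ, h1, h2⟩ := h
  have h3 := h2.left
  cases h1 with
  | cons g1 g2 g3 g4 =>
    have hα := iso_of_canIso g4
    refine ⟨_, _, ⟨_, g3, .refl ?_⟩, g2, hα, ?_⟩
    · have key : ∀ {Γ Δ σ}, CtxIso Γ Δ σ → SubOk Γ σ Δ := by
        intro Γ Δ σ h
        induction h with
        | nil => exact .nil .ctx_nil
        | @cons Γ Δ A B σ τ g1 g2 g3 g4 ih =>
          simp only [lift_eq]
          exact (ih.shift g1).scons (by simpa using (iso_of_canIso g4).tm)
      exact key g3
    · simp only [lift_eq] at h2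
      exact h2

theorem CtxI.cases_nil (h : CtxI Γ [] σ) : Γ = [] := by
  obtain ⟨_, h, _⟩ := h
  cases h; rfl

theorem CtxI.cases_cons (h : CtxI Γ (B :: Δ) σ) : ∃ A Γ', Γ = A :: Γ' := by
  obtain ⟨_, h, _⟩ := h
  cases h; exact ⟨_, _, rfl⟩

theorem CtxI.of_ctxIso (h : CtxIso Γ Δ σ) : CtxI Γ Δ σ := by
  induction h with
  | nil => exact .nil
  | cons _ g2 g3 g4 ih =>
    simp only [lift_eq]
    exact ih.cons g2 (iso_of_canIso g4)

/-- Recursion on the contexts. Once the two initial parts are equal, the two instances of the last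
type are joined by an identity and `Iso.unique` compares the last components. It follows that the
context isomorphism chosen in the relations between judgements does not matter. -/
theorem CtxI.unique : ∀ {Γ Δ σ τ}, CtxI Γ Δ σ → CtxI Γ Δ τ → SubEq Γ σ τ Δ
  | _, [], _, _, h, _ => .nil h.left
  | _, B :: Δ, σ, τ, h, h' => by
    obtain ⟨A, Γ, rfl⟩ := h.cases_cons
    obtain ⟨ρ, α, h1, hB, h2, h3⟩ := h.inv
    obtain ⟨ρ', α', h1', _, h2', h3'⟩ := h'.inv
    have e := CtxI.unique h1 h1'
    have hc : IsCtx (B :: Δ) := .ctx_cons hB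
    have h4 : Iso Γ A (B.subst ρ) α' := by
      simpa using h2'.comp (iso_of_subEq hB (e.symm (tail_ctx hc)))
    have s1 := SubOk.sh_one (.ctx_cons h2.left)
    have e2 := SubEq.scons (e.comp_right s1) hB (by simpa using h2.unique h4)
    exact ((h3.symm hc).trans hc e2).trans hc h3'

theorem CtxI.refl : ∀ {Γ}, IsCtx Γ → CtxI Γ Γ (sh 0)
  | [], _ => .nil
  | A :: Γ, h => by
    have := (CtxI.refl (tail_ctx h)).cons (head_ty h) (by simpa using Iso.refl (head_ty h))
    simpa using this

theorem CtxI.comp : ∀ {Γ Δ Θ σ τ}, CtxI Γ Δ σ → CtxI Δ Θ τ → CtxI Γ Θ (cmp τ σ)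
  | Γ, Δ, [], σ, τ, h, h' => by
    obtain rfl := h'.cases_nil
    obtain rfl := h.cases_nil
    exact .nil
  | Γ, Δ, C :: Θ, σ, τ, h, h' => by
    obtain ⟨B, Δ, rfl⟩ := h'.cases_cons
    obtain ⟨A, Γ, rfl⟩ := h.cases_cons
    obtain ⟨ρ, α, h1, hB, h2, h3⟩ := h.inv
    obtain ⟨ρ', α', h1', hC, h2', h3'⟩ := h'.inv
    have h4 := (CtxI.comp h1 h1').cons hC (by simpa using h2.comp (h2'.subst h1.subOk))
    refine h4.congr ?_
    simpa using h3'.comp h3 (.ctx_cons hC)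

theorem CtxI.symm : ∀ {Γ Δ σ}, CtxI Γ Δ σ → ∃ τ, CtxI Δ Γ τ
  | _, [], σ, h => by
    obtain rfl := h.cases_nil
    exact ⟨_, h⟩
  | _, B :: Δ, σ, h => by
    obtain ⟨A, Γ, rfl⟩ := h.cases_cons
    obtain ⟨ρ, α, h1, hB, h2, h3⟩ := h.inv
    obtain ⟨τ, hτ⟩ := CtxI.symm h1
    have e := (hτ.comp h1).unique (.refl hτ.left)
    obtain ⟨β, hβ⟩ := h2.symm
    have hB' := iso_of_subEq hB (e.symm hτ.left)
    simp only [subst_sh_zero] at hB'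
    exact ⟨_, hτ.cons h2.left (hB'.comp (by simpa using hβ.subst hτ.subOk))⟩

/-! ### Canonically related judgements in different contexts -/

theorem CtxI.cancel (h : CtxI Γ Δ σ) (h' : CtxI Δ Γ τ) : SubEq Δ (cmp σ τ) (sh 0) Δ :=
  (h'.comp h).unique (.refl h.right)

theorem ctxRel_iff : CtxRel Γ Δ ↔ ∃ σ, CtxI Γ Δ σ :=
  ⟨fun ⟨_, _, σ, h⟩ => ⟨σ, .of_ctxIso h⟩, fun ⟨_, h⟩ => ⟨h.left, h.right, _, h.choose_spec.1⟩⟩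

theorem tyRel_iff : TyRel ⟨Γ, A⟩ ⟨Δ, B⟩ ↔
    ∃ σ, CtxI Γ Δ σ ∧ IsTy Δ B .col ∧ TyI Γ A (B.subst σ) := by
  constructor
  · rintro ⟨_, h2, σ, τ, h3, h4⟩
    exact ⟨σ, .of_ctxIso h3, h2, _, iso_of_canIso h4⟩
  · rintro ⟨σ, ⟨ρ, h1, h2⟩, h3, h4⟩
    obtain ⟨θ, h5⟩ := h4.trans (.of_subEq h3 (h2.symm h1.codom))
    exact ⟨h5.left, h3, ρ, θ, h1, canIso_of_iso h5⟩

theorem tmRel_iff : TmRel ⟨Γ, a, A⟩ ⟨Δ, b, B⟩ ↔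
    ∃ σ, CtxI Γ Δ σ ∧ IsTm Δ b B ∧ TmI Γ a A (b.subst σ) (B.subst σ) := by
  constructor
  · rintro ⟨h1, h2, σ, τ, h3, h4, h5⟩
    exact ⟨σ, .of_ctxIso h3, h2, _, iso_of_canIso h4, h1, by simpa using h5⟩
  · rintro ⟨σ, ⟨ρ, h1, h2⟩, h3, h4⟩
    obtain ⟨θ, h5, h6, h7⟩ := h4.trans (.of_subEq h3 (h2.symm h1.codom))
    exact ⟨h6, h3, ρ, θ, h1, canIso_of_iso h5, by simpa using h7⟩

theorem ctxRel_refl (h : IsCtx Γ) : CtxRel Γ Γ := ctxRel_iff.2 ⟨_, .refl h⟩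

theorem CtxRel.symm (h : CtxRel Γ Δ) : CtxRel Δ Γ := by
  obtain ⟨σ, h⟩ := ctxRel_iff.1 h
  exact ctxRel_iff.2 h.symm

theorem CtxRel.trans (h : CtxRel Γ Δ) (h' : CtxRel Δ Θ) : CtxRel Γ Θ := by
  obtain ⟨σ, h⟩ := ctxRel_iff.1 h
  obtain ⟨τ, h'⟩ := ctxRel_iff.1 h'
  exact ctxRel_iff.2 ⟨_, h.comp h'⟩

theorem tyRel_of_tyI (h : TyI Γ A B) : TyRel ⟨Γ, A⟩ ⟨Γ, B⟩ :=
  tyRel_iff.2 ⟨_, .refl (ctx_of_ty h.left), h.right, by simpa using h⟩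

/-- A canonical isomorphism from a context to itself is the identity, so reindexing along it can be
undone. -/
theorem tyI_of_tyRel (h : TyRel ⟨Γ, A⟩ ⟨Γ, B⟩) : TyI Γ A B := by
  obtain ⟨σ, h1, h2, h3⟩ := tyRel_iff.1 h
  simpa using h3.trans (.of_subEq h2 (h1.unique (.refl h1.left)))

theorem tyRel_refl (h : IsTy Γ A .col) : TyRel ⟨Γ, A⟩ ⟨Γ, A⟩ := tyRel_of_tyI (.refl h)

theorem TyRel.symm {J K : TyJ} (h : TyRel J K) : TyRel K J := by
  obtain ⟨σ, h1, h2, h3⟩ := tyRel_iff.1 h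
  obtain ⟨τ, hτ⟩ := h1.symm
  have e := TyI.of_subEq h2 (h1.cancel hτ)
  refine tyRel_iff.2 ⟨τ, hτ, h3.left, ?_⟩
  simpa using e.symm.trans (by simpa using (h3.subst hτ.subOk).symm)

theorem TyRel.trans {I J K : TyJ} (h : TyRel I J) (h' : TyRel J K) : TyRel I K := by
  obtain ⟨σ, h1, h2, h3⟩ := tyRel_iff.1 h
  obtain ⟨τ, h1', h2', h3'⟩ := tyRel_iff.1 h'
  exact tyRel_iff.2 ⟨_, h1.comp h1', h2', by simpa using h3.trans (h3'.subst h1.subOk)⟩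

theorem tmRel_of_tmI (h : TmI Γ a A b B) : TmRel ⟨Γ, a, A⟩ ⟨Γ, b, B⟩ :=
  tmRel_iff.2 ⟨_, .refl (ctx_of_ty h.tyI.left), h.right, by simpa using h⟩

theorem tmI_of_tmRel (h : TmRel ⟨Γ, a, A⟩ ⟨Γ, b, B⟩) : TmI Γ a A b B := by
  obtain ⟨σ, h1, h2, h3⟩ := tmRel_iff.1 h
  simpa using h3.trans (.of_subEq h2 (h1.unique (.refl h1.left)))

theorem tmRel_refl (h : IsTm Γ a A) : TmRel ⟨Γ, a, A⟩ ⟨Γ, a, A⟩ := tmRel_of_tmI (.refl h)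

theorem TmRel.symm {J K : TmJ} (h : TmRel J K) : TmRel K J := by
  obtain ⟨σ, h1, h2, h3⟩ := tmRel_iff.1 h
  obtain ⟨τ, hτ⟩ := h1.symm
  have e := TmI.of_subEq h2 (h1.cancel hτ)
  refine tmRel_iff.2 ⟨τ, hτ, h3.left, ?_⟩
  simpa using e.symm.trans (by simpa using (h3.subst hτ.subOk).symm)

theorem TmRel.trans {I J K : TmJ} (h : TmRel I J) (h' : TmRel J K) : TmRel I K := by
  obtain ⟨σ, h1, h2, h3⟩ := tmRel_iff.1 h
  obtain ⟨τ, h1', h2', h3'⟩ := tmRel_iff.1 h'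
  exact tmRel_iff.2 ⟨_, h1.comp h1', h2', by simpa using h3.trans (h3'.subst h1.subOk)⟩

theorem TmRel.ty {J K : TmJ} (h : TmRel J K) : TyRel ⟨J.ctx, J.ty⟩ ⟨K.ctx, K.ty⟩ := by
  obtain ⟨σ, h1, h2, h3⟩ := tmRel_iff.1 h
  exact tyRel_iff.2 ⟨σ, h1, ty_of_tm h2, h3.tyI⟩

theorem TyRel.ctx {J K : TyJ} (h : TyRel J K) : CtxRel J.ctx K.ctx := by
  obtain ⟨σ, h1, h2, h3⟩ := tyRel_iff.1 h
  exact ctxRel_iff.2 ⟨σ, h1⟩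

theorem equivalence_ctxRel :
    Equivalence (fun Γ Δ : {Γ : Ctx // Der .emTT (.ctx Γ)} => CtxRel Γ Δ) :=
  ⟨fun Γ => ctxRel_refl Γ.2, fun h => h.symm, fun h h' => h.trans h'⟩

theorem equivalence_tyRel :
    Equivalence (fun J K : {J : TyJ // Der .emTT (.ty J.ctx J.ty .col)} => TyRel J K) :=
  ⟨fun J => tyRel_refl J.2, fun h => h.symm, fun h h' => h.trans h'⟩

theorem equivalence_tmRel :
    Equivalence (fun J K : {J : TmJ // Der .emTT (.tm J.ctx J.tm J.ty)} => TmRel J K) :=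
  ⟨fun J => tmRel_refl J.2, fun h => h.symm, fun h h' => h.trans h'⟩

/-! ### Equivalence classes -/

theorem ctxCls_eq_iff (h : IsCtx Δ) : ctxCls Γ = ctxCls Δ ↔ CtxRel Γ Δ := by
  refine ⟨fun e => ?_, fun r => Set.ext fun K => ⟨fun h => r.symm.trans h, fun h => r.trans h⟩⟩
  have : Δ ∈ ctxCls Δ := ctxRel_refl h
  rwa [← e] at this

theorem tyCls_eq_iff (h : IsTy Δ B .col) : tyCls Γ A = tyCls Δ B ↔ TyRel ⟨Γ, A⟩ ⟨Δ, B⟩ := by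
  refine ⟨fun e => ?_, fun r => Set.ext fun K => ⟨fun h => r.symm.trans h, fun h => r.trans h⟩⟩
  have : ⟨Δ, B⟩ ∈ tyCls Δ B := tyRel_refl h
  rwa [← e] at this

theorem tmCls_eq_iff (h : IsTm Δ b B) :
    tmCls Γ a A = tmCls Δ b B ↔ TmRel ⟨Γ, a, A⟩ ⟨Δ, b, B⟩ := by
  refine ⟨fun e => ?_, fun r => Set.ext fun K => ⟨fun h => r.symm.trans h, fun h => r.trans h⟩⟩
  have : ⟨Δ, b, B⟩ ∈ tmCls Δ b B := tmRel_refl h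
  rwa [← e] at this

/-! ## Congruence of the constructors with respect to canonical isomorphisms -/

/-! ### Inversion for terms -/

/-- The respect condition on the branch of a quotient eliminator. -/
def QuoResp (Γ : Ctx) (A R L : Ty) (l : Tm) : Prop :=
  EqTm (quoCtx Γ A R) (l.subst (sh 2)) (l.subst (scons (.var 1) (sh 3)))
    (L.subst (scons (.qcl (A.subst (sh 3)) (R.subst (ups (ups (sh 3)))) (.var 2)) (sh 3)))

/-- The data of the derivation of a term which cannot be recovered from its type. -/
def TmInv (Γ : Ctx) : Tm → Prop
  | .var i => ∃ B, Γ[i]? = some B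
  | .pcl φ => IsTy Γ φ .props
  | .tru φ => IsTy Γ φ .prop
  | .elQ A R L _ l => IsTy Γ A .set ∧ IsTy (A.subst (sh 1) :: A :: Γ) R .props ∧ QuoResp Γ A R L l
  | _ => True

/-- The motive of the inversion lemma for terms. -/
def Judg.TmInv : Judg → Prop
  | .tm Γ a _ => EmTT.TmInv Γ a
  | _ => True

/-- A variable is replaced by an arbitrary term, whose data are not determined by those of the
variable. The hypothesis `hs` supplies them, and in the induction it is the induction hypothesis on
the substitution. -/
theorem TmInv.subst (h : TmInv Γ a) (s : SubOk Δ σ Γ)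
    (hs : ∀ i B, Γ[i]? = some B → TmInv Δ (σ i)) : TmInv Δ (a.subst σ) := by
  cases a <;> try trivial
  case var i =>
    obtain ⟨B, hB⟩ := h
    exact hs i B hB
  case pcl => exact ty_subst h s
  case tru => exact ty_subst h s
  case elQ A R L p l =>
    obtain ⟨h1, h2, h3⟩ := h
    have s2 := s.ups_ups h1
    refine ⟨ty_subst h1 s, by simpa using ty_subst h2 s2, ?_⟩
    simpa [QuoResp] using eqTm_subst h3 (s2.ups h2)

theorem judg_tmInv {J : Judg} (h : Der .emTT J) : J.TmInv := by
  induction h with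
  | var _ h => exact ⟨_, h⟩
  | conv _ _ ih => exact ih
  | sub_tm h1 h2 _ _ ih ih' => exact EmTT.TmInv.subst ih' ⟨h1, by simpa using h2⟩ ih
  | quo_elim h1 h2 h3 h4 =>
    have hQ := quoCond (head_ty (ctx_of_ty h1))
    exact ⟨hQ.set, hQ.rel, by simpa [QuoResp] using h4⟩
  | P1_intro h => exact h
  | prop_true h => exact h
  | bot_elim _ h => exact h
  | and_intro h h' => exact .and_form false h h'
  | and_left h => exact h
  | and_right _ h => exact h
  | or_inl h h' => exact .or_form false h h'
  | or_inr h h' => exact .or_form false h h'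
  | or_elim _ _ h => exact h
  | imp_intro h h' => exact .imp_form false h h'
  | imp_elim _ h => exact h
  | ex_intro h => exact .ex_form false (head_ty (ctx_of_ty h)) h
  | ex_elim _ h => exact h
  | all_intro h => exact .all_form false (head_ty (ctx_of_ty h)) h
  | all_elim h _ ha => exact ty_subst h (.inst ha)
  | eq_intro h => exact eq_form' (ty_of_tm h) h h
  | quo_effective h ha hb => exact (ty_subst (quoCond h).rel (.two (.id (ctx_of_tm ha)) (by simpa using ha) (by simpa using hb))).ty_prop (s := true)
  | P1_effective h h' => exact iff_form (h.ty_prop (s := true)) (h'.ty_prop (s := true))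
  | _ => trivial

theorem tmInv (h : IsTm Γ a A) : TmInv Γ a := judg_tmInv h

/-! ### Types -/

/-- Comparisons of families are naturally given over `A`, while the contravariant domain of a
product, and the converse implications for quantifiers, require them over `A'`. -/
theorem Iso.pull (h : Iso Γ A' A α) (hα : Iso Γ A A' β) (hB : IsTy (A' :: Γ) B' k)
    (h' : TyI (A :: Γ) B (B'.subst (scons β (sh 1)))) :
    TyI (A' :: Γ) (B.subst (scons α (sh 1))) B' := by
  have e := h.cancel hα
  have h1 := h'.subst h.subOk
  have h2 := TyI.of_subEq hB (SubEq.scons (.refl (.sh_one (.ctx_cons h.left))) hα.right e)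
  exact h1.trans (by simpa using h2)

theorem TyI.sig (hα : Iso Γ A A' α) (hB' : IsTy (A' :: Γ) B' .col)
    (h : TyI (A :: Γ) B (B'.subst (scons α (sh 1)))) : TyI Γ (.sig A B) (.sig A' B') :=
  ⟨_, .mapSig h.left hB' hα h.choose_spec⟩

theorem TyI.pi (hα : Iso Γ A A' α) (h1 : IsTy Γ (.pi A B) k) (h2 : IsTy Γ (.pi A' B') k)
    (h : TyI (A :: Γ) B (B'.subst (scons α (sh 1)))) : TyI Γ (.pi A B) (.pi A' B') := by
  obtain ⟨β, hβ⟩ := hα.symm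
  exact ⟨_, .mapPi h1.ty_col h2.ty_col hβ (hβ.pull hα (tyInv h2).2.1 h).choose_spec⟩

theorem TyI.list (hA : IsTy Γ A .set) (hA' : IsTy Γ A' .set) (h : TyI Γ A A') :
    TyI Γ (.list A) (.list A') := ⟨_, .mapList hA hA' h.choose_spec⟩

theorem TyI.sum (h1 : IsTy Γ (.sum A B) k) (h2 : IsTy Γ (.sum A' B') k) (h : TyI Γ A A')
    (h' : TyI Γ B B') : TyI Γ (.sum A B) (.sum A' B') :=
  ⟨_, .mapSum (tyInv h1).1 (tyInv h2).1 (tyInv h1).2 (tyInv h2).2 h.choose_spec h'.choose_spec⟩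

/-- The isomorphism `α` applied to the last two variables. -/
abbrev twice (α : Tm) : Sub := scons (α.subst (scons (.var 0) (sh 2))) (scons (α.subst (sh 1)) (sh 2))

attribute [simp] twice

theorem TyI.quo (hα : Iso Γ A A' α) (h1 : IsTy Γ (.quo A R) k) (h2 : IsTy Γ (.quo A' R') k)
    (h : TyI (A.subst (sh 1) :: A :: Γ) R (R'.subst (twice α))) :
    TyI Γ (.quo A R) (.quo A' R') :=
  ⟨_, .mapQuo (quoCond h1).form (quoCond h2).form hα
    (h.prop ((quoCond h1).rel.ty_prop (s := true))).2⟩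

/-- For each connective one implication is proved, for arbitrary equiprovable arguments; the
converse is the same statement with the two sides exchanged. -/
theorem TyI.and (h1 : IsTy Γ (.and φ ψ) k) (h2 : IsTy Γ (.and φ' ψ') k) (h : TyI Γ φ φ')
    (h' : TyI Γ ψ ψ') : TyI Γ (.and φ ψ) (.and φ' ψ') := by
  obtain ⟨a1, a2⟩ := tyInv h1
  obtain ⟨b1, b2⟩ := tyInv h2
  have key : ∀ {φ ψ φ' ψ'}, IsTy Γ φ .prop → IsTy Γ ψ .prop → IsTy Γ φ' .prop → IsTy Γ ψ' .prop →
      IsTrue Γ (Exp.iff φ φ') → IsTrue Γ (Exp.iff ψ ψ') →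
      IsTrue (.and φ ψ :: Γ) ((Exp.and φ' ψ').subst (sh 1)) := by
    intro φ ψ φ' ψ' a1 a2 b1 b2 e e'
    have hp := Der.and_form false a1 a2
    have s := SubOk.sh_one (.ctx_cons hp.ty_col)
    have x := tr_head hp
    exact .and_intro (ty_subst b1 s) (ty_subst b2 s)
      (tr_mp (ty_subst a1 s) (ty_subst b1 s) (tr_subst e s)
        (.and_left (ty_subst a1 s) (ty_subst a2 s) x))
      (tr_mp (ty_subst a2 s) (ty_subst b2 s) (tr_subst e' s)
        (.and_right (ty_subst a1 s) (ty_subst a2 s) x))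
  have e := (h.prop a1).2
  have e' := (h'.prop a2).2
  exact .of_iff (.and_form false a1 a2) (.and_form false b1 b2)
    (iff_intro (.and_form false a1 a2) (.and_form false b1 b2) (key a1 a2 b1 b2 e e')
      (key b1 b2 a1 a2 (iff_symm a1 b1 e) (iff_symm a2 b2 e')))

theorem TyI.or (h1 : IsTy Γ (.or φ ψ) k) (h2 : IsTy Γ (.or φ' ψ') k) (h : TyI Γ φ φ')
    (h' : TyI Γ ψ ψ') : TyI Γ (.or φ ψ) (.or φ' ψ') := by
  obtain ⟨a1, a2⟩ := tyInv h1
  obtain ⟨b1, b2⟩ := tyInv h2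
  have key : ∀ {φ ψ φ' ψ'}, IsTy Γ φ .prop → IsTy Γ ψ .prop → IsTy Γ φ' .prop → IsTy Γ ψ' .prop →
      IsTrue Γ (Exp.iff φ φ') → IsTrue Γ (Exp.iff ψ ψ') →
      IsTrue (.or φ ψ :: Γ) ((Exp.or φ' ψ').subst (sh 1)) := by
    intro φ ψ φ' ψ' a1 a2 b1 b2 e e'
    have hp := Der.or_form false a1 a2
    have s := SubOk.sh_one (.ctx_cons hp.ty_col)
    have x := tr_head hp
    have p1 := ty_subst a1 s
    have p2 := ty_subst a2 s
    have t1 := SubOk.sh_one (.ctx_cons p1.ty_col)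
    have t2 := SubOk.sh_one (.ctx_cons p2.ty_col)
    have q := Der.or_form false (ty_subst b1 s) (ty_subst b2 s)
    refine .or_elim p1 p2 q x ?_ ?_
    · simpa using Der.or_inl (ty_subst (ty_subst b1 s) t1) (ty_subst (ty_subst b2 s) t1)
        (tr_mp (ty_subst p1 t1) (ty_subst (ty_subst b1 s) t1) (tr_subst (tr_subst e s) t1)
          (tr_head p1))
    · simpa using Der.or_inr (ty_subst (ty_subst b1 s) t2) (ty_subst (ty_subst b2 s) t2)
        (tr_mp (ty_subst p2 t2) (ty_subst (ty_subst b2 s) t2) (tr_subst (tr_subst e' s) t2)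
          (tr_head p2))
  have e := (h.prop a1).2
  have e' := (h'.prop a2).2
  exact .of_iff (.or_form false a1 a2) (.or_form false b1 b2)
    (iff_intro (.or_form false a1 a2) (.or_form false b1 b2) (key a1 a2 b1 b2 e e')
      (key b1 b2 a1 a2 (iff_symm a1 b1 e) (iff_symm a2 b2 e')))

theorem TyI.imp (h1 : IsTy Γ (.imp φ ψ) k) (h2 : IsTy Γ (.imp φ' ψ') k) (h : TyI Γ φ φ')
    (h' : TyI Γ ψ ψ') : TyI Γ (.imp φ ψ) (.imp φ' ψ') := by
  obtain ⟨a1, a2⟩ := tyInv h1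
  obtain ⟨b1, b2⟩ := tyInv h2
  have key : ∀ {φ ψ φ' ψ'}, IsTy Γ φ .prop → IsTy Γ ψ .prop → IsTy Γ φ' .prop → IsTy Γ ψ' .prop →
      IsTrue Γ (Exp.iff φ φ') → IsTrue Γ (Exp.iff ψ ψ') →
      IsTrue (.imp φ ψ :: Γ) ((Exp.imp φ' ψ').subst (sh 1)) := by
    intro φ ψ φ' ψ' a1 a2 b1 b2 e e'
    have hp := Der.imp_form false a1 a2
    have s := SubOk.sh_one (.ctx_cons hp.ty_col)
    have x := tr_head hp
    have q := ty_subst b1 s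
    have t := SubOk.sh_one (.ctx_cons q.ty_col)
    have st := s.comp t
    refine imp_intro' q (ty_subst b2 s) ?_
    have y := tr_mpr (ty_subst a1 st) (ty_subst b1 st) (tr_subst e st) (by simpa using tr_head q)
    have z := Der.imp_elim (ty_subst a1 st) (ty_subst a2 st) (by simpa using tr_subst x t) y
    simpa using tr_mp (ty_subst a2 st) (ty_subst b2 st) (tr_subst e' st) z
  have e := (h.prop a1).2
  have e' := (h'.prop a2).2
  exact .of_iff (.imp_form false a1 a2) (.imp_form false b1 b2)
    (iff_intro (.imp_form false a1 a2) (.imp_form false b1 b2) (key a1 a2 b1 b2 e e')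
      (key b1 b2 a1 a2 (iff_symm a1 b1 e) (iff_symm a2 b2 e')))

/-- A witness in `A` is moved to `A'` by `α`. The converse is the same implication for the inverse
isomorphism, with the comparison of the two families transported by `Iso.pull`. -/
theorem TyI.ex (hα : Iso Γ A A' α) (h1 : IsTy Γ (.ex A φ) k) (h2 : IsTy Γ (.ex A' φ') k)
    (h : TyI (A :: Γ) φ (φ'.subst (scons α (sh 1)))) : TyI Γ (.ex A φ) (.ex A' φ') := by
  have key : ∀ {A φ A' φ' α}, Iso Γ A A' α → IsTy (A :: Γ) φ .prop → IsTy (A' :: Γ) φ' .prop →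
      TyI (A :: Γ) φ (φ'.subst (scons α (sh 1))) →
      IsTrue (.ex A φ :: Γ) ((Exp.ex A' φ').subst (sh 1)) := by
    intro A φ A' φ' α hα a b h
    have hp := Der.ex_form false hα.left a
    have s := SubOk.sh_one (.ctx_cons hp.ty_col)
    have x := tr_head hp
    have a1 := ty_subst a (s.ups hα.left)
    have b1 := ty_subst b (s.ups hα.right)
    have q := Der.ex_form false (ty_subst hα.right s) b1
    refine .ex_elim a1 q x ?_
    have hc := Der.ctx_cons a1.ty_col
    have s2 := SubOk.sh_two hc
    have hα2 := hα.subst (s.comp s2)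
    have hv := tm_var_one hc
    have hv' : IsTm (φ.subst (ups (sh 1)) :: A.subst (sh 1) :: .ex A φ :: Γ) (.var 1)
        (A.subst (sh 3)) := by simpa using hv
    have hw := hα.act (s.comp s2) (by simpa using hv)
    have e := tr_subst (h.prop a).2 ((s.comp s2).scons (by simpa using hv))
    have y := tr_mp (ty_subst a ((s.comp s2).scons (by simpa using hv)))
      (by simpa using ty_subst b ((s.comp s2).scons hw)) (by simpa [Exp.iff] using e)
      (by simpa using tr_head a1)
    have := Der.ex_intro (φ := φ'.subst (ups (sh 3))) (A := A'.subst (sh 3))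
      (by simpa using ty_subst b ((s.comp s2).ups hα.right)) (by simpa using hw)
      (by simpa using y)
    simpa using this
  have a := (tyInv h1).2
  have b := (tyInv h2).2
  obtain ⟨β, hβ⟩ := hα.symm
  exact .of_iff (.ex_form false hα.left a) (.ex_form false hα.right b)
    (iff_intro (.ex_form false hα.left a) (.ex_form false hα.right b) (key hα a b h)
      (key hβ b a (hβ.pull hα b h).symm))

theorem TyI.all (hα : Iso Γ A A' α) (h1 : IsTy Γ (.all A φ) k) (h2 : IsTy Γ (.all A' φ') k)
    (h : TyI (A :: Γ) φ (φ'.subst (scons α (sh 1)))) : TyI Γ (.all A φ) (.all A' φ') := by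
  -- An element of `A` is used to instantiate the quantifier over `A'` through `α`, so `α` yields
  -- the implication from the primed side to the unprimed one.
  have key : ∀ {A φ A' φ' α}, Iso Γ A A' α → IsTy (A :: Γ) φ .prop → IsTy (A' :: Γ) φ' .prop →
      TyI (A :: Γ) φ (φ'.subst (scons α (sh 1))) →
      IsTrue (.all A' φ' :: Γ) ((Exp.all A φ).subst (sh 1)) := by
    intro A φ A' φ' α hα a b h
    have hp := Der.all_form false hα.right b
    have s := SubOk.sh_one (.ctx_cons hp.ty_col)
    have x := tr_head hp
    have a1 := ty_subst a (s.ups hα.left)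
    have hc := ctx_of_ty a1
    have s2 := s.comp (.sh_one hc)
    have hv := tm_var_zero (ty_subst hα.left s)
    have hw := hα.act s2 (by simpa using hv)
    refine .all_intro a1 ?_
    have sv := s2.scons (by simpa using hv)
    have e := tr_subst (h.prop a).2 sv
    have y := Der.all_elim (φ := φ'.subst (ups (sh 2))) (A := A'.subst (sh 2))
      (by simpa using ty_subst b (s2.ups hα.right)) (by simpa using tr_subst x (.sh_one hc))
      (by simpa using hw)
    have := tr_mpr (ty_subst a sv) (by simpa using ty_subst b (s2.scons hw))
      (by simpa [Exp.iff] using e) (by simpa using y)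
    simpa using this
  have a := (tyInv h1).2
  have b := (tyInv h2).2
  obtain ⟨β, hβ⟩ := hα.symm
  exact .of_iff (.all_form false hα.left a) (.all_form false hα.right b)
    (iff_intro (.all_form false hα.left a) (.all_form false hα.right b)
      (key hβ b a (hβ.pull hα b h).symm) (key hα a b h))

/-- An equation between `a` and `b` is carried to their counterparts by composing correspondences; a
correspondence inside a single type is an equality. -/
theorem TyI.eq (ha : TmI Γ a A a' A') (hb : TmI Γ b A b' A') :
    TyI Γ (.eq A a b) (.eq A' a' b') := by
  have key : ∀ {A a b A' a' b'}, TmI Γ a A a' A' → TmI Γ b A b' A' →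
      IsTrue (.eq A a b :: Γ) ((Exp.eq A' a' b').subst (sh 1)) := by
    intro A a b A' a' b' ha hb
    have hp := eq_form' ha.tyI.left ha.left hb.left
    have s := SubOk.sh_one (.ctx_cons hp.ty_col)
    have x := eqTm_of_tr (tr_head hp)
    exact tr_of_eqTm (((ha.symm.subst s).trans (.of_eqTm x)).trans (hb.subst s)).eqTm
  have h1 := eq_form' ha.tyI.left ha.left hb.left
  have h2 := eq_form' ha.tyI.right ha.right hb.right
  exact .of_iff h1 h2 (iff_intro h1 h2 (key ha hb) (key ha.symm hb.symm))

/-! ### Behaviour of the canonical isomorphisms -/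

theorem Iso.list_nil (h : Iso Γ (.list A) (.list B) θ) :
    EqTm Γ (θ.subst (scons (.nil A) (sh 0))) (.nil B) (.list B) := by
  cases h with
  | list _ _ _ _ h => exact h
  | prop h => exact (propHead h).elim

/-- A derivation of `Iso` contains components of its own. By uniqueness its equations hold with any
prescribed component, and it is in this form that they are used. -/
theorem Iso.list_cons (h : Iso Γ (.list A) (.list B) θ) (hα : Iso Γ A B α) :
    EqTm (A.subst (sh 1) :: .list A :: Γ) (θ.subst (scons (.cons (.var 1) (.var 0)) (sh 2)))
      (.cons (θ.subst (sh 1)) (α.subst (scons (.var 0) (sh 2)))) (.list (B.subst (sh 2))) := by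
  cases h with
  | list h1 h2 h3 h4 h5 h6 =>
    have s := SubOk.sh_one (ctx_list_two h1)
    refine .tm_trans h6 (.list_cons_eq (.tm_refl (by simpa using tm_subst h4 s)) ?_)
    have s2 := SubOk.sh_two (ctx_list_two h1)
    have := eqTm_subst (h3.unique hα) (s2.scons (a := .var 0)
      (by simpa using tm_var_zero (head_ty (ctx_list_two h1))))
    simpa using this
  | prop h => exact (propHead h).elim

theorem Iso.sum_inl (h : Iso Γ (.sum A B) (.sum A' B') θ) (hα : Iso Γ A A' α) :
    EqTm (A :: Γ) (θ.subst (scons (inlV A B) (sh 1)))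
      (.inl (A'.subst (sh 1)) (B'.subst (sh 1)) α) ((Exp.sum A' B').subst (sh 1)) := by
  cases h with
  | sum h1 h2 h3 h4 h5 h6 h7 h8 h9 =>
    have s := SubOk.sh_one (.ctx_cons h1.ty_col)
    exact .tm_trans h8 (.sum_inl_eq (.ty_refl (ty_subst h2 s)) (.ty_refl (ty_subst h4 s))
      (h5.unique hα))
  | prop h => exact (propHead h).elim

theorem Iso.sum_inr (h : Iso Γ (.sum A B) (.sum A' B') θ) (hβ : Iso Γ B B' β) :
    EqTm (B :: Γ) (θ.subst (scons (inrV A B) (sh 1)))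
      (.inr (A'.subst (sh 1)) (B'.subst (sh 1)) β) ((Exp.sum A' B').subst (sh 1)) := by
  cases h with
  | sum h1 h2 h3 h4 h5 h6 h7 h8 h9 =>
    have s := SubOk.sh_one (.ctx_cons h3.ty_col)
    exact .tm_trans h9 (.sum_inr_eq (.ty_refl (ty_subst h2 s)) (.ty_refl (ty_subst h4 s))
      (h6.unique hβ))
  | prop h => exact (propHead h).elim

theorem Iso.sig_pair (h : Iso Γ (.sig A B) (.sig A' B') θ) (hα : Iso Γ A A' α)
    (hβ : Iso (A :: Γ) B (B'.subst (scons α (sh 1))) β) :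
    EqTm (B :: A :: Γ) (θ.subst (scons (pairV A B) (sh 2)))
      (.pair (A'.subst (sh 2)) (B'.subst (ups (sh 2))) (α.subst (sh 1)) β)
      ((Exp.sig A' B').subst (sh 2)) := by
  cases h with
  | sig h1 h2 h3 h4 h5 h6 =>
    have hc := Der.ctx_cons h1
    have s1 := SubOk.sh_one hc
    have s2 := SubOk.sh_two hc
    have e := h3.unique hα
    have e' := h4.comp (iso_of_subEq h2 (.scons (.refl (.sh_one (.ctx_cons h3.left))) h3.right e))
    have e1 := eqTm_subst e s1
    refine .tm_trans h6 (.sig_intro_eq (.ty_refl (ty_subst h3.right s2))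
      (.ty_refl (ty_subst h2 (s2.ups h3.right))) (by simpa using e1) ?_)
    have := Der.conv_eq (by simpa using e'.unique hβ) (ty_substEq h2 (.scons (.refl s2) h3.right
      (by simpa using Der.tm_symm e1)))
    simpa using this
  | prop h => exact (propHead h).elim

theorem Iso.quo_qcl (h : Iso Γ (.quo A R) (.quo B S) θ) (hα : Iso Γ A B α) :
    EqTm (A :: Γ) (θ.subst (scons (qclV A R) (sh 1)))
        (.qcl (B.subst (sh 1)) (S.subst (ups (ups (sh 1)))) α) ((Exp.quo B S).subst (sh 1)) := by
  cases h with
  | quo h1 h2 h3 h4 h5 h6 =>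
    have s := SubOk.sh_one (.ctx_cons (quoCond h1).set.ty_col)
    have hQ := (quoCond h2).subst s
    exact .tm_trans h6 (.quo_intro_eq hQ.form (.ty_refl hQ.set)
      (.ty_refl (by simpa using hQ.rel)) (h3.unique hα))
  | prop h => exact (propHead h).elim

/-- The components are returned instead of prescribed: the domain component runs backwards, and its
users compare it with their own data through cancellation or uniqueness. -/
theorem Iso.pi_app (h : Iso Γ (.pi A B) (.pi A' B') θ) : ∃ α β, Iso Γ A' A α ∧
    Iso (A' :: Γ) (B.subst (scons α (sh 1))) B' β ∧ IsTy (A :: Γ) B .col ∧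
    EqTm (A'.subst (sh 1) :: .pi A B :: Γ) (.app (θ.subst (sh 1)) (.var 0))
        (β.subst (scons (.app (.var 1) (α.subst (scons (.var 0) (sh 2)))) (scons (.var 0) (sh 2))))
        (B'.subst (scons (.var 0) (sh 2))) := by
  cases h with
  | pi h1 h2 h3 h4 h5 h6 => exact ⟨_, _, h3, h4, (tyInv h1).2.1, h6⟩
  | prop h => exact (propHead h).elim

theorem TyI.list_inv (h : TyI Γ (.list A) (.list B)) : IsTy Γ A .set ∧ IsTy Γ B .set ∧ TyI Γ A B := by
  obtain ⟨θ, h⟩ := h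
  cases h with
  | list h1 h2 h3 => exact ⟨h1, h2, _, h3⟩
  | prop h => exact (propHead h).elim

theorem TyI.sum_inv (h : TyI Γ (.sum A B) (.sum A' B')) : TyI Γ A A' ∧ TyI Γ B B' := by
  obtain ⟨θ, h⟩ := h
  cases h with
  | sum _ _ _ _ h1 h2 => exact ⟨⟨_, h1⟩, ⟨_, h2⟩⟩
  | prop h => exact (propHead h).elim

theorem TyI.sig_inv (h : TyI Γ (.sig A B) (.sig A' B')) :
    IsTy (A :: Γ) B .col ∧ IsTy (A' :: Γ) B' .col ∧
    ∃ α, Iso Γ A A' α ∧ TyI (A :: Γ) B (B'.subst (scons α (sh 1))) := by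
  obtain ⟨θ, h⟩ := h
  cases h with
  | sig h1 h2 h3 h4 => exact ⟨h1, h2, _, h3, _, h4⟩
  | prop h => exact (propHead h).elim

theorem TyI.quo_inv (h : TyI Γ (.quo A R) (.quo B S)) : QuoCond Γ A R ∧ QuoCond Γ B S ∧
    ∃ α, Iso Γ A B α ∧ TyI (A.subst (sh 1) :: A :: Γ) R (S.subst (twice α)) := by
  obtain ⟨θ, h⟩ := h
  cases h with
  | quo h1 h2 h3 h4 =>
    have hQ := quoCond h1
    have hc := ctx_two hQ.set
    have s2 := SubOk.sh_two hc
    have hx := h3.act s2 (tm_var_one hc)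
    have hy := h3.act (a := .var 0) s2 (by simpa using tm_var_zero (head_ty hc))
    refine ⟨hQ, quoCond h2, _, h3, .of_iff (hQ.rel.ty_prop (s := true)) ?_ h4⟩
    simpa using (ty_subst (quoCond h2).rel (s2.two hx hy)).ty_prop (s := true)
  | prop h => exact (propHead h).elim

/-! ### Introduction terms -/

theorem TmI.pair (h : TyI Γ (.sig A B) (.sig A' B')) (ha : TmI Γ a A a' A')
    (hb : TmI Γ b (B.subst (scons a (sh 0))) b' (B'.subst (scons a' (sh 0)))) :
    TmI Γ (.pair A B a b) (.sig A B) (.pair A' B' a' b') (.sig A' B') := by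
  obtain ⟨hB, hB', α, hα, β, hβ⟩ := h.sig_inv
  obtain ⟨θ, hθ⟩ := h
  have s := (SubOk.inst ha.left).scons hb.left
  refine ⟨_, hθ, .sig_intro hB ha.left hb.left, ?_⟩
  have e := eqTm_subst (hθ.sig_pair hα hβ) s
  have ea := ha.eq_act hα
  have eB := SubEq.scons (.refl (.id hθ.ctx)) hα.right (a := α.subst (scons a (sh 0))) (b := a')
    (by simpa using ea)
  have hβ' := (hβ.subst (.inst ha.left)).comp (by simpa using iso_of_subEq hB' eB)
  have eb := hb.eq_act hβ'
  refine .tm_trans (by simpa using e) (.sig_intro_eq (.ty_refl hα.right) (.ty_refl hB') ea ?_)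
  refine Der.conv_eq (by simpa using eb) (.ty_symm ?_)
  simpa using ty_substEq hB' eB

theorem TmI.lam (h : TyI Γ (.pi A B) (.pi A' B')) (hα : Iso Γ A A' α)
    (hb : TmI (A :: Γ) b B (b'.subst (scons α (sh 1))) (B'.subst (scons α (sh 1))))
    (hb' : IsTm (A' :: Γ) b' B') :
    TmI Γ (.lam A b) (.pi A B) (.lam A' b') (.pi A' B') := by
  obtain ⟨θ, hθ⟩ := h
  obtain ⟨γ, β, hγ, hβ, hB, e⟩ := hθ.pi_app
  have hl := Der.pi_intro hθ.left hb.left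
  refine ⟨θ, hθ, hl, ?_⟩
  have hf : IsTm Γ (θ.subst (scons (.lam A b) (sh 0))) (.pi A' B') := by
    simpa using hθ.act (.id hθ.ctx) (by simpa using hl)
  refine pi_ext hf (.pi_intro hθ.right hb') ?_
  have s1 := SubOk.sh_one (.ctx_cons hγ.left)
  have s : SubOk (A' :: Γ) (scons (.var 0) (scons ((Exp.lam A b).subst (sh 1)) (sh 1)))
      (A'.subst (sh 1) :: .pi A B :: Γ) :=
    (s1.scons (tm_subst hl s1)).scons (by simpa using tm_var_zero hγ.left)
  -- At a variable `x` of `A'`, with `f` the abstraction of `b`, the chain is `θ(f)(x) = β(f(γ(x)),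
  -- x) = β(b(γ(x)), x) = b'(x)`. Its last link holds because `b(γ(x))` corresponds to `b'(α(γ(x)))`
  -- and `α` cancels `γ`.
  have e1 := eqTm_subst e s
  have e2 := Der.pi_beta (ty_subst hθ.left s1) (tm_subst hb.left (s1.ups hγ.right)) hγ.tm
  have e3 := hβ.congr (.id (.ctx_cons hγ.left)) (by simpa using e2)
  have t1 := hb.subst hγ.subOk
  have t2 := TmI.of_subEq hb' (.scons (.refl s1) hγ.left (hγ.cancel hα))
  have t := t1.trans (by simpa using t2)
  have e4 := t.eq_act (by simpa using hβ)
  have e5 := Der.pi_beta (ty_subst hθ.right s1) (tm_subst hb' (s1.ups hγ.left))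
    (tm_var_zero hγ.left)
  refine .tm_trans (by simpa using e1) (.tm_trans (by simpa using e3) (.tm_trans (by simpa using e4) ?_))
  simpa using Der.tm_symm e5

/-- The domain component `γ` goes from `A'` to `A`. The argument `a` is first replaced by the equal
term `γ(a')`, and then the equation for the product isomorphism applies. -/
theorem TmI.app (hf : TmI Γ f (.pi A B) f' (.pi A' B')) (ha : TmI Γ a A a' A') :
    TmI Γ (.app f a) (B.subst (scons a (sh 0))) (.app f' a') (B'.subst (scons a' (sh 0))) := by
  obtain ⟨θ, hθ⟩ := hf.tyI
  obtain ⟨γ, β, hγ, hβ, hB, e⟩ := hθ.pi_app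
  have s0 := SubOk.id hθ.ctx
  have s : SubOk Γ (scons a' (scons f (sh 0))) (A'.subst (sh 1) :: .pi A B :: Γ) :=
    (SubOk.inst hf.left).scons (by simpa using ha.right)
  have e1 := eqTm_subst e s
  have e2 := Der.pi_elim_eq (hf.eq_act hθ) (.tm_refl ha.right)
  have e3 := ha.symm.eq_act hγ
  have e4 := Der.pi_elim_eq (.tm_refl hf.left) (.tm_symm e3)
  have e5 := ty_substEq hB (SubEq.inst (.tm_symm e3))
  have t1 := (TmI.of_eqTm e4).trans (.conv (eqTm_right e4) e5)
  have t2 := TmI.act hβ (.inst ha.right) (by simpa using Der.conv (eqTm_right e4) e5)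
  have t3 := (TmI.of_eqTm (.tm_symm (by simpa using e1))).trans (.of_eqTm e2)
  exact (t1.trans (by simpa using t2)).trans (by simpa using t3)

theorem TmI.nil (h : TyI Γ (.list A) (.list A')) :
    TmI Γ (.nil A) (.list A) (.nil A') (.list A') :=
  ⟨_, h.choose_spec, .list_nil h.list_inv.1, h.choose_spec.list_nil⟩

theorem TmI.cons (hs : TmI Γ s (.list A) s' (.list A')) (hc : TmI Γ c A c' A') :
    TmI Γ (.cons s c) (.list A) (.cons s' c') (.list A') := by
  obtain ⟨θ, hθ⟩ := hs.tyI
  obtain ⟨α, hα⟩ := hc.tyI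
  refine ⟨θ, hθ, .list_cons hs.left hc.left, ?_⟩
  have e := eqTm_subst (hθ.list_cons hα) ((SubOk.inst hs.left).scons (by simpa using hc.left))
  exact .tm_trans (by simpa using e) (.list_cons_eq (hs.eq_act hθ) (hc.eq_act hα))

theorem TmI.inl (h : TyI Γ (.sum A B) (.sum A' B')) (ha : TmI Γ a A a' A') :
    TmI Γ (.inl A B a) (.sum A B) (.inl A' B' a') (.sum A' B') := by
  obtain ⟨θ, hθ⟩ := h
  obtain ⟨α, hα⟩ := ha.tyI
  have h1 := tyInv hθ.left
  have h2 := tyInv hθ.right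
  refine ⟨θ, hθ, .sum_inl (.sum_form h1.1 h1.2) ha.left, ?_⟩
  have e := eqTm_subst (hθ.sum_inl hα) (.inst ha.left)
  exact .tm_trans (by simpa using e) (.sum_inl_eq (.ty_refl h2.1) (.ty_refl h2.2) (ha.eq_act hα))

theorem TmI.inr (h : TyI Γ (.sum A B) (.sum A' B')) (hb : TmI Γ b B b' B') :
    TmI Γ (.inr A B b) (.sum A B) (.inr A' B' b') (.sum A' B') := by
  obtain ⟨θ, hθ⟩ := h
  obtain ⟨β, hβ⟩ := hb.tyI
  have h1 := tyInv hθ.left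
  have h2 := tyInv hθ.right
  refine ⟨θ, hθ, .sum_inr (.sum_form h1.1 h1.2) hb.left, ?_⟩
  have e := eqTm_subst (hθ.sum_inr hβ) (.inst hb.left)
  exact .tm_trans (by simpa using e) (.sum_inr_eq (.ty_refl h2.1) (.ty_refl h2.2) (hb.eq_act hβ))

theorem TmI.qcl (h : TyI Γ (.quo A R) (.quo A' R')) (ha : TmI Γ a A a' A') :
    TmI Γ (.qcl A R a) (.quo A R) (.qcl A' R' a') (.quo A' R') := by
  obtain ⟨θ, hθ⟩ := h
  obtain ⟨α, hα⟩ := ha.tyI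
  have h1 := quoCond hθ.left
  have h2 := quoCond hθ.right
  refine ⟨θ, hθ, .quo_intro h1.form ha.left, ?_⟩
  have e := eqTm_subst (hθ.quo_qcl hα) (.inst ha.left)
  exact .tm_trans (by simpa using e) (.quo_intro_eq h2.form (.ty_refl h2.set)
    (.ty_refl (by simpa using h2.rel)) (ha.eq_act hα))

theorem TmI.pcl (h : TyI Γ φ ψ) (hφ : IsTy Γ φ .props) (hψ : IsTy Γ ψ .props) :
    TmI Γ (.pcl φ) .P1 (.pcl ψ) .P1 :=
  .of_eqTm (.P1_class_eq hφ hψ (h.prop (hφ.ty_prop (s := true))).2)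

theorem TmI.tru (h : TyI Γ φ ψ) (hφ : IsTrue Γ φ) : TmI Γ (.tru φ) φ (.tru ψ) ψ := by
  have h1 : IsTy Γ φ .prop := tmInv hφ
  have h2 := h.prop h1
  exact .of_prop h1 h hφ (tr_mp h1 h2.1 h2.2 hφ)

/-! ### Extensionality for corresponding terms -/

/-- Transporting `u` along the isomorphism of the target types reduces a correspondence to an
equality, for which ordinary extensionality is available. The other principles of this kind are
obtained in the same way. -/
theorem TmI.sig_ext (hu : IsTm (.sig A B :: Γ) u C) (hv : IsTm (.sig A B :: Γ) v C')
    (h : TyI (.sig A B :: Γ) C C')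
    (e : TmI (B :: A :: Γ) (u.subst (scons (pairV A B) (sh 2))) (C.subst (scons (pairV A B) (sh 2)))
      (v.subst (scons (pairV A B) (sh 2))) (C'.subst (scons (pairV A B) (sh 2)))) :
    TmI (.sig A B :: Γ) u C v C' := by
  obtain ⟨κ, hκ⟩ := h
  have hw := (TmI.act_id hκ hu).right
  have s := SubOk.pairV (tyInv (head_ty (ctx_of_tm hu))).2
  exact ⟨κ, hκ, hu, EmTT.sig_ext hw hv (by simpa using e.eq_act (hκ.subst s))⟩

theorem TmI.sum_ext (hu : IsTm (.sum A B :: Γ) u C) (hv : IsTm (.sum A B :: Γ) v C')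
    (h : TyI (.sum A B :: Γ) C C')
    (e : TmI (A :: Γ) (u.subst (scons (inlV A B) (sh 1))) (C.subst (scons (inlV A B) (sh 1)))
      (v.subst (scons (inlV A B) (sh 1))) (C'.subst (scons (inlV A B) (sh 1))))
    (e' : TmI (B :: Γ) (u.subst (scons (inrV A B) (sh 1))) (C.subst (scons (inrV A B) (sh 1)))
      (v.subst (scons (inrV A B) (sh 1))) (C'.subst (scons (inrV A B) (sh 1)))) :
    TmI (.sum A B :: Γ) u C v C' := by
  obtain ⟨κ, hκ⟩ := h
  have hw := (TmI.act_id hκ hu).right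
  have hi := tyInv (head_ty (ctx_of_tm hu))
  exact ⟨κ, hκ, hu, EmTT.sum_ext hw hv
    (by simpa using e.eq_act (hκ.subst (.inlV hi.1 hi.2)))
    (by simpa using e'.eq_act (hκ.subst (.inrV hi.1 hi.2)))⟩

theorem TmI.N0_ext (hu : IsTm (.N0 :: Γ) u C) (hv : IsTm (.N0 :: Γ) v C')
    (h : TyI (.N0 :: Γ) C C') : TmI (.N0 :: Γ) u C v C' := by
  obtain ⟨κ, hκ⟩ := h
  exact ⟨κ, hκ, hu, EmTT.N0_ext (TmI.act_id hκ hu).right hv⟩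

theorem TmI.N1_ext (hu : IsTm (.N1 :: Γ) u C) (hv : IsTm (.N1 :: Γ) v C')
    (h : TyI (.N1 :: Γ) C C')
    (e : TmI Γ (u.subst (scons .star (sh 0))) (C.subst (scons .star (sh 0)))
      (v.subst (scons .star (sh 0))) (C'.subst (scons .star (sh 0)))) :
    TmI (.N1 :: Γ) u C v C' := by
  obtain ⟨κ, hκ⟩ := h
  have hw := (TmI.act_id hκ hu).right
  have s := SubOk.inst (Der.N1_intro (T := .emTT) (tail_ctx (ctx_of_tm hu)))
  exact ⟨κ, hκ, hu, EmTT.N1_ext hw hv (by simpa using e.eq_act (hκ.subst s))⟩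

theorem TmI.list_ext (hu : IsTm (.list A :: Γ) u C) (hv : IsTm (.list A :: Γ) v C')
    (h : TyI (.list A :: Γ) C C')
    (e : TmI Γ (u.subst (scons (.nil A) (sh 0))) (C.subst (scons (.nil A) (sh 0)))
      (v.subst (scons (.nil A) (sh 0))) (C'.subst (scons (.nil A) (sh 0))))
    (e' : ∀ φ, IsCtx (listCtx Γ A φ) →
      TmI (listCtx Γ A φ) (u.subst (sh 2)) (C.subst (sh 2)) (v.subst (sh 2)) (C'.subst (sh 2)) →
      TmI (listCtx Γ A φ) (u.subst (scons (.cons (.var 2) (.var 1)) (sh 3)))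
        (C.subst (scons (.cons (.var 2) (.var 1)) (sh 3)))
        (v.subst (scons (.cons (.var 2) (.var 1)) (sh 3)))
        (C'.subst (scons (.cons (.var 2) (.var 1)) (sh 3)))) :
    TmI (.list A :: Γ) u C v C' := by
  obtain ⟨κ, hκ⟩ := h
  have hw := (TmI.act_id hκ hu).right
  have hA : IsTy Γ A .set := tyInv (head_ty (ctx_of_tm hu))
  refine ⟨κ, hκ, hu, EmTT.list_ext hw hv
    (by simpa using e.eq_act (hκ.subst (.inst (.list_nil hA)))) fun φ hφ ih => ?_⟩
  have s2 : SubOk (listCtx Γ A φ) (sh 2) (.list A :: Γ) := SubOk.sh_two hφ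
  have s3 : SubOk (listCtx Γ A φ) (scons (.cons (.var 2) (.var 1)) (sh 3)) (.list A :: Γ) := by
    simpa using (SubOk.consV hA).comp (.sh_one hφ)
  have t := e' φ hφ ⟨_, hκ.subst s2, tm_subst hu s2, by simpa using ih⟩
  simpa using t.eq_act (hκ.subst s3)

theorem TmI.quo_ext (hu : IsTm (.quo A R :: Γ) u C) (hv : IsTm (.quo A R :: Γ) v C')
    (h : TyI (.quo A R :: Γ) C C')
    (e : TmI (A :: Γ) (u.subst (scons (qclV A R) (sh 1))) (C.subst (scons (qclV A R) (sh 1)))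
      (v.subst (scons (qclV A R) (sh 1))) (C'.subst (scons (qclV A R) (sh 1)))) :
    TmI (.quo A R :: Γ) u C v C' := by
  obtain ⟨κ, hκ⟩ := h
  have hw := (TmI.act_id hκ hu).right
  have s := SubOk.qclV (quoCond (head_ty (ctx_of_tm hu))).form
  exact ⟨κ, hκ, hu, EmTT.quo_ext hw hv (by simpa using e.eq_act (hκ.subst s))⟩

/-! ### Elimination terms -/

/-- Reduction of a congruence between eliminators to the generic element. -/
theorem TmI.of_generic (_ : IsTm (A :: Γ) u C) (hδ : Iso Γ A A' δ) (hd : TmI Γ d A d' A')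
    (h : TmI (A :: Γ) u C (v.subst (scons δ (sh 1))) (C'.subst (scons δ (sh 1))))
    (hv : IsTm (A' :: Γ) v C') :
    TmI Γ (u.subst (scons d (sh 0))) (C.subst (scons d (sh 0))) (v.subst (scons d' (sh 0)))
      (C'.subst (scons d' (sh 0))) := by
  have t1 := h.subst (.inst hd.left)
  have t2 := TmI.of_subEq hv (.inst (hd.eq_act hδ))
  exact t1.trans (by simpa using t2)

/-- The pattern for all eliminators: apply each of them to the last variable of a context extended
by its own domain, compare the results there by extensionality, and instantiate by `TmI.of_generic`.
-/
theorem TmI.emp (hc : TmI Γ c .N0 c' .N0) (hM' : IsTy (.N0 :: Γ) M' .col)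
    (h : TyI (.N0 :: Γ) M M') :
    TmI Γ (.emp M c) (M.subst (scons c (sh 0))) (.emp M' c') (M'.subst (scons c' (sh 0))) := by
  have h0 := hc.tyI.left
  have key : ∀ {M}, IsTy (.N0 :: Γ) M .col →
      IsTm (.N0 :: Γ) (.emp (M.subst (ups (sh 1))) (.var 0)) M := by
    intro M hM
    simpa using Der.N0_elim (ty_subst hM ((SubOk.sh_one (.ctx_cons h0)).ups h0)) (tm_var_zero h0)
  have t := TmI.N0_ext (key h.left) (key hM') h
  simpa using TmI.of_generic (key h.left) (.refl h0) hc (by simpa using t) (key hM')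

theorem TmI.elN1 (hd : TmI Γ d .N1 d' .N1) (h : TyI (.N1 :: Γ) M M')
    (hc : TmI Γ c (M.subst (scons .star (sh 0))) c' (M'.subst (scons .star (sh 0)))) :
    TmI Γ (.elN1 M d c) (M.subst (scons d (sh 0))) (.elN1 M' d' c') (M'.subst (scons d' (sh 0))) := by
  have h0 := hd.tyI.left
  have key : ∀ {M c}, IsTy (.N1 :: Γ) M .col → IsTm Γ c (M.subst (scons .star (sh 0))) →
      IsTm (.N1 :: Γ) (.elN1 (M.subst (ups (sh 1))) (.var 0) (c.subst (sh 1))) M := by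
    intro M c hM hc
    have s := SubOk.sh_one (.ctx_cons h0)
    simpa using Der.N1_elim (ty_subst hM (s.ups h0)) (tm_var_zero h0)
      (c := c.subst (sh 1)) (by simpa using tm_subst hc s)
  have t1 := TmI.of_eqTm (Der.N1_beta h.left hc.left)
  have t2 := TmI.of_eqTm (Der.N1_beta h.right hc.right)
  have t := TmI.N1_ext (key h.left hc.left) (key h.right hc.right) h
    (by simpa using (t1.trans hc).trans t2.symm)
  simpa using TmI.of_generic (key h.left hc.left) (.refl h0) hd (by simpa using t) (key h.right hc.right)

theorem tm_elSig (hM : IsTy (.sig A B :: Γ) M .col)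
    (hm : IsTm (B :: A :: Γ) m (M.subst (scons (pairV A B) (sh 2)))) :
    IsTm (.sig A B :: Γ) (.elSig (A.subst (sh 1)) (B.subst (ups (sh 1))) (M.subst (ups (sh 1)))
      (.var 0) (m.subst (ups (ups (sh 1))))) M := by
  have h0 := head_ty (ctx_of_ty hM)
  have hi := tyInv h0
  have s := SubOk.sh_one (.ctx_cons h0)
  have := Der.sig_elim (m := m.subst (ups (ups (sh 1)))) (ty_subst hM (s.ups h0)) (tm_var_zero h0)
    (by simpa using tm_subst hm ((s.ups hi.1).ups hi.2))
  simpa using this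

/-- On the generic pair both eliminators compute to their branches, since `δ` sends that pair to the
pair of the images (`Iso.sig_pair`). What remains to be compared are the branches, and this is the
hypothesis `hm`. -/
theorem TmI.elSig (hδ : Iso Γ (.sig A B) (.sig A' B') δ) (hα : Iso Γ A A' α)
    (hβ : Iso (A :: Γ) B (B'.subst (scons α (sh 1))) β)
    (hM : TyI (.sig A B :: Γ) M (M'.subst (scons δ (sh 1)))) (hM' : IsTy (.sig A' B' :: Γ) M' .col)
    (hd : TmI Γ d (.sig A B) d' (.sig A' B'))
    (hm : TmI (B :: A :: Γ) m (M.subst (scons (pairV A B) (sh 2)))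
      (m'.subst (scons β (scons (α.subst (sh 1)) (sh 2))))
      ((M'.subst (scons (pairV A' B') (sh 2))).subst (scons β (scons (α.subst (sh 1)) (sh 2)))))
    (hm' : IsTm (B' :: A' :: Γ) m' (M'.subst (scons (pairV A' B') (sh 2)))) :
    TmI Γ (.elSig A B M d m) (M.subst (scons d (sh 0))) (.elSig A' B' M' d' m')
      (M'.subst (scons d' (sh 0))) := by
  have hu := tm_elSig hM.left hm.left
  have hv := tm_elSig hM' hm'
  have hB' := (tyInv hδ.right).2
  have hc := Der.ctx_cons hβ.left
  have s1 := SubOk.sh_one hc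
  have s2 := SubOk.sh_two hc
  have ha : IsTm (B :: A :: Γ) (α.subst (sh 1)) (A'.subst (sh 2)) := by
    simpa using tm_subst hα.tm s1
  have hb : IsTm (B :: A :: Γ) β (B'.subst (scons (α.subst (sh 1)) (sh 2))) := by
    simpa using hβ.tm
  have t : TmI (.sig A B :: Γ) _ M _ (M'.subst (scons δ (sh 1))) :=
    TmI.sig_ext hu (tm_subst hv hδ.subOk) hM <| by
      have s := (s2.scons (tm_var_one hc)).scons (a := .var 0) (by simpa using tm_var_zero hβ.left)
      have h1 := Der.sig_beta (a := .var 1) (b := .var 0) (ty_subst hM.left (s2.ups hδ.left))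
        (tm_var_one hc) (by simpa using tm_var_zero hβ.left)
        (m := m.subst (ups (ups (sh 2)))) (by simpa using tm_subst hm.left ((s2.ups hα.left).ups hβ.left))
      have h2 := Der.sig_beta (ty_subst hM' (s2.ups hδ.right)) ha (b := β) (by simpa using hb)
        (m := m'.subst (ups (ups (sh 2)))) (by simpa using tm_subst hm' ((s2.ups hα.right).ups hB'))
      have e := hδ.sig_pair hα hβ
      have h3 := TmI.of_subEq hv (SubEq.scons (.refl s2) hδ.right e)
      have t1 := TmI.of_eqTm h1
      have t2 := TmI.of_eqTm h2
      have t3 : TmI (B :: A :: Γ) _ _ _ _ := TmI.trans (by simpa using t1) (by simpa using hm)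
      have t4 : TmI (B :: A :: Γ) _ _ _ _ := t3.trans (by simpa using t2.symm)
      simpa using t4.trans (by simpa using h3.symm)
  simpa using TmI.of_generic hu hδ hd (by simpa using t) hv

theorem tm_elSum (hM : IsTy (.sum A B :: Γ) M .col)
    (ha : IsTm (A :: Γ) a (M.subst (scons (inlV A B) (sh 1))))
    (hb : IsTm (B :: Γ) b (M.subst (scons (inrV A B) (sh 1)))) :
    IsTm (.sum A B :: Γ) (.elSum (A.subst (sh 1)) (B.subst (sh 1)) (M.subst (ups (sh 1)))
      (.var 0) (a.subst (ups (sh 1))) (b.subst (ups (sh 1)))) M := by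
  have h0 := head_ty (ctx_of_ty hM)
  have hi := tyInv h0
  have s := SubOk.sh_one (.ctx_cons h0)
  have := Der.sum_elim (a := a.subst (ups (sh 1))) (b := b.subst (ups (sh 1)))
    (ty_subst hM (s.ups h0)) (tm_var_zero h0)
    (by simpa using tm_subst ha (s.ups hi.1)) (by simpa using tm_subst hb (s.ups hi.2))
  simpa using this

theorem TmI.elSum (hδ : Iso Γ (.sum A B) (.sum A' B') δ) (hα : Iso Γ A A' α) (hβ : Iso Γ B B' β)
    (hM : TyI (.sum A B :: Γ) M (M'.subst (scons δ (sh 1)))) (hM' : IsTy (.sum A' B' :: Γ) M' .col)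
    (hd : TmI Γ d (.sum A B) d' (.sum A' B'))
    (ha : TmI (A :: Γ) a (M.subst (scons (inlV A B) (sh 1))) (a'.subst (scons α (sh 1)))
      ((M'.subst (scons (inlV A' B') (sh 1))).subst (scons α (sh 1))))
    (ha' : IsTm (A' :: Γ) a' (M'.subst (scons (inlV A' B') (sh 1))))
    (hb : TmI (B :: Γ) b (M.subst (scons (inrV A B) (sh 1))) (b'.subst (scons β (sh 1)))
      ((M'.subst (scons (inrV A' B') (sh 1))).subst (scons β (sh 1))))
    (hb' : IsTm (B' :: Γ) b' (M'.subst (scons (inrV A' B') (sh 1)))) :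
    TmI Γ (.elSum A B M d a b) (M.subst (scons d (sh 0))) (.elSum A' B' M' d' a' b')
      (M'.subst (scons d' (sh 0))) := by
  have hu := tm_elSum hM.left ha.left hb.left
  have hv := tm_elSum hM' ha' hb'
  have hi := tyInv hδ.left
  have hi' := tyInv hδ.right
  have t := TmI.sum_ext hu (tm_subst hv hδ.subOk) hM ?_ ?_
  · simpa using TmI.of_generic hu hδ hd (by simpa using t) hv
  · have s := SubOk.sh_one (.ctx_cons hα.left)
    have h1 := Der.sum_beta_inl (ty_subst hM.left (s.ups hδ.left)) (tm_var_zero hi.1)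
      (a := a.subst (ups (sh 1))) (b := b.subst (ups (sh 1)))
      (by simpa using tm_subst ha.left (s.ups hi.1)) (by simpa using tm_subst hb.left (s.ups hi.2))
    have h2 := Der.sum_beta_inl (ty_subst hM' (s.ups hδ.right)) hα.tm
      (a := a'.subst (ups (sh 1))) (b := b'.subst (ups (sh 1)))
      (by simpa using tm_subst ha' (s.ups hi'.1)) (by simpa using tm_subst hb' (s.ups hi'.2))
    have h3 := TmI.of_subEq hv (SubEq.scons (.refl s) hδ.right (hδ.sum_inl hα))
    have t3 : TmI (A :: Γ) _ _ _ _ :=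
      TmI.trans (by simpa using TmI.of_eqTm h1) (by simpa using ha)
    have t4 : TmI (A :: Γ) _ _ _ _ := t3.trans (by simpa using (TmI.of_eqTm h2).symm)
    simpa using t4.trans (by simpa using h3.symm)
  · have s := SubOk.sh_one (.ctx_cons hβ.left)
    have h1 := Der.sum_beta_inr (ty_subst hM.left (s.ups hδ.left)) (tm_var_zero hi.2)
      (a := a.subst (ups (sh 1))) (b := b.subst (ups (sh 1)))
      (by simpa using tm_subst ha.left (s.ups hi.1)) (by simpa using tm_subst hb.left (s.ups hi.2))
    have h2 := Der.sum_beta_inr (ty_subst hM' (s.ups hδ.right)) hβ.tm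
      (a := a'.subst (ups (sh 1))) (b := b'.subst (ups (sh 1)))
      (by simpa using tm_subst ha' (s.ups hi'.1)) (by simpa using tm_subst hb' (s.ups hi'.2))
    have h3 := TmI.of_subEq hv (SubEq.scons (.refl s) hδ.right (hδ.sum_inr hβ))
    have t3 : TmI (B :: Γ) _ _ _ _ :=
      TmI.trans (by simpa using TmI.of_eqTm h1) (by simpa using hb)
    have t4 : TmI (B :: Γ) _ _ _ _ := t3.trans (by simpa using (TmI.of_eqTm h2).symm)
    simpa using t4.trans (by simpa using h3.symm)

theorem tm_elQ (hL : IsTy (.quo A R :: Γ) L .col)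
    (hl : IsTm (A :: Γ) l (L.subst (scons (qclV A R) (sh 1)))) (hr : QuoResp Γ A R L l) :
    IsTm (.quo A R :: Γ) (.elQ (A.subst (sh 1)) (R.subst (ups (ups (sh 1)))) (L.subst (ups (sh 1)))
      (.var 0) (l.subst (ups (sh 1)))) L := by
  have h0 := head_ty (ctx_of_ty hL)
  have hQ := quoCond h0
  have s := SubOk.sh_one (.ctx_cons h0)
  have := Der.quo_elim (l := l.subst (ups (sh 1)))
    (ty_subst hL (s.ups h0)) (tm_var_zero h0)
    (by simpa using tm_subst hl (s.ups hQ.set))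
    (by simpa using eqTm_subst hr ((s.ups_ups hQ.set).ups hQ.rel))
  simpa using this

/-- The respect conditions `hr` and `hr'` are assumed because the typing of the branches does not
imply them; without them neither eliminator could be formed over the generic element. -/
theorem TmI.elQ (hδ : Iso Γ (.quo A R) (.quo A' R') δ) (hα : Iso Γ A A' α)
    (hL : TyI (.quo A R :: Γ) L (L'.subst (scons δ (sh 1)))) (hL' : IsTy (.quo A' R' :: Γ) L' .col)
    (hd : TmI Γ d (.quo A R) d' (.quo A' R'))
    (hl : TmI (A :: Γ) l (L.subst (scons (qclV A R) (sh 1))) (l'.subst (scons α (sh 1)))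
      ((L'.subst (scons (qclV A' R') (sh 1))).subst (scons α (sh 1))))
    (hl' : IsTm (A' :: Γ) l' (L'.subst (scons (qclV A' R') (sh 1))))
    (hr : QuoResp Γ A R L l) (hr' : QuoResp Γ A' R' L' l') :
    TmI Γ (.elQ A R L d l) (L.subst (scons d (sh 0))) (.elQ A' R' L' d' l')
      (L'.subst (scons d' (sh 0))) := by
  have hu := tm_elQ hL.left hl.left hr
  have hv := tm_elQ hL' hl' hr'
  have hQ := quoCond hδ.left
  have hQ' := quoCond hδ.right
  have s := SubOk.sh_one (.ctx_cons hα.left)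
  have t := TmI.quo_ext hu (tm_subst hv hδ.subOk) hL <| by
    have h1 := Der.quo_beta (ty_subst hL.left (s.ups hδ.left)) (tm_var_zero hQ.set)
      (l := l.subst (ups (sh 1)))
      (by simpa using tm_subst hl.left (s.ups hQ.set))
      (by simpa using eqTm_subst hr ((s.ups_ups hQ.set).ups hQ.rel))
    have h2 := Der.quo_beta (ty_subst hL' (s.ups hδ.right)) hα.tm
      (l := l'.subst (ups (sh 1)))
      (by simpa using tm_subst hl' (s.ups hQ'.set))
      (by simpa using eqTm_subst hr' ((s.ups_ups hQ'.set).ups hQ'.rel))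
    have h3 := TmI.of_subEq hv (SubEq.scons (.refl s) hδ.right (hδ.quo_qcl hα))
    have t3 : TmI (A :: Γ) _ _ _ _ :=
      TmI.trans (by simpa using TmI.of_eqTm h1) (by simpa using hl)
    have t4 : TmI (A :: Γ) _ _ _ _ := t3.trans (by simpa using (TmI.of_eqTm h2).symm)
    simpa using t4.trans (by simpa using h3.symm)
  simpa using TmI.of_generic hu hδ hd (by simpa using t) hv

theorem tm_elList (hL : IsTy (.list A :: Γ) L .col)
    (ha : IsTm Γ a (L.subst (scons (.nil A) (sh 0))))
    (hl : IsTm (listCtx Γ A L) l (L.subst (scons (.cons (.var 2) (.var 1)) (sh 3)))) :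
    IsTm (.list A :: Γ) (.elList (A.subst (sh 1)) (L.subst (ups (sh 1))) (.var 0) (a.subst (sh 1))
      (l.subst (ups (ups (ups (sh 1)))))) L := by
  have h0 := head_ty (ctx_of_ty hL)
  have s := SubOk.sh_one (.ctx_cons h0)
  have hc := ctx_of_tm hl
  have s3 := ((s.ups h0).ups (head_ty (tail_ctx hc))).ups (head_ty hc)
  have := Der.list_elim (a := a.subst (sh 1)) (l := l.subst (ups (ups (ups (sh 1)))))
    (ty_subst hL (s.ups h0)) (tm_var_zero h0)
    (by simpa using tm_subst ha s) (by simpa using tm_subst hl s3)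
  simpa using this

/-- The action of canonical isomorphisms on the context of the inductive step of a list
eliminator. -/
abbrev listAct (α δ κ : Tm) : Sub :=
  scons (κ.subst (scons (.var 0) (sh 2))) (scons (α.subst (scons (.var 1) (sh 3)))
    (scons (δ.subst (scons (.var 2) (sh 3))) (sh 3)))

attribute [simp] listAct

/-- The comparison over the generic list is by induction. The branches are assumed to correspond
along `listAct`, in which `κ` acts on the recursive value. -/
theorem TmI.elList (hδ : Iso Γ (.list A) (.list A') δ) (hα : Iso Γ A A' α)
    (hκ : Iso (.list A :: Γ) L (L'.subst (scons δ (sh 1))) κ) (hL' : IsTy (.list A' :: Γ) L' .col)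
    (hd : TmI Γ d (.list A) d' (.list A'))
    (ha : TmI Γ a (L.subst (scons (.nil A) (sh 0))) a' (L'.subst (scons (.nil A') (sh 0))))
    (hl : TmI (listCtx Γ A L) l (L.subst (scons (.cons (.var 2) (.var 1)) (sh 3)))
      (l'.subst (listAct α δ κ))
      ((L'.subst (scons (.cons (.var 2) (.var 1)) (sh 3))).subst (listAct α δ κ)))
    (hl' : IsTm (listCtx Γ A' L') l' (L'.subst (scons (.cons (.var 2) (.var 1)) (sh 3)))) :
    TmI Γ (.elList A L d a l) (L.subst (scons d (sh 0))) (.elList A' L' d' a' l')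
      (L'.subst (scons d' (sh 0))) := by
  have hu := tm_elList hκ.left ha.left hl.left
  have hv := tm_elList hL' ha.right hl'
  have hA : IsTy Γ A .set := tyInv hδ.left
  have hA' : IsTy Γ A' .set := tyInv hδ.right
  have t := TmI.list_ext hu (tm_subst hv hδ.subOk) ⟨_, hκ⟩ ?_ ?_
  · simpa using TmI.of_generic hu hδ hd (by simpa using t) hv
  · have h1 := Der.list_beta_nil hκ.left ha.left (by simpa using hl.left)
    have h2 := Der.list_beta_nil hL' ha.right (by simpa using hl')
    have h3 := TmI.of_subEq hv (SubEq.scons (.refl (.id hδ.ctx)) hδ.right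
      (by simpa using hδ.list_nil))
    have t3 : TmI Γ _ _ _ _ :=
      TmI.trans (by simpa using TmI.of_eqTm h1) (by simpa using ha)
    have t4 : TmI Γ _ _ _ _ := t3.trans (by simpa using (TmI.of_eqTm h2).symm)
    simpa using t4.trans (by simpa using h3.symm)
  · intro φ hc ih
    have s2 : SubOk (listCtx Γ A φ) (sh 2) (.list A :: Γ) := .sh_two hc
    have s3 : SubOk (listCtx Γ A φ) (sh 3) Γ := .sh_three hc
    have v2 := tm_var_two hc
    have v1 : IsTm (listCtx Γ A φ) (.var 1) (A.subst (sh 3)) := by simpa using tm_var_one hc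
    have c3 := ctx_of_tm hl.left
    have c3' := ctx_of_tm hl'
    have z := tm_subst hu s2
    have su : SubOk (listCtx Γ A φ) _ (listCtx Γ A L) :=
      ((s3.scons v2).scons (a := .var 1) (by simpa using v1)).scons (by simpa using z)
    have w2 := hδ.act s3 v2
    have w1 := hα.act s3 v1
    -- The induction hypothesis read along `κ`: the recursive value of the left eliminator is sent
    -- to the one of the right eliminator, so that the branches are compared at matching arguments.
    have ez := ih.eq_act (by simpa using hκ.subst s2)
    have s3' : ∀ {A L}, IsCtx (listCtx Γ A L) → SubOk _ _ (listCtx Γ A L) := fun c =>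
      ((s3.ups (head_ty (tail_ctx (tail_ctx c)))).ups (head_ty (tail_ctx c))).ups (head_ty c)
    have h1 := Der.list_beta_cons (s := .var 2) (c := .var 1) (a := a.subst (sh 3))
      (l := l.subst (ups (ups (ups (sh 3)))))
      (ty_subst hκ.left (s3.ups hδ.left)) v2 v1 (by simpa using tm_subst ha.left s3)
      (by simpa using tm_subst hl.left (s3' c3))
    have h2 := Der.list_beta_cons (a := a'.subst (sh 3))
      (l := l'.subst (ups (ups (ups (sh 3)))))
      (ty_subst hL' (s3.ups hδ.right)) w2 w1 (by simpa using tm_subst ha.right s3)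
      (by simpa using tm_subst hl' (s3' c3'))
    have s12 : SubOk (listCtx Γ A φ) (scons (.var 1) (scons (.var 2) (sh 3)))
        (A.subst (sh 1) :: .list A :: Γ) := (s3.scons v2).scons (by simpa using v1)
    have ec := eqTm_subst (hδ.list_cons hα) s12
    have h3 := TmI.of_subEq hv (SubEq.scons (.refl s3) hδ.right (by simpa using ec))
    have hl1 := hl.subst su
    have h4 := TmI.of_subEq hl' (SubEq.scons (A := L'.subst (sh 1))
      (.refl ((s3.scons w2).scons (by simpa using w1))) (head_ty c3') (by simpa using ez))
    have t3 : TmI (listCtx Γ A φ) _ _ _ _ :=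
      TmI.trans (by simpa using TmI.of_eqTm h1) (by simpa using hl1)
    have t4 : TmI (listCtx Γ A φ) _ _ _ _ := t3.trans (by simpa using h4)
    have t5 : TmI (listCtx Γ A φ) _ _ _ _ := t4.trans (by simpa using (TmI.of_eqTm h2).symm)
    simpa using t5.trans (by simpa using h3.symm)

/-! ## The interpretation described by representatives -/

/-- Interpretations in a fixed context: types, respectively terms with their types. -/
@[reducible] def Out : Srt → Type
  | .ty => Ty
  | .tm => Tm × Ty

/-- `rel e Γ X`: over the `emTT`-context `Γ`, the expression `e` is interpreted by `X`. -/
def rel : {s : Srt} → Exp s → Ctx → Out s → Prop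
  | _, .N0, Γ, X => TyI Γ .N0 X
  | _, .N1, Γ, X => TyI Γ .N1 X
  | _, .P1, Γ, X => TyI Γ .P1 X
  | _, .sig A B, Γ, X => ∃ A' B', rel A Γ A' ∧ rel B (A' :: Γ) B' ∧ TyI Γ (.sig A' B') X
  | _, .pi A B, Γ, X => ∃ A' B', rel A Γ A' ∧ rel B (A' :: Γ) B' ∧ TyI Γ (.pi A' B') X
  | _, .sum A B, Γ, X => ∃ A' B', rel A Γ A' ∧ rel B Γ B' ∧ TyI Γ (.sum A' B') X
  | _, .list A, Γ, X => ∃ A', rel A Γ A' ∧ TyI Γ (.list A') X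
  | _, .quo A R, Γ, X => ∃ A' R', rel A Γ A' ∧ rel R (A'.subst (sh 1) :: A' :: Γ) R' ∧
      TyI Γ (.quo A' R') X
  | _, .bot, Γ, X => TyI Γ .bot X
  | _, .and φ ψ, Γ, X => ∃ φ' ψ', rel φ Γ φ' ∧ rel ψ Γ ψ' ∧ TyI Γ (.and φ' ψ') X
  | _, .or φ ψ, Γ, X => ∃ φ' ψ', rel φ Γ φ' ∧ rel ψ Γ ψ' ∧ TyI Γ (.or φ' ψ') X
  | _, .imp φ ψ, Γ, X => ∃ φ' ψ', rel φ Γ φ' ∧ rel ψ Γ ψ' ∧ TyI Γ (.imp φ' ψ') X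
  | _, .ex A φ, Γ, X => ∃ A' φ', rel A Γ A' ∧ rel φ (A' :: Γ) φ' ∧ TyI Γ (.ex A' φ') X
  | _, .all A φ, Γ, X => ∃ A' φ', rel A Γ A' ∧ rel φ (A' :: Γ) φ' ∧ TyI Γ (.all A' φ') X
  | _, .eq A a b, Γ, X => ∃ A' a' b', rel A Γ A' ∧ rel a Γ (a', A') ∧ rel b Γ (b', A') ∧
      TyI Γ (.eq A' a' b') X
  | _, .var n, Γ, X => ∃ A', Γ[n]? = some A' ∧ TmI Γ (.var n) (A'.subst (sh (n + 1))) X.1 X.2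
  | _, .tru φ, Γ, X => ∃ φ', rel φ Γ φ' ∧ TmI Γ (.tru φ') φ' X.1 X.2
  | _, .emp M c, Γ, X => ∃ M' c', rel M (.N0 :: Γ) M' ∧ rel c Γ (c', .N0) ∧
      TmI Γ (.emp M' c') (M'.subst (scons c' (sh 0))) X.1 X.2
  | _, .star, Γ, X => TmI Γ .star .N1 X.1 X.2
  | _, .elN1 M t c, Γ, X => ∃ M' t' c', rel M (.N1 :: Γ) M' ∧ rel t Γ (t', .N1) ∧
      rel c Γ (c', M'.subst (scons .star (sh 0))) ∧
      TmI Γ (.elN1 M' t' c') (M'.subst (scons t' (sh 0))) X.1 X.2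
  | _, .pair A B a b, Γ, X => ∃ A' B' a' b', rel A Γ A' ∧ rel B (A' :: Γ) B' ∧ rel a Γ (a', A') ∧
      rel b Γ (b', B'.subst (scons a' (sh 0))) ∧
      TmI Γ (.pair A' B' a' b') (.sig A' B') X.1 X.2
  | _, .elSig A B M d m, Γ, X => ∃ A' B' M' d' m', rel A Γ A' ∧ rel B (A' :: Γ) B' ∧
      rel M (.sig A' B' :: Γ) M' ∧ rel d Γ (d', .sig A' B') ∧
      rel m (B' :: A' :: Γ) (m', M'.subst (scons (pairV A' B') (sh 2))) ∧
      TmI Γ (.elSig A' B' M' d' m') (M'.subst (scons d' (sh 0))) X.1 X.2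
  | _, .lam A b, Γ, X => ∃ A' B' b', rel A Γ A' ∧ rel b (A' :: Γ) (b', B') ∧
      TmI Γ (.lam A' b') (.pi A' B') X.1 X.2
  | _, .app f a, Γ, X => ∃ A' B' f' a', rel f Γ (f', .pi A' B') ∧ rel a Γ (a', A') ∧
      TmI Γ (.app f' a') (B'.subst (scons a' (sh 0))) X.1 X.2
  | _, .nil A, Γ, X => ∃ A', rel A Γ A' ∧ TmI Γ (.nil A') (.list A') X.1 X.2
  | _, .cons s c, Γ, X => ∃ A' s' c', rel s Γ (s', .list A') ∧ rel c Γ (c', A') ∧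
      TmI Γ (.cons s' c') (.list A') X.1 X.2
  | _, .elList A L s a l, Γ, X => ∃ A' L' s' a' l', rel A Γ A' ∧ rel L (.list A' :: Γ) L' ∧
      rel s Γ (s', .list A') ∧ rel a Γ (a', L'.subst (scons (.nil A') (sh 0))) ∧
      rel l (listCtx Γ A' L') (l', L'.subst (scons (.cons (.var 2) (.var 1)) (sh 3))) ∧
      TmI Γ (.elList A' L' s' a' l') (L'.subst (scons s' (sh 0))) X.1 X.2
  | _, .inl A B a, Γ, X => ∃ A' B' a', rel A Γ A' ∧ rel B Γ B' ∧ rel a Γ (a', A') ∧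
      TmI Γ (.inl A' B' a') (.sum A' B') X.1 X.2
  | _, .inr A B b, Γ, X => ∃ A' B' b', rel A Γ A' ∧ rel B Γ B' ∧ rel b Γ (b', B') ∧
      TmI Γ (.inr A' B' b') (.sum A' B') X.1 X.2
  | _, .elSum A B M w a b, Γ, X => ∃ A' B' M' w' a' b', rel A Γ A' ∧ rel B Γ B' ∧
      rel M (.sum A' B' :: Γ) M' ∧ rel w Γ (w', .sum A' B') ∧
      rel a (A' :: Γ) (a', M'.subst (scons (inlV A' B') (sh 1))) ∧
      rel b (B' :: Γ) (b', M'.subst (scons (inrV A' B') (sh 1))) ∧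
      TmI Γ (.elSum A' B' M' w' a' b') (M'.subst (scons w' (sh 0))) X.1 X.2
  | _, .qcl A R a, Γ, X => ∃ A' R' a', rel A Γ A' ∧ rel R (A'.subst (sh 1) :: A' :: Γ) R' ∧
      rel a Γ (a', A') ∧ TmI Γ (.qcl A' R' a') (.quo A' R') X.1 X.2
  | _, .elQ A R L p l, Γ, X => ∃ A' R' L' p' l', rel A Γ A' ∧
      rel R (A'.subst (sh 1) :: A' :: Γ) R' ∧ rel L (.quo A' R' :: Γ) L' ∧
      rel p Γ (p', .quo A' R') ∧ rel l (A' :: Γ) (l', L'.subst (scons (qclV A' R') (sh 1))) ∧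
      TmI Γ (.elQ A' R' L' p' l') (L'.subst (scons p' (sh 0))) X.1 X.2
  | _, .pcl φ, Γ, X => ∃ φ', rel φ Γ φ' ∧ TmI Γ (.pcl φ') .P1 X.1 X.2

/-- In every clause of `rel` the representative `X` occurs only in the last conjunct, which is
closed under composition. The tactic removes the rest and composes there. -/
theorem rel_ty_trans {A : Ty} : rel A Γ B → TyI Γ B C → rel A Γ C := by
  intro h e
  revert h
  cases A <;> simp only [rel] <;> (repeat with_reducible refine Exists.imp fun _ => ?_) <;>
    (repeat with_reducible refine And.imp_right ?_) <;> exact fun h => h.trans e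

theorem rel_tm_trans {t : Tm} : rel t Γ (a, A) → TmI Γ a A b B → rel t Γ (b, B) := by
  intro h e
  revert h
  cases t <;> simp only [rel] <;> (repeat with_reducible refine Exists.imp fun _ => ?_) <;>
    (repeat with_reducible refine And.imp_right ?_) <;> exact fun h => h.trans e

theorem rel_ty_der {A : Ty} (h : rel A Γ B) : IsTy Γ B .col := by
  revert h
  cases A <;> simp only [rel, forall_exists_index, and_imp] <;> intros <;> exact TyI.right ‹_›

theorem rel_tm_der {t : Tm} (h : rel t Γ (a, A)) : IsTm Γ a A := by
  revert h
  cases t <;> simp only [rel, forall_exists_index, and_imp] <;> intros <;>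
    exact TmI.right ‹_›

/-! ### Matching of equivalence classes -/

/-- Equality of classes provides some isomorphism of contexts; uniqueness allows the prescribed `ρ`
in its place. -/
theorem TyI.of_cls (hρ : CtxI Γ Δ ρ) (h : tyCls Γ A = tyCls Δ B) (hB : IsTy Δ B .col) :
    TyI Γ A (B.subst ρ) := by
  obtain ⟨σ, h1, _, h3⟩ := tyRel_iff.1 ((tyCls_eq_iff hB).1 h)
  exact h3.trans (.of_subEq hB (h1.unique hρ))

theorem TmI.of_cls (hρ : CtxI Γ Δ ρ) (h : tmCls Γ a A = tmCls Δ b B) (hb : IsTm Δ b B) :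
    TmI Γ a A (b.subst ρ) (B.subst ρ) := by
  obtain ⟨σ, h1, _, h3⟩ := tmRel_iff.1 ((tmCls_eq_iff hb).1 h)
  exact h3.trans (.of_subEq hb (h1.unique hρ))

theorem ctxI_of_tyCls (h : tyCls Γ A = tyCls Δ B) (hB : IsTy Δ B .col) : ∃ ρ, CtxI Γ Δ ρ := by
  obtain ⟨σ, h1, _, h3⟩ := tyRel_iff.1 ((tyCls_eq_iff hB).1 h)
  exact ⟨σ, h1⟩

theorem ctxI_of_tmCls (h : tmCls Γ a A = tmCls Δ b B) (hb : IsTm Δ b B) : ∃ ρ, CtxI Γ Δ ρ := by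
  obtain ⟨σ, h1, _, h3⟩ := tmRel_iff.1 ((tmCls_eq_iff hb).1 h)
  exact ⟨σ, h1⟩

theorem CtxI.cons_inv (h : CtxI (A :: Γ) (B :: Δ) σ) :
    ∃ ρ α, CtxI Γ Δ ρ ∧ IsTy Δ B .col ∧ Iso Γ A (B.subst ρ) α ∧
      CtxI (A :: Γ) (B :: Δ) (scons α (cmp ρ (sh 1))) := by
  obtain ⟨ρ, α, h1, h2, h3, _⟩ := h.inv
  exact ⟨ρ, α, h1, h2, h3, h1.cons h2 h3⟩

/-- A judgement built from arbitrarily chosen representatives is compared with the one built from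
the fixed representatives along `ρ`. The premise of `h` comes for free, because membership in a
class includes derivability of the judgement that generates it. -/
theorem mem_tyCls {K : TyJ} (hX : TyI Γ A C) (hρ : CtxI Γ Δ ρ) (hK : K ∈ tyCls Δ B)
    (h : IsTy Δ B .col → TyI Γ A (B.subst ρ)) : K ∈ tyCls Γ C :=
  TyRel.trans (tyRel_iff.2 ⟨ρ, hρ, hK.1, hX.symm.trans (h hK.1)⟩) hK

theorem mem_tmCls {K : TmJ} (hX : TmI Γ a A c C) (hρ : CtxI Γ Δ ρ) (hK : K ∈ tmCls Δ b B)
    (h : IsTm Δ b B → TmI Γ a A (b.subst ρ) (B.subst ρ)) : K ∈ tmCls Γ c C :=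
  TmRel.trans (tmRel_iff.2 ⟨ρ, hρ, hK.1, hX.symm.trans (h hK.1)⟩) hK

theorem tyCls_congr (h : TyI Γ A B) : tyCls Γ A = tyCls Γ B :=
  (tyCls_eq_iff h.right).2 (tyRel_of_tyI h)

theorem tmCls_congr (h : TmI Γ a A b B) : tmCls Γ a A = tmCls Γ b B :=
  (tmCls_eq_iff h.right).2 (tmRel_of_tmI h)

theorem tyIs_self (h : IsTy Γ A .col) : TyIs (tyCls Γ A) Γ A := ⟨h, rfl⟩
theorem tmIs_self (h : IsTm Γ a A) : TmIs (tmCls Γ a A) Γ a A := ⟨h, rfl⟩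
theorem ctxIs_self (h : IsCtx Γ) : CtxIs (ctxCls Γ) Γ := ⟨h, rfl⟩

theorem CtxIs.ctxI (h : CtxIs (ctxCls Γ) Δ) : ∃ ρ, CtxI Γ Δ ρ :=
  ctxRel_iff.1 ((ctxCls_eq_iff h.1).1 h.2)

theorem TyIs.tyI (h : TyIs (tyCls Γ A) Δ B) (hρ : CtxI Γ Δ ρ) : TyI Γ A (B.subst ρ) :=
  .of_cls hρ h.2 h.1
theorem TmIs.tmI (h : TmIs (tmCls Γ a A) Δ b B) (hρ : CtxI Γ Δ ρ) :
    TmI Γ a A (b.subst ρ) (B.subst ρ) := .of_cls hρ h.2 h.1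
theorem TyIs.ctxI (h : TyIs (tyCls Γ A) Δ B) : ∃ ρ, CtxI Γ Δ ρ := ctxI_of_tyCls h.2 h.1
theorem TmIs.ctxI (h : TmIs (tmCls Γ a A) Δ b B) : ∃ ρ, CtxI Γ Δ ρ := ctxI_of_tmCls h.2 h.1

theorem TyIs.inv (h : TyIs (tyCls (A :: Γ) B) (A' :: Δ) B') : ∃ ρ α, CtxI Γ Δ ρ ∧
    Iso Γ A (A'.subst ρ) α ∧ CtxI (A :: Γ) (A' :: Δ) (scons α (cmp ρ (sh 1))) ∧
    TyI (A :: Γ) B (B'.subst (scons α (cmp ρ (sh 1)))) := by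
  obtain ⟨σ, hσ⟩ := h.ctxI
  obtain ⟨ρ, α, h1, _, h3, h4⟩ := hσ.cons_inv
  exact ⟨ρ, α, h1, h3, h4, h.tyI h4⟩

theorem TmIs.inv (h : TmIs (tmCls (A :: Γ) b B) (A' :: Δ) b' B') : ∃ ρ α, CtxI Γ Δ ρ ∧
    Iso Γ A (A'.subst ρ) α ∧ CtxI (A :: Γ) (A' :: Δ) (scons α (cmp ρ (sh 1))) ∧
    TmI (A :: Γ) b B (b'.subst (scons α (cmp ρ (sh 1)))) (B'.subst (scons α (cmp ρ (sh 1)))) := by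
  obtain ⟨σ, hσ⟩ := h.ctxI
  obtain ⟨ρ, α, h1, _, h3, h4⟩ := hσ.cons_inv
  exact ⟨ρ, α, h1, h3, h4, h.tmI h4⟩

theorem CtxI.two_cons (hρ : CtxI Γ Δ ρ) (hB : IsTy Δ B k) (hα : Iso Γ A (B.subst ρ) α) :
    CtxI (A.subst (sh 1) :: A :: Γ) (B.subst (sh 1) :: B :: Δ)
      (scons (α.subst (scons (.var 0) (sh 2))) (scons (α.subst (sh 1)) (cmp ρ (sh 2)))) := by
  have h1 := hρ.cons hB hα
  have h2 := h1.cons (ty_subst hB (.sh_one (.ctx_cons hB.ty_col)))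
    (by simpa using hα.subst (.sh_one (.ctx_cons hα.left)))
  simpa using h2

theorem TyIs.inv_two (h : TyIs (tyCls (A.subst (sh 1) :: A :: Γ) R) (B.subst (sh 1) :: B :: Δ) S) :
    ∃ ρ α, CtxI Γ Δ ρ ∧ Iso Γ A (B.subst ρ) α ∧ IsTy Δ B .col ∧
      TyI (A.subst (sh 1) :: A :: Γ) R (S.subst
        (scons (α.subst (scons (.var 0) (sh 2))) (scons (α.subst (sh 1)) (cmp ρ (sh 2))))) := by
  obtain ⟨σ, hσ⟩ := h.ctxI
  obtain ⟨_, _, h1, _, _, _⟩ := hσ.cons_inv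
  obtain ⟨ρ, α, h2, h3, h4, _⟩ := h1.cons_inv
  exact ⟨ρ, α, h2, h4, h3, h.tyI (h2.two_cons h3 h4)⟩

/-- This lemma and the following ones evaluate the operations on classes at a single representative.
One inclusion is the compatibility of the construction with canonical isomorphisms, the other
chooses the given representative. -/
theorem ctxExt_tyCls (h : IsTy Γ A .col) : ctxExt (tyCls Γ A) = ctxCls (A :: Γ) := by
  ext Θ
  constructor
  · rintro ⟨Γ', A', hA, hΘ⟩
    obtain ⟨ρ, hρ⟩ := hA.ctxI
    exact CtxRel.trans (ctxRel_iff.2 ⟨_, hρ.cons hA.1 (hA.tyI hρ).choose_spec⟩) hΘ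
  · exact fun hΘ => ⟨Γ, A, tyIs_self h, hΘ⟩

theorem ctxExtTwice_tyCls (h : IsTy Γ A .col) :
    ctxExtTwice (tyCls Γ A) = ctxCls (A.subst (sh 1) :: A :: Γ) := by
  ext Θ
  constructor
  · rintro ⟨Γ', A', hA, hΘ⟩
    obtain ⟨ρ, hρ⟩ := hA.ctxI
    refine CtxRel.trans (ctxRel_iff.2 ⟨_, hρ.two_cons hA.1 (hA.tyI hρ).choose_spec⟩) ?_
    simpa [ctxCls] using hΘ
  · exact fun hΘ => ⟨Γ, A, tyIs_self h, by simpa using hΘ⟩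

/-- The canonical isomorphism between the contexts of the inductive step of list eliminators. -/
theorem CtxI.list_cons (hρ : CtxI Γ Δ ρ) (hA' : IsTy Δ A' .set) (hα : Iso Γ A (A'.subst ρ) α)
    (hδ : Iso Γ (.list A) ((Exp.list A').subst ρ) δ) (hL' : IsTy (.list A' :: Δ) L' .col)
    (hκ : Iso (.list A :: Γ) L (L'.subst (scons δ (cmp ρ (sh 1)))) κ) :
    CtxI (listCtx Γ A L) (listCtx Δ A' L')
      (scons (κ.subst (scons (.var 0) (sh 2))) (scons (α.subst (scons (.var 1) (sh 3)))
        (scons (δ.subst (scons (.var 2) (sh 3))) (cmp ρ (sh 3))))) := by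
  have hA : IsTy Γ A .set := tyInv hδ.left
  have h1 := hρ.cons (.list_form hA') hδ
  have h2 := h1.cons (head_ty (ctx_list_two hA'))
    (by simpa using hα.subst (.sh_one (.ctx_cons hδ.left)))
  have h3 := h2.cons (A := L.subst (sh 1)) (ty_subst hL' (.sh_one (ctx_list_two hA')))
    (by simpa using hκ.subst (.sh_one (ctx_list_two hA)))
  simpa using h3

theorem ctxExtList_tyCls (h : IsTy (.list A :: Γ) L .col) :
    ctxExtList (tyCls (.list A :: Γ) L) = ctxCls (listCtx Γ A L) := by
  ext Θ
  constructor
  · rintro ⟨Γ', A', L', hL, hΘ⟩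
    obtain ⟨ρ, δ, hρ, hδ, h1, κ, hκ⟩ := hL.inv
    have hA' : IsTy Γ' A' .set := tyInv (head_ty (ctx_of_ty hL.1))
    obtain ⟨_, _, α, hα⟩ := TyI.list_inv ⟨_, hδ⟩
    refine CtxRel.trans (ctxRel_iff.2 ⟨_, hρ.list_cons hA' hα hδ hL.1 hκ⟩) ?_
    simpa [ctxCls] using hΘ
  · exact fun hΘ => ⟨Γ, A, L, tyIs_self h, by simpa [ctxCls] using hΘ⟩

theorem semConst_ctxCls {K : Ty} (h : IsTy Γ K .col) (hK : ∀ σ, K.subst σ = K) :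
    semConst (ctxCls Γ) K = tyCls Γ K := by
  ext J
  constructor
  · rintro ⟨Γ', h', hJ⟩
    obtain ⟨ρ, hρ⟩ := h'.ctxI
    exact mem_tyCls (.refl h) hρ hJ fun _ => by simpa [hK] using TyI.refl h
  · exact fun hJ => ⟨Γ, ctxIs_self (ctx_of_ty h), hJ⟩

theorem semUn_tyCls {F : Ty → Ty} (hA : IsTy Γ A .col) (h : IsTy Γ (F A) .col)
    (hF : ∀ A σ, (F A).subst σ = F (A.subst σ))
    (hc : ∀ A', IsTy Γ (F A') .col → TyI Γ A A' → TyI Γ (F A) (F A')) :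
    semUn F (tyCls Γ A) = tyCls Γ (F A) := by
  ext J
  constructor
  · rintro ⟨Γ', A', hA, hJ⟩
    obtain ⟨ρ, hρ⟩ := hA.ctxI
    refine mem_tyCls (.refl h) hρ hJ fun h' => ?_
    rw [hF]
    exact hc _ (by simpa [hF] using ty_subst h' hρ.subOk) (hA.tyI hρ)
  · exact fun hJ => ⟨Γ, A, tyIs_self hA, hJ⟩

theorem semBin_tyCls {F : Ty → Ty → Ty} (hA : IsTy Γ A .col) (hB : IsTy Γ B .col)
    (h : IsTy Γ (F A B) .col) (hF : ∀ A B σ, (F A B).subst σ = F (A.subst σ) (B.subst σ))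
    (hc : ∀ A' B', IsTy Γ (F A' B') .col → TyI Γ A A' → TyI Γ B B' → TyI Γ (F A B) (F A' B')) :
    semBin F (tyCls Γ A) (tyCls Γ B) = tyCls Γ (F A B) := by
  ext J
  constructor
  · rintro ⟨Γ', A', B', hA, hB, hJ⟩
    obtain ⟨ρ, hρ⟩ := hA.ctxI
    refine mem_tyCls (.refl h) hρ hJ fun h' => ?_
    rw [hF]
    exact hc _ _ (by simpa [hF] using ty_subst h' hρ.subOk) (hA.tyI hρ) (hB.tyI hρ)
  · exact fun hJ => ⟨Γ, A, B, tyIs_self hA, tyIs_self hB, hJ⟩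

theorem semBind_tyCls {F : Ty → Ty → Ty} (hB : IsTy (A :: Γ) B .col)
    (h : IsTy Γ (F A B) .col) (hF : ∀ A B σ, (F A B).subst σ = F (A.subst σ) (B.subst (ups σ)))
    (hc : ∀ A' B' α, IsTy Γ (F A' B') .col → Iso Γ A A' α → IsTy (A' :: Γ) B' .col →
      TyI (A :: Γ) B (B'.subst (scons α (sh 1))) → TyI Γ (F A B) (F A' B')) :
    semBind F (tyCls (A :: Γ) B) = tyCls Γ (F A B) := by
  ext J
  constructor
  · rintro ⟨Γ', A', B', hB, hJ⟩
    obtain ⟨ρ, α, hρ, hα, _, hB1⟩ := hB.inv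
    refine mem_tyCls (.refl h) hρ hJ fun h' => ?_
    rw [hF]
    exact hc _ _ α (by rw [← hF]; exact ty_subst h' hρ.subOk) hα
      (ty_subst hB.1 (hρ.subOk.ups (head_ty (ctx_of_ty hB.1)))) (by simpa using hB1)
  · exact fun hJ => ⟨Γ, A, B, tyIs_self hB, hJ⟩

theorem semQuo_tyCls (hR : IsTy (A.subst (sh 1) :: A :: Γ) R .col) (h : IsTy Γ (.quo A R) .col) :
    semQuo (tyCls (A.subst (sh 1) :: A :: Γ) R) = tyCls Γ (.quo A R) := by
  ext J
  constructor
  · rintro ⟨Γ', A', R', hR, hJ⟩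
    obtain ⟨ρ, α, hρ, hα, hA', hR1⟩ := TyIs.inv_two (by simpa using hR)
    refine mem_tyCls (.refl h) hρ hJ fun h' => ?_
    exact .quo hα h (ty_subst h' hρ.subOk) (by simpa using hR1)
  · exact fun hJ => ⟨Γ, A, R, by simpa using tyIs_self hR, hJ⟩

/-! ### The interpretation is the class of its representatives -/

/-- The last variable is sent to the last component by construction; for an earlier one the
correspondence is weakened. `CtxI.inv` describes `ρ` only up to equality of substitutions, hence the
final correction by `TmI.of_subEq`. -/
theorem CtxI.var : ∀ {Γ Δ ρ i A B}, CtxI Γ Δ ρ → Γ[i]? = some A → Δ[i]? = some B →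
    TmI Γ (.var i) (A.subst (sh (i + 1))) (ρ i) (B.subst (cmp (sh (i + 1)) ρ))
  | Γ, [], ρ, i, A, B, h, h1, h2 => by simp at h2
  | Γ, C :: Δ, ρ, i, A, B, h, h1, h2 => by
    obtain ⟨D, Γ, rfl⟩ := h.cases_cons
    obtain ⟨σ, α, h3, hC, hα, e⟩ := h.inv
    have s1 := SubOk.sh_one (.ctx_cons hα.left)
    cases i with
    | zero =>
      obtain rfl : D = A := by simpa using h1
      obtain rfl : C = B := by simpa using h2
      have t1 := TmI.act hα s1 (tm_var_zero hα.left)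
      have t2 := TmI.of_subEq (tm_var_zero hC) e
      simpa using TmI.trans (by simpa using t1) t2
    | succ i =>
      have t1 := (CtxI.var h3 (by simpa using h1) (by simpa using h2)).subst s1
      have hv := Der.var (i := i + 1) (Der.ctx_cons hC) h2
      have t2 := TmI.of_subEq hv e
      simpa [Nat.add_assoc, Nat.add_comm 1] using
        TmI.trans (by simpa [Nat.add_assoc, Nat.add_comm 1] using t1) t2

/-- The class of the interpretation with representative `X`. -/
def cls : {s : Srt} → Ctx → Out s → Set (Obj s)
  | .ty, Γ, X => tyCls Γ X
  | .tm, Γ, X => tmCls Γ X.1 X.2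

/-- By the induction hypotheses the interpretations of the arguments are classes of representatives.
An element of the interpretation comes from some other choice of representatives, which matches the
given one along a context isomorphism, and the congruence of the constructor puts it in the class of
`X`. Conversely the given representatives are an admissible choice. -/
theorem sem_eq_cls {s : Srt} (e : Exp s) : ∀ {Γ X}, rel e Γ X → sem e (ctxCls Γ) = cls Γ X := by
  induction e with
  | N0 | N1 | P1 | bot =>
    intro Γ X hX
    exact (semConst_ctxCls (TyI.left hX) fun _ => rfl).trans (tyCls_congr hX)
  | sig A B ihA ihB =>
    rintro Γ X ⟨A', B', hA, hB, hX⟩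
    have e1 : sem A (ctxCls Γ) = tyCls Γ A' := ihA hA
    have e2 : sem B (ctxCls (A' :: Γ)) = tyCls (A' :: Γ) B' := ihB hB
    simp only [sem, e1, ctxExt_tyCls (rel_ty_der hA), e2]
    refine (semBind_tyCls (rel_ty_der hB) hX.left (fun _ _ _ => rfl) ?_).trans (tyCls_congr hX)
    exact fun _ _ _ _ h1 h2 h3 => .sig h1 h2 h3
  | pi A B ihA ihB =>
    rintro Γ X ⟨A', B', hA, hB, hX⟩
    have e1 : sem A (ctxCls Γ) = tyCls Γ A' := ihA hA
    have e2 : sem B (ctxCls (A' :: Γ)) = tyCls (A' :: Γ) B' := ihB hB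
    simp only [sem, e1, ctxExt_tyCls (rel_ty_der hA), e2]
    refine (semBind_tyCls (rel_ty_der hB) hX.left (fun _ _ _ => rfl) ?_).trans (tyCls_congr hX)
    exact fun _ _ _ h h1 _ h3 => .pi h1 hX.left h h3
  | ex A B ihA ihB =>
    rintro Γ X ⟨A', B', hA, hB, hX⟩
    have e1 : sem A (ctxCls Γ) = tyCls Γ A' := ihA hA
    have e2 : sem B (ctxCls (A' :: Γ)) = tyCls (A' :: Γ) B' := ihB hB
    simp only [sem, e1, ctxExt_tyCls (rel_ty_der hA), e2]
    refine (semBind_tyCls (rel_ty_der hB) hX.left (fun _ _ _ => rfl) ?_).trans (tyCls_congr hX)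
    exact fun _ _ _ h h1 _ h3 => .ex h1 hX.left h h3
  | all A B ihA ihB =>
    rintro Γ X ⟨A', B', hA, hB, hX⟩
    have e1 : sem A (ctxCls Γ) = tyCls Γ A' := ihA hA
    have e2 : sem B (ctxCls (A' :: Γ)) = tyCls (A' :: Γ) B' := ihB hB
    simp only [sem, e1, ctxExt_tyCls (rel_ty_der hA), e2]
    refine (semBind_tyCls (rel_ty_der hB) hX.left (fun _ _ _ => rfl) ?_).trans (tyCls_congr hX)
    exact fun _ _ _ h h1 _ h3 => .all h1 hX.left h h3
  | sum A B ihA ihB =>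
    rintro Γ X ⟨A', B', hA, hB, hX⟩
    have e1 : sem A (ctxCls Γ) = tyCls Γ A' := ihA hA
    have e2 : sem B (ctxCls Γ) = tyCls Γ B' := ihB hB
    simp only [sem, e1, e2]
    refine (semBin_tyCls (rel_ty_der hA) (rel_ty_der hB) hX.left (fun _ _ _ => rfl) ?_).trans
      (tyCls_congr hX)
    exact fun _ _ h h1 h2 => .sum hX.left h h1 h2
  | and A B ihA ihB =>
    rintro Γ X ⟨A', B', hA, hB, hX⟩
    have e1 : sem A (ctxCls Γ) = tyCls Γ A' := ihA hA
    have e2 : sem B (ctxCls Γ) = tyCls Γ B' := ihB hB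
    simp only [sem, e1, e2]
    refine (semBin_tyCls (rel_ty_der hA) (rel_ty_der hB) hX.left (fun _ _ _ => rfl) ?_).trans
      (tyCls_congr hX)
    exact fun _ _ h h1 h2 => .and hX.left h h1 h2
  | or A B ihA ihB =>
    rintro Γ X ⟨A', B', hA, hB, hX⟩
    have e1 : sem A (ctxCls Γ) = tyCls Γ A' := ihA hA
    have e2 : sem B (ctxCls Γ) = tyCls Γ B' := ihB hB
    simp only [sem, e1, e2]
    refine (semBin_tyCls (rel_ty_der hA) (rel_ty_der hB) hX.left (fun _ _ _ => rfl) ?_).trans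
      (tyCls_congr hX)
    exact fun _ _ h h1 h2 => .or hX.left h h1 h2
  | imp A B ihA ihB =>
    rintro Γ X ⟨A', B', hA, hB, hX⟩
    have e1 : sem A (ctxCls Γ) = tyCls Γ A' := ihA hA
    have e2 : sem B (ctxCls Γ) = tyCls Γ B' := ihB hB
    simp only [sem, e1, e2]
    refine (semBin_tyCls (rel_ty_der hA) (rel_ty_der hB) hX.left (fun _ _ _ => rfl) ?_).trans
      (tyCls_congr hX)
    exact fun _ _ h h1 h2 => .imp hX.left h h1 h2
  | list A ihA =>
    rintro Γ X ⟨A', hA, hX⟩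
    have e1 : sem A (ctxCls Γ) = tyCls Γ A' := ihA hA
    simp only [sem, e1]
    refine (semUn_tyCls (rel_ty_der hA) hX.left (fun _ _ => rfl) ?_).trans (tyCls_congr hX)
    exact fun _ h h1 => .list (tyInv hX.left) (tyInv h) h1
  | quo A R ihA ihR =>
    rintro Γ X ⟨A', R', hA, hR, hX⟩
    have e1 : sem A (ctxCls Γ) = tyCls Γ A' := ihA hA
    have e2 : sem R (ctxCls (A'.subst (sh 1) :: A' :: Γ)) = tyCls _ R' := ihR hR
    simp only [sem, e1, ctxExtTwice_tyCls (rel_ty_der hA), e2]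
    exact (semQuo_tyCls (rel_ty_der hR) hX.left).trans (tyCls_congr hX)
  | eq A a b ihA iha ihb =>
    rintro Γ X ⟨A', a', b', hA, ha, hb, hX⟩
    have e1 : sem A (ctxCls Γ) = tyCls Γ A' := ihA hA
    have e2 : sem a (ctxCls Γ) = tmCls Γ a' A' := iha ha
    have e3 : sem b (ctxCls Γ) = tmCls Γ b' A' := ihb hb
    refine Eq.trans ?_ (tyCls_congr hX)
    simp only [sem, e1, e2, e3]
    ext J
    constructor
    · rintro ⟨Γ', A1, a1, b1, h1, h2, h3, hJ⟩
      obtain ⟨ρ, hρ⟩ := h1.ctxI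
      exact mem_tyCls (.refl hX.left) hρ hJ fun h => .eq (h2.tmI hρ) (h3.tmI hρ)
    · exact fun hJ => ⟨Γ, A', a', b', tyIs_self (rel_ty_der hA), tmIs_self (rel_tm_der ha),
        tmIs_self (rel_tm_der hb), hJ⟩
  | var n =>
    rintro Γ ⟨x, X⟩ ⟨A', hA, hX⟩
    refine Eq.trans ?_ (tmCls_congr hX)
    simp only [sem]
    ext J
    constructor
    · rintro ⟨Γ', A1, h1, h2, hJ⟩
      obtain ⟨ρ, hρ⟩ := h1.ctxI
      rw [lift_eq] at hJ
      refine mem_tmCls (.refl hX.left) hρ hJ fun h => ?_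
      simpa using hρ.var hA h2
    · exact fun hJ => ⟨Γ, A', ctxIs_self (ctx_of_tm hX.left), hA, by rwa [lift_eq]⟩
  | tru φ ih =>
    rintro Γ ⟨x, X⟩ ⟨φ', hφ, hX⟩
    have e1 : sem φ (ctxCls Γ) = tyCls Γ φ' := ih hφ
    refine Eq.trans ?_ (tmCls_congr hX)
    simp only [sem, e1]
    ext J
    constructor
    · rintro ⟨Γ', φ1, h1, hJ⟩
      obtain ⟨ρ, hρ⟩ := h1.ctxI
      exact mem_tmCls (.refl hX.left) hρ hJ fun h => .tru (h1.tyI hρ) hX.left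
    · exact fun hJ => ⟨Γ, φ', tyIs_self (rel_ty_der hφ), hJ⟩
  | pcl φ ih =>
    rintro Γ ⟨x, X⟩ ⟨φ', hφ, hX⟩
    have e1 : sem φ (ctxCls Γ) = tyCls Γ φ' := ih hφ
    refine Eq.trans ?_ (tmCls_congr hX)
    simp only [sem, e1]
    ext J
    constructor
    · rintro ⟨Γ', φ1, h1, hJ⟩
      obtain ⟨ρ, hρ⟩ := h1.ctxI
      -- The definition of `sem` does not ask the propositions to be small. This is read off from
      -- the derivability of the two terms of `P1`.
      exact mem_tmCls (.refl hX.left) hρ hJ fun h =>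
        .pcl (h1.tyI hρ) (tmInv hX.left) (ty_subst (tmInv h) hρ.subOk)
    · exact fun hJ => ⟨Γ, φ', tyIs_self (rel_ty_der hφ), hJ⟩
  | star =>
    rintro Γ ⟨x, X⟩ hX
    refine Eq.trans ?_ (tmCls_congr hX)
    simp only [sem]
    ext J
    constructor
    · rintro ⟨Γ', h1, hJ⟩
      obtain ⟨ρ, hρ⟩ := h1.ctxI
      exact mem_tmCls (.refl hX.left) hρ hJ fun h => .refl hX.left
    · exact fun hJ => ⟨Γ, ctxIs_self (ctx_of_tm hX.left), hJ⟩
  | emp M c ihM ihc =>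
    rintro Γ ⟨x, X⟩ ⟨M', c', hM, hc, hX⟩
    have h0 := Der.N0_form (T := .emTT) (ctx_of_tm (rel_tm_der hc))
    have e1 : sem M (ctxCls (.N0 :: Γ)) = tyCls (.N0 :: Γ) M' := ihM hM
    have e2 : sem c (ctxCls Γ) = tmCls Γ c' .N0 := ihc hc
    refine Eq.trans ?_ (tmCls_congr hX)
    simp only [sem, semConst_ctxCls h0.ty_col (fun _ => rfl), ctxExt_tyCls h0.ty_col, e1, e2, inst₁_eq]
    ext J
    constructor
    · rintro ⟨Γ', M1, c1, h1, h2, hJ⟩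
      obtain ⟨ρ, hρ⟩ := h2.ctxI
      refine mem_tmCls (.refl hX.left) hρ hJ fun h => ?_
      have h0' := head_ty (ctx_of_ty h1.1)
      have hρ1 := hρ.cons h0' (.refl h0.ty_col)
      have := TmI.emp (h2.tmI hρ) (ty_subst h1.1 (hρ.subOk.ups h0')) (by simpa using h1.tyI hρ1)
      simpa using this
    · exact fun hJ => ⟨Γ, M', c', tyIs_self (rel_ty_der hM), tmIs_self (rel_tm_der hc), hJ⟩
  | elN1 M d c ihM ihd ihc =>
    rintro Γ ⟨x, X⟩ ⟨M', d', c', hM, hd, hc, hX⟩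
    have h0 := Der.N1_form (T := .emTT) (ctx_of_tm (rel_tm_der hc))
    have e1 : sem M (ctxCls (.N1 :: Γ)) = tyCls (.N1 :: Γ) M' := ihM hM
    have e2 : sem d (ctxCls Γ) = tmCls Γ d' .N1 := ihd hd
    have e3 : sem c (ctxCls Γ) = tmCls Γ c' _ := ihc hc
    refine Eq.trans ?_ (tmCls_congr hX)
    simp only [sem, semConst_ctxCls h0.ty_col (fun _ => rfl), ctxExt_tyCls h0.ty_col, e1, e2, e3,
      inst₁_eq]
    ext J
    constructor
    · rintro ⟨Γ', M1, d1, c1, h1, h2, h3, hJ⟩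
      obtain ⟨ρ, hρ⟩ := h2.ctxI
      refine mem_tmCls (.refl hX.left) hρ hJ fun h => ?_
      have hρ1 := hρ.cons (head_ty (ctx_of_ty h1.1)) (.refl h0.ty_col)
      have := TmI.elN1 (h2.tmI hρ) (M' := M1.subst (ups ρ)) (c' := c1.subst ρ)
        (by simpa using h1.tyI hρ1) (by simpa using h3.tmI hρ)
      simpa using this
    · exact fun hJ => ⟨Γ, M', d', c', tyIs_self (rel_ty_der hM), tmIs_self (rel_tm_der hd),
        tmIs_self (rel_tm_der hc), hJ⟩
  | pair A B a b ihA ihB iha ihb =>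
    rintro Γ ⟨x, X⟩ ⟨A', B', a', b', hA, hB, ha, hb, hX⟩
    have e1 : sem A (ctxCls Γ) = tyCls Γ A' := ihA hA
    have e2 : sem B (ctxCls (A' :: Γ)) = tyCls (A' :: Γ) B' := ihB hB
    have e3 : sem a (ctxCls Γ) = tmCls Γ a' A' := iha ha
    have e4 : sem b (ctxCls Γ) = tmCls Γ b' _ := ihb hb
    refine Eq.trans ?_ (tmCls_congr hX)
    simp only [sem, e1, ctxExt_tyCls (rel_ty_der hA), e2, e3, e4, inst₁_eq]
    ext J
    constructor
    · rintro ⟨Γ', A1, B1, a1, b1, h1, h2, h3, hJ⟩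
      obtain ⟨ρ, α, hρ, hα, hρ1, hB1⟩ := h1.inv
      refine mem_tmCls (.refl hX.left) hρ hJ fun h => ?_
      have hB2 := ty_subst h1.1 (hρ.subOk.ups (head_ty (ctx_of_ty h1.1)))
      exact .pair (.sig hα hB2 (by simpa using hB1)) (h2.tmI hρ) (by simpa using h3.tmI hρ)
    · exact fun hJ => ⟨Γ, A', B', a', b', tyIs_self (rel_ty_der hB), tmIs_self (rel_tm_der ha),
        tmIs_self (rel_tm_der hb), hJ⟩
  | lam A b ihA ihb =>
    rintro Γ ⟨x, X⟩ ⟨A', B', b', hA, hb, hX⟩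
    have e1 : sem A (ctxCls Γ) = tyCls Γ A' := ihA hA
    have e2 : sem b (ctxCls (A' :: Γ)) = tmCls (A' :: Γ) b' B' := ihb hb
    refine Eq.trans ?_ (tmCls_congr hX)
    simp only [sem, e1, ctxExt_tyCls (rel_ty_der hA), e2]
    ext J
    constructor
    · rintro ⟨Γ', A1, B1, b1, h1, hJ⟩
      obtain ⟨ρ, α, hρ, hα, hρ1, hb1⟩ := h1.inv
      refine mem_tmCls (.refl hX.left) hρ hJ fun h => ?_
      have hb2 := tm_subst h1.1 (hρ.subOk.ups (head_ty (ctx_of_tm h1.1)))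
      refine .lam (.pi hα (ty_of_tm hX.left) (ty_subst (ty_of_tm h) hρ.subOk) ?_) hα
        (by simpa using hb1) hb2
      simpa using hb1.tyI
    · exact fun hJ => ⟨Γ, A', B', b', tmIs_self (rel_tm_der hb), hJ⟩
  | app f a ihf iha =>
    rintro Γ ⟨x, X⟩ ⟨A', B', f', a', hf, ha, hX⟩
    have e1 : sem f (ctxCls Γ) = tmCls Γ f' (.pi A' B') := ihf hf
    have e2 : sem a (ctxCls Γ) = tmCls Γ a' A' := iha ha
    refine Eq.trans ?_ (tmCls_congr hX)
    simp only [sem, e1, e2, inst₁_eq]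
    ext J
    constructor
    · rintro ⟨Γ', A1, B1, f1, a1, h1, h2, hJ⟩
      obtain ⟨ρ, hρ⟩ := h1.ctxI
      refine mem_tmCls (.refl hX.left) hρ hJ fun h => ?_
      simpa using TmI.app (h1.tmI hρ) (h2.tmI hρ)
    · exact fun hJ => ⟨Γ, A', B', f', a', tmIs_self (rel_tm_der hf), tmIs_self (rel_tm_der ha), hJ⟩
  | nil A ihA =>
    rintro Γ ⟨x, X⟩ ⟨A', hA, hX⟩
    have e1 : sem A (ctxCls Γ) = tyCls Γ A' := ihA hA
    refine Eq.trans ?_ (tmCls_congr hX)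
    simp only [sem, e1]
    ext J
    constructor
    · rintro ⟨Γ', A1, h1, hJ⟩
      obtain ⟨ρ, hρ⟩ := h1.ctxI
      refine mem_tmCls (.refl hX.left) hρ hJ fun h => ?_
      have hs : IsTy Γ' A1 .set := tyInv (ty_of_tm h)
      exact .nil (.list (tyInv (ty_of_tm hX.left)) (ty_subst hs hρ.subOk) (h1.tyI hρ))
    · exact fun hJ => ⟨Γ, A', tyIs_self (rel_ty_der hA), hJ⟩
  | cons s c ihs ihc =>
    rintro Γ ⟨x, X⟩ ⟨A', s', c', hs, hc, hX⟩
    have e1 : sem s (ctxCls Γ) = tmCls Γ s' (.list A') := ihs hs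
    have e2 : sem c (ctxCls Γ) = tmCls Γ c' A' := ihc hc
    refine Eq.trans ?_ (tmCls_congr hX)
    simp only [sem, e1, e2]
    ext J
    constructor
    · rintro ⟨Γ', A1, s1, c1, h1, h2, hJ⟩
      obtain ⟨ρ, hρ⟩ := h1.ctxI
      exact mem_tmCls (.refl hX.left) hρ hJ fun h => .cons (h1.tmI hρ) (h2.tmI hρ)
    · exact fun hJ => ⟨Γ, A', s', c', tmIs_self (rel_tm_der hs), tmIs_self (rel_tm_der hc), hJ⟩
  | inl A B a ihA ihB iha =>
    rintro Γ ⟨x, X⟩ ⟨A', B', a', hA, hB, ha, hX⟩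
    have e1 : sem A (ctxCls Γ) = tyCls Γ A' := ihA hA
    have e2 : sem B (ctxCls Γ) = tyCls Γ B' := ihB hB
    have e3 : sem a (ctxCls Γ) = tmCls Γ a' A' := iha ha
    refine Eq.trans ?_ (tmCls_congr hX)
    simp only [sem, e1, e2, e3]
    ext J
    constructor
    · rintro ⟨Γ', A1, B1, a1, h1, h2, h3, hJ⟩
      obtain ⟨ρ, hρ⟩ := h1.ctxI
      exact mem_tmCls (.refl hX.left) hρ hJ fun h =>
        .inl (.sum (ty_of_tm hX.left) (ty_subst (ty_of_tm h) hρ.subOk) (h1.tyI hρ) (h2.tyI hρ))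
          (h3.tmI hρ)
    · exact fun hJ => ⟨Γ, A', B', a', tyIs_self (rel_ty_der hA), tyIs_self (rel_ty_der hB),
        tmIs_self (rel_tm_der ha), hJ⟩
  | inr A B b ihA ihB ihb =>
    rintro Γ ⟨x, X⟩ ⟨A', B', b', hA, hB, hb, hX⟩
    have e1 : sem A (ctxCls Γ) = tyCls Γ A' := ihA hA
    have e2 : sem B (ctxCls Γ) = tyCls Γ B' := ihB hB
    have e3 : sem b (ctxCls Γ) = tmCls Γ b' B' := ihb hb
    refine Eq.trans ?_ (tmCls_congr hX)
    simp only [sem, e1, e2, e3]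
    ext J
    constructor
    · rintro ⟨Γ', A1, B1, b1, h1, h2, h3, hJ⟩
      obtain ⟨ρ, hρ⟩ := h1.ctxI
      exact mem_tmCls (.refl hX.left) hρ hJ fun h =>
        .inr (.sum (ty_of_tm hX.left) (ty_subst (ty_of_tm h) hρ.subOk) (h1.tyI hρ) (h2.tyI hρ))
          (h3.tmI hρ)
    · exact fun hJ => ⟨Γ, A', B', b', tyIs_self (rel_ty_der hA), tyIs_self (rel_ty_der hB),
        tmIs_self (rel_tm_der hb), hJ⟩
  | qcl A R a ihA ihR iha =>
    rintro Γ ⟨x, X⟩ ⟨A', R', a', hA, hR, ha, hX⟩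
    have e1 : sem A (ctxCls Γ) = tyCls Γ A' := ihA hA
    have e2 : sem R (ctxCls (A'.subst (sh 1) :: A' :: Γ)) = tyCls _ R' := ihR hR
    have e3 : sem a (ctxCls Γ) = tmCls Γ a' A' := iha ha
    refine Eq.trans ?_ (tmCls_congr hX)
    simp only [sem, e1, ctxExtTwice_tyCls (rel_ty_der hA), e2, e3, lift_eq]
    ext J
    constructor
    · rintro ⟨Γ', A1, R1, a1, h1, h2, hJ⟩
      obtain ⟨ρ, α, hρ, hα, hA1, hR1⟩ := h1.inv_two
      exact mem_tmCls (.refl hX.left) hρ hJ fun h =>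
        .qcl (.quo hα (ty_of_tm hX.left) (ty_subst (ty_of_tm h) hρ.subOk) (by simpa using hR1))
          (h2.tmI hρ)
    · exact fun hJ => ⟨Γ, A', R', a', tyIs_self (rel_ty_der hR), tmIs_self (rel_tm_der ha), hJ⟩
  | elSig A B M d m ihA ihB ihM ihd ihm =>
    rintro Γ ⟨x, X⟩ ⟨A', B', M', d', m', hA, hB, hM, hd, hm, hX⟩
    have hB0 := rel_ty_der hB
    have hS := ty_of_tm (rel_tm_der hd)
    have e1 : sem A (ctxCls Γ) = tyCls Γ A' := ihA hA
    have e2 : sem B (ctxCls (A' :: Γ)) = tyCls (A' :: Γ) B' := ihB hB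
    have e3 : sem M (ctxCls (.sig A' B' :: Γ)) = tyCls _ M' := ihM hM
    have e4 : sem d (ctxCls Γ) = tmCls Γ d' (.sig A' B') := ihd hd
    have e5 : sem m (ctxCls (B' :: A' :: Γ)) = tmCls _ m' _ := ihm hm
    have e6 : semBind .sig (tyCls (A' :: Γ) B') = tyCls Γ (.sig A' B') :=
      semBind_tyCls hB0 hS (fun _ _ _ => rfl) fun _ _ _ _ h1 h2 h3 => .sig h1 h2 h3
    refine Eq.trans ?_ (tmCls_congr hX)
    simp only [sem, e1, ctxExt_tyCls (rel_ty_der hA), e2, e6, ctxExt_tyCls hS, e3, e4,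
      ctxExt_tyCls hB0, e5, inst₁_eq, lift_eq, lift₁_eq]
    ext J
    constructor
    · rintro ⟨Γ', A1, B1, M1, d1, m1, h1, h2, h3, h4, hJ⟩
      obtain ⟨ρ, α, hρ, hα, hρ1, β, hβ⟩ := h1.inv
      refine mem_tmCls (.refl hX.left) hρ hJ fun h => ?_
      have hA1 := head_ty (ctx_of_ty h1.1)
      have hS1 := ty_of_tm h3.1
      have td := h3.tmI hρ
      obtain ⟨δ, hδ⟩ := td.tyI
      have hM1 := h2.tyI (hρ.cons hS1 hδ)
      have hm1 := h4.tmI (hρ1.cons h1.1 hβ)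
      have := TmI.elSig (B' := B1.subst (ups ρ)) (M' := M1.subst (ups ρ))
        (m' := m1.subst (ups (ups ρ))) hδ hα (by simpa using hβ) (by simpa using hM1)
        (ty_subst h2.1 (hρ.subOk.ups hS1)) td (by simpa using hm1)
        (by simpa using tm_subst h4.1 ((hρ.subOk.ups hA1).ups h1.1))
      simpa using this
    · exact fun hJ => ⟨Γ, A', B', M', d', m', tyIs_self hB0, tyIs_self (rel_ty_der hM),
        tmIs_self (rel_tm_der hd), tmIs_self (rel_tm_der hm), hJ⟩
  | elSum A B M d a b ihA ihB ihM ihd iha ihb =>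
    rintro Γ ⟨x, X⟩ ⟨A', B', M', d', a', b', hA, hB, hM, hd, ha, hb, hX⟩
    have hA0 := rel_ty_der hA
    have hB0 := rel_ty_der hB
    have hS := ty_of_tm (rel_tm_der hd)
    have e1 : sem A (ctxCls Γ) = tyCls Γ A' := ihA hA
    have e2 : sem B (ctxCls Γ) = tyCls Γ B' := ihB hB
    have e3 : sem M (ctxCls (.sum A' B' :: Γ)) = tyCls _ M' := ihM hM
    have e4 : sem d (ctxCls Γ) = tmCls Γ d' (.sum A' B') := ihd hd
    have e5 : sem a (ctxCls (A' :: Γ)) = tmCls _ a' _ := iha ha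
    have e6 : sem b (ctxCls (B' :: Γ)) = tmCls _ b' _ := ihb hb
    have e7 : semBin .sum (tyCls Γ A') (tyCls Γ B') = tyCls Γ (.sum A' B') :=
      semBin_tyCls hA0 hB0 hS (fun _ _ _ => rfl) fun _ _ h h1 h2 => .sum hS h h1 h2
    refine Eq.trans ?_ (tmCls_congr hX)
    simp only [sem, e1, e2, e7, ctxExt_tyCls hA0, ctxExt_tyCls hB0, ctxExt_tyCls hS, e3, e4, e5,
      e6, inst₁_eq, lift_eq]
    ext J
    constructor
    · rintro ⟨Γ', A1, B1, M1, d1, a1, b1, h1, h2, h3, h4, h5, h6, hJ⟩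
      obtain ⟨ρ, hρ⟩ := h1.ctxI
      obtain ⟨α, hα⟩ := h1.tyI hρ
      obtain ⟨β, hβ⟩ := h2.tyI hρ
      refine mem_tmCls (.refl hX.left) hρ hJ fun h => ?_
      have hS1 := ty_of_tm h4.1
      have td := h4.tmI hρ
      obtain ⟨δ, hδ⟩ := td.tyI
      have hM1 := h3.tyI (hρ.cons hS1 hδ)
      have ha1 := h5.tmI (hρ.cons h1.1 hα)
      have hb1 := h6.tmI (hρ.cons h2.1 hβ)
      have := TmI.elSum (M' := M1.subst (ups ρ)) (a' := a1.subst (ups ρ)) (b' := b1.subst (ups ρ))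
        hδ hα hβ (by simpa using hM1)
        (ty_subst h3.1 (hρ.subOk.ups hS1)) td
        (by simpa using ha1) (by simpa using tm_subst h5.1 (hρ.subOk.ups h1.1))
        (by simpa using hb1) (by simpa using tm_subst h6.1 (hρ.subOk.ups h2.1))
      simpa using this
    · exact fun hJ => ⟨Γ, A', B', M', d', a', b', tyIs_self hA0, tyIs_self hB0,
        tyIs_self (rel_ty_der hM), tmIs_self (rel_tm_der hd), tmIs_self (rel_tm_der ha),
        tmIs_self (rel_tm_der hb), hJ⟩
  | elQ A R L d l ihA ihR ihL ihd ihl =>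
    rintro Γ ⟨x, X⟩ ⟨A', R', L', d', l', hA, hR, hL, hd, hl, hX⟩
    have hA0 := rel_ty_der hA
    have hS := ty_of_tm (rel_tm_der hd)
    have e1 : sem A (ctxCls Γ) = tyCls Γ A' := ihA hA
    have e2 : sem R (ctxCls (A'.subst (sh 1) :: A' :: Γ)) = tyCls _ R' := ihR hR
    have e3 : sem L (ctxCls (.quo A' R' :: Γ)) = tyCls _ L' := ihL hL
    have e4 : sem d (ctxCls Γ) = tmCls Γ d' (.quo A' R') := ihd hd
    have e5 : sem l (ctxCls (A' :: Γ)) = tmCls _ l' _ := ihl hl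
    refine Eq.trans ?_ (tmCls_congr hX)
    simp only [sem, e1, ctxExtTwice_tyCls hA0, e2, semQuo_tyCls (rel_ty_der hR) hS,
      ctxExt_tyCls hA0, ctxExt_tyCls hS, e3, e4, e5, inst₁_eq, lift_eq, lift₂_eq]
    ext J
    constructor
    · rintro ⟨Γ', A1, R1, L1, d1, l1, h1, h2, h3, h4, hJ⟩
      obtain ⟨ρ, α, hρ, hα, hA1, _⟩ := h1.inv_two
      refine mem_tmCls (.refl hX.left) hρ hJ fun h => ?_
      have hS1 := ty_of_tm h3.1
      have td := h3.tmI hρ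
      obtain ⟨δ, hδ⟩ := td.tyI
      have hL1 := h2.tyI (hρ.cons hS1 hδ)
      have hl1 := h4.tmI (hρ.cons hA1 hα)
      -- The respect conditions do not occur in `sem` either; inversion recovers them from the
      -- derivability of the two eliminators.
      have := TmI.elQ (L' := L1.subst (ups ρ)) (l' := l1.subst (ups ρ))
        hδ hα (by simpa using hL1)
        (ty_subst h2.1 (hρ.subOk.ups hS1)) td
        (by simpa using hl1) (by simpa using tm_subst h4.1 (hρ.subOk.ups hA1))
        (tmInv hX.left).2.2 (tmInv (tm_subst h hρ.subOk)).2.2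
      simpa using this
    · exact fun hJ => ⟨Γ, A', R', L', d', l', tyIs_self (rel_ty_der hR),
        tyIs_self (rel_ty_der hL), tmIs_self (rel_tm_der hd), tmIs_self (rel_tm_der hl), hJ⟩
  | elList A L d a l ihA ihL ihd iha ihl =>
    rintro Γ ⟨x, X⟩ ⟨A', L', d', a', l', hA, hL, hd, ha, hl, hX⟩
    have hA0 := rel_ty_der hA
    have hL0 := rel_ty_der hL
    have hS := ty_of_tm (rel_tm_der hd)
    have e1 : sem A (ctxCls Γ) = tyCls Γ A' := ihA hA
    have e2 : sem L (ctxCls (.list A' :: Γ)) = tyCls _ L' := ihL hL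
    have e3 : sem d (ctxCls Γ) = tmCls Γ d' (.list A') := ihd hd
    have e4 : sem a (ctxCls Γ) = tmCls Γ a' _ := iha ha
    have e5 : sem l (ctxCls (listCtx Γ A' L')) = tmCls _ l' _ := ihl hl
    have e6 : semUn .list (tyCls Γ A') = tyCls Γ (.list A') :=
      semUn_tyCls hA0 hS (fun _ _ => rfl) fun _ h h1 => .list (tyInv hS) (tyInv h) h1
    refine Eq.trans ?_ (tmCls_congr hX)
    simp only [sem, e1, e6, ctxExt_tyCls hS, e2, ctxExtList_tyCls hL0, e3, e4, e5,
      inst₁_eq, lift_eq, scons_var_one_sh]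
    ext J
    constructor
    · rintro ⟨Γ', A1, L1, d1, a1, l1, h1, h2, h3, h4, h5, hJ⟩
      obtain ⟨ρ, hρ⟩ := h1.ctxI
      obtain ⟨α, hα⟩ := h1.tyI hρ
      refine mem_tmCls (.refl hX.left) hρ hJ fun h => ?_
      have hS1 := ty_of_tm h3.1
      have hA1 : IsTy Γ' A1 .set := tyInv hS1
      have td := h3.tmI hρ
      obtain ⟨δ, hδ⟩ := td.tyI
      obtain ⟨κ, hκ⟩ := h2.tyI (hρ.cons hS1 hδ)
      have hl1 := h5.tmI (hρ.list_cons hA1 hα hδ h2.1 hκ)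
      have c5 := ctx_of_tm h5.1
      have s5 := ((hρ.subOk.ups hS1).ups (head_ty (tail_ctx c5))).ups (head_ty c5)
      have := TmI.elList (L' := L1.subst (ups ρ)) (a' := a1.subst ρ)
        (l' := l1.subst (ups (ups (ups ρ))))
        hδ hα (by simpa using hκ)
        (ty_subst h2.1 (hρ.subOk.ups hS1)) td
        (by simpa using h4.tmI hρ) (by simpa using hl1)
        (by simpa using tm_subst h5.1 s5)
      simpa using this
    · exact fun hJ => ⟨Γ, A', L', d', a', l', tyIs_self hA0, tyIs_self hL0,
        tmIs_self (rel_tm_der hd), tmIs_self (rel_tm_der ha), tmIs_self (rel_tm_der hl), hJ⟩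

/-! ### Representatives are unique and stable under substitution -/

/-- The clauses of `rel` leave choices open, but any two representatives generate the same class,
namely the interpretation of the expression. -/
theorem rel_ty_unique {A : Ty} (h : rel A Γ B) (h' : rel A Γ C) : TyI Γ B C :=
  tyI_of_tyRel ((tyCls_eq_iff (rel_ty_der h')).1
    ((sem_eq_cls A h).symm.trans (sem_eq_cls A h')))

theorem rel_tm_unique {t : Tm} (h : rel t Γ (a, A)) (h' : rel t Γ (b, B)) : TmI Γ a A b B :=
  tmI_of_tmRel ((tmCls_eq_iff (rel_tm_der h')).1
    ((sem_eq_cls t h).symm.trans (sem_eq_cls t h')))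

/-- Substitution in representatives. -/
def Out.subst : {s : Srt} → Out s → Sub → Out s
  | .ty, X, σ => Exp.subst X σ
  | .tm, X, σ => (Exp.subst X.1 σ, Exp.subst X.2 σ)

/-- Here `σ` acts on the expression and `σ'` on its representative. The property `P` is kept
abstract because the lemma is needed twice: first for renamings, then for general substitutions,
whose extension under a binder already uses the result for renamings. -/
theorem rel_subst_of {P : Sub → Sub → Ctx → Ctx → Prop}
    (hok : ∀ {σ σ' Δ Γ}, P σ σ' Δ Γ → SubOk Δ σ' Γ)
    (hvar : ∀ {σ σ' Δ Γ}, P σ σ' Δ Γ → ∀ i B, Γ[i]? = some B →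
      rel (σ i) Δ (σ' i, B.subst (cmp (sh (i + 1)) σ')))
    (hups : ∀ {σ σ' Δ Γ A}, P σ σ' Δ Γ → IsTy Γ A .col →
      P (ups σ) (ups σ') (A.subst σ' :: Δ) (A :: Γ)) {s : Srt} (e : Exp s) :
    ∀ {Γ X Δ σ σ'}, rel e Γ X → P σ σ' Δ Γ → rel (e.subst σ) Δ (X.subst σ') := by
  induction e with
  | N0 | N1 | P1 | bot => exact fun h p => TyI.subst h (hok p)
  | sig A B ihA ihB | pi A B ihA ihB | ex A B ihA ihB | all A B ihA ihB =>
    rintro Γ X Δ σ σ' ⟨A', B', hA, hB, hX⟩ p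
    exact ⟨_, _, ihA hA p, ihB hB (hups p (rel_ty_der hA)), hX.subst (hok p)⟩
  | sum A B ihA ihB | and A B ihA ihB | or A B ihA ihB | imp A B ihA ihB =>
    rintro Γ X Δ σ σ' ⟨A', B', hA, hB, hX⟩ p
    exact ⟨_, _, ihA hA p, ihB hB p, hX.subst (hok p)⟩
  | list A ihA =>
    rintro Γ X Δ σ σ' ⟨A', hA, hX⟩ p
    exact ⟨_, ihA hA p, hX.subst (hok p)⟩
  | quo A R ihA ihR =>
    rintro Γ X Δ σ σ' ⟨A', R', hA, hR, hX⟩ p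
    have hA0 := rel_ty_der hA
    have p2 := hups (hups p hA0) (head_ty (ctx_two hA0))
    exact ⟨_, _, ihA hA p, by simpa [Out.subst] using ihR hR p2, hX.subst (hok p)⟩
  | eq A a b ihA iha ihb =>
    rintro Γ X Δ σ σ' ⟨A', a', b', hA, ha, hb, hX⟩ p
    exact ⟨_, _, _, ihA hA p, iha ha p, ihb hb p, hX.subst (hok p)⟩
  | var n =>
    rintro Γ X Δ σ σ' ⟨A', hA, hX⟩ p
    refine rel_tm_trans (hvar p n A' hA) ?_
    simpa using hX.subst (hok p)
  | tru φ ih =>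
    rintro Γ X Δ σ σ' ⟨φ', h, hX⟩ p
    exact ⟨_, ih h p, hX.subst (hok p)⟩
  | pcl φ ih =>
    rintro Γ X Δ σ σ' ⟨φ', h, hX⟩ p
    exact ⟨_, ih h p, hX.subst (hok p)⟩
  | nil φ ih =>
    rintro Γ X Δ σ σ' ⟨φ', h, hX⟩ p
    exact ⟨_, ih h p, hX.subst (hok p)⟩
  | emp M c ihM ihc =>
    rintro Γ X Δ σ σ' ⟨M', c', hM, hc, hX⟩ p
    exact ⟨_, _, ihM hM (hups p (head_ty (ctx_of_ty (rel_ty_der hM)))), ihc hc p,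
      by simpa [Out.subst] using hX.subst (hok p)⟩
  | star => exact fun h p => TmI.subst h (hok p)
  | elN1 M t c ihM iht ihc =>
    rintro Γ X Δ σ σ' ⟨M', t', c', hM, ht, hc, hX⟩ p
    exact ⟨_, _, _, ihM hM (hups p (head_ty (ctx_of_ty (rel_ty_der hM)))), iht ht p,
      by simpa [Out.subst] using ihc hc p, by simpa [Out.subst] using hX.subst (hok p)⟩
  | pair A B a b ihA ihB iha ihb =>
    rintro Γ X Δ σ σ' ⟨A', B', a', b', hA, hB, ha, hb, hX⟩ p
    exact ⟨_, _, _, _, ihA hA p, ihB hB (hups p (rel_ty_der hA)), iha ha p,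
      by simpa [Out.subst] using ihb hb p, hX.subst (hok p)⟩
  | elSig A B M d m ihA ihB ihM ihd ihm =>
    rintro Γ X Δ σ σ' ⟨A', B', M', d', m', hA, hB, hM, hd, hm, hX⟩ p
    have p1 := hups p (rel_ty_der hA)
    exact ⟨_, _, _, _, _, ihA hA p, ihB hB p1,
      ihM hM (hups p (head_ty (ctx_of_ty (rel_ty_der hM)))), ihd hd p,
      by simpa [Out.subst] using ihm hm (hups p1 (rel_ty_der hB)),
      by simpa [Out.subst] using hX.subst (hok p)⟩
  | lam A b ihA ihb =>
    rintro Γ X Δ σ σ' ⟨A', B', b', hA, hb, hX⟩ p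
    exact ⟨_, _, _, ihA hA p, ihb hb (hups p (rel_ty_der hA)), hX.subst (hok p)⟩
  | app f a ihf iha =>
    rintro Γ X Δ σ σ' ⟨A', B', f', a', hf, ha, hX⟩ p
    exact ⟨_, _, _, _, ihf hf p, iha ha p, by simpa [Out.subst] using hX.subst (hok p)⟩
  | cons s c ihs ihc =>
    rintro Γ X Δ σ σ' ⟨A', s', c', hs, hc, hX⟩ p
    exact ⟨_, _, _, ihs hs p, ihc hc p, hX.subst (hok p)⟩
  | elList A L s a l ihA ihL ihs iha ihl =>
    rintro Γ X Δ σ σ' ⟨A', L', s', a', l', hA, hL, hs, ha, hl, hX⟩ p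
    have c3 := ctx_of_tm (rel_tm_der hl)
    have p1 := hups p (head_ty (tail_ctx (tail_ctx c3)))
    have p3 := hups (hups p1 (head_ty (tail_ctx c3))) (head_ty c3)
    exact ⟨_, _, _, _, _, ihA hA p, ihL hL p1, ihs hs p, by simpa [Out.subst] using iha ha p,
      by simpa [Out.subst] using ihl hl p3, by simpa [Out.subst] using hX.subst (hok p)⟩
  | inl A B a ihA ihB iha | inr A B a ihA ihB iha =>
    rintro Γ X Δ σ σ' ⟨A', B', a', hA, hB, ha, hX⟩ p
    exact ⟨_, _, _, ihA hA p, ihB hB p, iha ha p, hX.subst (hok p)⟩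
  | elSum A B M w a b ihA ihB ihM ihw iha ihb =>
    rintro Γ X Δ σ σ' ⟨A', B', M', w', a', b', hA, hB, hM, hw, ha, hb, hX⟩ p
    exact ⟨_, _, _, _, _, _, ihA hA p, ihB hB p,
      ihM hM (hups p (head_ty (ctx_of_ty (rel_ty_der hM)))), ihw hw p,
      by simpa [Out.subst] using iha ha (hups p (rel_ty_der hA)),
      by simpa [Out.subst] using ihb hb (hups p (rel_ty_der hB)),
      by simpa [Out.subst] using hX.subst (hok p)⟩
  | qcl A R a ihA ihR iha =>
    rintro Γ X Δ σ σ' ⟨A', R', a', hA, hR, ha, hX⟩ p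
    have hA0 := rel_ty_der hA
    have p2 := hups (hups p hA0) (head_ty (ctx_two hA0))
    exact ⟨_, _, _, ihA hA p, by simpa [Out.subst] using ihR hR p2, iha ha p, hX.subst (hok p)⟩
  | elQ A R L q l ihA ihR ihL ihq ihl =>
    rintro Γ X Δ σ σ' ⟨A', R', L', q', l', hA, hR, hL, hq, hl, hX⟩ p
    have hA0 := rel_ty_der hA
    have p1 := hups p hA0
    have p2 := hups p1 (head_ty (ctx_two hA0))
    exact ⟨_, _, _, _, _, ihA hA p, by simpa [Out.subst] using ihR hR p2,
      ihL hL (hups p (head_ty (ctx_of_ty (rel_ty_der hL)))), ihq hq p,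
      by simpa [Out.subst] using ihl hl p1,
      by simpa [Out.subst] using hX.subst (hok p)⟩

/-! ### Renamings and represented substitutions -/

/-- Substitutions by variables. -/
structure RenOk (Δ : Ctx) (σ : Sub) (Γ : Ctx) : Prop where
  ok : SubOk Δ σ Γ
  var : ∀ i B, Γ[i]? = some B → ∃ j C, σ i = .var j ∧ Δ[j]? = some C ∧
    B.subst (cmp (sh (i + 1)) σ) = C.subst (sh (j + 1))

theorem RenOk.ups (h : RenOk Δ σ Γ) (hA : IsTy Γ A k) :
    RenOk (A.subst σ :: Δ) (ups σ) (A :: Γ) := by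
  refine ⟨h.ok.ups hA, ?_⟩
  rintro (_ | i) B hB
  · obtain rfl : A = B := by simpa using hB
    exact ⟨0, _, by simp, rfl, by simp⟩
  · obtain ⟨j, C, e1, e2, e3⟩ := h.var i B (by simpa using hB)
    have := congrArg (fun E : Ty => E.subst (sh 1)) e3
    exact ⟨j + 1, C, by simp [e1], by simpa using e2,
      by simpa [Nat.add_assoc, Nat.add_comm 1] using this⟩

/-- A renaming represents itself, since variables are represented by variables. -/
theorem rel_ren {s : Srt} {e : Exp s} {X : Out s} (h : rel e Γ X) (p : RenOk Δ σ Γ) :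
    rel (e.subst σ) Δ (X.subst σ) := by
  refine rel_subst_of (P := fun σ σ' Δ Γ => σ = σ' ∧ RenOk Δ σ Γ) ?_ ?_ ?_ e h ⟨rfl, p⟩
  · rintro σ _ Δ Γ ⟨rfl, h⟩
    exact h.ok
  · rintro σ _ Δ Γ ⟨rfl, h⟩ i B hB
    obtain ⟨j, C, e1, e2, e3⟩ := h.var i B hB
    rw [e3, e1]
    exact ⟨C, e2, .refl (by simpa using Der.var h.ok.ctx e2)⟩
  · rintro σ _ Δ Γ A ⟨rfl, h⟩ hA
    exact ⟨rfl, h.ups hA⟩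

theorem RenOk.sh_one (h : IsCtx (A :: Γ)) : RenOk (A :: Γ) (sh 1) Γ :=
  ⟨.sh_one h, fun i B hB => ⟨i + 1, B, by simp [sh], by simpa using hB,
    by simp [Nat.add_comm]⟩⟩

theorem RenOk.sh_drop (h : IsCtx Γ) (i : ℕ) : RenOk Γ (sh i) (Γ.drop i) := by
  have := (SubOk.id h).drop i
  refine ⟨by simpa using this, fun j B hB => ⟨j + i, B, rfl, ?_, ?_⟩⟩
  · simpa [Nat.add_comm] using hB
  · simp [Nat.add_assoc, Nat.add_comm]

/-- `σ'` represents the substitution `σ`. -/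
structure RelSub (Δ : Ctx) (σ σ' : Sub) (Γ : Ctx) : Prop where
  ok : SubOk Δ σ' Γ
  var : ∀ i B, Γ[i]? = some B → rel (σ i) Δ (σ' i, B.subst (cmp (sh (i + 1)) σ'))

theorem rel_var (h : IsCtx Γ) {i : ℕ} (hA : Γ[i]? = some A) :
    rel (.var i) Γ (.var i, A.subst (sh (i + 1))) :=
  ⟨A, hA, .refl (by simpa using Der.var h hA)⟩

theorem RelSub.scons (h : RelSub Δ σ σ' Γ) (ha : rel a Δ (a', A.subst σ')) :
    RelSub Δ (scons a σ) (scons a' σ') (A :: Γ) := by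
  refine ⟨h.ok.scons (rel_tm_der ha), ?_⟩
  rintro (_ | i) B hB
  · obtain rfl : A = B := by simpa using hB
    simpa using ha
  · simpa using h.var i B (by simpa using hB)

/-- Going under a binder weakens the components of the substitution together with their
representatives, and this is a case of `rel_ren`. -/
theorem RelSub.ups (h : RelSub Δ σ σ' Γ) (hA : IsTy Γ A .col) :
    RelSub (A.subst σ' :: Δ) (ups σ) (ups σ') (A :: Γ) := by
  have c := Der.ctx_cons (ty_subst hA h.ok)
  have := RelSub.scons (a := .var 0) (a' := .var 0) (A := A) (σ := cmp σ (sh 1)) (σ' := cmp σ' (sh 1))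
    ⟨h.ok.shift (ty_subst hA h.ok), fun i B hB => ?_⟩ (by simpa using rel_var c (i := 0) (A := A.subst σ') rfl)
  · simpa [ups] using this
  · simpa [Out.subst] using rel_ren (h.var i B hB) (.sh_one c)

theorem RelSub.id (h : IsCtx Γ) : RelSub Γ (sh 0) (sh 0) Γ :=
  ⟨.id h, fun i B hB => by simpa [sh] using rel_var h hB⟩

theorem RelSub.nil (h : IsCtx Δ) : RelSub Δ σ σ' [] :=
  ⟨.nil h, fun i B hB => by simp at hB⟩

theorem rel_subst {s : Srt} {e : Exp s} {X : Out s} (h : rel e Γ X) (p : RelSub Δ σ σ' Γ) :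
    rel (e.subst σ) Δ (X.subst σ') :=
  rel_subst_of (P := fun σ σ' Δ Γ => RelSub Δ σ σ' Γ) RelSub.ok RelSub.var RelSub.ups e h p

theorem RelSub.inst (ha : rel a Γ (a', A)) :
    RelSub Γ (EmTT.scons a (sh 0)) (EmTT.scons a' (sh 0)) (A :: Γ) :=
  (RelSub.id (ctx_of_tm (rel_tm_der ha))).scons (by simpa using ha)

/-! ## Validity -/

/-- `Γ'` represents the interpretation of the context `Γ`. -/
inductive CtxR : Ctx → Ctx → Prop where
  | nil : CtxR [] []
  | cons {Γ Γ' : Ctx} {A A' : Ty} : CtxR Γ Γ' → rel A Γ' A' → CtxR (A :: Γ) (A' :: Γ')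

theorem CtxR.isCtx (h : CtxR Γ Γ') : IsCtx Γ' := by
  cases h with
  | nil => exact .ctx_nil
  | cons _ h => exact .ctx_cons (rel_ty_der h)

theorem CtxR.interp (h : CtxR Γ Γ') : interpCtx Γ = ctxCls Γ' := by
  induction h with
  | nil => rfl
  | cons _ hA ih =>
    rw [interpCtx, ih]
    exact (congrArg ctxExt (sem_eq_cls _ hA)).trans (ctxExt_tyCls (rel_ty_der hA))

theorem CtxR.getElem (h : CtxR Γ Γ') : ∀ {i : ℕ}, Γ[i]? = some A →
    ∃ A', Γ'[i]? = some A' ∧ rel A (Γ'.drop (i + 1)) A' := by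
  induction h with
  | nil => intro i h; simp at h
  | @cons _ _ B B' h hA ih =>
    rintro (_ | i) h
    · obtain rfl : B = A := by simpa using h
      exact ⟨_, rfl, hA⟩
    · exact ih (by simpa using h)

/-- The context `Γ` is interpreted, whatever the representatives of its initial segments. -/
def CtxV : Ctx → Prop
  | [] => True
  | A :: Γ => CtxV Γ ∧ ∀ Γ', CtxR Γ Γ' → ∃ A', rel A Γ' A'

theorem CtxV.exists : ∀ {Γ}, CtxV Γ → ∃ Γ', CtxR Γ Γ'
  | [], _ => ⟨_, .nil⟩
  | _ :: _, ⟨h, hA⟩ => by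
    obtain ⟨Γ', hΓ⟩ := h.exists
    obtain ⟨A', hA'⟩ := hA Γ' hΓ
    exact ⟨_, hΓ.cons hA'⟩

/-- Over `Γ'`, the types `A` and `B` have a common representative of kind `k`. -/
def TyAt (Γ' : Ctx) (A B : Ty) (k : Kind) : Prop :=
  ∃ A', rel A Γ' A' ∧ rel B Γ' A' ∧ IsTy Γ' A' k

/-- Over `Γ'`, the terms `a` and `b` have a common representative, of type `A`. -/
def TmAt (Γ' : Ctx) (a b : Tm) (A : Ty) : Prop :=
  ∃ a' A', rel A Γ' A' ∧ rel a Γ' (a', A') ∧ rel b Γ' (a', A')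

def TyV (Γ : Ctx) (A B : Ty) (k : Kind) : Prop := CtxV Γ ∧ ∀ Γ', CtxR Γ Γ' → TyAt Γ' A B k

def TmV (Γ : Ctx) (a b : Tm) (A : Ty) : Prop := CtxV Γ ∧ ∀ Γ', CtxR Γ Γ' → TmAt Γ' a b A

/-- The interpretation validates a judgement. -/
def Judg.Valid : Judg → Prop
  | .ctx Γ => CtxV Γ
  | .ty Γ A k => TyV Γ A A k
  | .tyEq Γ A B k => TyV Γ A B k
  | .tm Γ a A => TmV Γ a a A
  | .tmEq Γ a b A => TmV Γ a b A

/-- Every representative of `A` represents `B`. -/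
def Repl (Γ : Ctx) (A B : Ty) : Prop := ∀ Γ' X, CtxR Γ Γ' → rel A Γ' X → rel B Γ' X

theorem Repl.refl (Γ : Ctx) (A : Ty) : Repl Γ A A := fun _ _ _ h => h

/-- Any representative of `A` is canonically isomorphic to the common one, by uniqueness, and
representatives can be changed along canonical isomorphisms. -/
theorem TyAt.repl (h : TyAt Γ A B k) (hA : rel A Γ C) : rel B Γ C := by
  obtain ⟨A', h1, h2, _⟩ := h
  exact rel_ty_trans h2 (rel_ty_unique h1 hA)

theorem TyV.repl (h : TyV Γ A B k) : Repl Γ A B := fun Γ' _ c hA => (h.2 Γ' c).repl hA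

/-- The representative of the type can be prescribed, because the common representative of the terms
can be transported to it. This is how the premises of a rule are brought to matching types. -/
theorem TmAt.at (h : TmAt Γ a b A) (hA : rel A Γ C) :
    ∃ c, rel a Γ (c, C) ∧ rel b Γ (c, C) := by
  obtain ⟨a', A', h0, h1, h2⟩ := h
  obtain ⟨c, hc⟩ := TmI.cast (rel_tm_der h1) (rel_ty_unique h0 hA)
  exact ⟨c, rel_tm_trans h1 hc, rel_tm_trans h2 hc⟩

theorem TmV.at (h : TmV Γ a b A) (c : CtxR Γ Γ') (hA : rel A Γ' C) :
    ∃ u, rel a Γ' (u, C) ∧ rel b Γ' (u, C) := (h.2 Γ' c).at hA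

theorem rel_tm_eq (h : rel a Γ (t, A)) (e : EqTm Γ t u A) : rel a Γ (u, A) :=
  rel_tm_trans h (.of_eqTm e)

theorem eqTm_of_rel (h : rel a Γ (t, A)) (h' : rel a Γ (u, A)) : EqTm Γ t u A :=
  (rel_tm_unique h h').eqTm

/-- A representative of the proof-term exists only if some representative of `φ` is true, and all
representatives of `φ` are equiprovable. -/
theorem isTrue_of_rel (h : rel (.tru φ) Γ (t, A)) (hφ : rel φ Γ φ') (hp : IsTy Γ φ' .prop) :
    IsTrue Γ φ' := by
  obtain ⟨ψ, hψ, e⟩ := h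
  obtain ⟨h1, h2⟩ := (rel_ty_unique hφ hψ).prop hp
  exact tr_mpr hp h1 h2 e.left

theorem TmV.isTrue (h : TmV Γ (.tru φ) (.tru φ) φ) (c : CtxR Γ Γ') (hφ : rel φ Γ' φ')
    (hp : IsTy Γ' φ' .prop) : IsTrue Γ' φ' := by
  obtain ⟨u, hu, _⟩ := h.at c hφ
  exact isTrue_of_rel hu hφ hp

theorem TmAt.tru (hφ : rel φ Γ φ') (h : IsTrue Γ φ') : TmAt Γ (.tru φ) (.tru φ) φ :=
  ⟨_, _, hφ, ⟨_, hφ, .refl h⟩, _, hφ, .refl h⟩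

/-! ### Substitutions -/

/-- The representing substitution is built from the first variable on: each new component is
transported to the representative of its type under the part already built. One `σ'` represents both
substitutions, which is what their equality means in the interpretation. -/
theorem TmAt.relSub (c : CtxR Γ Γ') : ∀ {σ τ}, IsCtx Δ →
    (∀ i C, Γ[i]? = some C → TmAt Δ (σ i) (τ i) (C.subst (cmp (sh (i + 1)) σ))) →
    ∃ σ', RelSub Δ σ σ' Γ' ∧ RelSub Δ τ σ' Γ' := by
  induction c with
  | nil => exact fun hΔ _ => ⟨sh 0, .nil hΔ, .nil hΔ⟩
  | @cons Γ Γ' A A' c hA ih =>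
    intro σ τ hΔ h
    obtain ⟨σ', h1, h2⟩ := ih (σ := cmp (sh 1) σ) (τ := cmp (sh 1) τ) hΔ fun i C hC => by
      simpa [Exp.subst] using h (i + 1) C (by simpa using hC)
    obtain ⟨u, hu, hu'⟩ := (h 0 A rfl).at (rel_subst hA h1)
    exact ⟨scons u σ', by simpa using h1.scons hu, by simpa using h2.scons hu'⟩

theorem CtxV.relSub (hΓ : CtxV Γ) (cΔ : CtxR Δ Δ')
    (h : ∀ i C, Γ[i]? = some C → TmV Δ (σ i) (τ i) ((C.lift (i + 1)).subst σ)) :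
    ∃ Γ' σ', CtxR Γ Γ' ∧ RelSub Δ' σ σ' Γ' ∧ RelSub Δ' τ σ' Γ' := by
  obtain ⟨Γ', c⟩ := hΓ.exists
  obtain ⟨σ', h'⟩ := TmAt.relSub c cΔ.isCtx fun i C hC => by
    simpa using (h i C hC).2 Δ' cΔ
  exact ⟨Γ', σ', c, h'⟩

/-- One statement covers the rules of substitution and those of congruence under equal
substitutions, since typing is the case of equal sides. -/
theorem TyV.subst (h : TyV Γ A B k) (hΔ : CtxV Δ)
    (hs : ∀ i C, Γ[i]? = some C → TmV Δ (σ i) (τ i) ((C.lift (i + 1)).subst σ)) :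
    TyV Δ (A.subst σ) (B.subst τ) k := by
  refine ⟨hΔ, fun Δ' cΔ => ?_⟩
  obtain ⟨Γ', σ', c, h1, h2⟩ := h.1.relSub cΔ hs
  obtain ⟨A', hA, hB, hk⟩ := h.2 Γ' c
  exact ⟨_, rel_subst hA h1, rel_subst hB h2, ty_subst hk h1.ok⟩

theorem TmV.subst (h : TmV Γ a b A) (hΔ : CtxV Δ)
    (hs : ∀ i C, Γ[i]? = some C → TmV Δ (σ i) (τ i) ((C.lift (i + 1)).subst σ)) :
    TmV Δ (a.subst σ) (b.subst τ) (A.subst σ) := by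
  refine ⟨hΔ, fun Δ' cΔ => ?_⟩
  obtain ⟨Γ', σ', c, h1, h2⟩ := h.1.relSub cΔ hs
  obtain ⟨a', A', hA, ha, hb⟩ := h.2 Γ' c
  exact ⟨_, _, rel_subst hA h1, rel_subst ha h1, rel_subst hb h2⟩

theorem TmV.var {i : ℕ} (h : CtxV Γ) (hA : Γ[i]? = some A) :
    TmV Γ (.var i) (.var i) (A.lift (i + 1)) := by
  refine ⟨h, fun Γ' c => ?_⟩
  obtain ⟨A', h1, h2⟩ := c.getElem hA
  have h3 := rel_ren h2 (.sh_drop c.isCtx (i + 1))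
  exact ⟨_, _, by simpa [Out.subst] using h3, rel_var c.isCtx h1, rel_var c.isCtx h1⟩

theorem RenOk.relSub (h : RenOk Δ σ Γ) : RelSub Δ σ σ Γ := by
  refine ⟨h.ok, fun i B hB => ?_⟩
  obtain ⟨j, C, e1, e2, e3⟩ := h.var i B hB
  rw [e3, e1]
  exact rel_var h.ok.ctx e2

theorem RelSub.sh_one (h : IsCtx (A :: Γ)) : RelSub (A :: Γ) (sh 1) (sh 1) Γ :=
  (RenOk.sh_one h).relSub

theorem RelSub.sh_two (h : IsCtx (B :: A :: Γ)) : RelSub (B :: A :: Γ) (sh 2) (sh 2) Γ :=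
  (RenOk.sh_drop h 2).relSub

theorem RelSub.sh_three (h : IsCtx (C :: B :: A :: Γ)) :
    RelSub (C :: B :: A :: Γ) (sh 3) (sh 3) Γ :=
  (RenOk.sh_drop h 3).relSub

theorem CtxR.two (c : CtxR Γ Γ') (hA : rel A Γ' A') :
    CtxR (A.lift 1 :: A :: Γ) (A'.subst (sh 1) :: A' :: Γ') := by
  refine (c.cons hA).cons ?_
  simpa [Out.subst] using rel_ren hA (.sh_one (c.cons hA).isCtx)

theorem RelSub.two (h : RelSub Δ σ σ' Γ) (ha : rel a Δ (a', A.subst σ'))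
    (hb : rel b Δ (b', A.subst σ')) :
    RelSub Δ (EmTT.scons b (EmTT.scons a σ)) (EmTT.scons b' (EmTT.scons a' σ'))
      (A.subst (sh 1) :: A :: Γ) :=
  (h.scons ha).scons (by simpa using hb)

theorem RelSub.pairV (hA : rel A Γ A') (hB : rel B (A' :: Γ) B') :
    RelSub (B' :: A' :: Γ) (EmTT.scons (EmTT.pairV A B) (sh 2))
      (EmTT.scons (EmTT.pairV A' B') (sh 2)) (.sig A' B' :: Γ) := by
  have hB0 := rel_ty_der hB
  have c := Der.ctx_cons hB0
  have s := RelSub.sh_two c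
  refine s.scons ⟨_, _, _, _, rel_subst hA s, rel_subst hB (s.ups (rel_ty_der hA)),
    by simpa [Out.subst] using rel_var c (i := 1) (A := A') rfl,
    by simpa [Out.subst] using rel_var c (i := 0) (A := B') rfl, .refl (tm_pairV hB0)⟩

theorem RelSub.inlV (hA : rel A Γ A') (hB : rel B Γ B') (h : IsTy Γ (.sum A' B') k) :
    RelSub (A' :: Γ) (EmTT.scons (EmTT.inlV A B) (sh 1))
      (EmTT.scons (EmTT.inlV A' B') (sh 1)) (.sum A' B' :: Γ) := by
  have c := Der.ctx_cons (rel_ty_der hA)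
  have s := RelSub.sh_one c
  exact s.scons ⟨_, _, _, rel_subst hA s, rel_subst hB s, rel_var c (i := 0) (A := A') rfl,
    .refl (tm_inlV (tyInv h).1 (tyInv h).2)⟩

theorem RelSub.inrV (hA : rel A Γ A') (hB : rel B Γ B') (h : IsTy Γ (.sum A' B') k) :
    RelSub (B' :: Γ) (EmTT.scons (EmTT.inrV A B) (sh 1))
      (EmTT.scons (EmTT.inrV A' B') (sh 1)) (.sum A' B' :: Γ) := by
  have c := Der.ctx_cons (rel_ty_der hB)
  have s := RelSub.sh_one c
  exact s.scons ⟨_, _, _, rel_subst hA s, rel_subst hB s, rel_var c (i := 0) (A := B') rfl,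
    .refl (tm_inrV (tyInv h).1 (tyInv h).2)⟩

theorem RelSub.qclV (hA : rel A Γ A') (hR : rel R (A'.subst (sh 1) :: A' :: Γ) R')
    (h : IsTy Γ (.quo A' R') .set) :
    RelSub (A' :: Γ) (EmTT.scons (EmTT.qclV A R) (sh 1))
      (EmTT.scons (EmTT.qclV A' R') (sh 1)) (.quo A' R' :: Γ) := by
  have hA0 := rel_ty_der hA
  have c := Der.ctx_cons hA0
  have s := RelSub.sh_one c
  have s2 := (s.ups hA0).ups (head_ty (ctx_two hA0))
  exact s.scons ⟨_, _, _, rel_subst hA s, by simpa [Out.subst] using rel_subst hR s2,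
    rel_var c (i := 0) (A := A') rfl, .refl (tm_qclV h)⟩

theorem RelSub.list_cons (h : IsTy Γ A' .set) (hL : rel L (.list A' :: Γ) L') :
    RelSub (listCtx Γ A' L') (EmTT.scons (.cons (.var 2) (.var 1)) (sh 3))
      (EmTT.scons (.cons (.var 2) (.var 1)) (sh 3)) (.list A' :: Γ) := by
  have c := ctx_listCtx h (rel_ty_der hL)
  have := (SubOk.list_cons h (rel_ty_der hL)).tm 0 _ rfl
  have s := RelSub.sh_three c
  exact s.scons ⟨A'.subst (sh 3), _, _, by simpa using rel_var c (i := 2) (A := .list A') rfl,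
    by simpa using rel_var c (i := 1) (A := A'.subst (sh 1)) rfl, .refl (by simpa using this)⟩

theorem CtxR.listCtx (c : CtxR Γ Γ') (hA : rel A Γ' A') (h : IsTy Γ' A' .set)
    (hL : rel L (.list A' :: Γ') L') :
    CtxR (L.inst₁ 2 (.var 1) :: A.lift 1 :: .list A :: Γ) (EmTT.listCtx Γ' A' L') := by
  have hl : rel (.list A) Γ' (.list A') := ⟨_, hA, .refl (.list_form h)⟩
  have c1 := c.cons hl
  have h1 : rel (A.lift 1) (.list A' :: Γ') (A'.subst (sh 1)) := by
    simpa [Out.subst] using rel_ren hA (.sh_one c1.isCtx)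
  have c2 := c1.cons h1
  refine c2.cons ?_
  have s := (RelSub.sh_two c2.isCtx).scons (A := .list A')
    (by simpa using rel_var c2.isCtx (i := 1) (A := .list A') rfl)
  simpa [Out.subst] using rel_subst hL s

/-! ### Validity of the rules for types -/

theorem CtxV.head (h : CtxV (A :: Γ)) : TyV Γ A A .col := by
  refine ⟨h.1, fun Γ' c => ?_⟩
  obtain ⟨A', hA⟩ := h.2 Γ' c
  exact ⟨A', hA, hA, rel_ty_der hA⟩

theorem TyV.ctx_cons (h : TyV Γ A B k) : CtxV (A :: Γ) :=
  ⟨h.1, fun Γ' c => (h.2 Γ' c).imp fun _ h => h.1⟩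

theorem TyV.symm (h : TyV Γ A B k) : TyV Γ B A k :=
  ⟨h.1, fun Γ' c => (h.2 Γ' c).imp fun _ h => ⟨h.2.1, h.1, h.2.2⟩⟩

theorem TyV.trans (h : TyV Γ A B k) (h' : TyV Γ B C k) : TyV Γ A C k := by
  refine ⟨h.1, fun Γ' c => ?_⟩
  obtain ⟨A', hA, hB, hk⟩ := h.2 Γ' c
  exact ⟨A', hA, h'.repl _ _ c hB, hk⟩

theorem TyV.incl {k' : Kind} (i : k.Incl k') (h : TyV Γ A B k) : TyV Γ A B k' :=
  ⟨h.1, fun Γ' c => (h.2 Γ' c).imp fun _ h => ⟨h.1, h.2.1, .incl i h.2.2⟩⟩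

theorem TmV.symm (h : TmV Γ a b A) : TmV Γ b a A :=
  ⟨h.1, fun Γ' c => by
    obtain ⟨u, A', h0, h1, h2⟩ := h.2 Γ' c
    exact ⟨u, A', h0, h2, h1⟩⟩

theorem TmV.trans (h : TmV Γ a b A) (h' : TmV Γ b c A) : TmV Γ a c A := by
  refine ⟨h.1, fun Γ' x => ?_⟩
  obtain ⟨u, A', h0, h1, h2⟩ := h.2 Γ' x
  obtain ⟨v, h3, h4⟩ := h'.at x h0
  exact ⟨u, A', h0, h1, rel_tm_eq h4 (eqTm_of_rel h3 h2)⟩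

theorem TmV.conv (h : TmV Γ a b A) (e : TyV Γ A B .col) : TmV Γ a b B :=
  ⟨h.1, fun Γ' x => by
    obtain ⟨u, A', h0, h1, h2⟩ := h.2 Γ' x
    exact ⟨u, A', e.repl _ _ x h0, h1, h2⟩⟩

theorem TyV.N0 (h : CtxV Γ) : TyV Γ .N0 .N0 .set := by
  refine ⟨h, fun Γ' c => ?_⟩
  have := Der.N0_form c.isCtx
  exact ⟨_, TyI.refl this, TyI.refl this, this⟩

theorem TyV.N1 (h : CtxV Γ) : TyV Γ .N1 .N1 .set := by
  refine ⟨h, fun Γ' c => ?_⟩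
  have := Der.N1_form c.isCtx
  exact ⟨_, TyI.refl this, TyI.refl this, this⟩

theorem rel_P1 (h : IsCtx Γ) : rel .P1 Γ .P1 := TyI.refl (.P1_form h)

theorem TyV.P1 (h : CtxV Γ) : TyV Γ .P1 .P1 .col :=
  ⟨h, fun _ c => ⟨_, rel_P1 c.isCtx, rel_P1 c.isCtx, .P1_form c.isCtx⟩⟩

theorem rel_bot (h : IsCtx Γ) : rel .bot Γ .bot := TyI.refl (.bot_form h)

theorem TyV.bot (h : CtxV Γ) : TyV Γ .bot .bot .props :=
  ⟨h, fun _ c => ⟨_, rel_bot c.isCtx, rel_bot c.isCtx, .bot_form c.isCtx⟩⟩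

theorem TyV.sig {s : Bool} (h : TyV Γ A A' (.typ s)) (h' : TyV (A :: Γ) B B' (.typ s)) :
    TyV Γ (.sig A B) (.sig A' B') (.typ s) := by
  refine ⟨h.1, fun Γ' c => ?_⟩
  obtain ⟨X, a1, a2, hX⟩ := h.2 Γ' c
  obtain ⟨Y, b1, b2, hY⟩ := h'.2 _ (c.cons a1)
  have hf := Der.sig_form s hX hY
  exact ⟨_, ⟨_, _, a1, b1, .refl hf⟩, ⟨_, _, a2, b2, .refl hf⟩, hf⟩

theorem TyV.pi (h : TyV Γ A A' .set) (h' : TyV (A :: Γ) B B' .set) :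
    TyV Γ (.pi A B) (.pi A' B') .set := by
  refine ⟨h.1, fun Γ' c => ?_⟩
  obtain ⟨X, a1, a2, hX⟩ := h.2 Γ' c
  obtain ⟨Y, b1, b2, hY⟩ := h'.2 _ (c.cons a1)
  have hf := Der.pi_form hX hY
  exact ⟨_, ⟨_, _, a1, b1, .refl hf⟩, ⟨_, _, a2, b2, .refl hf⟩, hf⟩

theorem TyV.piP1 (h : TyV Γ A A' .set) : TyV Γ (.pi A .P1) (.pi A' .P1) .col := by
  refine ⟨h.1, fun Γ' c => ?_⟩
  obtain ⟨X, a1, a2, hX⟩ := h.2 Γ' c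
  have hP := rel_P1 (c.cons a1).isCtx
  have hf := Der.piP1_form hX
  exact ⟨_, ⟨_, _, a1, hP, .refl hf⟩, ⟨_, _, a2, hP, .refl hf⟩, hf⟩

theorem TyV.sum (h : TyV Γ A A' .set) (h' : TyV Γ B B' .set) :
    TyV Γ (.sum A B) (.sum A' B') .set := by
  refine ⟨h.1, fun Γ' c => ?_⟩
  obtain ⟨X, a1, a2, hX⟩ := h.2 Γ' c
  obtain ⟨Y, b1, b2, hY⟩ := h'.2 Γ' c
  have hf := Der.sum_form hX hY
  exact ⟨_, ⟨_, _, a1, b1, .refl hf⟩, ⟨_, _, a2, b2, .refl hf⟩, hf⟩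

theorem TyV.list (h : TyV Γ A A' .set) : TyV Γ (.list A) (.list A') .set := by
  refine ⟨h.1, fun Γ' c => ?_⟩
  obtain ⟨X, a1, a2, hX⟩ := h.2 Γ' c
  have hf := Der.list_form hX
  exact ⟨_, ⟨_, a1, .refl hf⟩, ⟨_, a2, .refl hf⟩, hf⟩

/-- The validity of the equivalence conditions says that their representatives are true in the
contexts built from the representatives `X` and `Y`. These are the premises of the formation of the
quotient of `X` by `Y` in `emTT`. -/
theorem TyV.quo (h : TyV Γ A A .set) (h' : TyV (A.lift 1 :: A :: Γ) R R .props)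
    (h1 : (Judg.tr (A :: Γ) (R.inst₂ 1 (.var 0) (.var 0))).Valid)
    (h2 : (Judg.tr (R :: A.lift 1 :: A :: Γ) (R.inst₂ 3 (.var 1) (.var 2))).Valid)
    (h3 : (Judg.tr (R.inst₂ 4 (.var 2) (.var 1) :: R.inst₂ 3 (.var 2) (.var 1) ::
          A.lift 2 :: A.lift 1 :: A :: Γ) (R.inst₂ 5 (.var 4) (.var 2))).Valid) :
    TyV Γ (.quo A R) (.quo A R) .set := by
  refine ⟨h.1, fun Γ' c => ?_⟩
  obtain ⟨X, hA, -, hX⟩ := h.2 Γ' c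
  have c1 := c.cons hA
  have c2 := c.two hA
  obtain ⟨Y, hR, -, hY⟩ := h'.2 _ c2
  have c3 := c2.cons hR
  have s1 := RelSub.sh_one c1.isCtx
  have v1 := rel_var c1.isCtx (i := 0) (A := X) rfl
  have r1 := rel_subst hR (s1.two v1 v1)
  have s3 := RelSub.sh_three c3.isCtx
  have u3 := s3.two (a := .var 1) (a' := .var 1) (b := .var 2) (b' := .var 2) (A := X)
    (by simpa using rel_var c3.isCtx (i := 1) (A := Exp.subst X (sh 1)) rfl)
    (by simpa using rel_var c3.isCtx (i := 2) (A := X) rfl)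
  have c4 : CtxR (A.lift 2 :: A.lift 1 :: A :: Γ) (X.subst (sh 2) :: X.subst (sh 1) :: X :: Γ') :=
    c2.cons (by simpa [Out.subst] using rel_subst hA (.sh_two c2.isCtx))
  have r3 := rel_subst hR ((RelSub.sh_three c4.isCtx).two
    (a := .var 2) (a' := .var 2) (b := .var 1) (b' := .var 1) (A := X)
    (by simpa using rel_var c4.isCtx (i := 2) (A := X) rfl)
    (by simpa using rel_var c4.isCtx (i := 1) (A := Exp.subst X (sh 1)) rfl))
  have c5 := c4.cons r3
  have w5 := (RenOk.sh_drop c5.isCtx 4).relSub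
  have r4 := rel_subst hR (w5.two
    (a := .var 2) (a' := .var 2) (b := .var 1) (b' := .var 1) (A := X)
    (by simpa using rel_var c5.isCtx (i := 2) (A := Exp.subst X (sh 1)) rfl)
    (by simpa using rel_var c5.isCtx (i := 1) (A := Exp.subst X (sh 2)) rfl))
  have c6 := c5.cons r4
  have w6 := (RenOk.sh_drop c6.isCtx 5).relSub
  have u6 := w6.two
    (a := .var 4) (a' := .var 4) (b := .var 2) (b' := .var 2) (A := X)
    (by simpa using rel_var c6.isCtx (i := 4) (A := X) rfl)
    (by simpa using rel_var c6.isCtx (i := 2) (A := Exp.subst X (sh 2)) rfl)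
  have hp := Der.incl .props_prop hY
  have hf : IsTy Γ' (.quo X Y) .set := .quo_form hX (by simpa using hY)
    (TmV.isTrue h1 c1 r1 (ty_subst hp (s1.two v1 v1).ok))
    (by simpa [Out.subst] using TmV.isTrue h2 c3 (rel_subst hR u3) (ty_subst hp u3.ok))
    (by simpa [Out.subst] using TmV.isTrue h3 c6 (rel_subst hR u6) (ty_subst hp u6.ok))
  exact ⟨_, ⟨_, _, hA, hR, .refl hf⟩, ⟨_, _, hA, hR, .refl hf⟩, hf⟩

/-- The representatives of a type headed by `quo`. -/
theorem rel_quo (h : rel (.quo A R) Γ C) : ∃ A' R', rel A Γ A' ∧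
    rel R (A'.subst (sh 1) :: A' :: Γ) R' ∧ QuoCond Γ A' R' ∧ rel (.quo A R) Γ (.quo A' R') := by
  obtain ⟨A', R', hA, hR, e⟩ := h
  exact ⟨A', R', hA, hR, quoCond e.left, _, _, hA, hR, .refl e.left⟩

theorem rel_pi (h : rel (.pi A B) Γ C) : ∃ A' B', rel A Γ A' ∧
    rel B (A' :: Γ) B' ∧ IsTy Γ (.pi A' B') .col ∧ rel (.pi A B) Γ (.pi A' B') := by
  obtain ⟨A', R', hA, hR, e⟩ := h
  exact ⟨A', R', hA, hR, e.left, _, _, hA, hR, .refl e.left⟩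

theorem rel_sum (h : rel (.sum A B) Γ C) : ∃ A' B', rel A Γ A' ∧
    rel B Γ B' ∧ IsTy Γ A' .set ∧ IsTy Γ B' .set ∧ rel (.sum A B) Γ (.sum A' B') := by
  obtain ⟨A', R', hA, hR, e⟩ := h
  exact ⟨A', R', hA, hR, (tyInv e.left).1, (tyInv e.left).2, _, _, hA, hR, .refl e.left⟩

theorem rel_list (h : rel (.list A) Γ C) : ∃ A', rel A Γ A' ∧ IsTy Γ A' .set ∧
    rel (.list A) Γ (.list A') := by
  obtain ⟨A', hA, e⟩ := h
  exact ⟨A', hA, tyInv e.left, _, hA, .refl e.left⟩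

/-- The equivalence conditions are already contained in the representatives of the left quotient,
and the components of these also represent the components of the right one. -/
theorem TyV.quo_eq (hQ : TyV Γ (.quo A R) (.quo A R) k) (h : Repl Γ A A')
    (h' : Repl (A.lift 1 :: A :: Γ) R R') : TyV Γ (.quo A R) (.quo A' R') .set := by
  refine ⟨hQ.1, fun Γ' c => ?_⟩
  obtain ⟨_, hC, -, -⟩ := hQ.2 Γ' c
  obtain ⟨X, Y, hA, hR, hq, hC'⟩ := rel_quo hC
  exact ⟨_, hC', ⟨_, _, h _ _ c hA, h' _ _ (c.two hA) hR, .refl hq.form⟩, hq.form⟩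

theorem TyV.and {s : Bool} (h : TyV Γ φ φ' (.prp s)) (h' : TyV Γ ψ ψ' (.prp s)) :
    TyV Γ (.and φ ψ) (.and φ' ψ') (.prp s) := by
  refine ⟨h.1, fun Γ' c => ?_⟩
  obtain ⟨X, a1, a2, hX⟩ := h.2 Γ' c
  obtain ⟨Y, b1, b2, hY⟩ := h'.2 Γ' c
  have hf := Der.and_form s hX hY
  exact ⟨_, ⟨_, _, a1, b1, .refl hf⟩, ⟨_, _, a2, b2, .refl hf⟩, hf⟩

theorem TyV.or {s : Bool} (h : TyV Γ φ φ' (.prp s)) (h' : TyV Γ ψ ψ' (.prp s)) :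
    TyV Γ (.or φ ψ) (.or φ' ψ') (.prp s) := by
  refine ⟨h.1, fun Γ' c => ?_⟩
  obtain ⟨X, a1, a2, hX⟩ := h.2 Γ' c
  obtain ⟨Y, b1, b2, hY⟩ := h'.2 Γ' c
  have hf := Der.or_form s hX hY
  exact ⟨_, ⟨_, _, a1, b1, .refl hf⟩, ⟨_, _, a2, b2, .refl hf⟩, hf⟩

theorem TyV.imp {s : Bool} (h : TyV Γ φ φ' (.prp s)) (h' : TyV Γ ψ ψ' (.prp s)) :
    TyV Γ (.imp φ ψ) (.imp φ' ψ') (.prp s) := by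
  refine ⟨h.1, fun Γ' c => ?_⟩
  obtain ⟨X, a1, a2, hX⟩ := h.2 Γ' c
  obtain ⟨Y, b1, b2, hY⟩ := h'.2 Γ' c
  have hf := Der.imp_form s hX hY
  exact ⟨_, ⟨_, _, a1, b1, .refl hf⟩, ⟨_, _, a2, b2, .refl hf⟩, hf⟩

theorem TyV.ex {s : Bool} (h : TyV Γ A A' (.typ s)) (h' : TyV (A :: Γ) φ φ' (.prp s)) :
    TyV Γ (.ex A φ) (.ex A' φ') (.prp s) := by
  refine ⟨h.1, fun Γ' c => ?_⟩
  obtain ⟨X, a1, a2, hX⟩ := h.2 Γ' c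
  obtain ⟨Y, b1, b2, hY⟩ := h'.2 _ (c.cons a1)
  have hf := Der.ex_form s hX hY
  exact ⟨_, ⟨_, _, a1, b1, .refl hf⟩, ⟨_, _, a2, b2, .refl hf⟩, hf⟩

theorem TyV.all {s : Bool} (h : TyV Γ A A' (.typ s)) (h' : TyV (A :: Γ) φ φ' (.prp s)) :
    TyV Γ (.all A φ) (.all A' φ') (.prp s) := by
  refine ⟨h.1, fun Γ' c => ?_⟩
  obtain ⟨X, a1, a2, hX⟩ := h.2 Γ' c
  obtain ⟨Y, b1, b2, hY⟩ := h'.2 _ (c.cons a1)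
  have hf := Der.all_form s hX hY
  exact ⟨_, ⟨_, _, a1, b1, .refl hf⟩, ⟨_, _, a2, b2, .refl hf⟩, hf⟩

theorem TyV.eq {s : Bool} (h : TyV Γ A A' (.typ s)) (ha : TmV Γ a a' A) (hb : TmV Γ b b' A) :
    TyV Γ (.eq A a b) (.eq A' a' b') (.prp s) := by
  refine ⟨h.1, fun Γ' c => ?_⟩
  obtain ⟨X, x1, x2, hX⟩ := h.2 Γ' c
  obtain ⟨u, u1, u2⟩ := ha.at c x1
  obtain ⟨v, v1, v2⟩ := hb.at c x1
  have hf := Der.eq_form s hX (rel_tm_der u1) (rel_tm_der v1)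
  exact ⟨_, ⟨_, _, _, x1, u1, v1, .refl hf⟩, ⟨_, _, _, x2, u2, v2, .refl hf⟩, hf⟩

theorem TyV.eqP1 (ha : TmV Γ a a' .P1) (hb : TmV Γ b b' .P1) :
    TyV Γ (.eq .P1 a b) (.eq .P1 a' b') .props := by
  refine ⟨ha.1, fun Γ' c => ?_⟩
  have x1 := rel_P1 c.isCtx
  obtain ⟨u, u1, u2⟩ := ha.at c x1
  obtain ⟨v, v1, v2⟩ := hb.at c x1
  have hf := Der.eqP1_form (rel_tm_der u1) (rel_tm_der v1)
  exact ⟨_, ⟨_, _, _, x1, u1, v1, .refl hf⟩, ⟨_, _, _, x1, u2, v2, .refl hf⟩, hf⟩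

theorem rel_iff (hφ : rel φ Γ φ') (hψ : rel ψ Γ ψ') (h : IsTy Γ φ' .prop) (h' : IsTy Γ ψ' .prop) :
    rel (Exp.iff φ ψ) Γ (Exp.iff φ' ψ') := by
  have h1 := Der.imp_form false h h'
  have h2 := Der.imp_form false h' h
  exact ⟨_, _, ⟨_, _, hφ, hψ, .refl h1⟩, ⟨_, _, hψ, hφ, .refl h2⟩,
    .refl (Der.and_form false h1 h2)⟩

/-- The decisive rule. The hypothesis makes the representatives of `φ` and `ψ` equiprovable in
`emTT`, hence canonically isomorphic; so the representative of `φ` represents `ψ` too, and it has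
the required kind. -/
theorem TyV.propext {s : Bool} (hφ : TyV Γ φ φ (.prp s)) (hψ : TyV Γ ψ ψ (.prp s))
    (h : (Judg.tr Γ (Exp.iff φ ψ)).Valid) : TyV Γ φ ψ (.prp s) := by
  refine ⟨hφ.1, fun Γ' c => ?_⟩
  obtain ⟨X, x1, -, hX⟩ := hφ.2 Γ' c
  obtain ⟨Y, y1, -, hY⟩ := hψ.2 Γ' c
  have := TmV.isTrue h c (rel_iff x1 y1 hX.ty_prop hY.ty_prop) (iff_form hX.ty_prop hY.ty_prop)
  exact ⟨X, x1, rel_ty_trans y1 (TyI.of_iff hX.ty_prop hY.ty_prop this).symm, hX⟩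

/-! ### Validity of the rules for terms -/

theorem rel_N0 (h : IsCtx Γ) : rel .N0 Γ .N0 := TyI.refl (.N0_form h)
theorem rel_N1 (h : IsCtx Γ) : rel .N1 Γ .N1 := TyI.refl (.N1_form h)

/-- As for the other constructors, typing and congruence are treated at once: representatives common
to both sides are chosen for the arguments, the rule of `emTT` is applied to them, and the result
represents both sides. -/
theorem TmV.emp (hM : TyV (.N0 :: Γ) M M' .col) (hc : TmV Γ c c' .N0) :
    TmV Γ (.emp M c) (.emp M' c') (M.inst₁ 0 c) := by
  refine ⟨hc.1, fun Γ' x => ?_⟩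
  have n := rel_N0 x.isCtx
  obtain ⟨X, m1, m2, hX⟩ := hM.2 _ (x.cons n)
  obtain ⟨u, u1, u2⟩ := hc.at x n
  have t := Der.N0_elim hX (rel_tm_der u1)
  exact ⟨_, _, rel_subst m1 (.inst u1), ⟨_, _, m1, u1, .refl t⟩, ⟨_, _, m2, u2, .refl t⟩⟩

theorem rel_star (h : IsCtx Γ) : rel .star Γ (.star, .N1) := TmI.refl (.N1_intro h)

theorem TmV.star (h : CtxV Γ) : TmV Γ .star .star .N1 :=
  ⟨h, fun _ c => ⟨_, _, rel_N1 c.isCtx, rel_star c.isCtx, rel_star c.isCtx⟩⟩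

theorem TmV.elN1 (hM : TyV (.N1 :: Γ) M M' .col) (ht : TmV Γ t t' .N1)
    (hc : TmV Γ c c' (M.inst₁ 0 .star)) :
    TmV Γ (.elN1 M t c) (.elN1 M' t' c') (M.inst₁ 0 t) := by
  refine ⟨hc.1, fun Γ' x => ?_⟩
  have n := rel_N1 x.isCtx
  obtain ⟨X, m1, m2, hX⟩ := hM.2 _ (x.cons n)
  obtain ⟨u, u1, u2⟩ := ht.at x n
  obtain ⟨v, v1, v2⟩ := hc.at x (rel_subst m1 (.inst (rel_star x.isCtx)))
  have t := Der.N1_elim hX (rel_tm_der u1) (rel_tm_der v1)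
  exact ⟨_, _, rel_subst m1 (.inst u1), ⟨_, _, _, m1, u1, v1, .refl t⟩,
    ⟨_, _, _, m2, u2, v2, .refl t⟩⟩

theorem TmV.elN1_beta (hM : TyV (.N1 :: Γ) M M .col) (hc : TmV Γ c c (M.inst₁ 0 .star)) :
    TmV Γ (.elN1 M .star c) c (M.inst₁ 0 .star) := by
  refine ⟨hc.1, fun Γ' x => ?_⟩
  obtain ⟨X, m1, -, hX⟩ := hM.2 _ (x.cons (rel_N1 x.isCtx))
  have s := rel_star x.isCtx
  have h := rel_subst m1 (.inst s)
  obtain ⟨v, v1, -⟩ := hc.at x h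
  exact ⟨_, _, h, ⟨_, _, _, m1, s, v1, .of_eqTm (.N1_beta hX (rel_tm_der v1))⟩, v1⟩

theorem TmV.pair (hA : TyV Γ A A' .col) (hB : TyV (A :: Γ) B B' .col) (ha : TmV Γ a a' A)
    (hb : TmV Γ b b' (B.inst₁ 0 a)) :
    TmV Γ (.pair A B a b) (.pair A' B' a' b') (.sig A B) := by
  refine ⟨ha.1, fun Γ' x => ?_⟩
  obtain ⟨X, x1, x2, hX⟩ := hA.2 _ x
  obtain ⟨Y, y1, y2, hY⟩ := hB.2 _ (x.cons x1)
  obtain ⟨u, u1, u2⟩ := ha.at x x1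
  obtain ⟨v, v1, v2⟩ := hb.at x (rel_subst y1 (.inst u1))
  have t := Der.sig_intro hY (rel_tm_der u1) (rel_tm_der v1)
  exact ⟨_, _, ⟨_, _, x1, y1, .refl (Der.sig_form false hX hY)⟩,
    ⟨_, _, _, _, x1, y1, u1, v1, .refl t⟩, ⟨_, _, _, _, x2, y2, u2, v2, .refl t⟩⟩

theorem TmV.elSig (hA : TyV Γ A A' .col) (hB : TyV (A :: Γ) B B' .col)
    (hM : TyV (.sig A B :: Γ) M M' .col) (hd : TmV Γ d d' (.sig A B))
    (hm : TmV (B :: A :: Γ) m m' (M.inst₁ 2 (.pair (A.lift 2) (B.lift₁ 2) (.var 1) (.var 0)))) :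
    TmV Γ (.elSig A B M d m) (.elSig A' B' M' d' m') (M.inst₁ 0 d) := by
  simp only [inst₁_eq, lift_eq, lift₁_eq] at hm ⊢
  refine ⟨hd.1, fun Γ' x => ?_⟩
  obtain ⟨X, x1, x2, hX⟩ := hA.2 _ x
  obtain ⟨Y, y1, y2, hY⟩ := hB.2 _ (x.cons x1)
  have hS : rel (.sig A B) Γ' (.sig X Y) := ⟨_, _, x1, y1, .refl (Der.sig_form false hX hY)⟩
  obtain ⟨Z, z1, z2, hZ⟩ := hM.2 _ (x.cons hS)
  obtain ⟨u, u1, u2⟩ := hd.at x hS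
  obtain ⟨v, v1, v2⟩ := hm.at ((x.cons x1).cons y1) (rel_subst z1 (.pairV x1 y1))
  have t := Der.sig_elim hZ (rel_tm_der u1) (by simpa [Out.subst] using rel_tm_der v1)
  exact ⟨_, _, rel_subst z1 (.inst u1), ⟨_, _, _, _, _, x1, y1, z1, u1, v1, .refl t⟩,
    ⟨_, _, _, _, _, x2, y2, z2, u2, v2, .refl t⟩⟩

theorem TmV.elSig_beta (hM : TyV (.sig A B :: Γ) M M .col)
    (ha : TmV Γ a a A) (hb : TmV Γ b b (B.inst₁ 0 a))
    (hm : TmV (B :: A :: Γ) m m (M.inst₁ 2 (.pair (A.lift 2) (B.lift₁ 2) (.var 1) (.var 0)))) :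
    TmV Γ (.elSig A B M (.pair A B a b) m) (m.inst₂ 0 a b) (M.inst₁ 0 (.pair A B a b)) := by
  simp only [inst₁_eq, lift_eq, lift₁_eq, inst₂_eq] at hm ⊢
  refine ⟨ha.1, fun Γ' x => ?_⟩
  -- The rule has no separate premises on `A` and `B`; their representatives come from the validity
  -- of the context of the branch.
  obtain ⟨X, x1, -, hX⟩ := hm.1.1.head.2 _ x
  obtain ⟨Y, y1, -, hY⟩ := hm.1.head.2 _ (x.cons x1)
  have hS : rel (.sig A B) Γ' (.sig X Y) := ⟨_, _, x1, y1, .refl (Der.sig_form false hX hY)⟩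
  obtain ⟨Z, z1, -, hZ⟩ := hM.2 _ (x.cons hS)
  obtain ⟨u, u1, -⟩ := ha.at x x1
  obtain ⟨w, w1, -⟩ := hb.at x (rel_subst y1 (.inst u1))
  obtain ⟨v, v1, -⟩ := hm.at ((x.cons x1).cons y1) (rel_subst z1 (.pairV x1 y1))
  have hp : rel (.pair A B a b) Γ' (.pair X Y u w, .sig X Y) :=
    ⟨_, _, _, _, x1, y1, u1, w1, .refl (Der.sig_intro hY (rel_tm_der u1) (rel_tm_der w1))⟩
  have t := Der.sig_beta hZ (rel_tm_der u1) (rel_tm_der w1)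
    (by simpa [Out.subst] using rel_tm_der v1)
  rw [inst₂_eq] at t
  have hr := rel_subst v1 ((RelSub.inst u1).scons w1)
  exact ⟨_, _, rel_subst z1 (.inst hp), ⟨_, _, _, _, _, x1, y1, z1, hp, v1, .of_eqTm t⟩,
    by simpa [Out.subst] using hr⟩

theorem TmV.lam (hP : TyV Γ (.pi A B) (.pi A B) k) (hA : Repl Γ A A')
    (hb : TmV (A :: Γ) b b' B) : TmV Γ (.lam A b) (.lam A' b') (.pi A B) := by
  refine ⟨hP.1, fun Γ' x => ?_⟩
  obtain ⟨_, hC, -, -⟩ := hP.2 _ x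
  obtain ⟨X, Y, x1, y1, hp, hC'⟩ := rel_pi hC
  obtain ⟨u, u1, u2⟩ := hb.at (x.cons x1) y1
  have t := Der.pi_intro hp (rel_tm_der u1)
  exact ⟨_, _, hC', ⟨_, _, _, x1, u1, .refl t⟩, ⟨_, _, _, hA _ _ x x1, u2, .refl t⟩⟩

theorem TmV.app (hf : TmV Γ f f' (.pi A B)) (ha : TmV Γ a a' A) :
    TmV Γ (.app f a) (.app f' a') (B.inst₁ 0 a) := by
  refine ⟨ha.1, fun Γ' x => ?_⟩
  obtain ⟨_, _, hC, -, -⟩ := hf.2 _ x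
  obtain ⟨X, Y, x1, y1, hp, hC'⟩ := rel_pi hC
  obtain ⟨u, u1, u2⟩ := hf.at x hC'
  obtain ⟨v, v1, v2⟩ := ha.at x x1
  have t := Der.pi_elim (rel_tm_der u1) (rel_tm_der v1)
  exact ⟨_, _, rel_subst y1 (.inst v1), ⟨_, _, _, _, u1, v1, .refl t⟩, ⟨_, _, _, _, u2, v2, .refl t⟩⟩

theorem TmV.app_beta (hP : TyV Γ (.pi A B) (.pi A B) k) (hb : TmV (A :: Γ) b b B)
    (ha : TmV Γ a a A) : TmV Γ (.app (.lam A b) a) (b.inst₁ 0 a) (B.inst₁ 0 a) := by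
  refine ⟨ha.1, fun Γ' x => ?_⟩
  obtain ⟨_, hC, -, -⟩ := hP.2 _ x
  obtain ⟨X, Y, x1, y1, hp, hC'⟩ := rel_pi hC
  obtain ⟨u, u1, -⟩ := hb.at (x.cons x1) y1
  obtain ⟨v, v1, -⟩ := ha.at x x1
  have t := Der.pi_intro hp (rel_tm_der u1)
  exact ⟨_, _, rel_subst y1 (.inst v1), ⟨_, _, _, _, ⟨_, _, _, x1, u1, .refl t⟩, v1,
    .of_eqTm (.pi_beta hp (rel_tm_der u1) (rel_tm_der v1))⟩, rel_subst u1 (.inst v1)⟩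

theorem TmV.pi_eta (hf : TmV Γ f f (.pi A B)) :
    TmV Γ (.lam A (.app (f.lift 1) (.var 0))) f (.pi A B) := by
  simp only [lift_eq]
  refine ⟨hf.1, fun Γ' x => ?_⟩
  obtain ⟨_, _, hC, -, -⟩ := hf.2 _ x
  obtain ⟨X, Y, x1, y1, hp, hC'⟩ := rel_pi hC
  obtain ⟨u, u1, -⟩ := hf.at x hC'
  have c := (x.cons x1).isCtx
  have hu := rel_tm_der u1
  have happ : rel (.app (f.subst (sh 1)) (.var 0)) (X :: Γ')
      (.app (u.subst (sh 1)) (.var 0), Y) :=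
    ⟨X.subst (sh 1), Exp.subst Y (ups (sh 1)), _, _, rel_ren u1 (.sh_one c), rel_var c (i := 0) rfl,
      by simpa using TmI.refl (tm_app_var hu)⟩
  exact ⟨_, _, hC', ⟨_, _, _, x1, happ, .of_eqTm (by simpa using Der.pi_eta hu)⟩, u1⟩

theorem TmV.nil (hA : TyV Γ A A' .set) : TmV Γ (.nil A) (.nil A') (.list A) := by
  refine ⟨hA.1, fun Γ' x => ?_⟩
  obtain ⟨X, x1, x2, hX⟩ := hA.2 _ x
  have t := Der.list_nil hX
  exact ⟨_, _, ⟨_, x1, .refl (Der.list_form hX)⟩, ⟨_, x1, .refl t⟩, ⟨_, x2, .refl t⟩⟩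

theorem TmV.cons (hs : TmV Γ s s' (.list A)) (hc : TmV Γ c c' A) :
    TmV Γ (.cons s c) (.cons s' c') (.list A) := by
  refine ⟨hs.1, fun Γ' x => ?_⟩
  obtain ⟨_, _, hC, -, -⟩ := hs.2 _ x
  obtain ⟨X, x1, hX, hC'⟩ := rel_list hC
  obtain ⟨u, u1, u2⟩ := hs.at x hC'
  obtain ⟨v, v1, v2⟩ := hc.at x x1
  have t := Der.list_cons (rel_tm_der u1) (rel_tm_der v1)
  exact ⟨_, _, hC', ⟨_, _, _, u1, v1, .refl t⟩, ⟨_, _, _, u2, v2, .refl t⟩⟩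

theorem TmV.elList (hA : Repl Γ A A') (hL : TyV (.list A :: Γ) L L' .col)
    (hs : TmV Γ s s' (.list A)) (ha : TmV Γ a a' (L.inst₁ 0 (.nil A)))
    (hl : TmV (L.inst₁ 2 (.var 1) :: A.lift 1 :: .list A :: Γ) l l'
      (L.inst₁ 3 (.cons (.var 2) (.var 1)))) :
    TmV Γ (.elList A L s a l) (.elList A' L' s' a' l') (L.inst₁ 0 s) := by
  refine ⟨hs.1, fun Γ' x => ?_⟩
  obtain ⟨_, _, hC, -, -⟩ := hs.2 _ x
  obtain ⟨X, x1, hX, hC'⟩ := rel_list hC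
  obtain ⟨Z, z1, z2, hZ⟩ := hL.2 _ (x.cons hC')
  obtain ⟨u, u1, u2⟩ := hs.at x hC'
  obtain ⟨v, v1, v2⟩ := ha.at x
    (rel_subst z1 (.inst ⟨_, x1, .refl (Der.list_nil hX)⟩))
  obtain ⟨w, w1, w2⟩ := hl.at (x.listCtx x1 hX z1) (rel_subst z1 (.list_cons hX z1))
  have t := Der.list_elim hZ (rel_tm_der u1) (rel_tm_der v1)
    (by simpa [Out.subst] using rel_tm_der w1)
  exact ⟨_, _, rel_subst z1 (.inst u1), ⟨_, _, _, _, _, x1, z1, u1, v1, w1, .refl t⟩,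
    ⟨_, _, _, _, _, hA _ _ x x1, z2, u2, v2, w2, .refl t⟩⟩

theorem TmV.elList_beta_nil (hL : TyV (.list A :: Γ) L L .col)
    (ha : TmV Γ a a (L.inst₁ 0 (.nil A)))
    (hl : TmV (L.inst₁ 2 (.var 1) :: A.lift 1 :: .list A :: Γ) l l
      (L.inst₁ 3 (.cons (.var 2) (.var 1)))) :
    TmV Γ (.elList A L (.nil A) a l) a (L.inst₁ 0 (.nil A)) := by
  refine ⟨ha.1, fun Γ' x => ?_⟩
  obtain ⟨_, hC, -, -⟩ := hL.1.head.2 _ x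
  obtain ⟨X, x1, hX, hC'⟩ := rel_list hC
  obtain ⟨Z, z1, -, hZ⟩ := hL.2 _ (x.cons hC')
  have u1 : rel (.nil A) Γ' (.nil X, .list X) := ⟨_, x1, .refl (Der.list_nil hX)⟩
  have hr := rel_subst z1 (.inst u1)
  obtain ⟨v, v1, -⟩ := ha.at x hr
  obtain ⟨w, w1, -⟩ := hl.at (x.listCtx x1 hX z1) (rel_subst z1 (.list_cons hX z1))
  have t := Der.list_beta_nil hZ (rel_tm_der v1) (by simpa [Out.subst] using rel_tm_der w1)
  exact ⟨_, _, hr, ⟨_, _, _, _, _, x1, z1, u1, v1, w1, .of_eqTm t⟩, v1⟩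

theorem TmV.elList_beta_cons (hL : TyV (.list A :: Γ) L L .col)
    (hs : TmV Γ s s (.list A)) (hc : TmV Γ c c A) (ha : TmV Γ a a (L.inst₁ 0 (.nil A)))
    (hl : TmV (L.inst₁ 2 (.var 1) :: A.lift 1 :: .list A :: Γ) l l
      (L.inst₁ 3 (.cons (.var 2) (.var 1)))) :
    TmV Γ (.elList A L (.cons s c) a l) (l.inst₃ 0 s c (.elList A L s a l))
      (L.inst₁ 0 (.cons s c)) := by
  refine ⟨ha.1, fun Γ' x => ?_⟩
  obtain ⟨_, hC, -, -⟩ := hL.1.head.2 _ x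
  obtain ⟨X, x1, hX, hC'⟩ := rel_list hC
  obtain ⟨Z, z1, -, hZ⟩ := hL.2 _ (x.cons hC')
  obtain ⟨u, u1, -⟩ := hs.at x hC'
  obtain ⟨d, d1, -⟩ := hc.at x x1
  obtain ⟨v, v1, -⟩ := ha.at x
    (rel_subst z1 (.inst ⟨_, x1, .refl (Der.list_nil hX)⟩))
  obtain ⟨w, w1, -⟩ := hl.at (x.listCtx x1 hX z1) (rel_subst z1 (.list_cons hX z1))
  have hw : IsTm (Z.inst₁ 2 (.var 1) :: X.lift 1 :: .list X :: Γ') w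
    (Z.inst₁ 3 (.cons (.var 2) (.var 1))) := by simpa [Out.subst] using rel_tm_der w1
  have hcons : rel (.cons s c) Γ' (.cons u d, .list X) :=
    ⟨_, _, _, u1, d1, .refl (Der.list_cons (rel_tm_der u1) (rel_tm_der d1))⟩
  have t := Der.list_beta_cons hZ (rel_tm_der u1) (rel_tm_der d1) (rel_tm_der v1) hw
  rw [inst₃_eq] at t
  have hr : rel (.elList A L s a l) Γ' (.elList X Z u v w, Z.subst (scons u (sh 0))) :=
    ⟨_, _, _, _, _, x1, z1, u1, v1, w1, .refl (Der.list_elim hZ (rel_tm_der u1) (rel_tm_der v1) hw)⟩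
  have s1 : RelSub Γ' (scons (.elList A L s a l) (scons c (scons s (sh 0))))
      (scons (.elList X Z u v w) (scons d (scons u (sh 0)))) (listCtx Γ' X Z) :=
    ((RelSub.inst u1).scons (by simpa using d1)).scons (by simpa [Out.subst] using hr)
  exact ⟨_, _, rel_subst z1 (.inst hcons), ⟨_, _, _, _, _, x1, z1, hcons, v1, w1, .of_eqTm t⟩,
    by simpa [Out.subst] using rel_subst w1 s1⟩

theorem TyV.sum_inv (h : TyV Γ (.sum A B) (.sum A B) k) : TyV Γ A A .set ∧ TyV Γ B B .set := by
  refine ⟨⟨h.1, fun Γ' x => ?_⟩, h.1, fun Γ' x => ?_⟩ <;>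
  · obtain ⟨_, hC, -, -⟩ := h.2 _ x
    obtain ⟨X, Y, x1, y1, hX, hY, -⟩ := rel_sum hC
    first
    | exact ⟨_, x1, x1, hX⟩
    | exact ⟨_, y1, y1, hY⟩

theorem TmV.inl (hA : TyV Γ A A' .set) (hB : TyV Γ B B' .set) (ha : TmV Γ a a' A) :
    TmV Γ (.inl A B a) (.inl A' B' a') (.sum A B) := by
  refine ⟨ha.1, fun Γ' x => ?_⟩
  obtain ⟨X, x1, x2, hX⟩ := hA.2 _ x
  obtain ⟨Y, y1, y2, hY⟩ := hB.2 _ x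
  obtain ⟨u, u1, u2⟩ := ha.at x x1
  have hS := Der.sum_form hX hY
  have t := Der.sum_inl hS (rel_tm_der u1)
  exact ⟨_, _, ⟨_, _, x1, y1, .refl hS⟩, ⟨_, _, _, x1, y1, u1, .refl t⟩,
    ⟨_, _, _, x2, y2, u2, .refl t⟩⟩

theorem TmV.inr (hA : TyV Γ A A' .set) (hB : TyV Γ B B' .set) (hb : TmV Γ b b' B) :
    TmV Γ (.inr A B b) (.inr A' B' b') (.sum A B) := by
  refine ⟨hb.1, fun Γ' x => ?_⟩
  obtain ⟨X, x1, x2, hX⟩ := hA.2 _ x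
  obtain ⟨Y, y1, y2, hY⟩ := hB.2 _ x
  obtain ⟨u, u1, u2⟩ := hb.at x y1
  have hS := Der.sum_form hX hY
  have t := Der.sum_inr hS (rel_tm_der u1)
  exact ⟨_, _, ⟨_, _, x1, y1, .refl hS⟩, ⟨_, _, _, x1, y1, u1, .refl t⟩,
    ⟨_, _, _, x2, y2, u2, .refl t⟩⟩

theorem TmV.elSum (hA : Repl Γ A A') (hB : Repl Γ B B') (hM : TyV (.sum A B :: Γ) M M' .col)
    (hw : TmV Γ w w' (.sum A B))
    (ha : TmV (A :: Γ) a a' (M.inst₁ 1 (.inl (A.lift 1) (B.lift 1) (.var 0))))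
    (hb : TmV (B :: Γ) b b' (M.inst₁ 1 (.inr (A.lift 1) (B.lift 1) (.var 0)))) :
    TmV Γ (.elSum A B M w a b) (.elSum A' B' M' w' a' b') (M.inst₁ 0 w) := by
  simp only [inst₁_eq, lift_eq] at ha hb ⊢
  refine ⟨hw.1, fun Γ' x => ?_⟩
  obtain ⟨_, _, hC, -, -⟩ := hw.2 _ x
  obtain ⟨X, Y, x1, y1, hX, hY, hC'⟩ := rel_sum hC
  have hS := Der.sum_form hX hY
  obtain ⟨Z, z1, z2, hZ⟩ := hM.2 _ (x.cons hC')
  obtain ⟨p, p1, p2⟩ := hw.at x hC'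
  obtain ⟨u, u1, u2⟩ := ha.at (x.cons x1) (rel_subst z1 (.inlV x1 y1 hS))
  obtain ⟨v, v1, v2⟩ := hb.at (x.cons y1) (rel_subst z1 (.inrV x1 y1 hS))
  have t := Der.sum_elim hZ (rel_tm_der p1) (by simpa [Out.subst] using rel_tm_der u1)
    (by simpa [Out.subst] using rel_tm_der v1)
  exact ⟨_, _, rel_subst z1 (.inst p1), ⟨_, _, _, _, _, _, x1, y1, z1, p1, u1, v1, .refl t⟩,
    ⟨_, _, _, _, _, _, hA _ _ x x1, hB _ _ x y1, z2, p2, u2, v2, .refl t⟩⟩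

theorem TmV.elSum_beta_inl (hM : TyV (.sum A B :: Γ) M M .col) (hc : TmV Γ c c A)
    (ha : TmV (A :: Γ) a a (M.inst₁ 1 (.inl (A.lift 1) (B.lift 1) (.var 0))))
    (hb : TmV (B :: Γ) b b (M.inst₁ 1 (.inr (A.lift 1) (B.lift 1) (.var 0)))) :
    TmV Γ (.elSum A B M (.inl A B c) a b) (a.inst₁ 0 c) (M.inst₁ 0 (.inl A B c)) := by
  simp only [inst₁_eq, lift_eq] at ha hb ⊢
  refine ⟨hc.1, fun Γ' x => ?_⟩
  obtain ⟨_, hC, -, -⟩ := hM.1.head.2 _ x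
  obtain ⟨X, Y, x1, y1, hX, hY, hC'⟩ := rel_sum hC
  have hS := Der.sum_form hX hY
  obtain ⟨Z, z1, -, hZ⟩ := hM.2 _ (x.cons hC')
  obtain ⟨d, d1, -⟩ := hc.at x x1
  obtain ⟨u, u1, -⟩ := ha.at (x.cons x1) (rel_subst z1 (.inlV x1 y1 hS))
  obtain ⟨v, v1, -⟩ := hb.at (x.cons y1) (rel_subst z1 (.inrV x1 y1 hS))
  have p1 : rel (.inl A B c) Γ' (.inl X Y d, .sum X Y) :=
    ⟨_, _, _, x1, y1, d1, .refl (Der.sum_inl hS (rel_tm_der d1))⟩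
  have t := Der.sum_beta_inl hZ (rel_tm_der d1) (by simpa [Out.subst] using rel_tm_der u1)
    (by simpa [Out.subst] using rel_tm_der v1)
  rw [inst₁_eq _ 0 d] at t
  exact ⟨_, _, rel_subst z1 (.inst p1), ⟨_, _, _, _, _, _, x1, y1, z1, p1, u1, v1, .of_eqTm t⟩,
    by simpa [Out.subst] using rel_subst u1 (.inst d1)⟩

theorem TmV.elSum_beta_inr (hM : TyV (.sum A B :: Γ) M M .col) (hc : TmV Γ c c B)
    (ha : TmV (A :: Γ) a a (M.inst₁ 1 (.inl (A.lift 1) (B.lift 1) (.var 0))))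
    (hb : TmV (B :: Γ) b b (M.inst₁ 1 (.inr (A.lift 1) (B.lift 1) (.var 0)))) :
    TmV Γ (.elSum A B M (.inr A B c) a b) (b.inst₁ 0 c) (M.inst₁ 0 (.inr A B c)) := by
  simp only [inst₁_eq, lift_eq] at ha hb ⊢
  refine ⟨hc.1, fun Γ' x => ?_⟩
  obtain ⟨_, hC, -, -⟩ := hM.1.head.2 _ x
  obtain ⟨X, Y, x1, y1, hX, hY, hC'⟩ := rel_sum hC
  have hS := Der.sum_form hX hY
  obtain ⟨Z, z1, -, hZ⟩ := hM.2 _ (x.cons hC')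
  obtain ⟨d, d1, -⟩ := hc.at x y1
  obtain ⟨u, u1, -⟩ := ha.at (x.cons x1) (rel_subst z1 (.inlV x1 y1 hS))
  obtain ⟨v, v1, -⟩ := hb.at (x.cons y1) (rel_subst z1 (.inrV x1 y1 hS))
  have p1 : rel (.inr A B c) Γ' (.inr X Y d, .sum X Y) :=
    ⟨_, _, _, x1, y1, d1, .refl (Der.sum_inr hS (rel_tm_der d1))⟩
  have t := Der.sum_beta_inr hZ (rel_tm_der d1) (by simpa [Out.subst] using rel_tm_der u1)
    (by simpa [Out.subst] using rel_tm_der v1)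
  rw [inst₁_eq _ 0 d] at t
  exact ⟨_, _, rel_subst z1 (.inst p1), ⟨_, _, _, _, _, _, x1, y1, z1, p1, u1, v1, .of_eqTm t⟩,
    by simpa [Out.subst] using rel_subst v1 (.inst d1)⟩

theorem TmV.qcl (hQ : TyV Γ (.quo A R) (.quo A R) k) (hA : Repl Γ A A')
    (hR : Repl (A.lift 1 :: A :: Γ) R R') (ha : TmV Γ a a' A) :
    TmV Γ (.qcl A R a) (.qcl A' R' a') (.quo A R) := by
  refine ⟨ha.1, fun Γ' x => ?_⟩
  obtain ⟨_, hC, -, -⟩ := hQ.2 _ x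
  obtain ⟨X, Y, x1, y1, hq, hC'⟩ := rel_quo hC
  obtain ⟨u, u1, u2⟩ := ha.at x x1
  have t := Der.quo_intro hq.form (rel_tm_der u1)
  exact ⟨_, _, hC', ⟨_, _, _, x1, y1, u1, .refl t⟩,
    ⟨_, _, _, hA _ _ x x1, hR _ _ (x.two x1) y1, u2, .refl t⟩⟩

theorem TmV.qcl_eq (hQ : TyV Γ (.quo A R) (.quo A R) k) (ha : TmV Γ a a A) (hb : TmV Γ b b A)
    (h : (Judg.tr Γ (R.inst₂ 0 a b)).Valid) :
    TmV Γ (.qcl A R a) (.qcl A R b) (.quo A R) := by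
  refine ⟨ha.1, fun Γ' x => ?_⟩
  obtain ⟨_, hC, -, -⟩ := hQ.2 _ x
  obtain ⟨X, Y, x1, y1, hq, hC'⟩ := rel_quo hC
  obtain ⟨u, u1, -⟩ := ha.at x x1
  obtain ⟨v, v1, -⟩ := hb.at x x1
  have s := (RelSub.id x.isCtx).two (A := X) (by simpa using u1) (by simpa using v1)
  have e := Der.quo_class_eq hq.form (rel_tm_der u1) (rel_tm_der v1)
    (TmV.isTrue h x (rel_subst y1 s) (ty_subst (.incl .props_prop hq.rel) s.ok))
  exact ⟨_, _, hC', ⟨_, _, _, x1, y1, u1, .of_eqTm e⟩,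
    ⟨_, _, _, x1, y1, v1, .refl (eqTm_right e)⟩⟩

theorem TmV.quo_effective (hQ : TyV Γ (.quo A R) (.quo A R) k) (ha : TmV Γ a a A)
    (hb : TmV Γ b b A) (h : TmV Γ (.qcl A R a) (.qcl A R b) (.quo A R)) :
    (Judg.tr Γ (R.inst₂ 0 a b)).Valid := by
  refine ⟨ha.1, fun Γ' x => ?_⟩
  obtain ⟨_, hC, -, -⟩ := hQ.2 _ x
  obtain ⟨X, Y, x1, y1, hq, hC'⟩ := rel_quo hC
  obtain ⟨u, u1, -⟩ := ha.at x x1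
  obtain ⟨v, v1, -⟩ := hb.at x x1
  obtain ⟨w, w1, w2⟩ := h.at x hC'
  have s := (RelSub.id x.isCtx).two (A := X) (by simpa using u1) (by simpa using v1)
  have hu : rel (.qcl A R a) Γ' (.qcl X Y u, .quo X Y) :=
    ⟨_, _, _, x1, y1, u1, .refl (Der.quo_intro hq.form (rel_tm_der u1))⟩
  have hv : rel (.qcl A R b) Γ' (.qcl X Y v, .quo X Y) :=
    ⟨_, _, _, x1, y1, v1, .refl (Der.quo_intro hq.form (rel_tm_der v1))⟩
  exact .tru (rel_subst y1 s)
    (Der.quo_effective hq.form (rel_tm_der u1) (rel_tm_der v1) ((eqTm_of_rel hu w1).tm_trans (eqTm_of_rel w2 hv)))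

/-- The branch at `x` and the branch at `y` are represented by instances of `l'`, the latter in the
type at `[y]`. Since `[x] = [y]` it can be moved to the type at `[x]`, where both instances are
equal to the common representative given by `h`. -/
theorem TmV.quoResp (x : CtxR Γ Γ') (x1 : rel A Γ' A')
    (y1 : rel R (A'.subst (sh 1) :: A' :: Γ') R') (hq : QuoCond Γ' A' R')
    (z1 : rel L (.quo A' R' :: Γ') L')
    (l1 : rel l (A' :: Γ') (l', L'.subst (scons (qclV A' R') (sh 1))))
    (h : TmV (R :: A.lift 1 :: A :: Γ) (l.inst₁ 3 (.var 2)) (l.inst₁ 3 (.var 1))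
      (L.inst₁ 3 (.qcl (A.lift 3) (R.lift₂ 3) (.var 2)))) :
    QuoResp Γ' A' R' L' l' := by
  simp only [inst₁_eq, lift_eq, lift₂_eq] at h
  have c3 := ((x.two x1).cons y1)
  rw [lift_eq] at c3
  have c := c3.isCtx
  have s := RelSub.sh_three c
  have v1 : rel (.var 1) (quoCtx Γ' A' R') (.var 1, A'.subst (sh 3)) := by
    simpa using rel_var c (i := 1) (A := A'.subst (sh 1)) rfl
  have v2 : rel (.var 2) (quoCtx Γ' A' R') (.var 2, A'.subst (sh 3)) := by
    simpa using rel_var c (i := 2) (A := A') rfl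
  have hA0 := rel_ty_der x1
  have q := hq.subst s.ok
  have hq2 := Der.quo_intro q.form (rel_tm_der v2)
  have hR3 : rel (R.subst (ups (ups (sh 3)))) _ (Exp.subst R' (ups (ups (sh 3)))) :=
    rel_subst y1 ((s.ups hA0).ups (head_ty (ctx_two hA0)))
  have r2 : rel (.qcl (A.subst (sh 3)) (R.subst (ups (ups (sh 3)))) (.var 2)) (quoCtx Γ' A' R')
      (.qcl (A'.subst (sh 3)) (R'.subst (ups (ups (sh 3)))) (.var 2),
        (Exp.quo A' R').subst (sh 3)) :=
    ⟨_, _, _, rel_subst x1 s, by simpa [Out.subst] using hR3, v2, .refl hq2⟩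
  obtain ⟨w, w1, w2⟩ := h.at c3 (rel_subst z1 (s.scons r2))
  have m2 := rel_subst l1 (s.scons v2)
  have m1 := rel_subst l1 (s.scons v1)
  have e1 := Der.quo_class_eq q.form (rel_tm_der v2) (rel_tm_der v1)
    (by simpa using tr_head (.incl .props_prop hq.rel))
  have e2 := ty_substEq (rel_ty_der z1) ((SubEq.refl s.ok).scons hq.form (.tm_symm e1))
  have m1' := rel_tm_trans m1
    (TmI.conv (by simpa [Out.subst] using rel_tm_der m1) (by simpa [Out.subst] using e2))
  have e3 := (eqTm_of_rel (by simpa [Out.subst] using m2) w1).tm_trans (eqTm_of_rel w2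
    (by simpa [Out.subst] using m1'))
  simpa [QuoResp, Out.subst] using e3

theorem TmV.elQ (hA : Repl Γ A A') (hR : Repl (A.lift 1 :: A :: Γ) R R')
    (hL : TyV (.quo A R :: Γ) L L' .col) (hp : TmV Γ p p' (.quo A R))
    (hl : TmV (A :: Γ) l l' (L.inst₁ 1 (.qcl (A.lift 1) (R.lift₂ 1) (.var 0))))
    (hr : TmV (R :: A.lift 1 :: A :: Γ) (l.inst₁ 3 (.var 2)) (l.inst₁ 3 (.var 1))
      (L.inst₁ 3 (.qcl (A.lift 3) (R.lift₂ 3) (.var 2)))) :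
    TmV Γ (.elQ A R L p l) (.elQ A' R' L' p' l') (L.inst₁ 0 p) := by
  simp only [inst₁_eq, lift_eq, lift₂_eq] at hl ⊢
  refine ⟨hp.1, fun Γ' x => ?_⟩
  obtain ⟨_, _, hC, -, -⟩ := hp.2 _ x
  obtain ⟨X, Y, x1, y1, hq, hC'⟩ := rel_quo hC
  obtain ⟨Z, z1, z2, hZ⟩ := hL.2 _ (x.cons hC')
  obtain ⟨u, u1, u2⟩ := hp.at x hC'
  obtain ⟨v, v1, v2⟩ := hl.at (x.cons x1) (rel_subst z1 (.qclV x1 y1 hq.form))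
  have hr' := TmV.quoResp x x1 y1 hq z1 v1 hr
  have t := Der.quo_elim hZ (rel_tm_der u1) (by simpa [Out.subst] using rel_tm_der v1)
    (by simpa [QuoResp] using hr')
  exact ⟨_, _, rel_subst z1 (.inst u1), ⟨_, _, _, _, _, x1, y1, z1, u1, v1, .refl t⟩,
    ⟨_, _, _, _, _, hA _ _ x x1, hR _ _ (x.two x1) y1, z2, u2, v2, .refl t⟩⟩

theorem TmV.elQ_beta (hL : TyV (.quo A R :: Γ) L L .col) (ha : TmV Γ a a A)
    (hl : TmV (A :: Γ) l l (L.inst₁ 1 (.qcl (A.lift 1) (R.lift₂ 1) (.var 0))))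
    (hr : TmV (R :: A.lift 1 :: A :: Γ) (l.inst₁ 3 (.var 2)) (l.inst₁ 3 (.var 1))
      (L.inst₁ 3 (.qcl (A.lift 3) (R.lift₂ 3) (.var 2)))) :
    TmV Γ (.elQ A R L (.qcl A R a) l) (l.inst₁ 0 a) (L.inst₁ 0 (.qcl A R a)) := by
  simp only [inst₁_eq, lift_eq, lift₂_eq] at hl ⊢
  refine ⟨ha.1, fun Γ' x => ?_⟩
  obtain ⟨_, hC, -, -⟩ := hL.1.head.2 _ x
  obtain ⟨X, Y, x1, y1, hq, hC'⟩ := rel_quo hC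
  obtain ⟨Z, z1, -, hZ⟩ := hL.2 _ (x.cons hC')
  obtain ⟨d, d1, -⟩ := ha.at x x1
  obtain ⟨v, v1, -⟩ := hl.at (x.cons x1) (rel_subst z1 (.qclV x1 y1 hq.form))
  have p1 : rel (.qcl A R a) Γ' (.qcl X Y d, .quo X Y) :=
    ⟨_, _, _, x1, y1, d1, .refl (Der.quo_intro hq.form (rel_tm_der d1))⟩
  have t := Der.quo_beta hZ (rel_tm_der d1) (by simpa [Out.subst] using rel_tm_der v1)
    (by simpa [QuoResp] using TmV.quoResp x x1 y1 hq z1 v1 hr)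
  rw [inst₁_eq _ 0 d] at t
  exact ⟨_, _, rel_subst z1 (.inst p1), ⟨_, _, _, _, _, x1, y1, z1, p1, v1, .of_eqTm t⟩,
    by simpa [Out.subst] using rel_subst v1 (.inst d1)⟩

theorem TmV.pcl (h : TyV Γ φ φ .props) : TmV Γ (.pcl φ) (.pcl φ) .P1 := by
  refine ⟨h.1, fun Γ' x => ?_⟩
  obtain ⟨X, x1, -, hX⟩ := h.2 _ x
  have t := Der.P1_intro hX
  exact ⟨_, _, rel_P1 x.isCtx, ⟨_, x1, .refl t⟩, ⟨_, x1, .refl t⟩⟩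

theorem TmV.pcl_eq (h : TyV Γ φ φ .props) (h' : TyV Γ ψ ψ .props)
    (e : (Judg.tr Γ (Exp.iff φ ψ)).Valid) : TmV Γ (.pcl φ) (.pcl ψ) .P1 := by
  refine ⟨h.1, fun Γ' x => ?_⟩
  obtain ⟨X, x1, -, hX⟩ := h.2 _ x
  obtain ⟨Y, y1, -, hY⟩ := h'.2 _ x
  have hX' := Der.incl .props_prop hX
  have hY' := Der.incl .props_prop hY
  have t := Der.P1_class_eq hX hY (TmV.isTrue e x (rel_iff x1 y1 hX' hY') (iff_form hX' hY'))
  exact ⟨_, _, rel_P1 x.isCtx, ⟨_, x1, .of_eqTm t⟩, ⟨_, y1, .refl (.P1_intro hY)⟩⟩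

theorem TmV.P1_effective (h : TyV Γ φ φ .props) (h' : TyV Γ ψ ψ .props)
    (e : TmV Γ (.pcl φ) (.pcl ψ) .P1) : (Judg.tr Γ (Exp.iff φ ψ)).Valid := by
  refine ⟨h.1, fun Γ' x => ?_⟩
  obtain ⟨X, x1, -, hX⟩ := h.2 _ x
  obtain ⟨Y, y1, -, hY⟩ := h'.2 _ x
  obtain ⟨u, u1, u2⟩ := e.at x (rel_P1 x.isCtx)
  have hu : rel (.pcl φ) Γ' (.pcl X, .P1) := ⟨_, x1, .refl (Der.P1_intro hX)⟩
  have hv : rel (.pcl ψ) Γ' (.pcl Y, .P1) := ⟨_, y1, .refl (Der.P1_intro hY)⟩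
  exact .tru (rel_iff x1 y1 (.incl .props_prop hX) (.incl .props_prop hY))
    (Der.P1_effective hX hY ((eqTm_of_rel hu u1).tm_trans (eqTm_of_rel u2 hv)))

theorem TmV.P1_eta (h : TmV Γ u u .P1) :
    TmV Γ (.pcl (.eq .P1 u (.pcl Exp.top))) u .P1 := by
  refine ⟨h.1, fun Γ' x => ?_⟩
  have hP := rel_P1 x.isCtx
  have hb := rel_bot x.isCtx
  have b0 := Der.bot_form (T := .emTT) x.isCtx
  obtain ⟨v, v1, -⟩ := h.at x hP
  have t0 := Der.imp_form true b0 b0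
  have t : rel (.pcl Exp.top) Γ' (.pcl Exp.top, .P1) :=
    ⟨_, ⟨_, _, hb, hb, .refl t0⟩, .refl (.P1_intro t0)⟩
  have e0 := Der.eqP1_form (rel_tm_der v1) (rel_tm_der t)
  exact ⟨_, _, hP, ⟨_, ⟨_, _, _, hP, v1, t, .refl e0⟩, .of_eqTm (.P1_eta (rel_tm_der v1))⟩, v1⟩

theorem TmV.prop_mono (h : TyV Γ φ φ .prop) (hp : TmV Γ p p φ) (hq : TmV Γ t t φ) :
    TmV Γ p t φ := by
  refine ⟨h.1, fun Γ' x => ?_⟩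
  obtain ⟨X, x1, -, hX⟩ := h.2 _ x
  obtain ⟨u, u1, -⟩ := hp.at x x1
  obtain ⟨v, v1, -⟩ := hq.at x x1
  exact ⟨v, X, x1, rel_tm_eq u1 (.prop_mono hX (rel_tm_der u1) (rel_tm_der v1)), v1⟩

theorem TmV.prop_true (h : TyV Γ φ φ .prop) (hp : TmV Γ p p φ) : (Judg.tr Γ φ).Valid := by
  refine ⟨h.1, fun Γ' x => ?_⟩
  obtain ⟨X, x1, -, hX⟩ := h.2 _ x
  obtain ⟨u, u1, -⟩ := hp.at x x1
  exact .tru x1 (.prop_true hX (rel_tm_der u1))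

theorem TmV.eq_reflect (ha : TmV Γ a a A) (hb : TmV Γ b b A)
    (h : (Judg.tr Γ (.eq A a b)).Valid) : TmV Γ a b A := by
  refine ⟨ha.1, fun Γ' x => ?_⟩
  obtain ⟨u, X, x1, u1, -⟩ := ha.2 _ x
  obtain ⟨v, v1, -⟩ := hb.at x x1
  have hf := eq_form' (rel_ty_der x1) (rel_tm_der u1) (rel_tm_der v1)
  have := TmV.isTrue h x ⟨_, _, _, x1, u1, v1, .refl hf⟩ hf
  exact ⟨v, X, x1, rel_tm_eq u1 (eqTm_of_tr this), v1⟩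

theorem TmV.eq_intro (ha : TmV Γ a a A) : (Judg.tr Γ (.eq A a a)).Valid := by
  refine ⟨ha.1, fun Γ' x => ?_⟩
  obtain ⟨u, X, x1, u1, -⟩ := ha.2 _ x
  have hf := eq_form' (rel_ty_der x1) (rel_tm_der u1) (rel_tm_der u1)
  exact .tru ⟨_, _, _, x1, u1, u1, .refl hf⟩ (.eq_intro (rel_tm_der u1))

/-! ### Validity of the rules of logic -/

theorem TyV.rel_lift (h : TyV Γ χ χ .prop) (x : CtxR Γ Γ') : ∃ χ', rel χ Γ' χ' ∧
    IsTy Γ' χ' .prop ∧ ∀ A A' : Ty, rel A Γ' A' → rel (χ.lift 1) (A' :: Γ') (χ'.lift 1) ∧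
      IsTy (A' :: Γ') (χ'.lift 1) .prop := by
  obtain ⟨X, x1, -, hX⟩ := h.2 _ x
  refine ⟨X, x1, hX, fun A A' hA => ?_⟩
  have c := Der.ctx_cons (rel_ty_der hA)
  rw [lift_eq, lift_eq]
  exact ⟨rel_ren x1 (.sh_one c), ty_subst hX (.sh_one c)⟩

theorem Valid.bot_elim (h : (Judg.tr Γ .bot).Valid) (hφ : TyV Γ φ φ .prop) :
    (Judg.tr Γ φ).Valid := by
  refine ⟨hφ.1, fun Γ' x => ?_⟩
  obtain ⟨X, x1, -, hX⟩ := hφ.2 _ x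
  exact .tru x1 (.bot_elim (TmV.isTrue h x (rel_bot x.isCtx)
    (.incl .props_prop (.bot_form x.isCtx))) hX)

theorem Valid.and_intro (hφ : TyV Γ φ φ .prop) (hψ : TyV Γ ψ ψ .prop)
    (h : (Judg.tr Γ φ).Valid) (h' : (Judg.tr Γ ψ).Valid) : (Judg.tr Γ (.and φ ψ)).Valid := by
  refine ⟨hφ.1, fun Γ' x => ?_⟩
  obtain ⟨X, x1, -, hX⟩ := hφ.2 _ x
  obtain ⟨Y, y1, -, hY⟩ := hψ.2 _ x
  exact .tru ⟨_, _, x1, y1, .refl (Der.and_form false hX hY)⟩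
    (.and_intro hX hY (TmV.isTrue h x x1 hX) (TmV.isTrue h' x y1 hY))

theorem Valid.and_elim (hφ : TyV Γ φ φ .prop) (hψ : TyV Γ ψ ψ .prop)
    (h : (Judg.tr Γ (.and φ ψ)).Valid) : (Judg.tr Γ φ).Valid ∧ (Judg.tr Γ ψ).Valid := by
  have H : ∀ Γ', CtxR Γ Γ' → TmAt Γ' (.tru φ) (.tru φ) φ ∧ TmAt Γ' (.tru ψ) (.tru ψ) ψ := by
    intro Γ' x
    obtain ⟨X, x1, -, hX⟩ := hφ.2 _ x
    obtain ⟨Y, y1, -, hY⟩ := hψ.2 _ x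
    have hf := Der.and_form false hX hY
    have := TmV.isTrue h x ⟨_, _, x1, y1, .refl hf⟩ hf
    exact ⟨.tru x1 (.and_left hX hY this), .tru y1 (.and_right hX hY this)⟩
  exact ⟨⟨hφ.1, fun Γ' x => (H Γ' x).1⟩, hφ.1, fun Γ' x => (H Γ' x).2⟩

theorem Valid.or_intro (hφ : TyV Γ φ φ .prop) (hψ : TyV Γ ψ ψ .prop)
    (h : (Judg.tr Γ φ).Valid ∨ (Judg.tr Γ ψ).Valid) : (Judg.tr Γ (.or φ ψ)).Valid := by
  refine ⟨hφ.1, fun Γ' x => ?_⟩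
  obtain ⟨X, x1, -, hX⟩ := hφ.2 _ x
  obtain ⟨Y, y1, -, hY⟩ := hψ.2 _ x
  refine .tru ⟨_, _, x1, y1, .refl (Der.or_form false hX hY)⟩ ?_
  exact h.elim (fun h => .or_inl hX hY (TmV.isTrue h x x1 hX))
    fun h => .or_inr hX hY (TmV.isTrue h x y1 hY)

theorem Valid.or_elim (hφ : TyV Γ φ φ .prop) (hψ : TyV Γ ψ ψ .prop) (hχ : TyV Γ χ χ .prop)
    (h : (Judg.tr Γ (.or φ ψ)).Valid) (h1 : (Judg.tr (φ :: Γ) (χ.lift 1)).Valid)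
    (h2 : (Judg.tr (ψ :: Γ) (χ.lift 1)).Valid) : (Judg.tr Γ χ).Valid := by
  refine ⟨hφ.1, fun Γ' x => ?_⟩
  obtain ⟨X, x1, -, hX⟩ := hφ.2 _ x
  obtain ⟨Y, y1, -, hY⟩ := hψ.2 _ x
  obtain ⟨Z, z1, hZ, hl⟩ := hχ.rel_lift x
  have hf := Der.or_form false hX hY
  exact .tru z1 (.or_elim hX hY hZ (TmV.isTrue h x ⟨_, _, x1, y1, .refl hf⟩ hf)
    (TmV.isTrue h1 (x.cons x1) (hl _ _ x1).1 (hl _ _ x1).2)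
    (TmV.isTrue h2 (x.cons y1) (hl _ _ y1).1 (hl _ _ y1).2))

theorem Valid.imp_intro (hφ : TyV Γ φ φ .prop) (hψ : TyV Γ ψ ψ .prop)
    (h : (Judg.tr (φ :: Γ) (ψ.lift 1)).Valid) : (Judg.tr Γ (.imp φ ψ)).Valid := by
  refine ⟨hφ.1, fun Γ' x => ?_⟩
  obtain ⟨X, x1, -, hX⟩ := hφ.2 _ x
  obtain ⟨Y, y1, hY, hl⟩ := hψ.rel_lift x
  exact .tru ⟨_, _, x1, y1, .refl (Der.imp_form false hX hY)⟩
    (.imp_intro hX hY (TmV.isTrue h (x.cons x1) (hl _ _ x1).1 (hl _ _ x1).2))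

theorem Valid.imp_elim (hφ : TyV Γ φ φ .prop) (hψ : TyV Γ ψ ψ .prop)
    (h : (Judg.tr Γ (.imp φ ψ)).Valid) (h' : (Judg.tr Γ φ).Valid) : (Judg.tr Γ ψ).Valid := by
  refine ⟨hφ.1, fun Γ' x => ?_⟩
  obtain ⟨X, x1, -, hX⟩ := hφ.2 _ x
  obtain ⟨Y, y1, -, hY⟩ := hψ.2 _ x
  have hf := Der.imp_form false hX hY
  exact .tru y1 (.imp_elim hX hY (TmV.isTrue h x ⟨_, _, x1, y1, .refl hf⟩ hf)
    (TmV.isTrue h' x x1 hX))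

theorem Valid.ex_intro (hφ : TyV (A :: Γ) φ φ .prop) (ha : TmV Γ a a A)
    (h : (Judg.tr Γ (φ.inst₁ 0 a)).Valid) : (Judg.tr Γ (.ex A φ)).Valid := by
  refine ⟨ha.1, fun Γ' x => ?_⟩
  obtain ⟨u, X, x1, u1, -⟩ := ha.2 _ x
  obtain ⟨Y, y1, -, hY⟩ := hφ.2 _ (x.cons x1)
  exact .tru ⟨_, _, x1, y1, .refl (Der.ex_form false (rel_ty_der x1) hY)⟩
    (.ex_intro hY (rel_tm_der u1) (TmV.isTrue h x (rel_subst y1 (.inst u1))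
      (ty_subst hY (.inst (rel_tm_der u1)))))

theorem Valid.ex_elim (hφ : TyV (A :: Γ) φ φ .prop) (hχ : TyV Γ χ χ .prop)
    (h : (Judg.tr Γ (.ex A φ)).Valid) (h' : (Judg.tr (φ :: A :: Γ) (χ.lift 2)).Valid) :
    (Judg.tr Γ χ).Valid := by
  refine ⟨hχ.1, fun Γ' x => ?_⟩
  obtain ⟨X, x1, -, hX⟩ := hφ.1.head.2 _ x
  obtain ⟨Y, y1, -, hY⟩ := hφ.2 _ (x.cons x1)
  obtain ⟨Z, z1, -, hZ⟩ := hχ.2 _ x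
  have hf := Der.ex_form false hX hY
  have s := RelSub.sh_two ((x.cons x1).cons y1).isCtx
  have r := rel_subst z1 s
  rw [← lift_eq] at r
  exact .tru z1 (.ex_elim hY hZ (TmV.isTrue h x ⟨_, _, x1, y1, .refl hf⟩ hf)
    (by simpa [Out.subst] using TmV.isTrue h' ((x.cons x1).cons y1) r (ty_subst hZ s.ok)))

theorem Valid.all_intro (hφ : TyV (A :: Γ) φ φ .prop) (h : (Judg.tr (A :: Γ) φ).Valid) :
    (Judg.tr Γ (.all A φ)).Valid := by
  refine ⟨hφ.1.1, fun Γ' x => ?_⟩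
  obtain ⟨X, x1, -, hX⟩ := hφ.1.head.2 _ x
  obtain ⟨Y, y1, -, hY⟩ := hφ.2 _ (x.cons x1)
  exact .tru ⟨_, _, x1, y1, .refl (Der.all_form false hX hY)⟩
    (.all_intro hY (TmV.isTrue h (x.cons x1) y1 hY))

theorem Valid.all_elim (hφ : TyV (A :: Γ) φ φ .prop) (h : (Judg.tr Γ (.all A φ)).Valid)
    (ha : TmV Γ a a A) : (Judg.tr Γ (φ.inst₁ 0 a)).Valid := by
  refine ⟨ha.1, fun Γ' x => ?_⟩
  obtain ⟨u, X, x1, u1, -⟩ := ha.2 _ x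
  obtain ⟨Y, y1, -, hY⟩ := hφ.2 _ (x.cons x1)
  have hf := Der.all_form false (rel_ty_der x1) hY
  exact .tru (rel_subst y1 (.inst u1))
    (.all_elim hY (TmV.isTrue h x ⟨_, _, x1, y1, .refl hf⟩ hf) (rel_tm_der u1))

/-! ### The interpretation validates all derivable judgements -/

/-- The theory is arbitrary. The case of `emTT` is needed as well, to handle conversions in
`judg_self`. -/
theorem judg_valid {T : Theory} {J : Judg} (h : Der T J) : J.Valid := by
  induction h with
  | ctx_nil => trivial
  | ctx_cons _ h => exact TyV.ctx_cons h
  | var _ hi h => exact TmV.var h hi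
  | incl i _ h | incl_eq i _ h => exact TyV.incl i h
  | ty_refl _ h | tm_refl _ h => exact h
  | ty_symm _ h => exact TyV.symm h
  | ty_trans _ _ h h' => exact TyV.trans h h'
  | tm_symm _ h => exact TmV.symm h
  | tm_trans _ _ h h' => exact TmV.trans h h'
  | conv _ _ h h' | conv_eq _ _ h h' => exact TmV.conv h h'
  | sub_ty _ _ _ hΔ hs h | sub_tyEq _ _ _ hΔ hs h => exact TyV.subst h hΔ hs
  | sub_tm _ _ _ hΔ hs h | sub_tmEq _ _ _ hΔ hs h => exact TmV.subst h hΔ hs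
  | subEq_ty _ _ _ _ _ hΔ _ _ hs h => exact TyV.subst h hΔ hs
  | subEq_tm _ _ _ _ _ hΔ _ _ hs h => exact TmV.subst h hΔ hs
  | N0_form _ h => exact TyV.N0 h
  | N1_form _ h => exact TyV.N1 h
  | P1_form _ h => exact TyV.P1 h
  | sig_form s _ _ h h' | sig_eq s _ _ h h' => exact TyV.sig h h'
  | pi_form _ _ h h' | pi_eq _ _ h h' => exact TyV.pi h h'
  | piP1_form _ h | piP1_eq _ h => exact TyV.piP1 h
  | sum_form _ _ h h' | sum_eq _ _ h h' => exact TyV.sum h h'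
  | list_form _ h | list_eq _ h => exact TyV.list h
  | quo_form _ _ _ _ _ h h' h1 h2 h3 => exact TyV.quo h h' h1 h2 h3
  | quo_eq _ _ _ hQ h h' => exact TyV.quo_eq hQ (TyV.repl h) (TyV.repl h')
  | bot_form _ h => exact TyV.bot h
  | and_form s _ _ h h' | and_eq s _ _ h h' => exact TyV.and h h'
  | or_form s _ _ h h' | or_eq s _ _ h h' => exact TyV.or h h'
  | imp_form s _ _ h h' | imp_eq s _ _ h h' => exact TyV.imp h h'
  | ex_form s _ _ h h' | ex_eq s _ _ h h' => exact TyV.ex h h'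
  | all_form s _ _ h h' | all_eq s _ _ h h' => exact TyV.all h h'
  | eq_form s _ _ _ h ha hb | eq_eq s _ _ _ h ha hb => exact TyV.eq h ha hb
  | eqP1_form _ _ ha hb | eqP1_eq _ _ ha hb => exact TyV.eqP1 ha hb
  | propext s _ _ _ _ h h' e => exact TyV.propext h h' e
  | N0_elim _ _ hM hc | N0_elim_eq _ _ hM hc => exact TmV.emp hM hc
  | N1_intro _ h => exact TmV.star h
  | N1_elim _ _ _ hM ht hc | N1_elim_eq _ _ _ hM ht hc => exact TmV.elN1 hM ht hc
  | N1_beta _ _ hM hc => exact TmV.elN1_beta hM hc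
  | sig_intro _ _ _ hB ha hb => exact TmV.pair (CtxV.head hB.1) hB ha hb
  | sig_intro_eq _ _ _ _ hA hB ha hb => exact TmV.pair hA hB ha hb
  | sig_elim _ _ _ hM hd hm =>
    exact TmV.elSig (CtxV.head hm.1.1) (CtxV.head hm.1) hM hd hm
  | sig_elim_eq _ _ _ _ _ hA hB hM hd hm => exact TmV.elSig hA hB hM hd hm
  | sig_beta _ _ _ _ hM ha hb hm => exact TmV.elSig_beta hM ha hb hm
  | pi_intro _ _ hP hb => exact TmV.lam hP (.refl _ _) hb
  | pi_intro_eq _ _ _ hP hA hb => exact TmV.lam hP (TyV.repl hA) hb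
  | pi_elim _ _ hf ha | pi_elim_eq _ _ hf ha => exact TmV.app hf ha
  | pi_beta _ _ _ hP hb ha => exact TmV.app_beta hP hb ha
  | pi_eta _ hf => exact TmV.pi_eta hf
  | list_nil _ h | list_nil_eq _ h => exact TmV.nil h
  | list_cons _ _ hs hc | list_cons_eq _ _ hs hc => exact TmV.cons hs hc
  | list_elim _ _ _ _ hL hs ha hl => exact TmV.elList (.refl _ _) hL hs ha hl
  | list_elim_eq _ _ _ _ _ hA hL hs ha hl => exact TmV.elList (TyV.repl hA) hL hs ha hl
  | list_beta_nil _ _ _ hL ha hl => exact TmV.elList_beta_nil hL ha hl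
  | list_beta_cons _ _ _ _ _ hL hs hc ha hl => exact TmV.elList_beta_cons hL hs hc ha hl
  | sum_inl _ _ h ha => exact TmV.inl (TyV.sum_inv h).1 (TyV.sum_inv h).2 ha
  | sum_inr _ _ h ha => exact TmV.inr (TyV.sum_inv h).1 (TyV.sum_inv h).2 ha
  | sum_inl_eq _ _ _ hA hB ha => exact TmV.inl hA hB ha
  | sum_inr_eq _ _ _ hA hB ha => exact TmV.inr hA hB ha
  | sum_elim _ _ _ _ hM hw ha hb => exact TmV.elSum (.refl _ _) (.refl _ _) hM hw ha hb
  | sum_elim_eq _ _ _ _ _ _ hA hB hM hw ha hb =>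
    exact TmV.elSum (TyV.repl hA) (TyV.repl hB) hM hw ha hb
  | sum_beta_inl _ _ _ _ hM hc ha hb => exact TmV.elSum_beta_inl hM hc ha hb
  | sum_beta_inr _ _ _ _ hM hc ha hb => exact TmV.elSum_beta_inr hM hc ha hb
  | quo_intro _ _ hQ ha => exact TmV.qcl hQ (.refl _ _) (.refl _ _) ha
  | quo_intro_eq _ _ _ _ hQ hA hR ha => exact TmV.qcl hQ (TyV.repl hA) (TyV.repl hR) ha
  | quo_class_eq _ _ _ _ hQ ha hb h => exact TmV.qcl_eq hQ ha hb h
  | quo_effective _ _ _ _ hQ ha hb h => exact TmV.quo_effective hQ ha hb h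
  | quo_elim _ _ _ _ hL hp hl hr => exact TmV.elQ (.refl _ _) (.refl _ _) hL hp hl hr
  | quo_elim_eq _ _ _ _ _ _ hA hR hL hp hl hr =>
    exact TmV.elQ (TyV.repl hA) (TyV.repl hR) hL hp hl hr
  | quo_beta _ _ _ _ hL ha hl hr => exact TmV.elQ_beta hL ha hl hr
  | P1_intro _ h => exact TmV.pcl h
  | P1_class_eq _ _ _ h h' e => exact TmV.pcl_eq h h' e
  | P1_effective _ _ _ h h' e => exact TmV.P1_effective h h' e
  | P1_eta _ h => exact TmV.P1_eta h
  | prop_mono _ _ _ h hp hq => exact TmV.prop_mono h hp hq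
  | prop_true _ _ h hp => exact TmV.prop_true h hp
  | bot_elim _ _ h hφ => exact Valid.bot_elim h hφ
  | and_intro _ _ _ _ hφ hψ h h' => exact Valid.and_intro hφ hψ h h'
  | and_left _ _ _ hφ hψ h => exact (Valid.and_elim hφ hψ h).1
  | and_right _ _ _ hφ hψ h => exact (Valid.and_elim hφ hψ h).2
  | or_inl _ _ _ hφ hψ h => exact Valid.or_intro hφ hψ (.inl h)
  | or_inr _ _ _ hφ hψ h => exact Valid.or_intro hφ hψ (.inr h)
  | or_elim _ _ _ _ _ _ hφ hψ hχ h h1 h2 => exact Valid.or_elim hφ hψ hχ h h1 h2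
  | imp_intro _ _ _ hφ hψ h => exact Valid.imp_intro hφ hψ h
  | imp_elim _ _ _ _ hφ hψ h h' => exact Valid.imp_elim hφ hψ h h'
  | ex_intro _ _ _ hφ ha h => exact Valid.ex_intro hφ ha h
  | ex_elim _ _ _ _ hφ hχ h h' => exact Valid.ex_elim hφ hχ h h'
  | all_intro _ _ hφ h => exact Valid.all_intro hφ h
  | all_elim _ _ _ hφ h ha => exact Valid.all_elim hφ h ha
  | eq_intro _ ha => exact TmV.eq_intro ha
  | eq_reflect _ _ _ ha hb h => exact TmV.eq_reflect ha hb h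

/-! ### The interpretation of `emTT` in itself -/

theorem rel_var_iso (hα : Iso Γ A B α) :
    rel (.var 0) (A :: Γ) (α, B.subst (sh 1)) := by
  have c := Der.ctx_cons hα.left
  exact rel_tm_trans (rel_var c (i := 0) rfl)
    (by simpa using TmI.act hα (.sh_one c) (tm_var_zero hα.left))

/-- Changes the representative of the last type of the context: an expression represented over `B`
is represented over `A` once its last variable is read as `α`. -/
theorem RelSub.iso (hα : Iso Γ A B α) : RelSub (A :: Γ) (sh 0) (EmTT.scons α (sh 1)) (B :: Γ) := by
  simpa using (RelSub.sh_one (.ctx_cons hα.left)).scons (a := .var 0) (A := B) (rel_var_iso hα)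

/-- The rule of application mentions a product only as the type of a function, so what represents
its domain and codomain must be extracted from what represents the product. The representatives
found in `h` are only isomorphic to `A'` and `B'`, and the codomain has to be moved over `A'`. -/
theorem rel_pi_inv (h : rel (.pi A B) Γ (.pi A' B')) : rel A Γ A' ∧ rel B (A' :: Γ) B' := by
  obtain ⟨X, Y, hA, hB, _, hθ⟩ := h
  obtain ⟨α, β, hα, hβ, -, -⟩ := hθ.pi_app
  refine ⟨rel_ty_trans hA (TyI.symm ⟨_, hα⟩), ?_⟩
  have := rel_subst hB (RelSub.iso hα)
  exact rel_ty_trans (by simpa [Out.subst] using this) ⟨_, hβ⟩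

theorem rel_sum_inv (h : rel (.sum A B) Γ (.sum A' B')) : rel A Γ A' ∧ rel B Γ B' := by
  obtain ⟨X, Y, hA, hB, e⟩ := h
  exact ⟨rel_ty_trans hA e.sum_inv.1, rel_ty_trans hB e.sum_inv.2⟩

theorem rel_list_inv (h : rel (.list A) Γ (.list A')) : rel A Γ A' := by
  obtain ⟨X, hA, e⟩ := h
  exact rel_ty_trans hA e.list_inv.2.2

theorem rel_quo_inv (h : rel (.quo A R) Γ (.quo A' R')) :
    rel A Γ A' ∧ rel R (A'.subst (sh 1) :: A' :: Γ) R' := by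
  obtain ⟨X, Y, hA, hR, e⟩ := h
  obtain ⟨-, -, α, hα, e'⟩ := e.symm.quo_inv
  refine ⟨rel_ty_trans hA (TyI.symm ⟨_, hα⟩), ?_⟩
  have c := ctx_two hα.left
  have t0 := TmI.act hα (.sh_two c) (a := .var 0) (by simpa using tm_var_zero (head_ty c))
  have v0 : rel (.var 0) _ (α.subst (scons (.var 0) (sh 2)), Exp.subst X (sh 2)) :=
    rel_tm_trans (rel_var c (i := 0) rfl) (by simpa using t0)
  have v1 := rel_ren (rel_var_iso hα) (.sh_one c)
  -- Both last variables change their type from the primed domain to `X`, so each of them is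
  -- represented by its image under `α`.
  have s : RelSub (A'.subst (sh 1) :: A' :: Γ) (sh 0) (twice α)
      (Exp.subst X (sh 1) :: X :: Γ) := by
    simpa [Out.subst] using (RelSub.sh_two c).two (a := .var 1) (A := X) (by simpa [Out.subst] using v1) v0
  have := rel_subst hR s
  exact rel_ty_trans (by simpa [Out.subst] using this) e'.symm

/-- Every expression of a derivable judgement of `emTT` represents itself. -/
def Judg.Self : Judg → Prop
  | .ctx Γ => CtxR Γ Γ
  | .ty Γ A _ => CtxR Γ Γ ∧ rel A Γ A
  | .tm Γ a A => CtxR Γ Γ ∧ rel A Γ A ∧ rel a Γ (a, A)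
  | _ => True

theorem self_tr (h : CtxR Γ Γ) (hφ : rel φ Γ φ) (t : IsTrue Γ φ) : (Judg.tr Γ φ).Self :=
  ⟨h, hφ, φ, hφ, .refl t⟩

theorem CtxR.head (h : CtxR (A :: Γ) (A' :: Γ')) : rel A Γ' A' := by
  cases h with
  | cons _ h => exact h

theorem CtxR.tail (h : CtxR (A :: Γ) (A' :: Γ')) : CtxR Γ Γ' := by
  cases h with
  | cons h _ => exact h

/-- Each constructor is interpreted as itself, applied to representatives which are the arguments
themselves by induction. Annotations without a premise of their own are found in the contexts of
other premises or by inversion of a representative. -/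
theorem judg_self {J : Judg} (h : Der .emTT J) : J.Self := by
  induction h with
  | ctx_nil => exact .nil
  | ctx_cons _ h => exact .cons h.1 h.2
  | var h hi ih =>
    obtain ⟨A', h1, h2⟩ := CtxR.getElem ih hi
    obtain rfl := Option.some.inj (hi.symm.trans h1)
    have h3 := rel_ren h2 (.sh_drop h _)
    rw [lift_eq]
    exact ⟨ih, by simpa [Out.subst] using h3, rel_var h hi⟩
  | incl _ _ h => exact h
  | conv h e ih =>
    -- `Self` says nothing about equalities. Validity of `e` makes `A` a representative of `B`, and
    -- the canonical identity between equal types then makes `B` a representative of itself.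
    have hB := (TyV.repl (judg_valid e)) _ _ ih.1 ih.2.1
    exact ⟨ih.1, rel_ty_trans hB (.of_eqTy e), rel_tm_trans ih.2.2 (.conv h e)⟩
  | sub_ty hΔ hs _ ihΔ ihs ih =>
    exact ⟨ihΔ, rel_subst ih.2 ⟨⟨hΔ, by simpa using hs⟩, fun i B hB => by
      simpa using (ihs i B hB).2.2⟩⟩
  | sub_tm hΔ hs _ ihΔ ihs ih =>
    have s : RelSub _ _ _ _ := ⟨⟨hΔ, by simpa using hs⟩, fun i B hB => by
      simpa using (ihs i B hB).2.2⟩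
    exact ⟨ihΔ, rel_subst ih.2.1 s, rel_subst ih.2.2 s⟩
  | N0_form h ih => exact ⟨ih, rel_N0 h⟩
  | N1_form h ih => exact ⟨ih, rel_N1 h⟩
  | P1_form h ih => exact ⟨ih, rel_P1 h⟩
  | sig_form s h h' ih ih' => exact ⟨ih.1, _, _, ih.2, ih'.2, .refl (Der.sig_form s h h')⟩
  | pi_form h h' ih ih' => exact ⟨ih.1, _, _, ih.2, ih'.2, .refl (Der.pi_form h h')⟩
  | piP1_form h ih =>
    exact ⟨ih.1, _, _, ih.2, rel_P1 (.ctx_cons h.ty_col), .refl (Der.piP1_form h)⟩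
  | sum_form h h' ih ih' => exact ⟨ih.1, _, _, ih.2, ih'.2, .refl (Der.sum_form h h')⟩
  | list_form h ih => exact ⟨ih.1, _, ih.2, .refl (Der.list_form h)⟩
  | quo_form h h' h1 h2 h3 ih ih' =>
    exact ⟨ih.1, _, _, ih.2, by simpa using ih'.2, .refl (Der.quo_form h h' h1 h2 h3)⟩
  | bot_form h ih => exact ⟨ih, rel_bot h⟩
  | and_form s h h' ih ih' => exact ⟨ih.1, _, _, ih.2, ih'.2, .refl (Der.and_form s h h')⟩
  | or_form s h h' ih ih' => exact ⟨ih.1, _, _, ih.2, ih'.2, .refl (Der.or_form s h h')⟩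
  | imp_form s h h' ih ih' => exact ⟨ih.1, _, _, ih.2, ih'.2, .refl (Der.imp_form s h h')⟩
  | ex_form s h h' ih ih' => exact ⟨ih.1, _, _, ih.2, ih'.2, .refl (Der.ex_form s h h')⟩
  | all_form s h h' ih ih' => exact ⟨ih.1, _, _, ih.2, ih'.2, .refl (Der.all_form s h h')⟩
  | eq_form s h ha hb ih iha ihb =>
    exact ⟨ih.1, _, _, _, ih.2, iha.2.2, ihb.2.2, .refl (Der.eq_form s h ha hb)⟩
  | eqP1_form ha hb iha ihb =>
    exact ⟨iha.1, _, _, _, iha.2.1, iha.2.2, ihb.2.2, .refl (Der.eqP1_form ha hb)⟩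
  | N0_elim hM hc ihM ihc =>
    exact ⟨ihc.1, rel_subst ihM.2 (.inst ihc.2.2), _, _, ihM.2, ihc.2.2,
      .refl (Der.N0_elim hM hc)⟩
  | N1_intro h ih => exact ⟨ih, rel_N1 h, rel_star h⟩
  | N1_elim hM ht hc ihM iht ihc =>
    exact ⟨ihc.1, rel_subst ihM.2 (.inst iht.2.2), _, _, _, ihM.2, iht.2.2, ihc.2.2,
      .refl (Der.N1_elim hM ht hc)⟩
  | sig_intro hB ha hb ihB iha ihb =>
    have hS := Der.sig_form false (ty_of_tm ha) hB
    exact ⟨iha.1, ⟨_, _, iha.2.1, ihB.2, .refl hS⟩, _, _, _, _, iha.2.1, ihB.2, iha.2.2, ihb.2.2,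
      .refl (Der.sig_intro hB ha hb)⟩
  | sig_elim hM hd hm ihM ihd ihm =>
    exact ⟨ihd.1, rel_subst ihM.2 (.inst ihd.2.2), _, _, _, _, _, ihm.1.tail.head, ihm.1.head,
      ihM.2, ihd.2.2, by simpa using ihm.2.2, .refl (Der.sig_elim hM hd hm)⟩
  | pi_intro h hb ih ihb =>
    exact ⟨ih.1, ih.2, _, _, _, ihb.1.head, ihb.2.2, .refl (Der.pi_intro h hb)⟩
  | pi_elim hf ha ihf iha =>
    exact ⟨ihf.1, rel_subst (rel_pi_inv ihf.2.1).2 (.inst iha.2.2), _, _, _, _, ihf.2.2, iha.2.2,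
      .refl (Der.pi_elim hf ha)⟩
  | list_nil h ih =>
    exact ⟨ih.1, ⟨_, ih.2, .refl (Der.list_form h)⟩, _, ih.2, .refl (Der.list_nil h)⟩
  | list_cons hs hc ihs ihc =>
    exact ⟨ihs.1, ihs.2.1, _, _, _, ihs.2.2, ihc.2.2, .refl (Der.list_cons hs hc)⟩
  | list_elim hL hs ha hl ihL ihs iha ihl =>
    exact ⟨ihs.1, rel_subst ihL.2 (.inst ihs.2.2), _, _, _, _, _, rel_list_inv ihs.2.1, ihL.2,
      ihs.2.2, iha.2.2, by simpa using ihl.2.2, .refl (Der.list_elim hL hs ha hl)⟩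
  | sum_inl h ha ih iha =>
    exact ⟨ih.1, ih.2, _, _, _, (rel_sum_inv ih.2).1, (rel_sum_inv ih.2).2, iha.2.2,
      .refl (Der.sum_inl h ha)⟩
  | sum_inr h hb ih ihb =>
    exact ⟨ih.1, ih.2, _, _, _, (rel_sum_inv ih.2).1, (rel_sum_inv ih.2).2, ihb.2.2,
      .refl (Der.sum_inr h hb)⟩
  | sum_elim hM hw ha hb ihM ihw iha ihb =>
    exact ⟨ihw.1, rel_subst ihM.2 (.inst ihw.2.2), _, _, _, _, _, _, iha.1.head, ihb.1.head,
      ihM.2, ihw.2.2, by simpa using iha.2.2, by simpa using ihb.2.2,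
      .refl (Der.sum_elim hM hw ha hb)⟩
  | quo_intro h ha ih iha =>
    exact ⟨ih.1, ih.2, _, _, _, iha.2.1, (rel_quo_inv ih.2).2, iha.2.2, .refl (Der.quo_intro h ha)⟩
  | quo_effective h ha hb e ih iha ihb =>
    have s := (RelSub.id (ctx_of_tm ha)).two (by simpa using iha.2.2) (by simpa using ihb.2.2)
    exact self_tr ih.1 (rel_subst (rel_quo_inv ih.2).2 s) (.quo_effective h ha hb e)
  | quo_elim hL hp hl hr ihL ihp ihl =>
    exact ⟨ihp.1, rel_subst ihL.2 (.inst ihp.2.2), _, _, _, _, _, ihl.1.head,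
      (rel_quo_inv ihp.2.1).2, ihL.2, ihp.2.2, by simpa using ihl.2.2,
      .refl (Der.quo_elim hL hp hl hr)⟩
  | P1_intro h ih => exact ⟨ih.1, rel_P1 (ctx_of_ty h), _, ih.2, .refl (Der.P1_intro h)⟩
  | P1_effective h h' e ih ih' =>
    exact self_tr ih.1 (rel_iff ih.2 ih'.2 (.incl .props_prop h) (.incl .props_prop h'))
      (.P1_effective h h' e)
  | prop_true h hp ih => exact self_tr ih.1 ih.2 (.prop_true h hp)
  | bot_elim h hφ _ ih => exact self_tr ih.1 ih.2 (.bot_elim h hφ)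
  | and_intro h h' t t' ih ih' =>
    exact self_tr ih.1 ⟨_, _, ih.2, ih'.2, .refl (Der.and_form false h h')⟩ (.and_intro h h' t t')
  | and_left h h' t ih => exact self_tr ih.1 ih.2 (.and_left h h' t)
  | and_right h h' t _ ih => exact self_tr ih.1 ih.2 (.and_right h h' t)
  | or_inl h h' t ih ih' =>
    exact self_tr ih.1 ⟨_, _, ih.2, ih'.2, .refl (Der.or_form false h h')⟩ (.or_inl h h' t)
  | or_inr h h' t ih ih' =>
    exact self_tr ih.1 ⟨_, _, ih.2, ih'.2, .refl (Der.or_form false h h')⟩ (.or_inr h h' t)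
  | or_elim h1 h2 h3 t t1 t2 _ _ ih => exact self_tr ih.1 ih.2 (.or_elim h1 h2 h3 t t1 t2)
  | imp_intro h h' t ih ih' =>
    exact self_tr ih.1 ⟨_, _, ih.2, ih'.2, .refl (Der.imp_form false h h')⟩ (.imp_intro h h' t)
  | imp_elim h h' t t' _ ih => exact self_tr ih.1 ih.2 (.imp_elim h h' t t')
  | ex_intro h ha t ih iha =>
    exact self_tr iha.1 ⟨_, _, iha.2.1, ih.2, .refl (Der.ex_form false (ty_of_tm ha) h)⟩
      (.ex_intro h ha t)
  | ex_elim h h' t t' _ ih => exact self_tr ih.1 ih.2 (.ex_elim h h' t t')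
  | all_intro h t ih =>
    exact self_tr ih.1.tail
      ⟨_, _, ih.1.head, ih.2, .refl (Der.all_form false (head_ty (ctx_of_ty h)) h)⟩
      (.all_intro h t)
  | all_elim h t ha ih _ iha =>
    exact self_tr iha.1 (rel_subst ih.2 (.inst iha.2.2)) (.all_elim h t ha)
  | eq_intro ha ih =>
    exact self_tr ih.1 ⟨_, _, _, ih.2.1, ih.2.2, ih.2.2,
      .refl (Der.eq_form false (ty_of_tm ha) ha ha)⟩ (.eq_intro ha)
  | _ => trivial

/-! ### The main theorem -/

theorem TyV.left_defined (h : TyV Γ A B k) : TyDefined Γ A k := by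
  obtain ⟨Γ', c⟩ := h.1.exists
  obtain ⟨A', hA, -, hk⟩ := h.2 Γ' c
  have e : interpTy Γ A = tyCls Γ' A' := by rw [interpTy, c.interp]; exact sem_eq_cls A hA
  rw [TyDefined, e, c.interp]
  exact ⟨⟨_, _, tyIs_self hk.ty_col⟩, fun J hJ => TyRel.ctx hJ, ⟨_, A'⟩,
    tyRel_refl hk.ty_col, hk⟩

theorem TmV.defined (h : TmV Γ a b A) : TmDefined Γ a ∧ TmDefined Γ b ∧
    interpTm Γ a = interpTm Γ b ∧ TyDefined Γ A .col ∧
    ∀ J ∈ interpTm Γ a, (⟨J.ctx, J.ty⟩ : TyJ) ∈ interpTy Γ A := by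
  obtain ⟨Γ', c⟩ := h.1.exists
  obtain ⟨t, A', hA, ha, hb⟩ := h.2 Γ' c
  have e : interpTy Γ A = tyCls Γ' A' := by rw [interpTy, c.interp]; exact sem_eq_cls A hA
  have ea : interpTm Γ a = tmCls Γ' t A' := by rw [interpTm, c.interp]; exact sem_eq_cls a ha
  have eb : interpTm Γ b = tmCls Γ' t A' := by rw [interpTm, c.interp]; exact sem_eq_cls b hb
  have hk := rel_ty_der hA
  rw [TmDefined, TmDefined, TyDefined, e, ea, eb, c.interp]
  have hd : ∀ J ∈ tmCls Γ' t A', J.ctx ∈ ctxCls Γ' := fun J hJ => (TmRel.ty hJ).ctx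
  exact ⟨⟨⟨_, _, _, tmIs_self (rel_tm_der ha)⟩, hd⟩, ⟨⟨_, _, _, tmIs_self (rel_tm_der ha)⟩, hd⟩,
    rfl, ⟨⟨_, _, tyIs_self hk⟩, fun J hJ => TyRel.ctx hJ, ⟨_, A'⟩, tyRel_refl hk, hk⟩,
    fun J hJ => TmRel.ty hJ⟩

theorem TyV.interp_eq (h : TyV Γ A B k) : interpTy Γ A = interpTy Γ B := by
  obtain ⟨Γ', c⟩ := h.1.exists
  obtain ⟨A', hA, hB, -⟩ := h.2 Γ' c
  rw [interpTy, interpTy, c.interp]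
  exact (sem_eq_cls A hA).trans (sem_eq_cls B hB).symm

end EmTT

theorem mainTheorem2 :
    -- being canonically related is an equivalence relation on derivable judgements of emTT
    (Equivalence (fun Γ Δ : {Γ : EmTT.Ctx // EmTT.Der .emTT (.ctx Γ)} => EmTT.CtxRel Γ Δ) ∧
     Equivalence (fun J K : {J : EmTT.TyJ // EmTT.Der .emTT (.ty J.ctx J.ty .col)} =>
       EmTT.TyRel J K) ∧
     Equivalence (fun J K : {J : EmTT.TmJ // EmTT.Der .emTT (.tm J.ctx J.tm J.ty)} =>
       EmTT.TmRel J K)) ∧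
    -- validity: the interpretation is total on the derivable judgements of emTT + propext
    ((∀ Γ : EmTT.Ctx, EmTT.Der .emTTpropext (.ctx Γ) → EmTT.CtxDefined Γ) ∧
     (∀ (Γ : EmTT.Ctx) (A : EmTT.Ty) (k : EmTT.Kind),
       EmTT.Der .emTTpropext (.ty Γ A k) → EmTT.TyDefined Γ A k) ∧
     (∀ (Γ : EmTT.Ctx) (a : EmTT.Tm) (A : EmTT.Ty), EmTT.Der .emTTpropext (.tm Γ a A) →
       EmTT.TmDefined Γ a ∧ EmTT.TyDefined Γ A .col ∧
       ∀ J ∈ EmTT.interpTm Γ a, (⟨J.ctx, J.ty⟩ : EmTT.TyJ) ∈ EmTT.interpTy Γ A) ∧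
     (∀ (Γ : EmTT.Ctx) (A B : EmTT.Ty) (k : EmTT.Kind),
       EmTT.Der .emTTpropext (.tyEq Γ A B k) →
       EmTT.TyDefined Γ A k ∧ EmTT.TyDefined Γ B k ∧
       EmTT.interpTy Γ A = EmTT.interpTy Γ B) ∧
     (∀ (Γ : EmTT.Ctx) (a b : EmTT.Tm) (A : EmTT.Ty),
       EmTT.Der .emTTpropext (.tmEq Γ a b A) →
       EmTT.TmDefined Γ a ∧ EmTT.TmDefined Γ b ∧
       EmTT.interpTm Γ a = EmTT.interpTm Γ b)) ∧
    -- on emTT the interpretation is the identity up to canonical isomorphisms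
    ((∀ Γ : EmTT.Ctx, EmTT.Der .emTT (.ctx Γ) → EmTT.interpCtx Γ = EmTT.ctxCls Γ) ∧
     (∀ (Γ : EmTT.Ctx) (A : EmTT.Ty) (k : EmTT.Kind), EmTT.Der .emTT (.ty Γ A k) →
       EmTT.interpTy Γ A = EmTT.tyCls Γ A) ∧
     (∀ (Γ : EmTT.Ctx) (a : EmTT.Tm) (A : EmTT.Ty), EmTT.Der .emTT (.tm Γ a A) →
       EmTT.interpTm Γ a = EmTT.tmCls Γ a A)) ∧
    -- conservativity
    (∀ (Γ : EmTT.Ctx) (φ : EmTT.Ty), EmTT.Der .emTT (.ty Γ φ .prop) →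
      EmTT.Der .emTTpropext (.tr Γ φ) → EmTT.Der .emTT (.tr Γ φ)) := by
  refine ⟨⟨EmTT.equivalence_ctxRel, EmTT.equivalence_tyRel, EmTT.equivalence_tmRel⟩,
    ⟨?_, fun Γ A k h => EmTT.TyV.left_defined (EmTT.judg_valid h), ?_, ?_, ?_⟩, ⟨?_, ?_, ?_⟩, ?_⟩
  · intro Γ h
    obtain ⟨Γ', c⟩ := EmTT.CtxV.exists (EmTT.judg_valid h)
    exact ⟨Γ', c.isCtx, c.interp⟩
  · intro Γ a A h
    obtain ⟨h1, -, -, h2, h3⟩ := EmTT.TmV.defined (EmTT.judg_valid h)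
    exact ⟨h1, h2, h3⟩
  · intro Γ A B k h
    have hv : EmTT.TyV Γ A B k := EmTT.judg_valid h
    exact ⟨hv.left_defined, hv.symm.left_defined, hv.interp_eq⟩
  · intro Γ a b A h
    obtain ⟨h1, h2, h3, -⟩ := EmTT.TmV.defined (EmTT.judg_valid h)
    exact ⟨h1, h2, h3⟩
  · intro Γ h
    exact EmTT.CtxR.interp (EmTT.judg_self h)
  · intro Γ A k h
    have hs := EmTT.judg_self h
    rw [EmTT.interpTy, hs.1.interp]
    exact EmTT.sem_eq_cls A hs.2
  · intro Γ a A h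
    have hs := EmTT.judg_self h
    rw [EmTT.interpTm, hs.1.interp]
    exact EmTT.sem_eq_cls a hs.2.2
  · intro Γ φ hφ h
    have hs := EmTT.judg_self hφ
    -- The validity of the judgement derived in the extension is evaluated at `Γ` and `φ`, which
    -- represent themselves.
    exact EmTT.TmV.isTrue (EmTT.judg_valid h) hs.1 hs.2 hφ
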